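/- Let $n\ge 2$ and $v>0$. Let $\mathfrak{su}(n)$ be the real space of trace-free skew-Hermitian $n\times n$ matrices, and let $\mathfrak m$ be either $\mathfrak{su}(n)$ or its complexification, the space of all trace-free complex $n\times n$ matrices. Greek indices run over $0,1,2$ and Latin ones over $1,2$, repeated indices are summed, indices are raised and lowered with the Minkowski metric of signature $(+,-,-)$ on $\mathbb R^{1+2}$, $\square=\partial_\mu\partial^\mu=\partial_t^2-\Delta$, $\epsilon_{\mu\nu\alpha}$ is totally skew-symmetric with $\epsilon_{012}=1$, $[X,Y]=XY-YX$, $X^\dagger$ is the conjugate transpose, and $Q^{\nu\alpha}(u,w)=\partial^\nu u\,\partial^\alpha w-\partial^\alpha u\,\partial^\nu w$. Consider, for $\phi:\mathbb R^{1+2}\to\mathfrak m$ and $A_\mu:\mathbb R^{1+2}\to\mathfrak{su}(n)$, the Chern–Simons–Higgs system in the Lorenz gauge $$\square\phi=-2[A^\mu,\partial_\mu\phi]-[A_\mu,[A^\mu,\phi]]-\mathcal V(\phi,\phi^\dagger),$$ $$\square A_\mu=[\partial^\nu A_\mu,A_\nu]-\epsilon_{\mu\nu\alpha}\big(Q^{\nu\alpha}(\phi^\dagger,\phi)+Q^{\nu\alpha}(\phi,\phi^\dagger)\big)-\epsilon_{\mu\nu\alpha}\partial^\nu\big([\phi^\dagger,[A^\alpha,\phi]]-[[A^\alpha,\phi]^\dagger,\phi]\big),$$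 with initial conditions $$\phi(0)=f,\quad \partial_t\phi(0)=0,\quad A_\mu(0)=a_\mu,\quad \partial_tA_0(0)=-\partial^ja_j,$$ $$\partial_tA_j(0)=\partial_ja_0-[a_0,a_j]+\epsilon_{0jk}\big([f^\dagger,\partial^kf]-[(\partial^kf)^\dagger,f]\big).$$ Here $\mathcal V=\partial V/\partial\phi^\dagger$ for the Higgs potential $V=\mathrm{Tr}\big(([[\phi,\phi^\dagger],\phi]-v^2\phi)^\dagger([[\phi,\phi^\dagger],\phi]-v^2\phi)\big)$; that is, on trace-free complex matrices, $\mathcal V$ is the trace-free matrix for which the real differential of $V$ at $\phi$ in each trace-free direction $h$ is $\mathrm{Re}\,\mathrm{Tr}(h^\dagger\mathcal V)$. For $s,\sigma\in\mathbb R$ and $T>0$ let $H^s\times H^\sigma$ be the real Banach space of pairs $(\phi,A)$ with $\phi\in H^s(\mathbb R^2;\mathfrak m)$ and $A=(A_0,A_1,A_2)\in H^\sigma(\mathbb R^2;\mathfrak{su}(n))^3$. A flow map is a map $\Phi$ from $H^s\times H^\sigma$ to $C([-T,T];H^s\times H^\sigma)$ such that, for all initial data $(f,a)$ in some neighbourhood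 of the origin, $\Phi(f,a)=(\phi,A)$ whenever $(\phi,A)\in C([-T,T];H^s\times H^\sigma)$ is a solution with these data that is $C^2$ on $(-T,T)\times\mathbb R^2$ (nothing is required of $\Phi(f,a)$ if there is no such solution). **Theorem.** Let $s\in\mathbb R$, $\sigma<\frac14$ and $T>0$. Then no flow map $(\phi(0),A(0))\mapsto(\phi(t),A(t))$ from $H^s\times H^\sigma$ to $C([-T,T];H^s\times H^\sigma)$ is $C^2$ at the origin, i.e. twice continuously Fréchet differentiable on a neighbourhood of the origin. Moreover, if $s<\frac12$, $\sigma\in\mathbb R$ and $T>0$, then no such flow map is $C^3$ at the origin. -/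

import Mathlib

open MeasureTheory Set Topology TemperedDistribution
open scoped SchwartzMap Matrix ENNReal

noncomputable section

namespace CSH

/-! ### Sobolev spaces -/

/-- The plane `ℝ²`. -/
abbrev Plane : Type := EuclideanSpace ℝ (Fin 2)

/-- The space `H^s(ℝ²; ℂ)`, as a space of tempered distributions. -/
def sobolevSubmodule (s : ℝ) : Submodule ℂ 𝓢'(Plane, ℂ) where
  carrier := {u | MemSobolev s 2 u}
  add_mem' := fun hu hw => hu.add hw
  zero_mem' := memSobolev_fun_zero Plane ℂ s 2
  smul_mem' := fun c _ hu => hu.smul c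

/-- The space `H^s(ℝ²; ℂ)`, to be equipped with its norm. -/
def Sobolev (s : ℝ) : Type := sobolevSubmodule s

instance (s : ℝ) : AddCommGroup (Sobolev s) := inferInstanceAs (AddCommGroup (sobolevSubmodule s))

instance (s : ℝ) : Module ℂ (Sobolev s) := inferInstanceAs (Module ℂ (sobolevSubmodule s))

/-- The inclusion of `H^s` into the tempered distributions. -/
def Sobolev.toDist (s : ℝ) : Sobolev s →ₗ[ℂ] 𝓢'(Plane, ℂ) := (sobolevSubmodule s).subtype

theorem Sobolev.toDist_injective (s : ℝ) : Function.Injective (Sobolev.toDist s) :=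
  Subtype.val_injective

theorem Sobolev.range_toDist (s : ℝ) :
    Set.range (Sobolev.toDist s) = {u | MemSobolev s 2 u} :=
  Subtype.range_coe

theorem toTemperedDistribution_injective :
    Function.Injective (Lp.toTemperedDistributionCLM ℂ (volume : Measure Plane) 2) := by
  have h := Lp.ker_toTemperedDistributionCLM_eq_bot (F := ℂ) (μ := (volume : Measure Plane))
    (p := 2)
  exact LinearMap.ker_eq_bot.mp h

/-- The `L²` function `⟨D⟩^s u` attached to `u ∈ H^s`. -/
def Sobolev.bessel (s : ℝ) : Sobolev s →ₗ[ℂ] Lp ℂ 2 (volume : Measure Plane) where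
  toFun u := Classical.choose u.2
  map_add' u w := by
    apply toTemperedDistribution_injective
    rw [map_add]
    simp only [Lp.toTemperedDistributionCLM_apply]
    rw [← Classical.choose_spec (u + w).2, ← Classical.choose_spec u.2,
      ← Classical.choose_spec w.2]
    exact map_add (besselPotential Plane ℂ s) _ _
  map_smul' c u := by
    apply toTemperedDistribution_injective
    rw [RingHom.id_apply, map_smul]
    simp only [Lp.toTemperedDistributionCLM_apply]
    rw [← Classical.choose_spec (c • u).2, ← Classical.choose_spec u.2]
    exact map_smul (besselPotential Plane ℂ s) c _

theorem Sobolev.bessel_spec {s : ℝ} (u : Sobolev s) :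
    besselPotential Plane ℂ s (Sobolev.toDist s u) = (Sobolev.bessel s u : 𝓢'(Plane, ℂ)) :=
  Classical.choose_spec u.2

theorem Sobolev.bessel_injective (s : ℝ) : Function.Injective (Sobolev.bessel s) := by
  intro u w h
  apply Sobolev.toDist_injective
  have h1 := Sobolev.bessel_spec u
  rw [h, ← Sobolev.bessel_spec w] at h1
  have h2 := congrArg (besselPotential Plane ℂ (-s)) h1
  simpa using h2

/-- The norm `‖u‖_{H^s} = ‖⟨D⟩^s u‖_{L²}`. -/
instance (s : ℝ) : NormedAddCommGroup (Sobolev s) :=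
  NormedAddCommGroup.induced (Sobolev s) (Lp ℂ 2 (volume : Measure Plane)) (Sobolev.bessel s)
    (Sobolev.bessel_injective s)

instance (s : ℝ) : NormedSpace ℂ (Sobolev s) :=
  NormedSpace.induced ℂ (Sobolev s) (Lp ℂ 2 (volume : Measure Plane)) (Sobolev.bessel s)

theorem Sobolev.norm_eq {s : ℝ} (u : Sobolev s) : ‖u‖ = ‖Sobolev.bessel s u‖ := rfl

/-! ### Matrix valued fields -/

/-- Complex `n × n` matrices. -/
abbrev Mat (n : ℕ) : Type := Matrix (Fin n) (Fin n) ℂ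

/-- The Lie algebra `𝔰𝔲(n)` of trace-free skew-Hermitian matrices. -/
def su (n : ℕ) : Submodule ℝ (Mat n) where
  carrier := {X | Xᴴ = -X ∧ X.trace = 0}
  add_mem' := by
    rintro X Y ⟨hX, hX'⟩ ⟨hY, hY'⟩
    exact ⟨by rw [Matrix.conjTranspose_add, hX, hY, neg_add], by
      rw [Matrix.trace_add, hX', hY', add_zero]⟩
  zero_mem' := by simp
  smul_mem' := by
    rintro c X ⟨hX, hX'⟩
    exact ⟨by rw [Matrix.conjTranspose_smul, hX]; simp, by rw [Matrix.trace_smul, hX', smul_zero]⟩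

/-- The complexification `𝔰𝔩(n, ℂ)` of `𝔰𝔲(n)`: all trace-free matrices, that is, all combinations
`φ_a T^a` with complex coefficients `φ_a`. -/
def sl (n : ℕ) : Submodule ℝ (Mat n) where
  carrier := {X | X.trace = 0}
  add_mem' := by
    intro X Y (hX : X.trace = 0) (hY : Y.trace = 0)
    change (X + Y).trace = 0
    rw [Matrix.trace_add, hX, hY, add_zero]
  zero_mem' := by simp
  smul_mem' := by
    intro c X (hX : X.trace = 0)
    change (c • X).trace = 0
    rw [Matrix.trace_smul, hX, smul_zero]

/-- The matrix obtained by pairing a matrix of distributions with a test function. -/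
def pairing {n : ℕ} {s : ℝ} (u : Fin n → Fin n → Sobolev s) (ψ : 𝓢(Plane, ℂ)) : Mat n :=
  Matrix.of fun i j => Sobolev.toDist s (u i j) ψ

/-- The real normed space `H^s(ℝ²; 𝔪)` for a real space `𝔪` of matrices: matrices of elements of
`H^s(ℝ²; ℂ)` whose pairing with every real valued test function lies in `𝔪`. -/
def fieldSpace (n : ℕ) (𝔪 : Submodule ℝ (Mat n)) (s : ℝ) :
    Submodule ℝ (Fin n → Fin n → Sobolev s) where
  carrier := {u | ∀ ψ : 𝓢(Plane, ℂ), (∀ x, (ψ x).im = 0) → pairing u ψ ∈ 𝔪}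
  add_mem' := by
    intro u w hu hw ψ hψ
    have h : pairing (u + w) ψ = pairing u ψ + pairing w ψ := by
      ext i j
      simp [pairing]
    rw [h]
    exact 𝔪.add_mem (hu ψ hψ) (hw ψ hψ)
  zero_mem' := by
    intro ψ _
    have h : pairing (0 : Fin n → Fin n → Sobolev s) ψ = 0 := by
      ext i j
      simp [pairing]
    rw [h]
    exact 𝔪.zero_mem
  smul_mem' := by
    intro c u hu ψ hψ
    have h : pairing (c • u) ψ = c • pairing u ψ := by
      ext i j
      simp [pairing]
    rw [h]
    exact 𝔪.smul_mem c (hu ψ hψ)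

/-- The space `H^s × H^σ` of pairs `(φ, A)`: a matter field `φ ∈ H^s(ℝ²; 𝔪)` and a gauge field
`A = (A₀, A₁, A₂)` with `A_μ ∈ H^σ(ℝ²; 𝔰𝔲(n))`. -/
abbrev State (n : ℕ) (𝔪 : Submodule ℝ (Mat n)) (s σ : ℝ) : Type :=
  fieldSpace n 𝔪 s × (Fin 3 → fieldSpace n (su n) σ)

/-- The space `C([-T, T]; H^s × H^σ)` with the supremum norm. -/
abbrev Traj (n : ℕ) (𝔪 : Submodule ℝ (Mat n)) (s σ T : ℝ) : Type :=
  C(Icc (-T) T, State n 𝔪 s σ)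

/-! ### The Chern-Simons-Higgs system in the Lorenz gauge -/

/-- The space-time `ℝ^{1+2}`, with points `(t, x)`. -/
abbrev Spacetime : Type := ℝ × Plane

/-- The coordinate vectors of space-time. -/
def coordVec (μ : Fin 3) : Spacetime :=
  Fin.cases ((1 : ℝ), (0 : Plane)) (fun j => ((0 : ℝ), EuclideanSpace.single j (1 : ℝ))) μ

/-- The diagonal entries of the Minkowski metric of signature `(+, -, -)`. -/
def eta (μ : Fin 3) : ℝ := if μ = 0 then 1 else -1

/-- The totally skew-symmetric symbol `ε_{μνα}` with `ε_{012} = 1` (lowering the three indices of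
`ε^{μνα}` multiplies it by `(+1)(-1)(-1) = 1`). -/
def eps (μ ν α : Fin 3) : ℝ :=
  (((ν : ℕ) : ℝ) - ((μ : ℕ) : ℝ)) * (((α : ℕ) : ℝ) - ((μ : ℕ) : ℝ)) *
    (((α : ℕ) : ℝ) - ((ν : ℕ) : ℝ)) / 2

theorem eps_zero_one_two : eps 0 1 2 = 1 := by norm_num [eps]

theorem eps_swap_left (μ ν α : Fin 3) : eps ν μ α = -eps μ ν α := by unfold eps; ring

theorem eps_swap_right (μ ν α : Fin 3) : eps μ α ν = -eps μ ν α := by unfold eps; ring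

variable {n : ℕ}

/-- The partial derivative `∂_μ F` of a matrix valued function, entry by entry. -/
def pd (μ : Fin 3) (F : Spacetime → Mat n) : Spacetime → Mat n := fun z =>
  Matrix.of fun i j => lineDeriv ℝ (fun w => F w i j) z (coordVec μ)

/-- The derivative `∂^μ F` with raised index. -/
def pdUp (μ : Fin 3) (F : Spacetime → Mat n) : Spacetime → Mat n := fun z => eta μ • pd μ F z

/-- The d'Alembertian `□ = ∂_μ ∂^μ = ∂_t² - Δ`. -/
def box (F : Spacetime → Mat n) : Spacetime → Mat n := fun z => ∑ μ, pd μ (pdUp μ F) z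

/-- The gauge field with raised index. -/
def up (A : Fin 3 → Spacetime → Mat n) (μ : Fin 3) : Spacetime → Mat n := fun z => eta μ • A μ z

/-- The conjugate transpose `φ†` of a field. -/
def dag (φ : Spacetime → Mat n) : Spacetime → Mat n := fun z => (φ z)ᴴ

/-- The null form `Q^{να}(u, w) = ∂^ν u ∂^α w - ∂^α u ∂^ν w`. -/
def nullForm (ν α : Fin 3) (u w : Spacetime → Mat n) : Spacetime → Mat n := fun z =>
  pdUp ν u z * pdUp α w z - pdUp α u z * pdUp ν w z

/-- The matrix `[[X, X†], X] - v² X`. -/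
def higgsCore (v : ℝ) (X : Mat n) : Mat n := ⁅⁅X, Xᴴ⁆, X⁆ - v ^ 2 • X

/-- The Higgs potential `V = Tr(([[X, X†], X] - v² X)† ([[X, X†], X] - v² X))`. -/
def higgsPotential (v : ℝ) (X : Mat n) : ℝ :=
  ((higgsCore v X)ᴴ * higgsCore v X).trace.re

/-- The derivative `𝒱 = ∂V/∂φ†`, i.e. `∑ₐ (∂V/∂φₐ*) T^a` for `φ = φₐ T^a` with
`Tr(T^a T^b) = 2 δ^{ab}`; see `hasDerivAt_higgsPotential`. -/
def higgsForce (v : ℝ) (X : Mat n) : Mat n :=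
  (2 : ℝ) • (⁅⁅X, Xᴴ⁆, higgsCore v X⁆ + ⁅X, ⁅Xᴴ, higgsCore v X⁆⁆
    - ⁅X, ⁅X, (higgsCore v X)ᴴ⁆⁆ - v ^ 2 • higgsCore v X)

theorem trace_higgsForce (v : ℝ) {X : Mat n} (hX : X.trace = 0) : (higgsForce v X).trace = 0 := by
  have hc : ∀ Y Z : Mat n, (⁅Y, Z⁆).trace = 0 := fun Y Z => by
    rw [Ring.lie_def, Matrix.trace_sub, Matrix.trace_mul_comm, sub_self]
  simp [higgsForce, higgsCore, Matrix.trace_sub, Matrix.trace_add, Matrix.trace_smul, hc, hX]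

section gradient

theorem trace_mul_lie (P Q R : Mat n) : (P * ⁅Q, R⁆).trace = (⁅P, Q⁆ * R).trace := by
  simp only [Ring.lie_def, mul_sub, sub_mul, Matrix.trace_sub, ← mul_assoc]
  rw [Matrix.trace_mul_comm (P * R) Q, mul_assoc Q P R]

theorem re_trace_conjTranspose (P : Mat n) : (Pᴴ).trace.re = P.trace.re := by
  rw [Matrix.trace_conjTranspose]; simp

theorem conjTranspose_lie (P Q : Mat n) : (⁅P, Q⁆)ᴴ = ⁅Qᴴ, Pᴴ⁆ := by
  simp [Ring.lie_def]

theorem trace_lie_lie_mul (P Q R W : Mat n) :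
    (⁅P, ⁅Q, R⁆⁆ * W).trace = (R * ⁅Q, ⁅P, W⁆⁆).trace := by
  have h1 : (P * (Q * (R * W))).trace = (R * (W * (P * Q))).trace := by
    rw [← mul_assoc, Matrix.trace_mul_comm, mul_assoc]
  have h2 : (P * (R * (Q * W))).trace = (R * (Q * (W * P))).trace := by
    rw [Matrix.trace_mul_comm]; simp only [mul_assoc]
  have h3 : (Q * (R * (P * W))).trace = (R * (P * (W * Q))).trace := by
    rw [Matrix.trace_mul_comm]; simp only [mul_assoc]
  simp only [Ring.lie_def, mul_sub, sub_mul, Matrix.trace_sub, mul_assoc]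
  rw [h1, h2, h3]
  ring

/-- The differential of `higgsCore` at `X` in the direction `H`. -/
def higgsCoreDiff (v : ℝ) (X H : Mat n) : Mat n :=
  ⁅⁅H, Xᴴ⁆ + ⁅X, Hᴴ⁆, X⁆ + ⁅⁅X, Xᴴ⁆, H⁆ - v ^ 2 • H

theorem re_trace_higgsCoreDiff (v : ℝ) (X H : Mat n) :
    2 * ((higgsCoreDiff v X H)ᴴ * higgsCore v X).trace.re = (Hᴴ * higgsForce v X).trace.re := by
  unfold higgsForce
  generalize higgsCore v X = W
  have h1 : (⁅Xᴴ, ⁅X, Hᴴ⁆⁆ * W).trace = (Hᴴ * ⁅X, ⁅Xᴴ, W⁆⁆).trace := trace_lie_lie_mul _ _ _ _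
  have h2 : (⁅Xᴴ, ⁅H, Xᴴ⁆⁆ * W).trace.re = -(Hᴴ * ⁅X, ⁅X, Wᴴ⁆⁆).trace.re := by
    have e1 : ⁅Xᴴ, ⁅H, Xᴴ⁆⁆ = -⁅Xᴴ, ⁅Xᴴ, H⁆⁆ := by
      simp only [Ring.lie_def, mul_sub, sub_mul]; abel
    have e2 : (H * ⁅Xᴴ, ⁅Xᴴ, W⁆⁆)ᴴ = ⁅X, ⁅X, Wᴴ⁆⁆ * Hᴴ := by
      simp only [Matrix.conjTranspose_mul, conjTranspose_lie, Matrix.conjTranspose_conjTranspose]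
      congr 1
      simp only [Ring.lie_def, mul_sub, sub_mul]; abel
    rw [e1, neg_mul, Matrix.trace_neg, Complex.neg_re, trace_lie_lie_mul,
      ← re_trace_conjTranspose (H * _), e2, Matrix.trace_mul_comm]
  have h3 : (⁅Hᴴ, ⁅X, Xᴴ⁆⁆ * W).trace = (Hᴴ * ⁅⁅X, Xᴴ⁆, W⁆).trace := (trace_mul_lie _ _ _).symm
  have e : (higgsCoreDiff v X H)ᴴ
      = ⁅Xᴴ, ⁅X, Hᴴ⁆⁆ + ⁅Xᴴ, ⁅H, Xᴴ⁆⁆ + ⁅Hᴴ, ⁅X, Xᴴ⁆⁆ - v ^ 2 • Hᴴ := by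
    simp only [higgsCoreDiff, Matrix.conjTranspose_sub, Matrix.conjTranspose_add,
      conjTranspose_lie, Matrix.conjTranspose_conjTranspose, Matrix.conjTranspose_smul,
      star_trivial]
    simp only [Ring.lie_def, mul_sub, sub_mul, mul_add, add_mul]; abel
  rw [e]
  simp only [sub_mul, add_mul, mul_sub, mul_add, Matrix.trace_sub, Matrix.trace_add,
    Complex.sub_re, Complex.add_re, Matrix.mul_smul, Matrix.smul_mul, Matrix.trace_smul,
    Complex.smul_re, smul_eq_mul, h1, h2, h3]
  ring

attribute [local instance] Matrix.frobeniusNormedRing Matrix.frobeniusNormedAlgebra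

/-- `higgsForce` is the gradient of the Higgs potential: its differential at `X` in the direction
`H` is `Re Tr(H† 𝒱)`, that is `2 Re ∑ₐ 𝒱ₐ hₐ*` in the coordinates with respect to the `T^a`. -/
theorem hasDerivAt_higgsPotential (v : ℝ) (X H : Mat n) :
    HasDerivAt (fun r : ℝ => higgsPotential v (X + r • H)) (Hᴴ * higgsForce v X).trace.re 0 := by
  have hlin : ∀ Y K : Mat n, HasDerivAt (fun r : ℝ => Y + r • K) K 0 := fun Y K => by
    have h := ((hasDerivAt_id (0 : ℝ)).smul_const K).const_add Y
    rw [one_smul] at h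
    exact h
  have hlie : ∀ (F G : ℝ → Mat n) (F' G' : Mat n), HasDerivAt F F' 0 → HasDerivAt G G' 0 →
      HasDerivAt (fun r => ⁅F r, G r⁆) (⁅F', G 0⁆ + ⁅F 0, G'⁆) 0 := by
    intro F G F' G' hF hG
    have h := (hF.mul hG).sub (hG.mul hF)
    refine h.congr_deriv ?_
    simp only [Ring.lie_def]
    abel
  have hP := hlin X H
  have hQ : HasDerivAt (fun r : ℝ => (X + r • H)ᴴ) Hᴴ 0 := by
    have e : (fun r : ℝ => (X + r • H)ᴴ) = fun r : ℝ => Xᴴ + r • Hᴴ := by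
      funext r
      simp
    rw [e]
    exact hlin Xᴴ Hᴴ
  have hW : HasDerivAt (fun r : ℝ => higgsCore v (X + r • H)) (higgsCoreDiff v X H) 0 := by
    have h := (hlie _ _ _ _ (hlie _ _ _ _ hP hQ) hP).sub (hP.const_smul (v ^ 2))
    refine HasDerivAt.congr_deriv (f := fun r : ℝ => higgsCore v (X + r • H)) h ?_
    simp [higgsCoreDiff]
  have hW' : HasDerivAt (fun r : ℝ => (higgsCore v (X + r • H))ᴴ) (higgsCoreDiff v X H)ᴴ 0 := by
    have h := (hlie _ _ _ _ hQ (hlie _ _ _ _ hP hQ)).sub (hQ.const_smul (v ^ 2))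
    have e : (fun r : ℝ => (higgsCore v (X + r • H))ᴴ) = fun r : ℝ =>
        ⁅(X + r • H)ᴴ, ⁅X + r • H, (X + r • H)ᴴ⁆⁆ - v ^ 2 • (X + r • H)ᴴ := by
      funext r
      simp [higgsCore, conjTranspose_lie]
    rw [e]
    refine HasDerivAt.congr_deriv h ?_
    simp only [higgsCoreDiff, Matrix.conjTranspose_sub, Matrix.conjTranspose_add,
      conjTranspose_lie, Matrix.conjTranspose_conjTranspose, Matrix.conjTranspose_smul,
      star_trivial, zero_smul, add_zero]
    simp only [Ring.lie_def, mul_sub, sub_mul, mul_add, add_mul]; abel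
  let L : Mat n →ₗ[ℝ] ℝ := Complex.reLm ∘ₗ (Matrix.traceLinearMap (Fin n) ℝ ℂ)
  have hL := (LinearMap.toContinuousLinearMap L).hasFDerivAt.comp_hasDerivAt (0 : ℝ) (hW'.mul hW)
  have hre : ((higgsCore v X)ᴴ * higgsCoreDiff v X H).trace.re
      = ((higgsCoreDiff v X H)ᴴ * higgsCore v X).trace.re := by
    rw [← re_trace_conjTranspose]
    simp [Matrix.conjTranspose_mul]
  refine HasDerivAt.congr_deriv (f := fun r : ℝ => higgsPotential v (X + r • H)) hL ?_
  rw [← re_trace_higgsCoreDiff]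
  rw [zero_smul, add_zero]
  change ((higgsCoreDiff v X H)ᴴ * higgsCore v X
    + (higgsCore v X)ᴴ * higgsCoreDiff v X H).trace.re = _
  rw [Matrix.trace_add, Complex.add_re, hre]
  ring

end gradient

/-- The fields `φ`, `A` on `(-T, T) × ℝ²` form a classical (`C²`) solution of the
Chern-Simons-Higgs system in the Lorenz gauge with `∂_t φ(0) = 0`. -/
structure IsClassicalSolution (v T : ℝ) (φ : Spacetime → Mat n) (A : Fin 3 → Spacetime → Mat n) :
    Prop where
  contDiff_phi : ∀ i j, ContDiffOn ℝ 2 (fun z => φ z i j) (Ioo (-T) T ×ˢ univ)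
  contDiff_A : ∀ μ i j, ContDiffOn ℝ 2 (fun z => A μ z i j) (Ioo (-T) T ×ˢ univ)
  eq_phi : ∀ z ∈ Ioo (-T) T ×ˢ (univ : Set Plane),
    box φ z = -(2 : ℝ) • ∑ μ, ⁅up A μ z, pd μ φ z⁆ - ∑ μ, ⁅A μ z, ⁅up A μ z, φ z⁆⁆
      - higgsForce v (φ z)
  eq_A : ∀ μ, ∀ z ∈ Ioo (-T) T ×ˢ (univ : Set Plane),
    box (A μ) z = ∑ ν, ⁅pdUp ν (A μ) z, A ν z⁆
      - ∑ ν, ∑ α, eps μ ν α • (nullForm ν α (dag φ) φ z + nullForm ν α φ (dag φ) z)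
      - ∑ ν, ∑ α, eps μ ν α •
          pdUp ν (fun w => ⁅(φ w)ᴴ, ⁅up A α w, φ w⁆⁆ - ⁅(⁅up A α w, φ w⁆)ᴴ, φ w⁆) z
  init_phi : ∀ x : Plane, pd 0 φ (0, x) = 0
  init_A_zero : ∀ x : Plane, pd 0 (A 0) (0, x) = -∑ j : Fin 2, pdUp j.succ (A j.succ) (0, x)
  init_A_succ : ∀ (j : Fin 2) (x : Plane),
    pd 0 (A j.succ) (0, x) = pd j.succ (A 0) (0, x) - ⁅A 0 (0, x), A j.succ (0, x)⁆
      + ∑ k : Fin 2, eps 0 j.succ k.succ •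
          (⁅(φ (0, x))ᴴ, pdUp k.succ φ (0, x)⁆ - ⁅(pdUp k.succ φ (0, x))ᴴ, φ (0, x)⁆)

/-- The matrix of distributions `u` is the matrix valued function `F` on the plane. -/
def Represents {s : ℝ} (u : Fin n → Fin n → Sobolev s) (F : Plane → Mat n) : Prop :=
  ∀ i j, ∀ ψ : 𝓢(Plane, ℂ), HasCompactSupport (ψ : Plane → ℂ) →
    Sobolev.toDist s (u i j) ψ = ∫ x, ψ x * F x i j

/-- The trajectory `u ∈ C([-T, T]; H^s × H^σ)` is a classical solution. -/
def IsSolution (v : ℝ) {𝔪 : Submodule ℝ (Mat n)} {s σ T : ℝ} (u : Traj n 𝔪 s σ T) : Prop :=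
  ∃ (φ : Spacetime → Mat n) (A : Fin 3 → Spacetime → Mat n), IsClassicalSolution v T φ A ∧
    ∀ t : Icc (-T) T, (t : ℝ) ∈ Ioo (-T) T →
      Represents (u t).1.1 (fun x => φ (t, x)) ∧
      ∀ μ, Represents ((u t).2 μ).1 (fun x => A μ (t, x))

/-- `Φ` is a flow map near the origin, from `H^s × H^σ` to `C([-T, T]; H^s × H^σ)`: for initial data
`(φ(0), A(0))` near `0` it returns the classical solution in `C([-T, T]; H^s × H^σ)` with these data,
whenever there is one. Nothing is asked for other data. -/
def IsFlowMap (v : ℝ) {𝔪 : Submodule ℝ (Mat n)} {s σ T : ℝ} (hT : 0 < T)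
    (Φ : State n 𝔪 s σ → Traj n 𝔪 s σ T) : Prop :=
  ∀ᶠ d in 𝓝 (0 : State n 𝔪 s σ), ∀ u : Traj n 𝔪 s σ T,
    IsSolution v u → u ⟨0, neg_nonpos.mpr hT.le, hT.le⟩ = d → Φ d = u

end CSH

end

open CSH

/-! If a flow map `Φ` is `C^p` near the origin, its `p`-th forward difference with step `δ d` is
`O(|δ|^p ‖d‖^p)`. Hence the coefficient of `δ^p` in any expansion of `Φ(δ d)` is at most `C ‖d‖^p`,
with `C` independent of `d` (`exists_fwdDiff_iter_le`, `exists_coeff_two_le`,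
`exists_coeff_three_le`). It remains to compute these coefficients for smooth data and to exhibit
data for which they are too large.

Expansion. Data whose Fourier transform is continuous with compact support, multiplied by a small
`δ`, have a classical solution on all of `(-T, T)`. Spatial Fourier transforms are measured in a
weighted supremum norm, an algebra under convolution (`wt_mul_wt_le`), and the first derivatives of
the fields are kept as extra unknowns; the Duhamel operators recover them because their symbols are
bounded (`norm_velSym_le`). The system becomes `U = δ L + δ² M + N₂(U) + N₃(U)`, solved by the
inverse function theorem together with its expansion to third order (`exists_small_solution`,
`InitData.exists_mild`). Only matter fields with values in `𝔰𝔲(n)` are used: then `φ` commutes with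
`φ†` and the Higgs force is the linear term `2 v⁴ φ` (`higgsForce_of_skew`), so `φ` solves a
Klein-Gordon equation and `A` massless wave equations. Uniqueness of small solutions keeps the
values in `𝔰𝔲(n)`, and a decay exponent `k ≥ max s σ` puts the trajectory in the right space, so `Φ`
must return it (`IsFlowMap.eventually_eq`). The profiles lie along generators `E₀, E₁, E₂` of a copy
of `𝔰𝔲(2)`, where the commutator is twice the vector product.

Second order. Take `φ = 0`, `A₀ = c E₀` and `A_j = ε_{jk} ∂_k g E₁`, with `ĉ` of height `N` and `ĝ`
of height `1` on boxes of size `N × H` around `±(5N, -2H)` and `±(5N, 2H)`. The second iterate of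
`A₀` along `E₂` is driven by the null form of `c` and `g`, of symbol `~ NH`. The detuning `|η| + |ζ|
- |η + ζ|` is `O(H²/N)`, so with `N = L H²` and `L` large the interaction is resonant up to times of
order one (`abs_resonance_sub_le`). Paired with `|ξ| sin(t|ξ|)` on the output box and averaged in
time, the iterate has size at least `T₀ N⁴ H³` (`second_lower_bound`), while `C²` would allow only
`N^{4+σ} H (NH)^{1/2}`. This forces `H^{1/2} ≲ H^{2σ}`, which is false for `σ < 1/4` as `H → ∞`.

Third order. Take `A = 0` and `φ = f₁ E₀ + f₂ E₁` with bumps of width `~ N` around `±(2N, 0)` and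
`±(0, 2N)`. The current of `φ` enters the initial velocity of `A`, so that `A` grows linearly in
time; for `t = 10⁻⁵/N` nothing has oscillated yet and the Duhamel part of `A` is a small relative
error. The third iterate of `φ` contains `[A^μ, ∂_μ φ]`, whose Fourier transform has a definite sign
near `(2N, 4N)`, giving at least `t³ N⁶` on an area `~ N²` (`third_lower_bound`). Against a bound
`N^{4+2s}` for the pairing this yields `N^{1-2s} ≲ 1`, which is false for `s < 1/2`. -/

noncomputable section

namespace CSH

open FourierTransform

/-! ### Elements of Sobolev spaces given by their Fourier transform -/

/-- The Japanese bracket `⟨ξ⟩^s`. -/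
def bracketPow (s : ℝ) (ξ : Plane) : ℝ := (1 + ‖ξ‖ ^ 2) ^ (s / 2)

theorem bracketPow_pos (s : ℝ) (ξ : Plane) : 0 < bracketPow s ξ :=
  Real.rpow_pos_of_pos (by positivity) _

theorem bracketPow_neg_mul (s : ℝ) (ξ : Plane) : bracketPow (-s) ξ * bracketPow s ξ = 1 := by
  unfold bracketPow
  rw [← Real.rpow_add (by positivity)]
  simp [neg_div]

theorem continuous_bracketPow (s : ℝ) : Continuous (bracketPow s) := by
  unfold bracketPow
  exact Continuous.rpow_const (by fun_prop) fun ξ => Or.inl (by positivity)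

/-- The element of `H^s` whose Fourier transform is `⟨ξ⟩^{-s} h`. -/
def Sobolev.ofFourier (s : ℝ) : Lp ℂ 2 (volume : Measure Plane) →ₗ[ℂ] Sobolev s where
  toFun h := ⟨besselPotential Plane ℂ (-s)
      ((𝓕⁻ h : Lp ℂ 2 (volume : Measure Plane)) : 𝓢'(Plane, ℂ)), 𝓕⁻ h, by simp⟩
  map_add' h k := by
    apply Sobolev.toDist_injective
    change besselPotential Plane ℂ (-s) (Lp.toTemperedDistributionCLM ℂ volume 2 (𝓕⁻ (h + k)))
      = besselPotential Plane ℂ (-s) (Lp.toTemperedDistributionCLM ℂ volume 2 (𝓕⁻ h))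
        + besselPotential Plane ℂ (-s) (Lp.toTemperedDistributionCLM ℂ volume 2 (𝓕⁻ k))
    rw [FourierTransform.fourierInv_add, map_add, map_add]
  map_smul' c h := by
    apply Sobolev.toDist_injective
    change besselPotential Plane ℂ (-s) (Lp.toTemperedDistributionCLM ℂ volume 2 (𝓕⁻ (c • h)))
      = c • besselPotential Plane ℂ (-s) (Lp.toTemperedDistributionCLM ℂ volume 2 (𝓕⁻ h))
    rw [FourierTransform.fourierInv_smul, map_smul, map_smul]

theorem Sobolev.toDist_ofFourier (s : ℝ) (h : Lp ℂ 2 (volume : Measure Plane)) :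
    Sobolev.toDist s (Sobolev.ofFourier s h) = besselPotential Plane ℂ (-s)
      ((𝓕⁻ h : Lp ℂ 2 (volume : Measure Plane)) : 𝓢'(Plane, ℂ)) := rfl

theorem Sobolev.bessel_ofFourier (s : ℝ) (h : Lp ℂ 2 (volume : Measure Plane)) :
    Sobolev.bessel s (Sobolev.ofFourier s h) = 𝓕⁻ h := by
  apply toTemperedDistribution_injective
  simp only [Lp.toTemperedDistributionCLM_apply]
  rw [← Sobolev.bessel_spec, Sobolev.toDist_ofFourier]
  simp

theorem Sobolev.norm_ofFourier (s : ℝ) (h : Lp ℂ 2 (volume : Measure Plane)) :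
    ‖Sobolev.ofFourier s h‖ = ‖h‖ := by
  rw [Sobolev.norm_eq, Sobolev.bessel_ofFourier, ← Lp.norm_fourier_eq (𝓕⁻ h)]
  simp

/-- The embedding of weighted square integrable functions into `H^s`, as an isometry. -/
def Sobolev.ofFourierIsometry (s : ℝ) : Lp ℂ 2 (volume : Measure Plane) →ₗᵢ[ℂ] Sobolev s :=
  ⟨Sobolev.ofFourier s, Sobolev.norm_ofFourier s⟩

/-- The functional `u ↦ ⟨χ, ⟨ξ⟩^s û⟩` on `H^s`. -/
def Sobolev.fourierPairing (s : ℝ) (χ : Lp ℂ 2 (volume : Measure Plane)) : Sobolev s →L[ℂ] ℂ :=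
  LinearMap.mkContinuous
    ((innerSL ℂ χ).toLinearMap ∘ₗ
      (Lp.fourierTransformₗᵢ Plane ℂ).toLinearEquiv.toLinearMap ∘ₗ Sobolev.bessel s) ‖χ‖ (by
    intro u
    rw [Sobolev.norm_eq]
    refine (norm_inner_le_norm (𝕜 := ℂ) χ _).trans_eq ?_
    congr 1
    exact (Lp.fourierTransformₗᵢ Plane ℂ).norm_map _)

theorem Sobolev.norm_fourierPairing_le (s : ℝ) (χ : Lp ℂ 2 (volume : Measure Plane)) :
    ‖Sobolev.fourierPairing s χ‖ ≤ ‖χ‖ :=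
  LinearMap.mkContinuous_norm_le _ (norm_nonneg _) _

theorem Sobolev.fourierPairing_ofFourier (s : ℝ) (χ h : Lp ℂ 2 (volume : Measure Plane)) :
    Sobolev.fourierPairing s χ (Sobolev.ofFourier s h) = inner ℂ χ h := by
  change inner ℂ χ (𝓕 (Sobolev.bessel s (Sobolev.ofFourier s h))) = _
  rw [Sobolev.bessel_ofFourier]
  simp

/-- Fubini, in the form of the self-adjointness of the Fourier integral. Using `-innerₗ Plane` as
the bilinear form turns both transforms into inverse ones. -/
theorem integral_mul_fourierInv {g : Plane → ℂ} (hg : Integrable g) (ψ : 𝓢(Plane, ℂ)) :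
    ∫ ξ, (𝓕⁻ ψ) ξ * g ξ = ∫ x, ψ x * 𝓕⁻ g x := by
  have h := VectorFourier.integral_fourierIntegral_smul_eq_flip (L := -innerₗ Plane)
    (μ := volume) (ν := volume) (f := (ψ : Plane → ℂ)) (g := g) (e := Real.fourierChar)
    Real.continuous_fourierChar (by simpa using! continuous_inner.neg) ψ.integrable hg
  have e1 : ∀ f : Plane → ℂ, VectorFourier.fourierIntegral Real.fourierChar volume
      (-innerₗ Plane) f = 𝓕⁻ f := by
    intro f
    ext w
    rw [Real.fourierInv_eq]
    simp [VectorFourier.fourierIntegral, real_inner_comm]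
  have e2 : ∀ f : Plane → ℂ, VectorFourier.fourierIntegral Real.fourierChar volume
      (-innerₗ Plane).flip f = 𝓕⁻ f := by
    intro f
    ext w
    rw [Real.fourierInv_eq]
    simp [VectorFourier.fourierIntegral, LinearMap.flip_apply, real_inner_comm]
  rw [e1, e2] at h
  simpa [SchwartzMap.fourierInv_coe] using h

/-- The pairing of a Sobolev function with integrable Fourier transform. -/
theorem Sobolev.toDist_ofFourier_apply (s : ℝ) {g : Plane → ℂ} (hg : Integrable g)
    {h : Lp ℂ 2 (volume : Measure Plane)} (hh : h =ᵐ[volume] fun ξ => (bracketPow s ξ : ℂ) * g ξ)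
    (ψ : 𝓢(Plane, ℂ)) :
    Sobolev.toDist s (Sobolev.ofFourier s h) ψ = ∫ x, ψ x * 𝓕⁻ g x := by
  rw [Sobolev.toDist_ofFourier, besselPotential, fourierMultiplierCLM_apply_apply,
    ← Lp.fourierInv_toTemperedDistribution_eq, TemperedDistribution.fourierInv_apply,
    Lp.toTemperedDistribution_apply, ← integral_mul_fourierInv hg]
  refine integral_congr_ae ?_
  filter_upwards [hh] with ξ hξ
  have ht : (fun ξ : Plane => (((1 + ‖ξ‖ ^ 2) ^ (-s / 2) : ℝ) : ℂ)).HasTemperateGrowth := by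
    fun_prop
  rw [hξ]
  simp only [FourierTransform.fourierInv_fourier_eq, smul_eq_mul]
  rw [SchwartzMap.smulLeftCLM_apply_apply ht]
  have h1 := bracketPow_neg_mul s ξ
  have h2 : (((1 + ‖ξ‖ ^ 2) ^ (-s / 2) : ℝ) : ℂ) * (bracketPow s ξ : ℂ) = 1 := by
    exact_mod_cast h1
  rw [smul_eq_mul]
  linear_combination (𝓕⁻ ψ ξ * g ξ) * h2

/-! ### Continuity in `L²` by dominated convergence -/

/-- Serves to show that trajectories are continuous in time with values in `H^r`. Dominated
convergence is applied to the squared `L²` distance, with majorant `4 b²`. -/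
theorem continuous_toLp_of_dominated {X : Type*} [TopologicalSpace X] [FirstCountableTopology X]
    {F : X → Plane → ℂ} (hm : ∀ t, MemLp (F t) 2 volume) {b : Plane → ℝ}
    (hb : Integrable (fun ξ => b ξ ^ 2)) (hF : ∀ t ξ, ‖F t ξ‖ ≤ b ξ)
    (hc : ∀ ξ, Continuous fun t => F t ξ) :
    Continuous fun t => (hm t).toLp (F t) := by
  rw [continuous_iff_continuousAt]
  intro t₀
  unfold ContinuousAt
  rw [tendsto_iff_norm_sub_tendsto_zero]
  have hn : ∀ t, ‖(hm t).toLp (F t) - (hm t₀).toLp (F t₀)‖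
      = (∫ ξ, ‖F t ξ - F t₀ ξ‖ ^ 2) ^ (1 / 2 : ℝ) := by
    intro t
    rw [← MemLp.toLp_sub, Lp.norm_toLp, MemLp.eLpNorm_eq_integral_rpow_norm (by norm_num)
      (by norm_num) ((hm t).sub (hm t₀)), ENNReal.toReal_ofReal (by positivity)]
    simp
  simp_rw [hn]
  have h0 : Filter.Tendsto (fun t => ∫ ξ, ‖F t ξ - F t₀ ξ‖ ^ 2) (𝓝 t₀) (𝓝 0) := by
    have h1 : ContinuousAt (fun t => ∫ ξ, ‖F t ξ - F t₀ ξ‖ ^ 2) t₀ := by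
      refine continuousAt_of_dominated (bound := fun ξ => 4 * b ξ ^ 2) ?_ ?_ (hb.const_mul 4) ?_
      · exact Filter.Eventually.of_forall fun t =>
          (((hm t).1.sub (hm t₀).1).norm.pow 2)
      · refine Filter.Eventually.of_forall fun t => Filter.Eventually.of_forall fun ξ => ?_
        have h2 : ‖F t ξ - F t₀ ξ‖ ≤ 2 * b ξ :=
          (norm_sub_le _ _).trans (by linarith [hF t ξ, hF t₀ ξ])
        rw [Real.norm_of_nonneg (by positivity)]
        calc ‖F t ξ - F t₀ ξ‖ ^ 2 ≤ (2 * b ξ) ^ 2 := by gcongr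
          _ = 4 * b ξ ^ 2 := by ring
      · refine Filter.Eventually.of_forall fun ξ => ?_
        have := hc ξ
        fun_prop
    have h2 := h1.tendsto
    simpa using h2
  have h3 := h0.rpow_const (p := (1 / 2 : ℝ)) (Or.inr (by norm_num))
  simpa using h3

end CSH

end

noncomputable section

namespace CSH

open FourierTransform
open scoped BoundedContinuousFunction

/-! ### The weighted space of Fourier transforms of space-time functions -/

/-- Bounded continuous functions `g` of `(t, ξ)`; such a `g` stands for the function with spatial
Fourier transform `wt k ξ * g (t, ξ)`. -/
abbrev WSpace : Type := (ℝ × Plane) →ᵇ ℂ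

/-- The weight `(1 + |ξ|)^{-k-6}`. -/
def wt (k : ℕ) (ξ : Plane) : ℝ := ((1 + ‖ξ‖) ^ (k + 6))⁻¹

theorem wt_pos (k : ℕ) (ξ : Plane) : 0 < wt k ξ := by unfold wt; positivity

theorem wt_neg (k : ℕ) (ξ : Plane) : wt k (-ξ) = wt k ξ := by simp [wt]

@[fun_prop]
theorem continuous_wt (k : ℕ) : Continuous (wt k) := by
  unfold wt
  exact Continuous.inv₀ (by fun_prop) fun ξ => by positivity

theorem integrable_inv_one_add_norm_pow_four :
    Integrable (fun ξ : Plane => ((1 + ‖ξ‖) ^ 4)⁻¹) := by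
  have h := integrable_one_add_norm (E := Plane) (μ := volume) (r := 4) (by simp; norm_num)
  refine h.congr (Filter.Eventually.of_forall fun ξ => ?_)
  simp only
  rw [Real.rpow_neg (by positivity)]
  norm_cast

/-- The exponent `k + 6` of the weight splits as `k + 2 + 4`: `k` pays for the Sobolev regularity `r
≤ k`, two powers for two derivatives in `x` and `t`, and four for integrability over the plane. -/
theorem sq_mul_wt_le (k : ℕ) (ξ : Plane) : (1 + ‖ξ‖) ^ 2 * wt k ξ ≤ ((1 + ‖ξ‖) ^ 4)⁻¹ := by
  have h1 : (1 : ℝ) ≤ (1 + ‖ξ‖) ^ k := one_le_pow₀ (by linarith [norm_nonneg ξ])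
  unfold wt
  rw [← div_eq_mul_inv, div_le_iff₀ (by positivity)]
  have h2 : ((1 + ‖ξ‖) ^ 4)⁻¹ * (1 + ‖ξ‖) ^ (k + 6) = (1 + ‖ξ‖) ^ 2 * (1 + ‖ξ‖) ^ k := by
    field_simp
    ring
  rw [h2]
  exact le_mul_of_one_le_right (by positivity) h1

theorem wt_le (k : ℕ) (ξ : Plane) : wt k ξ ≤ ((1 + ‖ξ‖) ^ 4)⁻¹ := by
  refine le_trans ?_ (sq_mul_wt_le k ξ)
  exact le_mul_of_one_le_left (wt_pos k ξ).le (one_le_pow₀ (by linarith [norm_nonneg ξ]))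

theorem wt_le_one (k : ℕ) (ξ : Plane) : wt k ξ ≤ 1 :=
  inv_le_one_of_one_le₀ (one_le_pow₀ (by linarith [norm_nonneg ξ]))

theorem integrable_wt (k : ℕ) : Integrable (wt k) :=
  integrable_inv_one_add_norm_pow_four.mono' (continuous_wt k).aestronglyMeasurable
    (Filter.Eventually.of_forall fun ξ => by
      rw [Real.norm_of_nonneg (wt_pos k ξ).le]; exact wt_le k ξ)

/-- The algebra property of the weight. From `1 + |η + ζ| ≤ (1 + |η|) + (1 + |ζ|)` and the convexity
of `x ↦ x^{k+6}`, one of the two factors carries the weight of the sum, and the other remains and is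
integrable. -/
theorem wt_mul_wt_le (k : ℕ) (η ζ : Plane) :
    wt k η * wt k ζ ≤ 2 ^ (k + 5) * wt k (η + ζ) * (wt k η + wt k ζ) := by
  have h1 : (1 + ‖η + ζ‖) ^ (k + 6) ≤ 2 ^ (k + 5) * ((1 + ‖η‖) ^ (k + 6) + (1 + ‖ζ‖) ^ (k + 6)) := by
    refine le_trans ?_ (add_pow_le (by positivity) (by positivity) (k + 6))
    refine pow_le_pow_left₀ (by positivity) ?_ _
    linarith [norm_add_le η ζ]
  unfold wt
  rw [← mul_inv, inv_eq_one_div, div_le_iff₀ (by positivity)]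
  have h2 : 2 ^ (k + 5) * ((1 + ‖η + ζ‖) ^ (k + 6))⁻¹ *
      (((1 + ‖η‖) ^ (k + 6))⁻¹ + ((1 + ‖ζ‖) ^ (k + 6))⁻¹) *
      ((1 + ‖η‖) ^ (k + 6) * (1 + ‖ζ‖) ^ (k + 6))
      = (2 ^ (k + 5) * ((1 + ‖η‖) ^ (k + 6) + (1 + ‖ζ‖) ^ (k + 6))) / (1 + ‖η + ζ‖) ^ (k + 6) := by
    field_simp
    ring
  rw [h2, le_div_iff₀ (by positivity), one_mul]
  exact h1

/-- The constant in the convolution estimate for the weights. -/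
def wtConst (k : ℕ) : ℝ := 2 ^ (k + 6) * ∫ ξ, wt k ξ

theorem integral_wt_mul_wt_le (k : ℕ) (ξ : Plane) :
    ∫ η, wt k η * wt k (ξ - η) ≤ wtConst k * wt k ξ := by
  have hi : Integrable (fun η => wt k (ξ - η)) := (integrable_wt k).comp_sub_left ξ
  have h1 : ∫ η, wt k η * wt k (ξ - η) ≤
      ∫ η, 2 ^ (k + 5) * wt k ξ * (wt k η + wt k (ξ - η)) := by
    refine integral_mono_of_nonneg (Filter.Eventually.of_forall fun η =>
      mul_nonneg (wt_pos k _).le (wt_pos k _).le) (((integrable_wt k).add hi).const_mul _)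
      (Filter.Eventually.of_forall fun η => ?_)
    have := wt_mul_wt_le k η (ξ - η)
    rwa [add_sub_cancel] at this
  refine h1.trans_eq ?_
  rw [integral_const_mul, integral_add (integrable_wt k) hi,
    integral_sub_left_eq_self (wt k) volume ξ, wtConst]
  ring

/-- The spatial Fourier transform attached to an element of the weighted space. -/
def hat (k : ℕ) (g : WSpace) (t : ℝ) (ξ : Plane) : ℂ := (wt k ξ : ℂ) * g (t, ξ)

theorem continuous_hat (k : ℕ) (g : WSpace) : Continuous fun z : ℝ × Plane => hat k g z.1 z.2 := by
  unfold hat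
  fun_prop

@[fun_prop]
theorem continuous_hat_comp {X : Type*} [TopologicalSpace X] {a : X → ℝ} {b : X → Plane} (k : ℕ)
    (g : WSpace) (ha : Continuous a) (hb : Continuous b) :
    Continuous fun x => hat k g (a x) (b x) := by
  unfold CSH.hat
  fun_prop

theorem continuous_hat_right (k : ℕ) (g : WSpace) (t : ℝ) : Continuous (hat k g t) := by
  unfold hat
  fun_prop

theorem norm_hat_le (k : ℕ) (g : WSpace) (t : ℝ) (ξ : Plane) :
    ‖hat k g t ξ‖ ≤ ‖g‖ * wt k ξ := by
  unfold hat
  rw [norm_mul, Complex.norm_real, Real.norm_of_nonneg (wt_pos k ξ).le, mul_comm]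
  exact mul_le_mul_of_nonneg_right (g.norm_coe_le_norm _) (wt_pos k ξ).le

theorem integrable_hat (k : ℕ) (g : WSpace) (t : ℝ) : Integrable (hat k g t) :=
  ((integrable_wt k).const_mul ‖g‖).mono' (continuous_hat_right k g t).aestronglyMeasurable
    (Filter.Eventually.of_forall (norm_hat_le k g t))

theorem hat_add (k : ℕ) (g h : WSpace) (t : ℝ) (ξ : Plane) :
    hat k (g + h) t ξ = hat k g t ξ + hat k h t ξ := by simp [hat, mul_add]

theorem hat_sub (k : ℕ) (g h : WSpace) (t : ℝ) (ξ : Plane) :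
    hat k (g - h) t ξ = hat k g t ξ - hat k h t ξ := by simp [hat, mul_sub]

theorem hat_neg (k : ℕ) (g : WSpace) (t : ℝ) (ξ : Plane) :
    hat k (-g) t ξ = -hat k g t ξ := by simp [hat]

theorem hat_smul (k : ℕ) (c : ℝ) (g : WSpace) (t : ℝ) (ξ : Plane) :
    hat k (c • g) t ξ = c * hat k g t ξ := by
  simp only [hat, BoundedContinuousFunction.coe_smul, Complex.real_smul]; ring

theorem hat_csmul (k : ℕ) (c : ℂ) (g : WSpace) (t : ℝ) (ξ : Plane) :
    hat k (c • g) t ξ = c * hat k g t ξ := by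
  simp only [hat, BoundedContinuousFunction.coe_smul, smul_eq_mul]; ring

theorem hat_zero (k : ℕ) (t : ℝ) (ξ : Plane) : hat k 0 t ξ = 0 := by simp [hat]

theorem hat_sum (k : ℕ) {ι : Type*} (s : Finset ι) (g : ι → WSpace) (t : ℝ) (ξ : Plane) :
    hat k (∑ i ∈ s, g i) t ξ = ∑ i ∈ s, hat k (g i) t ξ := by
  induction s using Finset.cons_induction with
  | empty => simp [hat_zero]
  | cons a s ha ih => rw [Finset.sum_cons, Finset.sum_cons, hat_add, ih]

theorem ext_hat (k : ℕ) {g h : WSpace} (H : ∀ t ξ, hat k g t ξ = hat k h t ξ) : g = h := by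
  ext ⟨t, ξ⟩
  have h1 := H t ξ
  have h2 : (wt k ξ : ℂ) ≠ 0 := by exact_mod_cast (wt_pos k ξ).ne'
  exact mul_left_cancel₀ h2 h1

/-- The element of the weighted space with prescribed Fourier transform. -/
def ofHat (k : ℕ) (F : ℝ → Plane → ℂ) (hF : Continuous fun z : ℝ × Plane => F z.1 z.2) (C : ℝ)
    (hC : ∀ t ξ, ‖F t ξ‖ ≤ C * wt k ξ) : WSpace :=
  BoundedContinuousFunction.ofNormedAddCommGroup (fun z => ((wt k z.2)⁻¹ : ℝ) * F z.1 z.2)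
    (by
      have h : Continuous fun z : ℝ × Plane => (wt k z.2)⁻¹ :=
        Continuous.inv₀ (by fun_prop) fun z => (wt_pos k z.2).ne'
      fun_prop) C (by
    intro z
    rw [norm_mul, Complex.norm_real, Real.norm_of_nonneg (inv_nonneg.2 (wt_pos k _).le),
      inv_mul_le_iff₀ (wt_pos k _), mul_comm]
    exact hC _ _)

theorem hat_ofHat (k : ℕ) (F : ℝ → Plane → ℂ) (hF : Continuous fun z : ℝ × Plane => F z.1 z.2)
    (C : ℝ) (hC : ∀ t ξ, ‖F t ξ‖ ≤ C * wt k ξ) (t : ℝ) (ξ : Plane) :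
    hat k (ofHat k F hF C hC) t ξ = F t ξ := by
  change (wt k ξ : ℂ) * (((wt k ξ)⁻¹ : ℝ) * F t ξ) = F t ξ
  have h2 : (wt k ξ : ℂ) ≠ 0 := by exact_mod_cast (wt_pos k ξ).ne'
  rw [Complex.ofReal_inv, mul_inv_cancel_left₀ h2]

theorem norm_ofHat_le (k : ℕ) (F : ℝ → Plane → ℂ)
    (hF : Continuous fun z : ℝ × Plane => F z.1 z.2)
    (C : ℝ) (hC : ∀ t ξ, ‖F t ξ‖ ≤ C * wt k ξ) (h0 : 0 ≤ C) : ‖ofHat k F hF C hC‖ ≤ C :=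
  BoundedContinuousFunction.norm_ofNormedAddCommGroup_le _ h0 _

/-! ### Products -/

/-- The Fourier transform of a product. -/
def hatConv (k : ℕ) (g h : WSpace) (t : ℝ) (ξ : Plane) : ℂ :=
  ∫ η, hat k g t η * hat k h t (ξ - η)

theorem integrable_hat_mul_hat (k : ℕ) (g h : WSpace) (t : ℝ) (ξ : Plane) :
    Integrable fun η => hat k g t η * hat k h t (ξ - η) := by
  refine (((integrable_wt k).const_mul (‖g‖ * ‖h‖))).mono' ?_
    (Filter.Eventually.of_forall fun η => ?_)
  · have := continuous_hat_right k g t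
    have := continuous_hat_right k h t
    exact Continuous.aestronglyMeasurable (by fun_prop)
  · rw [norm_mul]
    calc ‖hat k g t η‖ * ‖hat k h t (ξ - η)‖ ≤ (‖g‖ * wt k η) * (‖h‖ * wt k (ξ - η)) := by
          gcongr
          · exact mul_nonneg (norm_nonneg _) (wt_pos _ _).le
          · exact norm_hat_le _ _ _ _
          · exact norm_hat_le _ _ _ _
      _ ≤ (‖g‖ * wt k η) * (‖h‖ * 1) := by
          have := (wt_pos k η).le
          gcongr
          exact wt_le_one _ _
      _ = _ := by ring

theorem continuous_hatConv (k : ℕ) (g h : WSpace) :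
    Continuous fun z : ℝ × Plane => hatConv k g h z.1 z.2 := by
  unfold hatConv
  refine continuous_of_dominated (bound := fun η => ‖g‖ * ‖h‖ * wt k η)
    (fun z => (integrable_hat_mul_hat k g h z.1 z.2).1) (fun z => ?_)
    ((integrable_wt k).const_mul _) (Filter.Eventually.of_forall fun η => ?_)
  · refine Filter.Eventually.of_forall fun η => ?_
    rw [norm_mul]
    calc ‖hat k g z.1 η‖ * ‖hat k h z.1 (z.2 - η)‖ ≤ (‖g‖ * wt k η) * (‖h‖ * wt k (z.2 - η)) := by
          gcongr
          · exact mul_nonneg (norm_nonneg _) (wt_pos _ _).le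
          · exact norm_hat_le _ _ _ _
          · exact norm_hat_le _ _ _ _
      _ ≤ (‖g‖ * wt k η) * (‖h‖ * 1) := by
          have := (wt_pos k η).le
          gcongr
          exact wt_le_one _ _
      _ = _ := by ring
  · fun_prop

theorem norm_hatConv_le (k : ℕ) (g h : WSpace) (t : ℝ) (ξ : Plane) :
    ‖hatConv k g h t ξ‖ ≤ wtConst k * ‖g‖ * ‖h‖ * wt k ξ := by
  have h1 : ‖hatConv k g h t ξ‖ ≤ ∫ η, ‖g‖ * ‖h‖ * (wt k η * wt k (ξ - η)) := by
    refine norm_integral_le_of_norm_le ?_ (Filter.Eventually.of_forall fun η => ?_)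
    · refine Integrable.const_mul ?_ _
      refine (integrable_wt k).mono' ?_ (Filter.Eventually.of_forall fun η => ?_)
      · exact Continuous.aestronglyMeasurable (by fun_prop)
      · rw [Real.norm_of_nonneg (mul_nonneg (wt_pos k _).le (wt_pos k _).le)]
        exact mul_le_of_le_one_right (wt_pos k _).le (wt_le_one _ _)
    · rw [norm_mul]
      calc ‖hat k g t η‖ * ‖hat k h t (ξ - η)‖ ≤ (‖g‖ * wt k η) * (‖h‖ * wt k (ξ - η)) := by
            gcongr
            · exact mul_nonneg (norm_nonneg _) (wt_pos _ _).le
            · exact norm_hat_le _ _ _ _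
            · exact norm_hat_le _ _ _ _
        _ = _ := by ring
  refine h1.trans ?_
  rw [integral_const_mul]
  calc ‖g‖ * ‖h‖ * ∫ η, wt k η * wt k (ξ - η) ≤ ‖g‖ * ‖h‖ * (wtConst k * wt k ξ) := by
        gcongr
        exact integral_wt_mul_wt_le k ξ
    _ = _ := by ring

/-- The product of space-time functions on the Fourier side. -/
def cmul (k : ℕ) : WSpace →L[ℂ] WSpace →L[ℂ] WSpace :=
  LinearMap.mkContinuous₂
    (LinearMap.mk₂ ℂ (fun g h => ofHat k (hatConv k g h) (continuous_hatConv k g h) _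
      (norm_hatConv_le k g h))
      (fun g g' h => ext_hat k fun t ξ => by
        rw [hat_add]
        simp only [hat_ofHat, hatConv]
        rw [← integral_add (integrable_hat_mul_hat _ _ _ _ _) (integrable_hat_mul_hat _ _ _ _ _)]
        simp only [hat_add, add_mul])
      (fun c g h => ext_hat k fun t ξ => by
        rw [hat_csmul]
        simp only [hat_ofHat, hatConv]
        rw [← integral_const_mul]
        simp only [hat_csmul, mul_assoc])
      (fun g h h' => ext_hat k fun t ξ => by
        rw [hat_add]
        simp only [hat_ofHat, hatConv]
        rw [← integral_add (integrable_hat_mul_hat _ _ _ _ _) (integrable_hat_mul_hat _ _ _ _ _)]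
        simp only [hat_add, mul_add])
      (fun c g h => ext_hat k fun t ξ => by
        rw [hat_csmul]
        simp only [hat_ofHat, hatConv]
        rw [← integral_const_mul]
        simp only [hat_csmul, mul_left_comm]))
    (wtConst k) (fun g h => norm_ofHat_le k _ (continuous_hatConv k g h) _
      (norm_hatConv_le k g h) (by
      have : 0 ≤ ∫ ξ, wt k ξ := integral_nonneg fun ξ => (wt_pos k ξ).le
      unfold wtConst
      positivity))

theorem hat_cmul (k : ℕ) (g h : WSpace) (t : ℝ) (ξ : Plane) :
    hat k (cmul k g h) t ξ = ∫ η, hat k g t η * hat k h t (ξ - η) :=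
  hat_ofHat k (hatConv k g h) (continuous_hatConv k g h) _ (norm_hatConv_le k g h) t ξ

theorem cmul_comm (k : ℕ) (g h : WSpace) : cmul k g h = cmul k h g := by
  refine ext_hat k fun t ξ => ?_
  rw [hat_cmul, hat_cmul, ← integral_sub_left_eq_self _ volume ξ]
  simp [mul_comm]

/-- The Fourier inversion of a convolution of integrable functions is the product. -/
theorem fourierInv_conv {f g : Plane → ℂ} (hf : Integrable f) (hg : Integrable g) (x : Plane) :
    𝓕⁻ (fun ξ => ∫ η, f η * g (ξ - η)) x = 𝓕⁻ f x * 𝓕⁻ g x := by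
  have h := Real.fourier_mul_convolution_eq hf hg (-x)
  have e : ∀ f : Plane → ℂ, 𝓕 f (-x) = 𝓕⁻ f x := fun f => by
    rw [Real.fourierInv_eq_fourier_neg]
  rw [e, e, e] at h
  exact h

theorem fourierInv_hat_cmul (k : ℕ) (g h : WSpace) (t : ℝ) (x : Plane) :
    𝓕⁻ (hat k (cmul k g h) t) x = 𝓕⁻ (hat k g t) x * 𝓕⁻ (hat k h t) x := by
  rw [← fourierInv_conv (integrable_hat k g t) (integrable_hat k h t)]
  rw [show hat k (cmul k g h) t = fun ξ => ∫ η, hat k g t η * hat k h t (ξ - η) from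
    funext (hat_cmul k g h t)]

/-! ### Duhamel operators -/

/-- Truncation of the time to `[-T, T]`. -/
def clip (T t : ℝ) : ℝ := max (-T) (min T t)

@[fun_prop]
theorem continuous_clip (T : ℝ) : Continuous (clip T) := by unfold clip; fun_prop

theorem abs_clip_le {T : ℝ} (hT : 0 ≤ T) (t : ℝ) : |clip T t| ≤ T := by
  unfold clip
  rw [abs_le]
  exact ⟨le_max_left _ _, max_le (by linarith) (min_le_left _ _)⟩

theorem clip_of_mem {T t : ℝ} (ht : t ∈ Icc (-T) T) : clip T t = t := by
  unfold clip
  rw [min_eq_right ht.2, max_eq_right ht.1]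

theorem clip_eventuallyEq {T t : ℝ} (ht : t ∈ Ioo (-T) T) : clip T =ᶠ[𝓝 t] id := by
  filter_upwards [Ioo_mem_nhds ht.1 ht.2] with r hr
  exact clip_of_mem ⟨hr.1.le, hr.2.le⟩

/-- A time dependent Fourier multiplier, bounded on bounded time intervals. -/
structure Propagator where
  toFun : ℝ → Plane → ℂ
  continuous' : Continuous fun z : ℝ × Plane => toFun z.1 z.2
  bound : ℝ → ℝ
  norm_le' : ∀ R t, |t| ≤ R → ∀ ξ, ‖toFun t ξ‖ ≤ bound R

theorem Propagator.bound_nonneg (κ : Propagator) {R : ℝ} (hR : 0 ≤ R) : 0 ≤ κ.bound R :=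
  (norm_nonneg _).trans (κ.norm_le' R 0 (by simpa using hR) 0)

/-- The Fourier transform of the Duhamel term. -/
def hatDuhamel (k : ℕ) (T : ℝ) (κ : Propagator) (g : WSpace) (t : ℝ) (ξ : Plane) : ℂ :=
  ∫ s in (0 : ℝ)..clip T t, κ.toFun (clip T t - s) ξ * hat k g s ξ

theorem continuous_hatDuhamel (k : ℕ) (T : ℝ) (κ : Propagator) (g : WSpace) :
    Continuous fun z : ℝ × Plane => hatDuhamel k T κ g z.1 z.2 := by
  unfold hatDuhamel
  refine intervalIntegral.continuous_parametric_intervalIntegral_of_continuous ?_ (by fun_prop)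
  have h1 := κ.continuous'
  have h2 := continuous_hat k g
  exact (h1.comp (by fun_prop : Continuous fun z : (ℝ × Plane) × ℝ =>
    (clip T z.1.1 - z.2, z.1.2))).mul
      (h2.comp (by fun_prop : Continuous fun z : (ℝ × Plane) × ℝ => (z.2, z.1.2)))

theorem norm_hatDuhamel_le (k : ℕ) {T : ℝ} (hT : 0 ≤ T) (κ : Propagator) (g : WSpace) (t : ℝ)
    (ξ : Plane) : ‖hatDuhamel k T κ g t ξ‖ ≤ T * κ.bound (2 * T) * ‖g‖ * wt k ξ := by
  have h0 := abs_clip_le hT t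
  have hb : 0 ≤ κ.bound (2 * T) := κ.bound_nonneg (by linarith)
  -- Both `clip T t` and the integration variable lie in `[-T, T]`, so their difference is at most
  -- `2T` in absolute value.
  have h1 : ‖hatDuhamel k T κ g t ξ‖ ≤ (κ.bound (2 * T) * (‖g‖ * wt k ξ)) * |clip T t - 0| := by
    refine intervalIntegral.norm_integral_le_of_norm_le_const fun s hs => ?_
    rw [norm_mul]
    refine mul_le_mul (κ.norm_le' _ _ ?_ _) (norm_hat_le _ _ _ _) (norm_nonneg _) hb
    have hs' : |s| ≤ T := by
      rcases le_total 0 (clip T t) with h | h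
      · rw [uIoc_of_le h] at hs
        rw [abs_le] at h0 ⊢
        exact ⟨by linarith [hs.1], by linarith [hs.2]⟩
      · rw [uIoc_of_ge h] at hs
        rw [abs_le] at h0 ⊢
        exact ⟨by linarith [hs.1], by linarith [hs.2]⟩
    calc |clip T t - s| ≤ |clip T t| + |s| := abs_sub _ _
      _ ≤ 2 * T := by linarith
  refine h1.trans ?_
  rw [sub_zero]
  have h3 : 0 ≤ κ.bound (2 * T) * (‖g‖ * wt k ξ) :=
    mul_nonneg hb (mul_nonneg (norm_nonneg _) (wt_pos _ _).le)
  calc _ ≤ (κ.bound (2 * T) * (‖g‖ * wt k ξ)) * T := by gcongr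
    _ = _ := by ring

theorem intervalIntegrable_duhamel (k : ℕ) (κ : Propagator) (g : WSpace) (a b r : ℝ) (ξ : Plane) :
    IntervalIntegrable (fun s => κ.toFun (r - s) ξ * hat k g s ξ) volume a b := by
  have h1 := κ.continuous'
  have h2 := continuous_hat k g
  exact Continuous.intervalIntegrable ((h1.comp (by fun_prop : Continuous fun s : ℝ =>
    (r - s, ξ))).mul (h2.comp (by fun_prop : Continuous fun s : ℝ => (s, ξ)))) _ _

/-- The Duhamel operator with the propagator `κ`. -/
def duhamel (k : ℕ) {T : ℝ} (hT : 0 ≤ T) (κ : Propagator) : WSpace →L[ℂ] WSpace :=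
  LinearMap.mkContinuous
    { toFun := fun g => ofHat k (hatDuhamel k T κ g) (continuous_hatDuhamel k T κ g) _
        (norm_hatDuhamel_le k hT κ g)
      map_add' := fun g h => ext_hat k fun t ξ => by
        rw [hat_add]
        simp only [hat_ofHat, hatDuhamel]
        rw [← intervalIntegral.integral_add (intervalIntegrable_duhamel _ _ _ _ _ _ _)
          (intervalIntegrable_duhamel _ _ _ _ _ _ _)]
        simp only [hat_add, mul_add]
      map_smul' := fun c g => ext_hat k fun t ξ => by
        rw [RingHom.id_apply, hat_csmul]
        simp only [hat_ofHat, hatDuhamel]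
        rw [← intervalIntegral.integral_const_mul]
        simp only [hat_csmul, mul_left_comm] }
    (T * κ.bound (2 * T)) (fun g => norm_ofHat_le k _ (continuous_hatDuhamel k T κ g) _
      (norm_hatDuhamel_le k hT κ g) (by
      have := κ.bound_nonneg (by linarith : 0 ≤ 2 * T)
      positivity))

theorem hat_duhamel (k : ℕ) {T : ℝ} (hT : 0 ≤ T) (κ : Propagator) (g : WSpace) (t : ℝ)
    (ξ : Plane) : hat k (duhamel k hT κ g) t ξ
      = ∫ s in (0 : ℝ)..clip T t, κ.toFun (clip T t - s) ξ * hat k g s ξ :=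
  hat_ofHat k (hatDuhamel k T κ g) (continuous_hatDuhamel k T κ g) _
    (norm_hatDuhamel_le k hT κ g) t ξ

end CSH

end

noncomputable section

namespace CSH

open FourierTransform

/-! ### Space-time functions given by their spatial Fourier transform -/

/-- The space-time function with spatial Fourier transform `g`. -/
def synth (g : ℝ → Plane → ℂ) (z : Spacetime) : ℂ := 𝓕⁻ (g z.1) z.2

/-- The symbol `2πi ξ_j` of the partial derivative `∂_j`. -/
def dsym (j : Fin 2) (ξ : Plane) : ℂ := 2 * Real.pi * Complex.I * (ξ j : ℂ)

@[fun_prop]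
theorem continuous_dsym (j : Fin 2) : Continuous (dsym j) := by unfold dsym; fun_prop

theorem norm_dsym (j : Fin 2) (ξ : Plane) : ‖dsym j ξ‖ = 2 * Real.pi * |ξ j| := by
  simp [dsym, abs_of_pos Real.pi_pos]

theorem abs_coord_le (ξ : Plane) (j : Fin 2) : |ξ j| ≤ ‖ξ‖ := by
  simpa using PiLp.norm_apply_le ξ j

theorem norm_dsym_le (j : Fin 2) (ξ : Plane) : ‖dsym j ξ‖ ≤ 2 * Real.pi * (1 + ‖ξ‖) := by
  rw [norm_dsym]
  have := abs_coord_le ξ j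
  have := Real.pi_pos
  gcongr
  linarith

theorem synth_eq (g : ℝ → Plane → ℂ) (z : Spacetime) :
    synth g z = ∫ ξ, Complex.exp (↑(2 * Real.pi * inner ℝ ξ z.2) * Complex.I) * g z.1 ξ := by
  simp [synth, Real.fourierInv_eq']

theorem norm_exp_phase (r : ℝ) : ‖Complex.exp (↑r * Complex.I)‖ = 1 :=
  Complex.norm_exp_ofReal_mul_I r

/-- The bound `|g(t, ξ)| ≤ C (1 + |ξ|)^{-4-m}`. -/
def DecayBound (m : ℕ) (g : ℝ → Plane → ℂ) : Prop :=
  ∃ C : ℝ, ∀ t ξ, (1 + ‖ξ‖) ^ m * ‖g t ξ‖ ≤ C * ((1 + ‖ξ‖) ^ 4)⁻¹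

theorem DecayBound.zero_le {m : ℕ} {g : ℝ → Plane → ℂ} (h : DecayBound m g) :
    ∃ C : ℝ, 0 ≤ C ∧ ∀ t ξ, (1 + ‖ξ‖) ^ m * ‖g t ξ‖ ≤ C * ((1 + ‖ξ‖) ^ 4)⁻¹ := by
  obtain ⟨C, hC⟩ := h
  exact ⟨max C 0, le_max_right _ _, fun t ξ => (hC t ξ).trans (by gcongr; exact le_max_left _ _)⟩

theorem DecayBound.mono {m l : ℕ} (hml : l ≤ m) {g : ℝ → Plane → ℂ} (h : DecayBound m g) :
    DecayBound l g := by
  obtain ⟨C, hC⟩ := h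
  refine ⟨C, fun t ξ => le_trans ?_ (hC t ξ)⟩
  gcongr
  linarith [norm_nonneg ξ]

theorem DecayBound.mul {m l : ℕ} {g : ℝ → Plane → ℂ} (h : DecayBound (m + l) g) {p : Plane → ℂ}
    {B : ℝ} (hp : ∀ ξ, ‖p ξ‖ ≤ B * (1 + ‖ξ‖) ^ l) : DecayBound m fun t ξ => p ξ * g t ξ := by
  obtain ⟨C, hC0, hC⟩ := h.zero_le
  refine ⟨max B 0 * C, fun t ξ => ?_⟩
  have h1 : ‖p ξ‖ ≤ max B 0 * (1 + ‖ξ‖) ^ l := (hp ξ).trans (by gcongr; exact le_max_left _ _)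
  rw [norm_mul]
  calc (1 + ‖ξ‖) ^ m * (‖p ξ‖ * ‖g t ξ‖)
      ≤ (1 + ‖ξ‖) ^ m * ((max B 0 * (1 + ‖ξ‖) ^ l) * ‖g t ξ‖) := by gcongr
    _ = max B 0 * ((1 + ‖ξ‖) ^ (m + l) * ‖g t ξ‖) := by ring
    _ ≤ max B 0 * (C * ((1 + ‖ξ‖) ^ 4)⁻¹) :=
        mul_le_mul_of_nonneg_left (hC t ξ) (le_max_right _ _)
    _ = _ := by ring

theorem DecayBound.add {m : ℕ} {g h : ℝ → Plane → ℂ} (hg : DecayBound m g) (hh : DecayBound m h) :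
    DecayBound m fun t ξ => g t ξ + h t ξ := by
  obtain ⟨C, hC⟩ := hg
  obtain ⟨D, hD⟩ := hh
  refine ⟨C + D, fun t ξ => ?_⟩
  calc (1 + ‖ξ‖) ^ m * ‖g t ξ + h t ξ‖ ≤ (1 + ‖ξ‖) ^ m * (‖g t ξ‖ + ‖h t ξ‖) := by
        gcongr; exact norm_add_le _ _
    _ ≤ _ := by linarith [hC t ξ, hD t ξ]

theorem DecayBound.hat (k : ℕ) (g : WSpace) : DecayBound 2 (hat k g) := by
  refine ⟨‖g‖, fun t ξ => ?_⟩
  calc (1 + ‖ξ‖) ^ 2 * ‖CSH.hat k g t ξ‖ ≤ (1 + ‖ξ‖) ^ 2 * (‖g‖ * wt k ξ) := by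
        gcongr; exact norm_hat_le k g t ξ
    _ = ‖g‖ * ((1 + ‖ξ‖) ^ 2 * wt k ξ) := by ring
    _ ≤ _ := by gcongr; exact sq_mul_wt_le k ξ

theorem DecayBound.integrable {g : ℝ → Plane → ℂ} (h : DecayBound 0 g) {t : ℝ}
    (hc : Continuous (g t)) : Integrable (g t) := by
  obtain ⟨C, hC⟩ := h
  refine (integrable_inv_one_add_norm_pow_four.const_mul C).mono' hc.aestronglyMeasurable
    (Filter.Eventually.of_forall fun ξ => ?_)
  simpa using hC t ξ

theorem continuous_synth {g : ℝ → Plane → ℂ} (hc : Continuous fun z : ℝ × Plane => g z.1 z.2)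
    (h : DecayBound 0 g) : Continuous (synth g) := by
  obtain ⟨C, hC⟩ := h
  rw [show synth g = _ from funext (synth_eq g)]
  refine continuous_of_dominated (bound := fun ξ => C * ((1 + ‖ξ‖) ^ 4)⁻¹) (fun z => ?_)
    (fun z => Filter.Eventually.of_forall fun ξ => ?_)
    (integrable_inv_one_add_norm_pow_four.const_mul C) (Filter.Eventually.of_forall fun ξ => ?_)
  · have : Continuous fun ξ => g z.1 ξ := hc.comp (by fun_prop : Continuous fun ξ => (z.1, ξ))
    exact Continuous.aestronglyMeasurable (by fun_prop)
  · rw [norm_mul, norm_exp_phase, one_mul]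
    simpa using hC z.1 ξ
  · have : Continuous fun z : Spacetime => g z.1 ξ :=
      hc.comp (by fun_prop : Continuous fun z : Spacetime => (z.1, ξ))
    fun_prop

/-- The differential of `synth g`, where `g'` is the time derivative of `g`. -/
def synthDeriv (g g' : ℝ → Plane → ℂ) (z : Spacetime) : Spacetime →L[ℝ] ℂ :=
  (ContinuousLinearMap.fst ℝ ℝ Plane).smulRight (synth g' z) +
    ∑ j : Fin 2, ((EuclideanSpace.proj j : Plane →L[ℝ] ℝ).comp
      (ContinuousLinearMap.snd ℝ ℝ Plane)).smulRight (synth (fun t ξ => dsym j ξ * g t ξ) z)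

/-- Differentiation under the inverse Fourier integral. A spatial derivative costs one factor `2π(1
+ ‖ξ‖)`, whence `DecayBound 1` for `g`; the time derivative only needs `g'` to be dominated, whence
`DecayBound 0` for `g'`. -/
theorem hasFDerivAt_synth {g g' : ℝ → Plane → ℂ} {a b : ℝ}
    (hc : ∀ t, Continuous (g t)) (hc' : ∀ t, Continuous (g' t))
    (hg : DecayBound 1 g) (hg' : DecayBound 0 g')
    (hd : ∀ t ∈ Ioo a b, ∀ ξ, HasDerivAt (fun r => g r ξ) (g' t ξ) t)
    {z : Spacetime} (hz : z ∈ Ioo a b ×ˢ (univ : Set Plane)) :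
    HasFDerivAt (synth g) (synthDeriv g g' z) z := by
  obtain ⟨C, hC0, hC⟩ := hg.zero_le
  obtain ⟨D, hD0, hD⟩ := hg'.zero_le
  let e : Spacetime → Plane → ℂ := fun z ξ =>
    Complex.exp (↑(2 * Real.pi * inner ℝ ξ z.2) * Complex.I)
  have hec : ∀ z, Continuous (e z) := fun z => by fun_prop
  let F : Spacetime → Plane → ℂ := fun z ξ => e z ξ * g z.1 ξ
  let F' : Spacetime → Plane → Spacetime →L[ℝ] ℂ := fun z ξ =>
    (ContinuousLinearMap.fst ℝ ℝ Plane).smulRight (e z ξ * g' z.1 ξ) +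
    ∑ j : Fin 2, ((EuclideanSpace.proj j : Plane →L[ℝ] ℝ).comp
      (ContinuousLinearMap.snd ℝ ℝ Plane)).smulRight (e z ξ * (dsym j ξ * g z.1 ξ))
  have hF'c : ∀ z, Continuous (F' z) := fun z => by
    have h1 := hec z
    have h2 := hc z.1
    have h3 := hc' z.1
    have h4 : ∀ (L : Spacetime →L[ℝ] ℝ) (f : Plane → ℂ), Continuous f →
        Continuous fun ξ => L.smulRight (f ξ) := fun L f hf =>
      (ContinuousLinearMap.smulRightL ℝ Spacetime ℂ L).continuous.comp hf
    exact (h4 _ _ (by fun_prop)).add (continuous_finsetSum _ fun j _ => h4 _ _ (by fun_prop))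
  have hns : ∀ (L : Spacetime →L[ℝ] ℝ) (c : ℂ), ‖L‖ ≤ 1 → ‖L.smulRight c‖ ≤ ‖c‖ := by
    intro L c hL
    rw [ContinuousLinearMap.norm_smulRight_apply]
    exact mul_le_of_le_one_left (norm_nonneg _) hL
  have hn1 : ‖ContinuousLinearMap.fst ℝ ℝ Plane‖ ≤ 1 := ContinuousLinearMap.norm_fst_le ℝ ℝ Plane
  have hn2 : ∀ j : Fin 2, ‖(EuclideanSpace.proj j : Plane →L[ℝ] ℝ).comp
      (ContinuousLinearMap.snd ℝ ℝ Plane)‖ ≤ 1 := fun j => by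
    refine ContinuousLinearMap.opNorm_le_bound _ zero_le_one fun w => ?_
    rw [one_mul]
    exact (abs_coord_le w.2 j).trans (norm_snd_le w)
  have hF'b : ∀ z ξ, ‖F' z ξ‖ ≤ (D + 4 * Real.pi * C) * ((1 + ‖ξ‖) ^ 4)⁻¹ := by
    intro z ξ
    have he : ‖e z ξ‖ = 1 := norm_exp_phase _
    have h1 : ‖(ContinuousLinearMap.fst ℝ ℝ Plane).smulRight (e z ξ * g' z.1 ξ)‖
        ≤ D * ((1 + ‖ξ‖) ^ 4)⁻¹ := by
      refine (hns _ _ hn1).trans ?_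
      rw [norm_mul, he, one_mul]
      simpa using hD z.1 ξ
    have h2 : ∀ j : Fin 2, ‖((EuclideanSpace.proj j : Plane →L[ℝ] ℝ).comp
        (ContinuousLinearMap.snd ℝ ℝ Plane)).smulRight (e z ξ * (dsym j ξ * g z.1 ξ))‖
        ≤ 2 * Real.pi * (C * ((1 + ‖ξ‖) ^ 4)⁻¹) := by
      intro j
      refine (hns _ _ (hn2 j)).trans ?_
      rw [norm_mul, he, one_mul, norm_mul]
      have hp := Real.pi_pos
      calc ‖dsym j ξ‖ * ‖g z.1 ξ‖ ≤ 2 * Real.pi * (1 + ‖ξ‖) * ‖g z.1 ξ‖ := by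
            gcongr; exact norm_dsym_le j ξ
        _ = 2 * Real.pi * ((1 + ‖ξ‖) ^ 1 * ‖g z.1 ξ‖) := by ring
        _ ≤ _ := mul_le_mul_of_nonneg_left (hC z.1 ξ) (by positivity)
    refine (norm_add_le _ _).trans ?_
    have h3 := norm_sum_le (Finset.univ : Finset (Fin 2)) fun j =>
      ((EuclideanSpace.proj j : Plane →L[ℝ] ℝ).comp
        (ContinuousLinearMap.snd ℝ ℝ Plane)).smulRight (e z ξ * (dsym j ξ * g z.1 ξ))
    rw [Fin.sum_univ_two (f := fun j => ‖((EuclideanSpace.proj j : Plane →L[ℝ] ℝ).comp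
        (ContinuousLinearMap.snd ℝ ℝ Plane)).smulRight (e z ξ * (dsym j ξ * g z.1 ξ))‖)] at h3
    linarith [h2 0, h2 1]
  have hF'i : ∀ z, Integrable (F' z) := fun z =>
    (integrable_inv_one_add_norm_pow_four.const_mul _).mono' (hF'c z).aestronglyMeasurable
      (Filter.Eventually.of_forall (hF'b z))
  have hopen : Ioo a b ×ˢ (univ : Set Plane) ∈ 𝓝 z :=
    (isOpen_Ioo.prod isOpen_univ).mem_nhds hz
  have hFi : ∀ {f : ℝ → Plane → ℂ} (w : Spacetime), DecayBound 0 f → Continuous (f w.1) →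
      Integrable fun ξ => e w ξ * f w.1 ξ := by
    intro f w hf hfc
    refine (hf.integrable hfc).norm.mono' ?_ (Filter.Eventually.of_forall fun ξ => ?_)
    · have := hec w
      exact Continuous.aestronglyMeasurable (by fun_prop)
    · rw [norm_mul, norm_exp_phase, one_mul]
  have key := hasFDerivAt_integral_of_dominated_of_fderiv_le (μ := volume) (F := F) (F' := F')
    (x₀ := z) (bound := fun ξ => (D + 4 * Real.pi * C) * ((1 + ‖ξ‖) ^ 4)⁻¹) hopen
    (Filter.Eventually.of_forall fun w => by
      have h1 := hec w
      have h2 := hc w.1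
      exact Continuous.aestronglyMeasurable (by fun_prop))
    (hFi z (hg.mono zero_le_one) (hc _)) (hF'i z).1
    (Filter.Eventually.of_forall fun ξ w _ => hF'b w ξ)
    (integrable_inv_one_add_norm_pow_four.const_mul _)
    (Filter.Eventually.of_forall fun ξ w hw => by
      have h1 : HasFDerivAt (fun w : Spacetime => g w.1 ξ)
          ((ContinuousLinearMap.fst ℝ ℝ Plane).smulRight (g' w.1 ξ)) w := by
        have := (hd w.1 hw.1 ξ).hasFDerivAt.comp w hasFDerivAt_fst
        refine this.congr_fderiv ?_
        ext v <;> simp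
      have h2 : HasFDerivAt (fun w : Spacetime => e w ξ)
          (e w ξ • ((2 * Real.pi * Complex.I) •
            (Complex.ofRealCLM.comp ((innerSL ℝ ξ).comp (ContinuousLinearMap.snd ℝ ℝ Plane))))) w := by
        have h3 : HasFDerivAt (fun w : Spacetime =>
            (↑(2 * Real.pi * inner ℝ ξ w.2) * Complex.I : ℂ))
            ((2 * Real.pi * Complex.I) •
            (Complex.ofRealCLM.comp ((innerSL ℝ ξ).comp (ContinuousLinearMap.snd ℝ ℝ Plane)))) w := by
          have h4 := ((2 * Real.pi * Complex.I) •
            (Complex.ofRealCLM.comp ((innerSL ℝ ξ).comp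
              (ContinuousLinearMap.snd ℝ ℝ Plane)))).hasFDerivAt (x := w)
          refine h4.congr_of_eventuallyEq (Filter.Eventually.of_forall fun w => ?_)
          simp
          ring
        exact h3.cexp
      refine (h2.mul h1).congr_fderiv ?_
      refine ContinuousLinearMap.ext fun v => ?_
      have hin : (inner ℝ ξ v.2 : ℝ) = ∑ j : Fin 2, ξ j * v.2 j := by
        simp [PiLp.inner_apply, mul_comm]
      simp only [F', add_apply, smul_apply,
        ContinuousLinearMap.smulRight_apply, ContinuousLinearMap.comp_apply,
        ContinuousLinearMap.coe_fst', ContinuousLinearMap.coe_snd', innerSL_apply_apply, hin,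
        Complex.ofRealCLM_apply, smul_eq_mul, Fin.sum_univ_two, dsym, Complex.real_smul]
      push_cast
      simp
      ring)
  rw [show synth g = _ from funext (synth_eq g)]
  refine key.congr_fderiv (ContinuousLinearMap.ext fun v => ?_)
  rw [ContinuousLinearMap.integral_apply (hF'i z)]
  simp only [F', synthDeriv, add_apply, sum_apply,
    ContinuousLinearMap.smulRight_apply, synth_eq]
  have hi : ∀ j : Fin 2, Integrable fun ξ => e z ξ * (dsym j ξ * g z.1 ξ) := fun j => by
    refine hFi (f := fun t ξ => dsym j ξ * g t ξ) z (DecayBound.mul (m := 0) (l := 1) hg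
      (B := 2 * Real.pi) fun ξ => by simpa using norm_dsym_le j ξ) ?_
    have := hc z.1
    fun_prop
  rw [integral_add, integral_finsetSum]
  · simp only [integral_smul, e]
  · exact fun j _ => (hi j).smul _
  · exact (hFi z hg' (hc' _)).smul _
  · exact integrable_finsetSum _ fun j _ => (hi j).smul _

theorem continuous_left {g : ℝ → Plane → ℂ} (hc : Continuous fun z : ℝ × Plane => g z.1 z.2)
    (t : ℝ) : Continuous (g t) := hc.comp (by fun_prop : Continuous fun ξ => (t, ξ))

theorem decayBound_dsym {g : ℝ → Plane → ℂ} {m : ℕ} (hg : DecayBound (m + 1) g) (j : Fin 2) :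
    DecayBound m fun t ξ => dsym j ξ * g t ξ :=
  DecayBound.mul (m := m) (l := 1) hg (B := 2 * Real.pi) fun ξ => by
    simpa using norm_dsym_le j ξ

theorem contDiffOn_one_synth {g g' : ℝ → Plane → ℂ} {a b : ℝ}
    (hc : Continuous fun z : ℝ × Plane => g z.1 z.2)
    (hc' : Continuous fun z : ℝ × Plane => g' z.1 z.2)
    (hg : DecayBound 1 g) (hg' : DecayBound 0 g')
    (hd : ∀ t ∈ Ioo a b, ∀ ξ, HasDerivAt (fun r => g r ξ) (g' t ξ) t) :
    ContDiffOn ℝ 1 (synth g) (Ioo a b ×ˢ (univ : Set Plane)) := by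
  have ho : IsOpen (Ioo a b ×ˢ (univ : Set Plane)) := isOpen_Ioo.prod isOpen_univ
  have hf := fun z hz => hasFDerivAt_synth (continuous_left hc) (continuous_left hc') hg hg' hd
    (z := z) hz
  rw [← zero_add (1 : WithTop ℕ∞), contDiffOn_succ_iff_fderiv_of_isOpen ho]
  refine ⟨fun z hz => (hf z hz).differentiableAt.differentiableWithinAt, by simp, ?_⟩
  refine ContDiffOn.congr (f := synthDeriv g g') ?_ fun z hz => (hf z hz).fderiv
  rw [contDiffOn_zero]
  refine Continuous.continuousOn ?_
  have h4 : ∀ (L : Spacetime →L[ℝ] ℝ) (f : Spacetime → ℂ), Continuous f →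
      Continuous fun ξ => L.smulRight (f ξ) := fun L f hf =>
    (ContinuousLinearMap.smulRightL ℝ Spacetime ℂ L).continuous.comp hf
  refine (h4 _ _ (continuous_synth hc' hg')).add (continuous_finsetSum _ fun j _ =>
    h4 _ _ (continuous_synth (by fun_prop) (decayBound_dsym hg j)))

/-- The components of the differential are again synthesized functions, of `g'` and of `dsym j * g`,
and each of them is `C¹` by `contDiffOn_one_synth`. -/
theorem contDiffOn_two_synth {g g' g'' : ℝ → Plane → ℂ} {a b : ℝ}
    (hc : Continuous fun z : ℝ × Plane => g z.1 z.2)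
    (hc' : Continuous fun z : ℝ × Plane => g' z.1 z.2)
    (hc'' : Continuous fun z : ℝ × Plane => g'' z.1 z.2)
    (hg : DecayBound 2 g) (hg' : DecayBound 1 g') (hg'' : DecayBound 0 g'')
    (hd : ∀ t ∈ Ioo a b, ∀ ξ, HasDerivAt (fun r => g r ξ) (g' t ξ) t)
    (hd' : ∀ t ∈ Ioo a b, ∀ ξ, HasDerivAt (fun r => g' r ξ) (g'' t ξ) t) :
    ContDiffOn ℝ 2 (synth g) (Ioo a b ×ˢ (univ : Set Plane)) := by
  have ho : IsOpen (Ioo a b ×ˢ (univ : Set Plane)) := isOpen_Ioo.prod isOpen_univ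
  have hf := fun z hz => hasFDerivAt_synth (continuous_left hc) (continuous_left hc')
    (hg.mono one_le_two) (hg'.mono zero_le_one) hd (z := z) hz
  rw [show (2 : WithTop ℕ∞) = 1 + 1 by norm_num, contDiffOn_succ_iff_fderiv_of_isOpen ho]
  refine ⟨fun z hz => (hf z hz).differentiableAt.differentiableWithinAt, by simp, ?_⟩
  refine ContDiffOn.congr (f := synthDeriv g g') ?_ fun z hz => (hf z hz).fderiv
  have h4 : ∀ (L : Spacetime →L[ℝ] ℝ) (f : Spacetime → ℂ) (s : Set Spacetime),
      ContDiffOn ℝ 1 f s → ContDiffOn ℝ 1 (fun z => L.smulRight (f z)) s := fun L f s hf =>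
    (ContinuousLinearMap.smulRightL ℝ Spacetime ℂ L).contDiff.comp_contDiffOn hf
  refine (h4 _ _ _ (contDiffOn_one_synth hc' hc'' hg' hg'' hd')).add
    (ContDiffOn.sum fun j _ => h4 _ _ _ (contDiffOn_one_synth
      (g' := fun t ξ => dsym j ξ * g' t ξ) (by fun_prop) (by fun_prop)
      (decayBound_dsym hg j) (decayBound_dsym hg' j) fun t ht ξ => ?_))
  exact (hd t ht ξ).const_mul _

theorem lineDeriv_synth_zero {g g' : ℝ → Plane → ℂ} {a b : ℝ}
    (hc : ∀ t, Continuous (g t)) (hc' : ∀ t, Continuous (g' t))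
    (hg : DecayBound 1 g) (hg' : DecayBound 0 g')
    (hd : ∀ t ∈ Ioo a b, ∀ ξ, HasDerivAt (fun r => g r ξ) (g' t ξ) t)
    {z : Spacetime} (hz : z ∈ Ioo a b ×ˢ (univ : Set Plane)) :
    lineDeriv ℝ (synth g) z (coordVec 0) = synth g' z := by
  rw [((hasFDerivAt_synth hc hc' hg hg' hd hz).hasLineDerivAt _).lineDeriv]
  simp [synthDeriv, coordVec]

theorem coordVec_succ (j : Fin 2) :
    coordVec j.succ = ((0 : ℝ), EuclideanSpace.single j (1 : ℝ)) := rfl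

theorem lineDeriv_synth_succ {g g' : ℝ → Plane → ℂ} {a b : ℝ}
    (hc : ∀ t, Continuous (g t)) (hc' : ∀ t, Continuous (g' t))
    (hg : DecayBound 1 g) (hg' : DecayBound 0 g')
    (hd : ∀ t ∈ Ioo a b, ∀ ξ, HasDerivAt (fun r => g r ξ) (g' t ξ) t)
    {z : Spacetime} (hz : z ∈ Ioo a b ×ˢ (univ : Set Plane)) (j : Fin 2) :
    lineDeriv ℝ (synth g) z (coordVec j.succ) = synth (fun t ξ => dsym j ξ * g t ξ) z := by
  rw [((hasFDerivAt_synth hc hc' hg hg' hd hz).hasLineDerivAt _).lineDeriv, coordVec_succ]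
  fin_cases j <;> simp [synthDeriv]

end CSH

end

noncomputable section

namespace CSH

open FourierTransform
open scoped CompactlySupported

/-! ### The propagators of the Klein-Gordon equation -/

/-- The dispersion relation `ω(ξ) = (4π²|ξ|² + m)^{1/2}`. -/
def disp (m : ℝ) (ξ : Plane) : ℝ := √(4 * Real.pi ^ 2 * ‖ξ‖ ^ 2 + m)

@[fun_prop]
theorem continuous_disp (m : ℝ) : Continuous (disp m) := by unfold disp; fun_prop

theorem disp_nonneg (m : ℝ) (ξ : Plane) : 0 ≤ disp m ξ := Real.sqrt_nonneg _

theorem disp_neg (m : ℝ) (ξ : Plane) : disp m (-ξ) = disp m ξ := by simp [disp]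

theorem disp_sq {m : ℝ} (hm : 0 ≤ m) (ξ : Plane) :
    disp m ξ ^ 2 = 4 * Real.pi ^ 2 * ‖ξ‖ ^ 2 + m := Real.sq_sqrt (by positivity)

theorem two_pi_mul_norm_le_disp {m : ℝ} (hm : 0 ≤ m) (ξ : Plane) :
    2 * Real.pi * ‖ξ‖ ≤ disp m ξ := by
  refine Real.le_sqrt_of_sq_le ?_
  nlinarith

/-- `sin(tω)/ω`. -/
def sinProp (m t : ℝ) (ξ : Plane) : ℝ := t * Real.sinc (t * disp m ξ)

/-- `cos(tω)`. -/
def cosProp (m t : ℝ) (ξ : Plane) : ℝ := Real.cos (t * disp m ξ)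

@[fun_prop]
theorem continuous_sinProp {X : Type*} [TopologicalSpace X] {a : X → ℝ} {b : X → Plane} (m : ℝ)
    (ha : Continuous a) (hb : Continuous b) : Continuous fun x => sinProp m (a x) (b x) := by
  unfold sinProp
  exact ha.mul (Real.continuous_sinc.comp (by fun_prop))

@[fun_prop]
theorem continuous_cosProp {X : Type*} [TopologicalSpace X] {a : X → ℝ} {b : X → Plane} (m : ℝ)
    (ha : Continuous a) (hb : Continuous b) : Continuous fun x => cosProp m (a x) (b x) := by
  unfold cosProp
  fun_prop

/-- The frequency `ω` vanishes at `ξ = 0` when `m = 0`, as for the gauge field. Writing `sin(tω)/ω`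
through `sinc` keeps the symbol continuous there, and this identity replaces the division by `ω` in
what follows. -/
theorem disp_mul_sinProp (m t : ℝ) (ξ : Plane) :
    disp m ξ * sinProp m t ξ = Real.sin (t * disp m ξ) := by
  unfold sinProp
  by_cases h : t * disp m ξ = 0
  · rw [h, Real.sin_zero]
    rcases mul_eq_zero.1 h with h | h <;> simp [h]
  · rw [Real.sinc_of_ne_zero h, ← mul_assoc, mul_comm (disp m ξ) t, mul_div_cancel₀ _ h]

theorem abs_sinProp_le (m t : ℝ) (ξ : Plane) : |sinProp m t ξ| ≤ |t| := by
  unfold sinProp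
  rw [abs_mul]
  exact mul_le_of_le_one_right (abs_nonneg _) (Real.abs_sinc_le_one _)

theorem abs_cosProp_le (m t : ℝ) (ξ : Plane) : |cosProp m t ξ| ≤ 1 := Real.abs_cos_le_one _

theorem sinProp_zero (m : ℝ) (ξ : Plane) : sinProp m 0 ξ = 0 := by simp [sinProp]

theorem cosProp_zero (m : ℝ) (ξ : Plane) : cosProp m 0 ξ = 1 := by simp [cosProp]

theorem sinProp_neg (m t : ℝ) (ξ : Plane) : sinProp m t (-ξ) = sinProp m t ξ := by
  simp [sinProp, disp_neg]

theorem cosProp_neg (m t : ℝ) (ξ : Plane) : cosProp m t (-ξ) = cosProp m t ξ := by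
  simp [cosProp, disp_neg]

theorem sinProp_sub (m t s : ℝ) (ξ : Plane) : sinProp m (t - s) ξ
    = sinProp m t ξ * cosProp m s ξ - cosProp m t ξ * sinProp m s ξ := by
  by_cases h : disp m ξ = 0
  · simp [sinProp, cosProp, h]
  · have h1 := disp_mul_sinProp m (t - s) ξ
    rw [sub_mul, Real.sin_sub, ← disp_mul_sinProp m t, ← disp_mul_sinProp m s] at h1
    refine mul_left_cancel₀ h ?_
    rw [h1]
    unfold cosProp
    ring

theorem cosProp_sub (m t s : ℝ) (ξ : Plane) : cosProp m (t - s) ξ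
    = cosProp m t ξ * cosProp m s ξ + disp m ξ ^ 2 * (sinProp m t ξ * sinProp m s ξ) := by
  have h : disp m ξ ^ 2 * (sinProp m t ξ * sinProp m s ξ)
      = (disp m ξ * sinProp m t ξ) * (disp m ξ * sinProp m s ξ) := by ring
  rw [h, disp_mul_sinProp, disp_mul_sinProp]
  unfold cosProp
  rw [sub_mul, Real.cos_sub]

theorem hasDerivAt_cosProp (m t : ℝ) (ξ : Plane) :
    HasDerivAt (fun r => cosProp m r ξ) (-(disp m ξ ^ 2 * sinProp m t ξ)) t := by
  have h := ((hasDerivAt_id t).mul_const (disp m ξ)).cos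
  refine h.congr_deriv ?_
  have h1 := disp_mul_sinProp m t ξ
  simp only [id]
  rw [← h1]
  ring

theorem hasDerivAt_sinProp (m t : ℝ) (ξ : Plane) :
    HasDerivAt (fun r => sinProp m r ξ) (cosProp m t ξ) t := by
  by_cases h : disp m ξ = 0
  · simpa [sinProp, cosProp, h] using hasDerivAt_id' t
  · have h1 := (((hasDerivAt_id t).mul_const (disp m ξ)).sin).div_const (disp m ξ)
    have h2 : (fun r => sinProp m r ξ) = fun r => Real.sin (r * disp m ξ) / disp m ξ := by
      funext r
      rw [← disp_mul_sinProp]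
      field_simp
    rw [h2]
    refine h1.congr_deriv ?_
    simp [cosProp, h]

/-- The propagators acting on the initial velocity: `sin(tω)/ω` and its derivatives. -/
def velSym (m : ℝ) : Option (Fin 3) → ℝ → Plane → ℂ
  | none => fun t ξ => sinProp m t ξ
  | some μ => Fin.cases (fun t ξ => cosProp m t ξ) (fun j t ξ => dsym j ξ * sinProp m t ξ) μ

/-- The propagators acting on the initial position: `cos(tω)` and its derivatives. -/
def posSym (m : ℝ) : Option (Fin 3) → ℝ → Plane → ℂ
  | none => fun t ξ => cosProp m t ξ
  | some μ => Fin.cases (fun t ξ => -(disp m ξ ^ 2 * sinProp m t ξ))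
      (fun j t ξ => dsym j ξ * cosProp m t ξ) μ

@[simp] theorem velSym_none (m t : ℝ) (ξ : Plane) : velSym m none t ξ = sinProp m t ξ := rfl
@[simp] theorem velSym_zero (m t : ℝ) (ξ : Plane) : velSym m (some 0) t ξ = cosProp m t ξ := rfl
@[simp] theorem velSym_succ (m : ℝ) (j : Fin 2) (t : ℝ) (ξ : Plane) :
    velSym m (some j.succ) t ξ = dsym j ξ * sinProp m t ξ := rfl
@[simp] theorem posSym_none (m t : ℝ) (ξ : Plane) : posSym m none t ξ = cosProp m t ξ := rfl
@[simp] theorem posSym_zero (m t : ℝ) (ξ : Plane) :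
    posSym m (some 0) t ξ = -(disp m ξ ^ 2 * sinProp m t ξ) := rfl
@[simp] theorem posSym_succ (m : ℝ) (j : Fin 2) (t : ℝ) (ξ : Plane) :
    posSym m (some j.succ) t ξ = dsym j ξ * cosProp m t ξ := rfl

theorem forall_option_fin_three {P : Option (Fin 3) → Prop} :
    (∀ d, P d) ↔ P none ∧ P (some 0) ∧ ∀ j : Fin 2, P (some j.succ) :=
  ⟨fun h => ⟨h _, h _, fun _ => h _⟩, fun ⟨h1, h2, h3⟩ d => by
    rcases d with _ | μ
    · exact h1
    · exact Fin.cases h2 h3 μ⟩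

theorem continuous_velSym (m : ℝ) : ∀ d : Option (Fin 3),
    Continuous fun z : ℝ × Plane => velSym m d z.1 z.2 := by
  rw [forall_option_fin_three]
  simp only [velSym_none, velSym_zero, velSym_succ]
  exact ⟨by fun_prop, by fun_prop, fun j => by fun_prop⟩

theorem continuous_posSym (m : ℝ) : ∀ d : Option (Fin 3),
    Continuous fun z : ℝ × Plane => posSym m d z.1 z.2 := by
  rw [forall_option_fin_three]
  simp only [posSym_none, posSym_zero, posSym_succ]
  exact ⟨by fun_prop, by fun_prop, fun j => by fun_prop⟩

/-- The gain of one derivative by Duhamel's formula: `2π|ξ_j| ≤ ω` and `|ω · sin(tω)/ω| ≤ 1`, so the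
first derivatives of the propagator are bounded multipliers. The symbols `posSym` have no such
bound, but they only act on compactly supported profiles. -/
theorem norm_velSym_le {m : ℝ} (hm : 0 ≤ m) (R t : ℝ) (ht : |t| ≤ R) (ξ : Plane) :
    ∀ d : Option (Fin 3), ‖velSym m d t ξ‖ ≤ R + 1 := by
  have hR : 0 ≤ R := (abs_nonneg t).trans ht
  rw [forall_option_fin_three]
  simp only [velSym_none, velSym_zero, velSym_succ, Complex.norm_real, norm_mul, Real.norm_eq_abs]
  refine ⟨(abs_sinProp_le _ _ _).trans (by linarith), (abs_cosProp_le _ _ _).trans (by linarith),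
    fun j => ?_⟩
  calc ‖dsym j ξ‖ * |sinProp m t ξ| ≤ disp m ξ * |sinProp m t ξ| := by
        refine mul_le_mul_of_nonneg_right ?_ (abs_nonneg _)
        rw [norm_dsym]
        refine le_trans ?_ (two_pi_mul_norm_le_disp hm ξ)
        have := Real.pi_pos
        gcongr
        exact abs_coord_le ξ j
    _ = |Real.sin (t * disp m ξ)| := by
        rw [← disp_mul_sinProp, abs_mul, abs_of_nonneg (disp_nonneg m ξ)]
    _ ≤ R + 1 := (Real.abs_sin_le_one _).trans (by linarith)

/-- The propagators for the inhomogeneous equation. -/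
def velPropagator {m : ℝ} (hm : 0 ≤ m) (d : Option (Fin 3)) : Propagator where
  toFun := velSym m d
  continuous' := continuous_velSym m d
  bound R := R + 1
  norm_le' R t ht ξ := norm_velSym_le hm R t ht ξ d

/-! ### Free evolutions of compactly supported profiles -/

/-- The Fourier transform of a free evolution. -/
def hatFree (T m : ℝ) (d : Option (Fin 3)) (b₀ b₁ : C_c(Plane, ℂ)) (t : ℝ) (ξ : Plane) : ℂ :=
  posSym m d (clip T t) ξ * b₀ ξ + velSym m d (clip T t) ξ * b₁ ξ

theorem continuous_hatFree (T m : ℝ) (d : Option (Fin 3)) (b₀ b₁ : C_c(Plane, ℂ)) :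
    Continuous fun z : ℝ × Plane => hatFree T m d b₀ b₁ z.1 z.2 := by
  unfold hatFree
  have h0 := b₀.continuous
  have h1 := b₁.continuous
  have h2 : Continuous fun z : ℝ × Plane => posSym m d (clip T z.1) z.2 :=
    (continuous_posSym m d).comp (by fun_prop : Continuous fun z : ℝ × Plane => (clip T z.1, z.2))
  have h3 : Continuous fun z : ℝ × Plane => velSym m d (clip T z.1) z.2 :=
    (continuous_velSym m d).comp (by fun_prop : Continuous fun z : ℝ × Plane => (clip T z.1, z.2))
  fun_prop

theorem exists_hatFree_le (k : ℕ) (T m : ℝ) (d : Option (Fin 3)) (b₀ b₁ : C_c(Plane, ℂ)) :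
    ∃ C, ∀ t ξ, ‖hatFree T m d b₀ b₁ t ξ‖ ≤ C * wt k ξ := by
  -- The derivatives in `posSym` grow with `ξ`, so the constant comes from compactness: times in
  -- `[-|T|, |T|]`, which contains every value of `clip T` whatever the sign of `T`, and frequencies
  -- in the supports.
  let K : Set (ℝ × Plane) := Icc (-|T|) |T| ×ˢ (tsupport b₀ ∪ tsupport b₁)
  have hK : IsCompact K :=
    isCompact_Icc.prod (b₀.hasCompactSupport.union b₁.hasCompactSupport)
  let f : ℝ × Plane → ℂ := fun z =>
    ((wt k z.2)⁻¹ : ℝ) * (posSym m d z.1 z.2 * b₀ z.2 + velSym m d z.1 z.2 * b₁ z.2)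
  have hf : Continuous f := by
    have h0 := b₀.continuous
    have h1 := b₁.continuous
    have h2 := continuous_posSym m d
    have h3 := continuous_velSym m d
    have h : Continuous fun z : ℝ × Plane => (wt k z.2)⁻¹ :=
      Continuous.inv₀ (by fun_prop) fun z => (wt_pos k z.2).ne'
    fun_prop
  obtain ⟨C, hC⟩ := hK.exists_bound_of_continuousOn hf.continuousOn
  refine ⟨max C 0, fun t ξ => ?_⟩
  have hw := wt_pos k ξ
  by_cases hξ : ξ ∈ tsupport b₀ ∪ tsupport b₁
  · have hclip : clip T t ∈ Icc (-|T|) |T| := by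
      unfold clip
      rcases abs_cases T with ⟨h, h'⟩ | ⟨h, h'⟩ <;> rw [h]
      · exact ⟨le_max_left _ _, max_le (by linarith) (min_le_left _ _)⟩
      · refine ⟨?_, max_le (by linarith) ((min_le_left _ _).trans (by linarith))⟩
        rw [le_max_iff]
        left
        linarith
    have h1 := hC (clip T t, ξ) ⟨hclip, hξ⟩
    simp only [f, norm_mul, Complex.norm_real, norm_inv, Real.norm_of_nonneg hw.le] at h1
    rw [inv_mul_le_iff₀ hw, mul_comm (wt k ξ) C] at h1
    exact h1.trans (mul_le_mul_of_nonneg_right (le_max_left _ _) hw.le)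
  · have h0 : b₀ ξ = 0 := image_eq_zero_of_notMem_tsupport fun h => hξ (Or.inl h)
    have h1 : b₁ ξ = 0 := image_eq_zero_of_notMem_tsupport fun h => hξ (Or.inr h)
    simp only [hatFree, h0, h1, mul_zero, add_zero, norm_zero]
    positivity

/-- The free evolution with initial position `b₀` and initial velocity `b₁`. -/
def free (k : ℕ) (T m : ℝ) (d : Option (Fin 3)) (b₀ b₁ : C_c(Plane, ℂ)) : WSpace :=
  ofHat k (hatFree T m d b₀ b₁) (continuous_hatFree T m d b₀ b₁) _
    (exists_hatFree_le k T m d b₀ b₁).choose_spec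

theorem hat_free (k : ℕ) (T m : ℝ) (d : Option (Fin 3)) (b₀ b₁ : C_c(Plane, ℂ)) (t : ℝ)
    (ξ : Plane) : hat k (free k T m d b₀ b₁) t ξ
      = posSym m d (clip T t) ξ * b₀ ξ + velSym m d (clip T t) ξ * b₁ ξ :=
  hat_ofHat k (hatFree T m d b₀ b₁) _ _ (exists_hatFree_le k T m d b₀ b₁).choose_spec t ξ

theorem free_zero (k : ℕ) (T m : ℝ) (d : Option (Fin 3)) : free k T m d 0 0 = 0 :=
  ext_hat k fun t ξ => by simp [hat_free, hat_zero]

/-! ### The Klein-Gordon equation on the Fourier side -/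

/-- The addition formulas separate `r` from `s`, so that the parameter leaves the integrand; the
fundamental theorem of calculus and the product rule then suffice. The boundary term of the first
integral vanishes, and that of the second is `F t` because `cos² + sin² = 1`. -/
theorem hasDerivAt_duhamel_sin {F : ℝ → ℂ} (hF : Continuous F) (m t : ℝ) (ξ : Plane) :
    HasDerivAt (fun r => ∫ s in (0 : ℝ)..r, (sinProp m (r - s) ξ : ℂ) * F s)
      (∫ s in (0 : ℝ)..t, (cosProp m (t - s) ξ : ℂ) * F s) t ∧
    HasDerivAt (fun r => ∫ s in (0 : ℝ)..r, (cosProp m (r - s) ξ : ℂ) * F s)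
      (F t - disp m ξ ^ 2 * ∫ s in (0 : ℝ)..t, (sinProp m (t - s) ξ : ℂ) * F s) t := by
  have hc : Continuous fun s => (cosProp m s ξ : ℂ) * F s := by fun_prop
  have hs : Continuous fun s => (sinProp m s ξ : ℂ) * F s := by fun_prop
  have ha := hc.integral_hasStrictDerivAt 0 t |>.hasDerivAt
  have hb := hs.integral_hasStrictDerivAt 0 t |>.hasDerivAt
  have e1 : ∀ r, ∫ s in (0 : ℝ)..r, (sinProp m (r - s) ξ : ℂ) * F s
      = sinProp m r ξ * (∫ s in (0 : ℝ)..r, (cosProp m s ξ : ℂ) * F s)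
        - cosProp m r ξ * (∫ s in (0 : ℝ)..r, (sinProp m s ξ : ℂ) * F s) := fun r => by
    rw [← intervalIntegral.integral_const_mul, ← intervalIntegral.integral_const_mul,
      ← intervalIntegral.integral_sub ((hc.const_mul _).intervalIntegrable _ _)
        ((hs.const_mul _).intervalIntegrable _ _)]
    refine intervalIntegral.integral_congr fun s _ => ?_
    simp only [sinProp_sub]
    push_cast
    ring
  have e2 : ∀ r, ∫ s in (0 : ℝ)..r, (cosProp m (r - s) ξ : ℂ) * F s
      = cosProp m r ξ * (∫ s in (0 : ℝ)..r, (cosProp m s ξ : ℂ) * F s)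
        + disp m ξ ^ 2 * sinProp m r ξ * (∫ s in (0 : ℝ)..r, (sinProp m s ξ : ℂ) * F s) :=
    fun r => by
    rw [← intervalIntegral.integral_const_mul, ← intervalIntegral.integral_const_mul,
      ← intervalIntegral.integral_add ((hc.const_mul _).intervalIntegrable _ _)
        ((hs.const_mul _).intervalIntegrable _ _)]
    refine intervalIntegral.integral_congr fun s _ => ?_
    simp only [cosProp_sub]
    push_cast
    ring
  have hS := (hasDerivAt_sinProp m t ξ).ofReal_comp
  have hC := (hasDerivAt_cosProp m t ξ).ofReal_comp
  constructor
  · rw [funext e1]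
    refine ((hS.mul ha).sub (hC.mul hb)).congr_deriv ?_
    rw [e2]
    push_cast
    ring
  · rw [funext e2]
    refine ((hC.mul ha).add ((hS.const_mul (disp m ξ ^ 2 : ℂ)).mul hb)).congr_deriv ?_
    rw [e1]
    have hpy : (cosProp m t ξ : ℂ) ^ 2 + (disp m ξ : ℂ) ^ 2 * (sinProp m t ξ : ℂ) ^ 2 = 1 := by
      have h1 : cosProp m t ξ ^ 2 + disp m ξ ^ 2 * sinProp m t ξ ^ 2 = 1 := by
        rw [← mul_pow, disp_mul_sinProp]
        exact Real.cos_sq_add_sin_sq _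
      exact_mod_cast h1
    push_cast
    linear_combination F t * hpy

/-- The first order form of the Klein-Gordon equation with mass `m` and source `F`. -/
structure IsWave (k : ℕ) (T m : ℝ) (u : Option (Fin 3) → WSpace) (F : WSpace) : Prop where
  deriv_none : ∀ t ∈ Ioo (-T) T, ∀ ξ,
    HasDerivAt (fun r => hat k (u none) r ξ) (hat k (u (some 0)) t ξ) t
  deriv_zero : ∀ t ∈ Ioo (-T) T, ∀ ξ,
    HasDerivAt (fun r => hat k (u (some 0)) r ξ)
      (-(disp m ξ ^ 2) * hat k (u none) t ξ + hat k F t ξ) t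
  succ : ∀ (j : Fin 2) t ξ, hat k (u (some j.succ)) t ξ = dsym j ξ * hat k (u none) t ξ

theorem IsWave.free (k : ℕ) (T m : ℝ) (b₀ b₁ : C_c(Plane, ℂ)) :
    IsWave k T m (fun d => free k T m d b₀ b₁) 0 where
  deriv_none t ht ξ := by
    simp only [hat_free]
    have h : HasDerivAt (fun r => posSym m none r ξ * b₀ ξ + velSym m none r ξ * b₁ ξ)
        (posSym m (some 0) t ξ * b₀ ξ + velSym m (some 0) t ξ * b₁ ξ) t := by
      simp only [posSym_none, velSym_none, posSym_zero, velSym_zero]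
      refine ((((hasDerivAt_cosProp m t ξ).ofReal_comp).mul_const _).add
        (((hasDerivAt_sinProp m t ξ).ofReal_comp).mul_const _)).congr_deriv ?_
      push_cast
      ring
    rw [clip_of_mem ⟨ht.1.le, ht.2.le⟩]
    refine h.congr_of_eventuallyEq ?_
    filter_upwards [clip_eventuallyEq ht] with r hr
    rw [hr]; rfl
  deriv_zero t ht ξ := by
    simp only [hat_free, hat_zero, add_zero]
    have h : HasDerivAt (fun r => posSym m (some 0) r ξ * b₀ ξ + velSym m (some 0) r ξ * b₁ ξ)
        (-(disp m ξ ^ 2) * (posSym m none t ξ * b₀ ξ + velSym m none t ξ * b₁ ξ)) t := by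
      simp only [posSym_none, velSym_none, posSym_zero, velSym_zero]
      refine (((((hasDerivAt_sinProp m t ξ).ofReal_comp).const_mul (disp m ξ ^ 2 : ℂ)).neg.mul_const
        _).add (((hasDerivAt_cosProp m t ξ).ofReal_comp).mul_const _)).congr_deriv ?_
      push_cast
      ring
    rw [clip_of_mem ⟨ht.1.le, ht.2.le⟩]
    refine h.congr_of_eventuallyEq ?_
    filter_upwards [clip_eventuallyEq ht] with r hr
    rw [hr]; rfl
  succ j t ξ := by
    simp only [hat_free, posSym_succ, velSym_succ, posSym_none, velSym_none]
    ring

theorem IsWave.duhamel (k : ℕ) {T : ℝ} (hT : 0 ≤ T) {m : ℝ} (hm : 0 ≤ m) (F : WSpace) :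
    IsWave k T m (fun d => duhamel k hT (velPropagator hm d) F) F where
  deriv_none t ht ξ := by
    simp only [hat_duhamel]
    rw [clip_of_mem ⟨ht.1.le, ht.2.le⟩]
    have h := (hasDerivAt_duhamel_sin (F := fun s => hat k F s ξ) (by fun_prop) m t ξ).1
    refine h.congr_of_eventuallyEq ?_
    filter_upwards [clip_eventuallyEq ht] with r hr
    rw [hr]; rfl
  deriv_zero t ht ξ := by
    simp only [hat_duhamel]
    rw [clip_of_mem ⟨ht.1.le, ht.2.le⟩]
    have h := (hasDerivAt_duhamel_sin (F := fun s => hat k F s ξ) (by fun_prop) m t ξ).2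
    refine (h.congr_of_eventuallyEq ?_).congr_deriv ?_
    · filter_upwards [clip_eventuallyEq ht] with r hr
      rw [hr]; rfl
    · change _ = -(disp m ξ ^ 2 : ℂ) * (∫ s in (0 : ℝ)..t, (sinProp m (t - s) ξ : ℂ) * hat k F s ξ)
        + hat k F t ξ
      ring
  succ j t ξ := by
    simp only [hat_duhamel, velPropagator, velSym_succ, velSym_none, mul_assoc]
    rw [intervalIntegral.integral_const_mul]

theorem IsWave.add {k : ℕ} {T m : ℝ} {u w : Option (Fin 3) → WSpace} {F G : WSpace}
    (hu : IsWave k T m u F) (hw : IsWave k T m w G) :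
    IsWave k T m (fun d => u d + w d) (F + G) where
  deriv_none t ht ξ := by
    simp only [hat_add]
    exact (hu.deriv_none t ht ξ).add (hw.deriv_none t ht ξ)
  deriv_zero t ht ξ := by
    simp only [hat_add]
    exact ((hu.deriv_zero t ht ξ).add (hw.deriv_zero t ht ξ)).congr_deriv (by ring)
  succ j t ξ := by
    simp only [hat_add, hu.succ, hw.succ]
    ring

theorem IsWave.smul {k : ℕ} {T m : ℝ} {u : Option (Fin 3) → WSpace} {F : WSpace}
    (hu : IsWave k T m u F) (c : ℝ) : IsWave k T m (fun d => c • u d) (c • F) where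
  deriv_none t ht ξ := by
    simp only [hat_smul]
    exact (hu.deriv_none t ht ξ).const_mul _
  deriv_zero t ht ξ := by
    simp only [hat_smul]
    exact ((hu.deriv_zero t ht ξ).const_mul _).congr_deriv (by ring)
  succ j t ξ := by
    simp only [hat_smul, hu.succ]
    ring

end CSH

end

noncomputable section

namespace CSH

open FourierTransform
open scoped CompactlySupported

/-! ### Small solutions of a fixed point equation -/

section FixedPoint

variable {E : Type*} [NormedAddCommGroup E] [NormedSpace ℝ E]

/-- Along the line through `v` the map is `c ↦ c^p • N v`, whose derivative at `c = 0` vanishes as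
soon as `p ≥ 2`. -/
theorem fderiv_eq_zero_of_homogeneous {N : E → E} {p : ℕ} (hp : 2 ≤ p)
    (hN : DifferentiableAt ℝ N 0) (hom : ∀ (c : ℝ) U, N (c • U) = c ^ p • N U) :
    fderiv ℝ N 0 = 0 := by
  ext v
  have h1 : HasDerivAt (fun c : ℝ => N (c • v)) (fderiv ℝ N 0 v) 0 := by
    have h2 : HasDerivAt (fun c : ℝ => c • v) v 0 := by
      simpa using (hasDerivAt_id (0 : ℝ)).smul_const v
    have h3 : HasFDerivAt N (fderiv ℝ N 0) ((0 : ℝ) • v) := by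
      rw [zero_smul]; exact hN.hasFDerivAt
    exact h3.comp_hasDerivAt (0 : ℝ) h2
  have h2 : HasDerivAt (fun c : ℝ => N (c • v)) (((p : ℝ) * 0 ^ (p - 1)) • N v) 0 := by
    simp only [hom]
    exact (hasDerivAt_pow p (0 : ℝ)).smul_const (N v)
  rw [h1.unique h2, zero_pow (by omega)]
  simp

variable [CompleteSpace E]

/-- The equation `U = δ L + δ² M + N₂(U) + N₃(U)` with `N₂`, `N₃` homogeneous of degrees two and
three has a unique small solution for small `δ`, with the expected expansion. -/
theorem exists_small_solution {N₂ N₃ : E → E} (h2 : ContDiff ℝ 1 N₂) (h3 : ContDiff ℝ 1 N₃)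
    (hom2 : ∀ (c : ℝ) U, N₂ (c • U) = c ^ 2 • N₂ U)
    (hom3 : ∀ (c : ℝ) U, N₃ (c • U) = c ^ 3 • N₃ U) (L M : E) :
    ∃ U : ℝ → E, Filter.Tendsto U (𝓝 0) (𝓝 0) ∧
      (∀ᶠ δ in 𝓝 (0 : ℝ), U δ = δ • L + δ ^ 2 • M + N₂ (U δ) + N₃ (U δ)) ∧
      (∀ V : ℝ → E, Filter.Tendsto V (𝓝 0) (𝓝 0) →
        (∀ᶠ δ in 𝓝 (0 : ℝ), V δ = δ • L + δ ^ 2 • M + N₂ (V δ) + N₃ (V δ)) → V =ᶠ[𝓝 0] U) ∧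
      (fun δ => U δ - δ • L - δ ^ 2 • (M + N₂ L)
        - δ ^ 3 • (fderiv ℝ N₂ L (M + N₂ L) + N₃ L)) =o[𝓝 0] fun δ : ℝ => δ ^ 3 := by
  have hz2 : N₂ 0 = 0 := by simpa using hom2 0 0
  have hz3 : N₃ 0 = 0 := by simpa using hom3 0 0
  -- The equation reads `G U = δ L + δ² M`, and `G` has the identity as strict derivative at `0`.
  -- Its local inverse gives existence, and the left inverse property gives uniqueness.
  let G : E → E := fun U => U - N₂ U - N₃ U
  have hG0 : G 0 = 0 := by simp [G, hz2, hz3]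
  have hG : HasStrictFDerivAt G ((ContinuousLinearEquiv.refl ℝ E : E ≃L[ℝ] E) : E →L[ℝ] E) 0 := by
    have a2 := h2.contDiffAt (x := (0 : E)) |>.hasStrictFDerivAt one_ne_zero
    have a3 := h3.contDiffAt (x := (0 : E)) |>.hasStrictFDerivAt one_ne_zero
    rw [fderiv_eq_zero_of_homogeneous le_rfl (h2.differentiable one_ne_zero 0) hom2] at a2
    rw [fderiv_eq_zero_of_homogeneous (by norm_num) (h3.differentiable one_ne_zero 0) hom3] at a3
    have := ((hasStrictFDerivAt_id (𝕜 := ℝ) (0 : E)).sub a2).sub a3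
    refine this.congr_fderiv ?_
    ext v
    simp
  let g := hG.localInverse G _ 0
  have hg : HasStrictFDerivAt g
      ((ContinuousLinearEquiv.refl ℝ E : E ≃L[ℝ] E).symm : E →L[ℝ] E) (G 0) := hG.to_localInverse
  rw [hG0] at hg
  have hg0 : g 0 = 0 := by
    have := hG.localInverse_apply_image
    rwa [hG0] at this
  let c : ℝ → E := fun δ => δ • L + δ ^ 2 • M
  have hc : HasDerivAt c L 0 := by
    have a1 := (hasDerivAt_id (0 : ℝ)).smul_const L
    have a2 := (hasDerivAt_pow 2 (0 : ℝ)).smul_const M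
    refine (a1.add a2).congr_deriv ?_
    simp
  have hc0 : c 0 = 0 := by simp [c]
  have hU : HasDerivAt (fun δ => g (c δ)) L 0 := by
    have a : HasFDerivAt g
      ((ContinuousLinearEquiv.refl ℝ E : E ≃L[ℝ] E).symm : E →L[ℝ] E) (c 0) := by
      rw [hc0]; exact hg.hasFDerivAt
    exact a.comp_hasDerivAt (0 : ℝ) hc
  have hUt : Filter.Tendsto (fun δ => g (c δ)) (𝓝 0) (𝓝 0) := by
    have := hU.continuousAt.tendsto
    rwa [hc0, hg0] at this
  have hct : Filter.Tendsto c (𝓝 0) (𝓝 0) := by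
    have := hc.continuousAt.tendsto
    rwa [hc0] at this
  have heq : ∀ᶠ δ in 𝓝 (0 : ℝ), g (c δ) = δ • L + δ ^ 2 • M + N₂ (g (c δ)) + N₃ (g (c δ)) := by
    have a := hG.eventually_right_inverse
    rw [hG0] at a
    filter_upwards [hct.eventually a] with δ hδ
    have : g (c δ) - N₂ (g (c δ)) - N₃ (g (c δ)) = c δ := hδ
    change _ = c δ + _ + _
    nth_rw 2 [← this]
    abel
  refine ⟨fun δ => g (c δ), hUt, heq, ?_, ?_⟩
  · intro V hV hVeq
    filter_upwards [hV.eventually hG.eventually_left_inverse, hVeq] with δ h1 h2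
    have : G (V δ) = c δ := by
      change V δ - N₂ (V δ) - N₃ (V δ) = c δ
      nth_rw 1 [h2]
      simp only [c]
      abel
    rw [this] at h1
    exact h1.symm
  · set U : ℝ → E := fun δ => g (c δ) with hUdef
    -- Rescaling `U = δ V`, homogeneity gives `V = L + δ (M + N₂ V) + δ² N₃ V`. Hence `V` is
    -- differentiable at `0` with derivative `M + N₂ L`, and inserting this once more produces the
    -- third order term although `N₂` and `N₃` are only assumed `C¹`.
    let V : ℝ → E := fun δ => if δ = 0 then L else δ⁻¹ • U δ
    have hUV : ∀ δ, U δ = δ • V δ := fun δ => by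
      by_cases h : δ = 0
      · simp [h, hUdef, hc0, hg0]
      · simp [V, h, smul_smul]
    have hV0 : V 0 = L := by simp [V]
    have hVt : Filter.Tendsto V (𝓝[≠] 0) (𝓝 L) := by
      have a := hU.tendsto_slope_zero
      refine a.congr' ?_
      filter_upwards [self_mem_nhdsWithin] with δ hδ
      have hδ' : δ ≠ 0 := hδ
      simp [V, hδ', hUdef, hc0, hg0]
    have hVeq : ∀ᶠ δ in 𝓝[≠] (0 : ℝ), V δ = L + δ • M + δ • N₂ (V δ) + δ ^ 2 • N₃ (V δ) := by
      filter_upwards [self_mem_nhdsWithin, heq.filter_mono nhdsWithin_le_nhds] with δ hδ h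
      have hδ' : δ ≠ 0 := hδ
      have h' : U δ = δ • L + δ ^ 2 • M + N₂ (U δ) + N₃ (U δ) := h
      rw [hUV δ, hom2, hom3] at h'
      have h4 : δ • V δ = δ • (L + δ • M + δ • N₂ (V δ) + δ ^ 2 • N₃ (V δ)) := by
        rw [h']
        simp only [smul_add, smul_smul]
        ring_nf
      exact smul_right_injective E hδ' h4
    have t2 : Filter.Tendsto (fun δ => N₂ (V δ)) (𝓝[≠] 0) (𝓝 (N₂ L)) :=
      (h2.continuous.tendsto L).comp hVt
    have t3 : Filter.Tendsto (fun δ => N₃ (V δ)) (𝓝[≠] 0) (𝓝 (N₃ L)) :=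
      (h3.continuous.tendsto L).comp hVt
    have hid : Filter.Tendsto (fun δ : ℝ => δ) (𝓝[≠] 0) (𝓝 0) :=
      Filter.tendsto_id.mono_left nhdsWithin_le_nhds
    have hVd : HasDerivAt V (M + N₂ L) 0 := by
      rw [hasDerivAt_iff_tendsto_slope_zero]
      have a : Filter.Tendsto (fun δ : ℝ => M + N₂ (V δ) + δ • N₃ (V δ)) (𝓝[≠] 0)
          (𝓝 (M + N₂ L + (0 : ℝ) • N₃ L)) := (tendsto_const_nhds.add t2).add (hid.smul t3)
      rw [zero_smul, add_zero] at a
      refine a.congr' ?_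
      filter_upwards [self_mem_nhdsWithin, hVeq] with δ hδ h
      have hδ' : δ ≠ 0 := hδ
      rw [zero_add, hV0]
      nth_rw 3 [h]
      have : L + δ • M + δ • N₂ (V δ) + δ ^ 2 • N₃ (V δ) - L
          = δ • (M + N₂ (V δ) + δ • N₃ (V δ)) := by
        simp only [smul_add, smul_smul, sq]; abel
      rw [this, smul_smul, inv_mul_cancel₀ hδ', one_smul]
    have hN : HasDerivAt (fun δ => N₂ (V δ)) (fderiv ℝ N₂ L (M + N₂ L)) 0 := by
      have a : HasFDerivAt N₂ (fderiv ℝ N₂ L) (V 0) := by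
        rw [hV0]; exact (h2.differentiable one_ne_zero L).hasFDerivAt
      exact a.comp_hasDerivAt (0 : ℝ) hVd
    have o1 := hN.isLittleO
    simp only [sub_zero, hV0] at o1
    have o2 : (fun δ => N₃ (V δ) - N₃ L) =o[𝓝 0] fun _ : ℝ => (1 : ℝ) := by
      rw [Asymptotics.isLittleO_one_iff, tendsto_sub_nhds_zero_iff]
      have a := hVd.continuousAt.tendsto
      rw [hV0] at a
      exact (h3.continuous.tendsto L).comp a
    have o3 : (fun δ : ℝ => δ ^ 2 • (N₂ (V δ) - N₂ L - δ • fderiv ℝ N₂ L (M + N₂ L)))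
        =o[𝓝 0] fun δ : ℝ => δ ^ 2 • δ :=
      (Asymptotics.isBigO_refl (fun δ : ℝ => δ ^ 2) (𝓝 0)).smul_isLittleO o1
    have o4 : (fun δ : ℝ => δ ^ 3 • (N₃ (V δ) - N₃ L)) =o[𝓝 0] fun δ : ℝ => δ ^ 3 • (1 : ℝ) :=
      (Asymptotics.isBigO_refl (fun δ : ℝ => δ ^ 3) (𝓝 0)).smul_isLittleO o2
    have o5 : (fun δ : ℝ => δ ^ 2 • δ) = fun δ : ℝ => δ ^ 3 := by
      funext δ; rw [smul_eq_mul]; ring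
    have o6 : (fun δ : ℝ => δ ^ 3 • (1 : ℝ)) = fun δ : ℝ => δ ^ 3 := by
      funext δ; rw [smul_eq_mul]; ring
    rw [o5] at o3
    rw [o6] at o4
    refine (o3.add o4).congr' ?_ Filter.EventuallyEq.rfl
    filter_upwards [heq] with δ h
    have h' : U δ = δ • L + δ ^ 2 • M + N₂ (U δ) + N₃ (U δ) := h
    rw [h', hUV δ, hom2, hom3]
    simp only [smul_sub, smul_add, smul_smul]
    rw [show δ ^ 2 * δ = δ ^ 3 by ring]
    abel

end FixedPoint

end CSH

end

noncomputable section

namespace CSH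

open FourierTransform
open scoped CompactlySupported

variable {n : ℕ}

/-! ### The nonlinearities on the Fourier side -/

/-- Matrices of elements of the weighted space. -/
abbrev MatW (n : ℕ) : Type := Fin n → Fin n → WSpace

/-- The unknowns on the Fourier side: the first index selects the field (`none` is `φ`, `some μ` is
`A_μ`), the second one selects the field itself (`none`) or its derivative `∂_μ` (`some μ`). -/
abbrev FieldW (n : ℕ) : Type := Option (Fin 3) → Option (Fin 3) → MatW n

/-- The commutator of matrix valued space-time functions on the Fourier side. -/
def lieW (n k : ℕ) : MatW n →L[ℝ] MatW n →L[ℝ] MatW n :=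
  LinearMap.mkContinuous₂
    (LinearMap.mk₂ ℝ
      (fun (X Y : MatW n) i j => ∑ l, (cmul k (X i l) (Y l j) - cmul k (Y i l) (X l j)))
      (fun X X' Y => by
        funext i j
        simp only [Pi.add_apply, map_add, add_apply, ← Finset.sum_add_distrib]
        exact Finset.sum_congr rfl fun l _ => by abel)
      (fun c X Y => by
        funext i j
        simp only [Pi.smul_apply, ContinuousLinearMap.map_smul_of_tower,
          smul_apply, ← smul_sub, ← Finset.smul_sum])
      (fun X Y Y' => by
        funext i j
        simp only [Pi.add_apply, map_add, add_apply, ← Finset.sum_add_distrib]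
        exact Finset.sum_congr rfl fun l _ => by abel)
      (fun c X Y => by
        funext i j
        simp only [Pi.smul_apply, ContinuousLinearMap.map_smul_of_tower,
          smul_apply, ← smul_sub, ← Finset.smul_sum]))
    (n * (2 * ‖cmul k‖)) (fun X Y => by
      have hX : ∀ i j, ‖X i j‖ ≤ ‖X‖ := fun i j => (norm_le_pi_norm (X i) j).trans (norm_le_pi_norm X i)
      have hY : ∀ i j, ‖Y i j‖ ≤ ‖Y‖ := fun i j => (norm_le_pi_norm (Y i) j).trans (norm_le_pi_norm Y i)
      have hb : ∀ g h : WSpace, ‖cmul k g h‖ ≤ ‖cmul k‖ * ‖g‖ * ‖h‖ := fun g h =>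
        (cmul k).le_opNorm₂ g h
      refine (pi_norm_le_iff_of_nonneg (by positivity)).2 fun i =>
        (pi_norm_le_iff_of_nonneg (by positivity)).2 fun j => ?_
      simp only [LinearMap.mk₂_apply]
      refine (norm_sum_le _ _).trans ?_
      have h1 : ∀ l ∈ Finset.univ, ‖cmul k (X i l) (Y l j) - cmul k (Y i l) (X l j)‖
          ≤ 2 * ‖cmul k‖ * ‖X‖ * ‖Y‖ := fun l _ => by
        refine (norm_sub_le _ _).trans ?_
        have h2 : ‖cmul k (X i l) (Y l j)‖ ≤ ‖cmul k‖ * ‖X‖ * ‖Y‖ := (hb _ _).trans (by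
          gcongr
          · exact hX _ _
          · exact hY _ _)
        have h3 : ‖cmul k (Y i l) (X l j)‖ ≤ ‖cmul k‖ * ‖Y‖ * ‖X‖ := (hb _ _).trans (by
          gcongr
          · exact hY _ _
          · exact hX _ _)
        linarith
      refine (Finset.sum_le_sum h1).trans_eq ?_
      simp
      ring)

theorem lieW_apply (k : ℕ) (X Y : MatW n) (i j : Fin n) :
    lieW n k X Y i j = ∑ l, (cmul k (X i l) (Y l j) - cmul k (Y i l) (X l j)) := rfl

/-- The quadratic nonlinearity. -/
def quad (k : ℕ) (U V : FieldW n) : Option (Fin 3) → MatW n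
  | none => (-2 : ℝ) • ∑ μ, eta μ • lieW n k (U (some μ) none) (V none (some μ))
  | some μ => ∑ ν, eta ν • lieW n k (U (some μ) (some ν)) (V (some ν) none)
      + (2 : ℝ) • ∑ ν, ∑ α, (eps μ ν α * eta ν * eta α) •
          lieW n k (U none (some ν)) (V none (some α))

/-- The cubic nonlinearity. -/
def cubic (k : ℕ) (U : FieldW n) : Option (Fin 3) → MatW n
  | none => (-1 : ℝ) • ∑ μ, eta μ •
      lieW n k (U (some μ) none) (lieW n k (U (some μ) none) (U none none))
  | some μ => (2 : ℝ) • ∑ ν, ∑ α, (eps μ ν α * eta ν * eta α) •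
      (lieW n k (U none (some ν)) (lieW n k (U (some α) none) (U none none))
        + lieW n k (U none none) (lieW n k (U (some α) (some ν)) (U none none))
        + lieW n k (U none none) (lieW n k (U (some α) none) (U none (some ν))))

theorem contDiff_lieW {E : Type*} [NormedAddCommGroup E] [NormedSpace ℝ E] {X Y : E → MatW n}
    {p : WithTop ℕ∞} (k : ℕ) (hX : ContDiff ℝ p X) (hY : ContDiff ℝ p Y) :
    ContDiff ℝ p fun u => lieW n k (X u) (Y u) := by
  have h : ContDiff ℝ p (fun X : MatW n => lieW n k X) :=
    ContinuousLinearMap.contDiff (𝕜 := ℝ) (E := MatW n) (F := MatW n →L[ℝ] MatW n) (lieW n k)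
  exact (h.comp hX).clm_apply hY

theorem contDiff_field {p : WithTop ℕ∞} (a d : Option (Fin 3)) :
    ContDiff ℝ p fun U : FieldW n => U a d :=
  (contDiff_apply ℝ (MatW n) d).comp (contDiff_apply ℝ (Option (Fin 3) → MatW n) a)

theorem contDiff_quad {p : WithTop ℕ∞} (k : ℕ) (a : Option (Fin 3)) :
    ContDiff ℝ p fun U : FieldW n => quad k U U a := by
  have h2 : ∀ a d a' d' : Option (Fin 3), ContDiff ℝ p fun U : FieldW n =>
      lieW n k (U a d) (U a' d') := fun a d a' d' =>
    contDiff_lieW k (contDiff_field a d) (contDiff_field a' d')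
  rcases a with _ | μ
  · simp only [quad]
    refine ContDiff.const_smul (-2 : ℝ) (ContDiff.sum fun μ _ => ContDiff.const_smul (eta μ) ?_)
    exact h2 (some μ) none none (some μ)
  · simp only [quad]
    refine ContDiff.add (ContDiff.sum fun ν _ => ContDiff.const_smul (eta ν) ?_)
      (ContDiff.const_smul (2 : ℝ) (ContDiff.sum fun ν _ => ContDiff.sum fun α _ =>
        ContDiff.const_smul (eps μ ν α * eta ν * eta α) ?_))
    · exact h2 (some μ) (some ν) (some ν) none
    · exact h2 none (some ν) none (some α)

theorem contDiff_cubic {p : WithTop ℕ∞} (k : ℕ) (a : Option (Fin 3)) :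
    ContDiff ℝ p fun U : FieldW n => cubic k U a := by
  have h3 : ∀ a d a' d' a'' d'' : Option (Fin 3), ContDiff ℝ p fun U : FieldW n =>
      lieW n k (U a d) (lieW n k (U a' d') (U a'' d'')) := fun a d a' d' a'' d'' =>
    contDiff_lieW k (contDiff_field a d)
      (contDiff_lieW k (contDiff_field a' d') (contDiff_field a'' d''))
  rcases a with _ | μ
  · simp only [cubic]
    refine ContDiff.const_smul (-1 : ℝ) (ContDiff.sum fun μ _ => ContDiff.const_smul (eta μ) ?_)
    exact h3 (some μ) none (some μ) none none none
  · simp only [cubic]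
    refine ContDiff.const_smul (2 : ℝ) (ContDiff.sum fun ν _ => ContDiff.sum fun α _ =>
        ContDiff.const_smul (eps μ ν α * eta ν * eta α) (ContDiff.add (ContDiff.add ?_ ?_) ?_))
    · exact h3 none (some ν) (some α) none none none
    · exact h3 none none (some α) (some ν) none none
    · exact h3 none none (some α) none none (some ν)

theorem quad_smul_smul (k : ℕ) (b c : ℝ) (U V : FieldW n) (a : Option (Fin 3)) :
    quad k (b • U) (c • V) a = (b * c) • quad k U V a := by
  rcases a with _ | μ <;>
  simp only [quad, Pi.smul_apply, map_smul, smul_apply, smul_add, Finset.smul_sum, smul_smul]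
  · exact Finset.sum_congr rfl fun μ _ => by congr 1; ring
  · congr 1
    · exact Finset.sum_congr rfl fun μ _ => by congr 1; ring
    · exact Finset.sum_congr rfl fun μ _ => Finset.sum_congr rfl fun μ _ => by congr 1; ring

theorem quad_add_left (k : ℕ) (U U' V : FieldW n) (a : Option (Fin 3)) :
    quad k (U + U') V a = quad k U V a + quad k U' V a := by
  rcases a with _ | μ <;>
  simp only [quad, Pi.add_apply, map_add, add_apply, smul_add, Finset.sum_add_distrib]
  abel

theorem quad_add_right (k : ℕ) (U V V' : FieldW n) (a : Option (Fin 3)) :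
    quad k U (V + V') a = quad k U V a + quad k U V' a := by
  rcases a with _ | μ <;>
  simp only [quad, Pi.add_apply, map_add, smul_add, Finset.sum_add_distrib]
  abel

theorem cubic_smul (k : ℕ) (c : ℝ) (U : FieldW n) (a : Option (Fin 3)) :
    cubic k (c • U) a = c ^ 3 • cubic k U a := by
  rcases a with _ | μ <;>
  simp only [cubic, Pi.smul_apply, map_smul, smul_apply, smul_add, Finset.smul_sum, smul_smul]
  · exact Finset.sum_congr rfl fun μ _ => by congr 1; ring
  · exact Finset.sum_congr rfl fun μ _ => Finset.sum_congr rfl fun μ _ => by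
      congr 1
      · congr 1 <;> (congr 1; ring)
      · congr 1; ring

/-- The mass of the field with index `a` when the mass of `φ` is `m`. -/
def fieldMass (m : ℝ) : Option (Fin 3) → ℝ
  | none => m
  | some _ => 0

theorem fieldMass_nonneg {m : ℝ} (hm : 0 ≤ m) (a : Option (Fin 3)) : 0 ≤ fieldMass m a := by
  rcases a with _ | _
  · exact hm
  · exact le_rfl

/-- Solution of the inhomogeneous linear equations with zero initial data. -/
def solve (k : ℕ) {T m : ℝ} (hT : 0 ≤ T) (hm : 0 ≤ m) (S : Option (Fin 3) → MatW n) : FieldW n :=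
  fun a d i j => duhamel k hT (velPropagator (fieldMass_nonneg hm a) d) (S a i j)

theorem solve_add (k : ℕ) {T m : ℝ} (hT : 0 ≤ T) (hm : 0 ≤ m) (S S' : Option (Fin 3) → MatW n) :
    solve k hT hm (S + S') = solve k hT hm S + solve k hT hm S' := by
  funext a d i j
  simp [solve]

theorem solve_smul (k : ℕ) {T m : ℝ} (hT : 0 ≤ T) (hm : 0 ≤ m) (c : ℝ)
    (S : Option (Fin 3) → MatW n) : solve k hT hm (c • S) = c • solve k hT hm S := by
  funext a d i j
  simp only [solve, Pi.smul_apply, ContinuousLinearMap.map_smul_of_tower]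

theorem contDiff_solve {p : WithTop ℕ∞} (k : ℕ) {T m : ℝ} (hT : 0 ≤ T) (hm : 0 ≤ m)
    {S : FieldW n → Option (Fin 3) → MatW n} (hS : ∀ a, ContDiff ℝ p fun U => S U a) :
    ContDiff ℝ p fun U => solve k hT hm (S U) := by
  refine contDiff_pi.2 fun a => contDiff_pi.2 fun d => contDiff_pi.2 fun i => contDiff_pi.2 fun j => ?_
  have h : ContDiff ℝ p fun U => S U a i j := contDiff_pi.1 (contDiff_pi.1 (hS a) i) j
  exact ((duhamel k hT (velPropagator (fieldMass_nonneg hm a) d)).restrictScalars ℝ).contDiff.comp h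

/-- The quadratic part of the fixed point map. -/
def quadMap (k : ℕ) {T m : ℝ} (hT : 0 ≤ T) (hm : 0 ≤ m) (U : FieldW n) : FieldW n :=
  solve k hT hm (quad k U U)

/-- The cubic part of the fixed point map. -/
def cubicMap (k : ℕ) {T m : ℝ} (hT : 0 ≤ T) (hm : 0 ≤ m) (U : FieldW n) : FieldW n :=
  solve k hT hm (cubic k U)

theorem contDiff_quadMap {p : WithTop ℕ∞} (k : ℕ) {T m : ℝ} (hT : 0 ≤ T) (hm : 0 ≤ m) :
    ContDiff ℝ p (quadMap (n := n) k hT hm) := contDiff_solve k hT hm (contDiff_quad k)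

theorem contDiff_cubicMap {p : WithTop ℕ∞} (k : ℕ) {T m : ℝ} (hT : 0 ≤ T) (hm : 0 ≤ m) :
    ContDiff ℝ p (cubicMap (n := n) k hT hm) := contDiff_solve k hT hm (contDiff_cubic k)

theorem quadMap_smul (k : ℕ) {T m : ℝ} (hT : 0 ≤ T) (hm : 0 ≤ m) (c : ℝ) (U : FieldW n) :
    quadMap k hT hm (c • U) = c ^ 2 • quadMap k hT hm U := by
  unfold quadMap
  rw [← solve_smul]
  congr 1
  funext a
  rw [quad_smul_smul, Pi.smul_apply, sq]

theorem cubicMap_smul (k : ℕ) {T m : ℝ} (hT : 0 ≤ T) (hm : 0 ≤ m) (c : ℝ) (U : FieldW n) :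
    cubicMap k hT hm (c • U) = c ^ 3 • cubicMap k hT hm U := by
  unfold cubicMap
  rw [← solve_smul]
  congr 1
  funext a
  rw [cubic_smul, Pi.smul_apply]

/-- `quadMap` is a bilinear map on the diagonal, and `quad` is not symmetric, so both orders of the
arguments appear. -/
theorem fderiv_quadMap (k : ℕ) {T m : ℝ} (hT : 0 ≤ T) (hm : 0 ≤ m) (L V : FieldW n) :
    fderiv ℝ (quadMap k hT hm) L V = solve k hT hm (quad k L V) + solve k hT hm (quad k V L) := by
  have h1 : HasDerivAt (fun c : ℝ => quadMap k hT hm (L + c • V))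
      (fderiv ℝ (quadMap k hT hm) L V) 0 := by
    have h2 : HasDerivAt (fun c : ℝ => L + c • V) V 0 := by
      simpa using ((hasDerivAt_id (0 : ℝ)).smul_const V).const_add L
    have h3 : HasFDerivAt (quadMap k hT hm) (fderiv ℝ (quadMap k hT hm) L) (L + (0 : ℝ) • V) := by
      rw [zero_smul, add_zero]
      exact ((contDiff_quadMap (p := 1) k hT hm).differentiable one_ne_zero L).hasFDerivAt
    exact h3.comp_hasDerivAt (0 : ℝ) h2
  have e : ∀ c : ℝ, quadMap k hT hm (L + c • V) = quadMap k hT hm L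
      + c • (solve k hT hm (quad k L V) + solve k hT hm (quad k V L))
      + c ^ 2 • quadMap k hT hm V := fun c => by
    unfold quadMap
    simp only [← solve_add, ← solve_smul]
    congr 1
    funext a
    have hr := quad_smul_smul k 1 c L V a
    have hl := quad_smul_smul k c 1 V L a
    have hb := quad_smul_smul k c c V V a
    rw [one_smul] at hr hl
    simp only [quad_add_left, quad_add_right, Pi.add_apply, Pi.smul_apply, hr, hl, hb, smul_add,
      one_mul, mul_one, sq]
    abel
  have h2 : HasDerivAt (fun c : ℝ => quadMap k hT hm (L + c • V))
      (solve k hT hm (quad k L V) + solve k hT hm (quad k V L)) 0 := by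
    rw [funext e]
    have a1 := (hasDerivAt_id (0 : ℝ)).smul_const
      (solve k hT hm (quad k L V) + solve k hT hm (quad k V L))
    have a2 := (hasDerivAt_pow 2 (0 : ℝ)).smul_const (quadMap k hT hm V)
    refine ((a1.const_add _).add a2).congr_deriv ?_
    simp
  exact h1.unique h2

/-! ### The symmetry characterizing `𝔰𝔲(n)` valued fields -/

/-- The complex conjugation of a space-time function, on the Fourier side. -/
def wconj (g : WSpace) : WSpace :=
  star (g.compContinuous ⟨fun z : ℝ × Plane => (z.1, -z.2), by fun_prop⟩)

theorem hat_wconj (k : ℕ) (g : WSpace) (t : ℝ) (ξ : Plane) :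
    hat k (wconj g) t ξ = starRingEnd ℂ (hat k g t (-ξ)) := by
  simp [hat, wconj, wt_neg]

theorem continuous_wconj : Continuous wconj := by
  unfold wconj
  exact continuous_star.comp (BoundedContinuousFunction.continuous_compContinuous _)

theorem wconj_add (g h : WSpace) : wconj (g + h) = wconj g + wconj h :=
  ext_hat 0 fun t ξ => by simp [hat_wconj, hat_add]

theorem wconj_sub (g h : WSpace) : wconj (g - h) = wconj g - wconj h :=
  ext_hat 0 fun t ξ => by simp [hat_wconj, hat_sub]

theorem wconj_smul (c : ℝ) (g : WSpace) : wconj (c • g) = c • wconj g :=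
  ext_hat 0 fun t ξ => by simp [hat_wconj, hat_smul]

theorem wconj_sum {ι : Type*} (s : Finset ι) (g : ι → WSpace) :
    wconj (∑ i ∈ s, g i) = ∑ i ∈ s, wconj (g i) :=
  ext_hat 0 fun t ξ => by simp [hat_wconj, hat_sum]

theorem cmul_wconj (k : ℕ) (g h : WSpace) : cmul k (wconj g) (wconj h) = wconj (cmul k g h) := by
  refine ext_hat k fun t ξ => ?_
  rw [hat_wconj, hat_cmul, hat_cmul, ← integral_conj]
  have e := integral_neg_eq_self (fun η => starRingEnd ℂ (hat k g t η * hat k h t (-ξ - η))) volume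
  rw [← e]
  refine integral_congr_ae (Filter.Eventually.of_forall fun η => ?_)
  simp only [hat_wconj, map_mul]
  congr 3
  abel

theorem duhamel_wconj (k : ℕ) {T : ℝ} (hT : 0 ≤ T) {κ : Propagator}
    (hκ : ∀ t ξ, κ.toFun t (-ξ) = starRingEnd ℂ (κ.toFun t ξ)) (g : WSpace) :
    duhamel k hT κ (wconj g) = wconj (duhamel k hT κ g) := by
  refine ext_hat k fun t ξ => ?_
  rw [hat_wconj, hat_duhamel, hat_duhamel, ← intervalIntegral.intervalIntegral_conj]
  refine intervalIntegral.integral_congr fun s _ => ?_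
  simp only [hat_wconj, map_mul, hκ, Complex.conj_conj]

theorem dsym_neg (j : Fin 2) (ξ : Plane) : dsym j (-ξ) = starRingEnd ℂ (dsym j ξ) := by
  have h : (starRingEnd ℂ) (2 : ℂ) = 2 := Complex.conj_ofNat 2
  simp [dsym, h]

theorem velSym_neg (m t : ℝ) (ξ : Plane) :
    ∀ d, velSym m d t (-ξ) = starRingEnd ℂ (velSym m d t ξ) := by
  rw [forall_option_fin_three]
  simp [sinProp_neg, cosProp_neg, dsym_neg]

theorem posSym_neg (m t : ℝ) (ξ : Plane) :
    ∀ d, posSym m d t (-ξ) = starRingEnd ℂ (posSym m d t ξ) := by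
  rw [forall_option_fin_three]
  simp [sinProp_neg, cosProp_neg, dsym_neg, disp_neg]

/-- The operation `X ↦ -X†` on matrix valued space-time functions, on the Fourier side. -/
def skewAdj : MatW n →ₗ[ℝ] MatW n where
  toFun X i j := -wconj (X j i)
  map_add' X Y := by funext i j; simp [wconj_add]; abel
  map_smul' c X := by funext i j; simp [wconj_smul]

theorem skewAdj_apply (X : MatW n) (i j : Fin n) : skewAdj X i j = -wconj (X j i) := rfl

/-- `X ↦ -X†` is an automorphism of the real Lie algebra of matrices, with the skew-Hermitian
matrices as fixed points. Since the nonlinearities are built from brackets with real coefficients,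
the whole fixed point equation commutes with it. -/
theorem lieW_skewAdj (k : ℕ) (X Y : MatW n) :
    lieW n k (skewAdj X) (skewAdj Y) = skewAdj (lieW n k X Y) := by
  funext i j
  simp only [skewAdj_apply, lieW_apply, wconj_sum, wconj_sub, map_neg, neg_apply, neg_neg,
    cmul_wconj]
  rw [← Finset.sum_neg_distrib]
  refine Finset.sum_congr rfl fun l _ => ?_
  rw [cmul_comm k (X l i), cmul_comm k (Y l i)]
  abel

/-- The operation `X ↦ -X†` on all fields. -/
def skewField (U : FieldW n) : FieldW n := fun a d => skewAdj (U a d)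

theorem continuous_skewField : Continuous (skewField (n := n)) := by
  refine continuous_pi fun a => continuous_pi fun d => continuous_pi fun i => continuous_pi fun j => ?_
  have h : Continuous fun U : FieldW n => U a d j i := by fun_prop
  exact (continuous_wconj.comp h).neg

theorem skewField_add (U V : FieldW n) : skewField (U + V) = skewField U + skewField V := by
  funext a d; simp [skewField]

theorem skewField_smul (c : ℝ) (U : FieldW n) : skewField (c • U) = c • skewField U := by
  funext a d; simp [skewField]

theorem quad_skewField (k : ℕ) (U V : FieldW n) (a : Option (Fin 3)) :
    quad k (skewField U) (skewField V) a = skewAdj (quad k U V a) := by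
  rcases a with _ | μ <;>
  simp only [quad, skewField, lieW_skewAdj, map_add, map_smul, map_sum]

theorem cubic_skewField (k : ℕ) (U : FieldW n) (a : Option (Fin 3)) :
    cubic k (skewField U) a = skewAdj (cubic k U a) := by
  rcases a with _ | μ <;>
  simp only [cubic, skewField, lieW_skewAdj, ← map_add, ← map_smul, ← map_sum]

theorem solve_skewField (k : ℕ) {T m : ℝ} (hT : 0 ≤ T) (hm : 0 ≤ m)
    {S S' : Option (Fin 3) → MatW n} (h : ∀ a, S' a = skewAdj (S a)) :
    solve k hT hm S' = skewField (solve k hT hm S) := by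
  funext a d i j
  simp only [solve, skewField, h, skewAdj_apply, map_neg]
  rw [duhamel_wconj k hT (fun t ξ => velSym_neg _ t ξ d)]

theorem lieW_trace (k : ℕ) (X Y : MatW n) : ∑ i, lieW n k X Y i i = 0 := by
  simp only [lieW_apply, Finset.sum_sub_distrib]
  rw [sub_eq_zero, Finset.sum_comm]
  refine Finset.sum_congr rfl fun i _ => Finset.sum_congr rfl fun l _ => cmul_comm _ _ _

/-- The trace of a matrix of elements of the weighted space. -/
def traceW : MatW n →ₗ[ℝ] WSpace where
  toFun X := ∑ i, X i i
  map_add' X Y := by simp [Finset.sum_add_distrib]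
  map_smul' c X := by simp [Finset.smul_sum]

theorem traceW_lieW (k : ℕ) (X Y : MatW n) : traceW (lieW n k X Y) = 0 := lieW_trace k X Y

theorem traceW_quad (k : ℕ) (U V : FieldW n) (a : Option (Fin 3)) : traceW (quad k U V a) = 0 := by
  rcases a with _ | μ <;> simp [quad, traceW_lieW]

theorem traceW_cubic (k : ℕ) (U : FieldW n) (a : Option (Fin 3)) : traceW (cubic k U a) = 0 := by
  rcases a with _ | μ <;> simp [cubic, traceW_lieW]

theorem traceW_solve (k : ℕ) {T m : ℝ} (hT : 0 ≤ T) (hm : 0 ≤ m)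
    {S : Option (Fin 3) → MatW n} (h : ∀ a, traceW (S a) = 0) (a d : Option (Fin 3)) :
    traceW (solve k hT hm S a d) = 0 := by
  change ∑ i, duhamel k hT _ (S a i i) = 0
  rw [← map_sum, show ∑ i, S a i i = 0 from h a, map_zero]

end CSH

end

noncomputable section

namespace CSH

open FourierTransform
open scoped CompactlySupported

variable {n : ℕ}

/-! ### Initial data with compactly supported Fourier transform -/

/-- The Fourier transform of `∂_j`, acting on compactly supported profiles. -/
def dmul (j : Fin 2) (b : C_c(Plane, ℂ)) : C_c(Plane, ℂ) :=
  ⟨⟨fun ξ => dsym j ξ * b ξ, by have := b.continuous; fun_prop⟩, b.hasCompactSupport.mul_left⟩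

@[simp] theorem dmul_apply (j : Fin 2) (b : C_c(Plane, ℂ)) (ξ : Plane) :
    dmul j b ξ = dsym j ξ * b ξ := rfl

theorem integrable_profile (b : C_c(Plane, ℂ)) : Integrable b :=
  b.continuous.integrable_of_hasCompactSupport b.hasCompactSupport

/-- The convolution of compactly supported profiles. -/
def pconv (b c : C_c(Plane, ℂ)) : C_c(Plane, ℂ) where
  toFun ξ := ∫ η, b η * c (ξ - η)
  continuous_toFun := c.hasCompactSupport.continuous_convolution_right (ContinuousLinearMap.mul ℂ ℂ)
    (integrable_profile b).locallyIntegrable c.continuous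
  hasCompactSupport' := b.hasCompactSupport.convolution (ContinuousLinearMap.mul ℂ ℂ)
    c.hasCompactSupport

theorem pconv_apply (b c : C_c(Plane, ℂ)) (ξ : Plane) :
    pconv b c ξ = ∫ η, b η * c (ξ - η) := rfl

theorem pconv_comm (b c : C_c(Plane, ℂ)) : pconv b c = pconv c b := by
  ext ξ
  rw [pconv_apply, pconv_apply, ← integral_sub_left_eq_self _ volume ξ]
  simp [mul_comm]

/-- Matrices of compactly supported profiles. -/
abbrev MatC (n : ℕ) : Type := Fin n → Fin n → C_c(Plane, ℂ)

/-- The commutator on the Fourier side. -/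
def lieC (X Y : MatC n) : MatC n := fun i j =>
  ∑ l, (pconv (X i l) (Y l j) - pconv (Y i l) (X l j))

/-- The profile is the Fourier transform of a field with values in `𝔰𝔲(n)`. -/
structure IsSkew (X : MatC n) : Prop where
  skew : ∀ i j ξ, X j i (-ξ) = -starRingEnd ℂ (X i j ξ)
  trace : ∀ ξ, ∑ i, X i i ξ = 0

theorem IsSkew.zero : IsSkew (0 : MatC n) := ⟨fun i j ξ => by simp, fun ξ => by simp⟩

theorem IsSkew.add {X Y : MatC n} (hX : IsSkew X) (hY : IsSkew Y) : IsSkew (X + Y) :=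
  ⟨fun i j ξ => by simp [hX.skew i j ξ, hY.skew i j ξ]; ring,
    fun ξ => by simp [Finset.sum_add_distrib, hX.trace, hY.trace]⟩

theorem IsSkew.smul {X : MatC n} (hX : IsSkew X) (c : ℝ) : IsSkew (c • X) :=
  ⟨fun i j ξ => by simp [hX.skew i j ξ], fun ξ => by simp [← Finset.mul_sum, hX.trace]⟩

theorem IsSkew.sum {ι : Type*} {s : Finset ι} {X : ι → MatC n} (hX : ∀ i, IsSkew (X i)) :
    IsSkew (∑ i ∈ s, X i) := by
  induction s using Finset.cons_induction with
  | empty => exact IsSkew.zero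
  | cons a s ha ih => rw [Finset.sum_cons]; exact (hX a).add ih

theorem IsSkew.dmul {X : MatC n} (hX : IsSkew X) (k : Fin 2) :
    IsSkew fun i j => dmul k (X i j) :=
  ⟨fun i j ξ => by simp [hX.skew i j ξ, dsym_neg], fun ξ => by simp [← Finset.mul_sum, hX.trace]⟩

theorem pconv_neg_of_skew {b b' c c' : C_c(Plane, ℂ)}
    (hb : ∀ ξ, b' (-ξ) = -starRingEnd ℂ (b ξ)) (hc : ∀ ξ, c' (-ξ) = -starRingEnd ℂ (c ξ))
    (ξ : Plane) : pconv b' c' (-ξ) = starRingEnd ℂ (pconv b c ξ) := by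
  rw [pconv_apply, pconv_apply, ← integral_conj, ← integral_neg_eq_self]
  refine integral_congr_ae (Filter.Eventually.of_forall fun η => ?_)
  simp only
  rw [show -ξ - -η = -(ξ - η) by abel, hb, hc]
  simp

theorem IsSkew.lie {X Y : MatC n} (hX : IsSkew X) (hY : IsSkew Y) : IsSkew (lieC X Y) := by
  refine ⟨fun i j ξ => ?_, fun ξ => ?_⟩
  · simp only [lieC, CompactlySupportedContinuousMap.sum_apply,
      CompactlySupportedContinuousMap.sub_apply, map_sum, map_sub]
    rw [← Finset.sum_neg_distrib]
    refine Finset.sum_congr rfl fun l _ => ?_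
    rw [pconv_neg_of_skew (hX.skew l j) (hY.skew i l), pconv_neg_of_skew (hY.skew l j) (hX.skew i l),
      pconv_comm (X l j), pconv_comm (Y l j)]
    ring
  · simp only [lieC, CompactlySupportedContinuousMap.sum_apply,
      CompactlySupportedContinuousMap.sub_apply, Finset.sum_sub_distrib]
    rw [sub_eq_zero, Finset.sum_comm]
    refine Finset.sum_congr rfl fun i _ => Finset.sum_congr rfl fun l _ => ?_
    rw [pconv_comm]

/-- Initial positions of all fields (`none` is `φ`, `some μ` is `A_μ`). -/
structure InitData (n : ℕ) where
  pos : Option (Fin 3) → MatC n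
  isSkew : ∀ a, IsSkew (pos a)

/-- The part of the initial velocities which is linear in the initial positions. -/
def InitData.vel (D : InitData n) : Option (Fin 3) → MatC n
  | none => 0
  | some μ => Fin.cases (∑ j : Fin 2, fun i l => dmul j (D.pos (some j.succ) i l))
      (fun j i l => dmul j (D.pos (some 0) i l)) μ

/-- The part of the initial velocities which is quadratic in the initial positions. -/
def InitData.velQuad (D : InitData n) : Option (Fin 3) → MatC n
  | none => 0
  | some μ => Fin.cases 0 (fun j => (-1 : ℝ) • lieC (D.pos (some 0)) (D.pos (some j.succ))
      + (2 : ℝ) • ∑ k : Fin 2, eps 0 j.succ k.succ •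
          lieC (D.pos none) (fun i l => dmul k (D.pos none i l))) μ

theorem InitData.isSkew_vel (D : InitData n) : ∀ a, IsSkew (D.vel a) := by
  rw [forall_option_fin_three]
  have h0 : IsSkew (∑ j : Fin 2, fun i l => dmul j (D.pos (some j.succ) i l)) :=
    IsSkew.sum fun j => (D.isSkew _).dmul j
  exact ⟨IsSkew.zero, h0, fun j => (D.isSkew _).dmul j⟩

theorem InitData.isSkew_velQuad (D : InitData n) : ∀ a, IsSkew (D.velQuad a) := by
  rw [forall_option_fin_three]
  exact ⟨IsSkew.zero, IsSkew.zero, fun j => (((D.isSkew _).lie (D.isSkew _)).smul _).add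
    (IsSkew.smul (IsSkew.sum fun k => ((D.isSkew _).lie ((D.isSkew _).dmul k)).smul _) _)⟩

/-- The free evolution of matrices of profiles. -/
def freeField (k : ℕ) (T m : ℝ) (b₀ b₁ : Option (Fin 3) → MatC n) : FieldW n := fun a d i j =>
  free k T (fieldMass m a) d (b₀ a i j) (b₁ a i j)

theorem skewField_freeField (k : ℕ) (T m : ℝ) {b₀ b₁ : Option (Fin 3) → MatC n}
    (h₀ : ∀ a, IsSkew (b₀ a)) (h₁ : ∀ a, IsSkew (b₁ a)) :
    skewField (freeField k T m b₀ b₁) = freeField k T m b₀ b₁ := by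
  funext a d i j
  refine ext_hat k fun t ξ => ?_
  simp only [skewField, skewAdj_apply, hat_neg, hat_wconj, freeField, hat_free, posSym_neg,
    velSym_neg, (h₀ a).skew, (h₁ a).skew, map_add, map_mul, map_neg, Complex.conj_conj]
  ring

theorem traceW_freeField (k : ℕ) (T m : ℝ) {b₀ b₁ : Option (Fin 3) → MatC n}
    (h₀ : ∀ a, IsSkew (b₀ a)) (h₁ : ∀ a, IsSkew (b₁ a)) (a d : Option (Fin 3)) :
    traceW (freeField k T m b₀ b₁ a d) = 0 := by
  refine ext_hat k fun t ξ => ?_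
  change hat k (∑ i, free k T (fieldMass m a) d (b₀ a i i) (b₁ a i i)) t ξ = _
  simp only [hat_sum, hat_free, Finset.sum_add_distrib, ← Finset.mul_sum, (h₀ a).trace,
    (h₁ a).trace, hat_zero, mul_zero, add_zero]

/-- The first order part of the solution. -/
def InitData.lin (D : InitData n) (k : ℕ) (T m : ℝ) : FieldW n := freeField k T m D.pos D.vel

/-- The contribution of the quadratic part of the initial velocities. -/
def InitData.linQuad (D : InitData n) (k : ℕ) (T m : ℝ) : FieldW n :=
  freeField k T m (fun _ => 0) D.velQuad

/-- The second order part of the solution. -/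
def InitData.second (D : InitData n) (k : ℕ) {T m : ℝ} (hT : 0 ≤ T) (hm : 0 ≤ m) : FieldW n :=
  D.linQuad k T m + quadMap k hT hm (D.lin k T m)

/-- The third order part of the solution. -/
def InitData.third (D : InitData n) (k : ℕ) {T m : ℝ} (hT : 0 ≤ T) (hm : 0 ≤ m) : FieldW n :=
  solve k hT hm (quad k (D.lin k T m) (D.second k hT hm))
    + solve k hT hm (quad k (D.second k hT hm) (D.lin k T m))
    + cubicMap k hT hm (D.lin k T m)

/-- `U` is a solution on the Fourier side with initial data `δ D`. -/
structure IsMild (D : InitData n) (k : ℕ) {T m : ℝ} (hT : 0 ≤ T) (hm : 0 ≤ m) (δ : ℝ)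
    (U : FieldW n) : Prop where
  eq : U = δ • D.lin k T m + δ ^ 2 • D.linQuad k T m + quadMap k hT hm U + cubicMap k hT hm U
  skew : ∀ a d, skewAdj (U a d) = U a d
  trace : ∀ a d, traceW (U a d) = 0

theorem skewField_rhs (D : InitData n) (k : ℕ) {T m : ℝ} (hT : 0 ≤ T) (hm : 0 ≤ m) (δ : ℝ)
    (U : FieldW n) :
    skewField (δ • D.lin k T m + δ ^ 2 • D.linQuad k T m + quadMap k hT hm U + cubicMap k hT hm U)
      = δ • D.lin k T m + δ ^ 2 • D.linQuad k T m + quadMap k hT hm (skewField U)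
        + cubicMap k hT hm (skewField U) := by
  rw [skewField_add, skewField_add, skewField_add, skewField_smul, skewField_smul]
  congr 1
  · congr 1
    · unfold InitData.lin InitData.linQuad
      rw [skewField_freeField k T m D.isSkew D.isSkew_vel,
        skewField_freeField k T m (fun _ => IsSkew.zero) D.isSkew_velQuad]
    · exact (solve_skewField k hT hm fun a => quad_skewField k U U a).symm
  · exact (solve_skewField k hT hm fun a => cubic_skewField k U a).symm

/-- Existence and expansion of small solutions. -/
theorem InitData.exists_mild (D : InitData n) (k : ℕ) {T m : ℝ} (hT : 0 ≤ T) (hm : 0 ≤ m) :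
    ∃ U : ℝ → FieldW n, (∀ᶠ δ in 𝓝 (0 : ℝ), IsMild D k hT hm δ (U δ)) ∧
      (fun δ => U δ - δ • D.lin k T m - δ ^ 2 • D.second k hT hm - δ ^ 3 • D.third k hT hm)
        =o[𝓝 0] fun δ : ℝ => δ ^ 3 := by
  obtain ⟨U, hU0, hUeq, huniq, hexp⟩ := exists_small_solution (contDiff_quadMap k hT hm)
    (contDiff_cubicMap k hT hm) (quadMap_smul k hT hm) (cubicMap_smul k hT hm) (D.lin k T m)
    (D.linQuad k T m)
  -- `-U†` is small and solves the same equation as `U`, hence equals `U` by uniqueness.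
  have hsk : (fun δ => skewField (U δ)) =ᶠ[𝓝 0] U := by
    refine huniq _ ?_ ?_
    · have h := (continuous_skewField (n := n)).tendsto 0
      have h0 : skewField (0 : FieldW n) = 0 := by
        simpa using skewField_smul (0 : ℝ) (0 : FieldW n)
      rw [h0] at h
      exact h.comp hU0
    · filter_upwards [hUeq] with δ h
      conv_lhs => rw [h]
      exact skewField_rhs D k hT hm δ (U δ)
  refine ⟨U, ?_, ?_⟩
  · filter_upwards [hUeq, hsk] with δ h h'
    -- The trace vanishes by inspection of the equation: the data are trace-free, and so are all
    -- commutators.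
    refine ⟨h, fun a d => congrFun (congrFun h' a) d, fun a d => ?_⟩
    rw [h]
    simp only [Pi.add_apply, Pi.smul_apply, map_add, map_smul]
    unfold InitData.lin InitData.linQuad quadMap cubicMap
    rw [traceW_freeField k T m D.isSkew D.isSkew_vel,
      traceW_freeField k T m (fun _ => IsSkew.zero) D.isSkew_velQuad,
      traceW_solve k hT hm (traceW_quad k _ _), traceW_solve k hT hm (traceW_cubic k _)]
    simp
  · rw [fderiv_quadMap] at hexp
    exact hexp

end CSH

end

noncomputable section

namespace CSH

open FourierTransform
open scoped CompactlySupported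

variable {n : ℕ}

/-! ### Mild solutions are classical solutions -/

/-- The matrix valued space-time function represented by a matrix of elements of the weighted
space. -/
def phys (k : ℕ) (X : MatW n) (z : Spacetime) : Mat n :=
  Matrix.of fun i j => synth (hat k (X i j)) z

theorem phys_apply (k : ℕ) (X : MatW n) (z : Spacetime) (i j : Fin n) :
    phys k X z i j = synth (hat k (X i j)) z := rfl

theorem fourierInv_sum {ι : Type*} (s : Finset ι) {f : ι → Plane → ℂ} (hf : ∀ i, Integrable (f i))
    (x : Plane) : 𝓕⁻ (fun ξ => ∑ i ∈ s, f i ξ) x = ∑ i ∈ s, 𝓕⁻ (f i) x := by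
  simp only [Real.fourierInv_eq', smul_eq_mul, Finset.mul_sum]
  rw [integral_finsetSum]
  intro i _
  refine (hf i).norm.mono' ?_ (Filter.Eventually.of_forall fun ξ => ?_)
  · exact (Continuous.aestronglyMeasurable (by fun_prop)).mul (hf i).1
  · rw [norm_mul, norm_exp_phase, one_mul]

theorem fourierInv_add {f g : Plane → ℂ} (hf : Integrable f) (hg : Integrable g)
    (x : Plane) : 𝓕⁻ (fun ξ => f ξ + g ξ) x = 𝓕⁻ f x + 𝓕⁻ g x := by
  have := fourierInv_sum (Finset.univ : Finset (Fin 2)) (f := ![f, g])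
    (fun i => by fin_cases i <;> simpa) x
  simpa [Fin.sum_univ_two] using this

theorem fourierInv_const_mul (c : ℂ) (f : Plane → ℂ) (x : Plane) :
    𝓕⁻ (fun ξ => c * f ξ) x = c * 𝓕⁻ f x := by
  simp only [Real.fourierInv_eq', smul_eq_mul, mul_left_comm _ c]
  rw [integral_const_mul]

theorem phys_add (k : ℕ) (X Y : MatW n) (z : Spacetime) :
    phys k (X + Y) z = phys k X z + phys k Y z := by
  ext i j
  simp only [phys_apply, Matrix.add_apply, synth, Pi.add_apply]
  rw [← fourierInv_add (integrable_hat _ _ _) (integrable_hat _ _ _)]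
  exact congrArg (fun f : Plane → ℂ => (𝓕⁻ f : Plane → ℂ) z.2) (funext fun ξ => hat_add _ _ _ _ _)

theorem phys_smul (k : ℕ) (c : ℝ) (X : MatW n) (z : Spacetime) :
    phys k (c • X) z = c • phys k X z := by
  ext i j
  simp only [phys_apply, Matrix.smul_apply, synth, Pi.smul_apply, Complex.real_smul]
  rw [← fourierInv_const_mul]
  exact congrArg (fun f : Plane → ℂ => (𝓕⁻ f : Plane → ℂ) z.2) (funext fun ξ => hat_smul _ _ _ _ _)

theorem phys_zero (k : ℕ) (z : Spacetime) : phys k (0 : MatW n) z = 0 := by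
  have := phys_smul k 0 (0 : MatW n) z
  simpa using this

theorem phys_sum (k : ℕ) {ι : Type*} (s : Finset ι) (X : ι → MatW n) (z : Spacetime) :
    phys k (∑ i ∈ s, X i) z = ∑ i ∈ s, phys k (X i) z := by
  induction s using Finset.cons_induction with
  | empty => simp [phys_zero]
  | cons a s ha ih => rw [Finset.sum_cons, Finset.sum_cons, phys_add, ih]

theorem phys_lieW (k : ℕ) (X Y : MatW n) (z : Spacetime) :
    phys k (lieW n k X Y) z = ⁅phys k X z, phys k Y z⁆ := by
  ext i j
  have e : hat k (lieW n k X Y i j) z.1 = fun ξ => ∑ l : Fin n,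
      (hat k (cmul k (X i l) (Y l j)) z.1 ξ + (-1) * hat k (cmul k (Y i l) (X l j)) z.1 ξ) := by
    funext ξ
    rw [lieW_apply, hat_sum]
    exact Finset.sum_congr rfl fun l _ => by rw [hat_sub]; ring
  have e2 : ∀ l, 𝓕⁻ (fun ξ => hat k (cmul k (X i l) (Y l j)) z.1 ξ
      + (-1) * hat k (cmul k (Y i l) (X l j)) z.1 ξ) z.2
      = 𝓕⁻ (hat k (X i l) z.1) z.2 * 𝓕⁻ (hat k (Y l j) z.1) z.2
        - 𝓕⁻ (hat k (Y i l) z.1) z.2 * 𝓕⁻ (hat k (X l j) z.1) z.2 := fun l => by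
    rw [fourierInv_add (integrable_hat _ _ _) ((integrable_hat _ _ _).const_mul _),
      fourierInv_const_mul, fourierInv_hat_cmul, fourierInv_hat_cmul]
    ring
  rw [phys_apply, synth, e, fourierInv_sum]
  · simp only [e2, Ring.lie_def, Matrix.sub_apply, Matrix.mul_apply, Finset.sum_sub_distrib]
    rfl
  · exact fun l => (integrable_hat _ _ _).add ((integrable_hat _ _ _).const_mul _)

theorem phys_congr (k : ℕ) {X Y : MatW n} {t : ℝ}
    (h : ∀ i j ξ, hat k (X i j) t ξ = hat k (Y i j) t ξ) (x : Plane) :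
    phys k X (t, x) = phys k Y (t, x) := by
  ext i j
  simp only [phys_apply, synth]
  rw [funext (h i j)]

theorem conj_fourierInv (f : Plane → ℂ) (x : Plane) :
    starRingEnd ℂ (𝓕⁻ f x) = 𝓕⁻ (fun ξ => starRingEnd ℂ (f (-ξ))) x := by
  simp only [Real.fourierInv_eq', smul_eq_mul]
  rw [← integral_conj, ← integral_neg_eq_self]
  refine integral_congr_ae (Filter.Eventually.of_forall fun ξ => ?_)
  simp only [map_mul, ← Complex.exp_conj, Complex.conj_I, Complex.conj_ofReal, inner_neg_left]
  congr 2
  push_cast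
  ring

/-- Conjugation in `x` is conjugation composed with `ξ ↦ -ξ` in frequency, so the symmetry `skewAdj
X = X` says exactly that the values are skew-Hermitian. -/
theorem phys_conjTranspose (k : ℕ) {X : MatW n} (hX : skewAdj X = X) (z : Spacetime) :
    (phys k X z)ᴴ = -phys k X z := by
  ext i j
  have h : hat k (X i j) z.1 = fun ξ => -1 * starRingEnd ℂ (hat k (X j i) z.1 (-ξ)) := by
    funext ξ
    conv_lhs => rw [← hX]
    rw [skewAdj_apply, hat_neg, hat_wconj, neg_one_mul]
  rw [Matrix.conjTranspose_apply, Matrix.neg_apply, phys_apply, phys_apply, synth, synth, h,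
    fourierInv_const_mul, ← conj_fourierInv]
  simp

/-! #### Derivatives -/

theorem mem_slab_nhds {T : ℝ} {z : Spacetime} (hz : z ∈ Ioo (-T) T ×ˢ (univ : Set Plane)) :
    Ioo (-T) T ×ˢ (univ : Set Plane) ∈ 𝓝 z :=
  (isOpen_Ioo.prod isOpen_univ).mem_nhds hz

theorem IsWave.lineDeriv {k : ℕ} {T m : ℝ} {u : Option (Fin 3) → WSpace} {F : WSpace}
    (hu : IsWave k T m u F) {z : Spacetime} (hz : z ∈ Ioo (-T) T ×ˢ (univ : Set Plane))
    (μ : Fin 3) : lineDeriv ℝ (synth (hat k (u none))) z (coordVec μ)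
      = synth (hat k (u (some μ))) z := by
  refine Fin.cases ?_ (fun j => ?_) μ
  · exact lineDeriv_synth_zero (continuous_hat_right k _) (continuous_hat_right k _)
      ((DecayBound.hat k _).mono (by norm_num)) ((DecayBound.hat k _).mono (by norm_num))
      hu.deriv_none hz
  · rw [lineDeriv_synth_succ (continuous_hat_right k _) (continuous_hat_right k _)
      ((DecayBound.hat k _).mono (by norm_num)) ((DecayBound.hat k _).mono (by norm_num))
      hu.deriv_none hz j]
    congr 1
    funext t ξ
    exact (hu.succ j t ξ).symm

theorem decayBound_disp_sq {m : ℝ} (hm : 0 ≤ m) (k : ℕ) (g : WSpace) :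
    DecayBound 0 fun t ξ => -(disp m ξ ^ 2 : ℂ) * hat k g t ξ := by
  refine DecayBound.mul (m := 0) (l := 2) (DecayBound.hat k g)
    (B := 4 * Real.pi ^ 2 + m) fun ξ => ?_
  rw [norm_neg, norm_pow, Complex.norm_real, Real.norm_of_nonneg (disp_nonneg _ _), disp_sq hm]
  have h0 := norm_nonneg ξ
  have hp : 0 < Real.pi ^ 2 := by positivity
  have h1 : ‖ξ‖ ^ 2 ≤ (1 + ‖ξ‖) ^ 2 := by gcongr; linarith
  have h2 : 1 ≤ (1 + ‖ξ‖) ^ 2 := one_le_pow₀ (by linarith)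
  nlinarith

theorem IsWave.contDiffOn {k : ℕ} {T m : ℝ} (hm : 0 ≤ m) {u : Option (Fin 3) → WSpace} {F : WSpace}
    (hu : IsWave k T m u F) :
    ContDiffOn ℝ 2 (synth (hat k (u none))) (Ioo (-T) T ×ˢ (univ : Set Plane)) :=
  contDiffOn_two_synth (continuous_hat k _) (continuous_hat k _)
    (g'' := fun t ξ => -(disp m ξ ^ 2 : ℂ) * hat k (u none) t ξ + hat k F t ξ)
    (by fun_prop) (DecayBound.hat k _)
    ((DecayBound.hat k _).mono (by norm_num))
    ((decayBound_disp_sq hm k _).add ((DecayBound.hat k _).mono (by norm_num)))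
    hu.deriv_none hu.deriv_zero

/-- In frequency the second time derivative contributes `-ω²` and the source, and `-Δ` contributes
`4π²|ξ|²`. By the dispersion relation only `-m` and the source remain. -/
theorem IsWave.lineDeriv_lineDeriv {k : ℕ} {T m : ℝ} (hm : 0 ≤ m) {u : Option (Fin 3) → WSpace}
    {F : WSpace} (hu : IsWave k T m u F) {z : Spacetime}
    (hz : z ∈ Ioo (-T) T ×ˢ (univ : Set Plane)) :
    ∑ μ, (eta μ : ℂ) * _root_.lineDeriv ℝ (synth (hat k (u (some μ)))) z (coordVec μ)
      = synth (hat k F) z - m * synth (hat k (u none)) z := by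
  have hb := (decayBound_disp_sq hm k (u none)).add
    ((DecayBound.hat k F).mono (by norm_num : 0 ≤ 2))
  have h0 : _root_.lineDeriv ℝ (synth (hat k (u (some 0)))) z (coordVec 0)
      = synth (fun t ξ => -(disp m ξ ^ 2 : ℂ) * hat k (u none) t ξ + hat k F t ξ) z :=
    lineDeriv_synth_zero (continuous_hat_right k _) (fun t => by fun_prop)
      ((DecayBound.hat k _).mono (by norm_num)) hb hu.deriv_zero hz
  have hj : ∀ j : Fin 2, _root_.lineDeriv ℝ (synth (hat k (u (some j.succ)))) z (coordVec j.succ)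
      = synth (fun t ξ => dsym j ξ * hat k (u (some j.succ)) t ξ) z := fun j =>
    lineDeriv_synth_succ (g' := fun t ξ => dsym j ξ * hat k (u (some 0)) t ξ)
      (continuous_hat_right k _) (fun t => by fun_prop)
      ((DecayBound.hat k _).mono (by norm_num))
      (decayBound_dsym ((DecayBound.hat k _).mono (by norm_num)) j)
      (fun t ht ξ => by
        simp only [hu.succ]
        exact (hu.deriv_none t ht ξ).const_mul _) hz j
  rw [Fin.sum_univ_succ, h0]
  simp only [hj]
  have he : ∀ j : Fin 2, eta j.succ = -1 := fun j => by simp [eta, Fin.succ_ne_zero]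
  simp only [he, synth, Fin.sum_univ_two]
  rw [show eta 0 = 1 by simp [eta]]
  have i1 : Integrable fun ξ => -(disp m ξ ^ 2 : ℂ) * hat k (u none) z.1 ξ :=
    (decayBound_disp_sq hm k (u none)).integrable (by fun_prop)
  have i2 : ∀ j : Fin 2, Integrable fun ξ => dsym j ξ * hat k (u (some j.succ)) z.1 ξ := fun j =>
    DecayBound.integrable (g := fun t ξ => dsym j ξ * hat k (u (some j.succ)) t ξ)
      (decayBound_dsym ((DecayBound.hat k _).mono (by norm_num)) j) (by fun_prop)
  have i3 : ∀ j : Fin 2, Integrable fun ξ =>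
      (-1 : ℂ) * (dsym j ξ * hat k (u (some j.succ)) z.1 ξ) := fun j => (i2 j).const_mul _
  have i5 : Integrable (hat k F z.1) := integrable_hat _ _ _
  have e : ∀ j : Fin 2, ((-1 : ℝ) : ℂ) * 𝓕⁻ (fun ξ => dsym j ξ * hat k (u (some j.succ)) z.1 ξ) z.2
      = 𝓕⁻ (fun ξ => (-1 : ℂ) * (dsym j ξ * hat k (u (some j.succ)) z.1 ξ)) z.2 := fun j => by
    rw [fourierInv_const_mul]
    norm_num
  have i6 : Integrable fun ξ => -(disp m ξ ^ 2 : ℂ) * hat k (u none) z.1 ξ + hat k F z.1 ξ :=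
    i1.add i5
  have i7 : Integrable fun ξ => (-1 : ℂ) * (dsym 0 ξ * hat k (u (some (Fin.succ 0))) z.1 ξ)
      + (-1 : ℂ) * (dsym 1 ξ * hat k (u (some (Fin.succ 1))) z.1 ξ) := (i3 0).add (i3 1)
  rw [e, e, Complex.ofReal_one, one_mul, ← fourierInv_add (i3 0) (i3 1),
    ← fourierInv_add i6 i7, sub_eq_add_neg, ← neg_mul,
    ← fourierInv_const_mul, ← fourierInv_add i5 ((integrable_hat _ _ _).const_mul _)]
  refine congrArg (fun f : Plane → ℂ => (𝓕⁻ f : Plane → ℂ) z.2) (funext fun ξ => ?_)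
  have hd : (disp m ξ : ℂ) ^ 2 = 4 * Real.pi ^ 2 * ((ξ 0 : ℂ) ^ 2 + (ξ 1 : ℂ) ^ 2) + m := by
    have h1 := disp_sq hm ξ
    rw [EuclideanSpace.norm_sq_eq, Fin.sum_univ_two, Real.norm_eq_abs, Real.norm_eq_abs, sq_abs,
      sq_abs] at h1
    exact_mod_cast h1
  rw [hu.succ, hu.succ, hd]
  unfold dsym
  linear_combination (-4 * Real.pi ^ 2 * ((ξ 0 : ℂ) ^ 2 + (ξ 1 : ℂ) ^ 2) * hat k (u none) z.1 ξ)
    * Complex.I_sq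

end CSH

end

/-! ### Verification of the system and of its initial conditions for mild solutions. -/

noncomputable section

namespace CSH

open FourierTransform
open scoped CompactlySupported

variable {n : ℕ}

section lie

variable (X Y Z : Mat n) (c : ℝ)

theorem mat_lie_add : ⁅X, Y + Z⁆ = ⁅X, Y⁆ + ⁅X, Z⁆ := by simp only [Ring.lie_def]; noncomm_ring

theorem mat_lie_smul : ⁅X, c • Y⁆ = c • ⁅X, Y⁆ := by simp [Ring.lie_def, smul_sub]

theorem mat_smul_lie : ⁅c • X, Y⁆ = c • ⁅X, Y⁆ := by simp [Ring.lie_def, smul_sub]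

theorem mat_lie_neg : ⁅X, -Y⁆ = -⁅X, Y⁆ := by simp only [Ring.lie_def]; noncomm_ring

theorem mat_neg_lie : ⁅-X, Y⁆ = -⁅X, Y⁆ := by simp only [Ring.lie_def]; noncomm_ring

theorem mat_lie_swap : ⁅X, Y⁆ = -⁅Y, X⁆ := by simp only [Ring.lie_def]; noncomm_ring

theorem mat_lie_self : ⁅X, X⁆ = 0 := by simp only [Ring.lie_def]; noncomm_ring

theorem mat_zero_lie : ⁅(0 : Mat n), X⁆ = 0 := by simp only [Ring.lie_def]; noncomm_ring

theorem mat_lie_zero : ⁅X, (0 : Mat n)⁆ = 0 := by simp only [Ring.lie_def]; noncomm_ring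

end lie

theorem pd_congr {F G : Spacetime → Mat n} {z : Spacetime} (μ : Fin 3) (h : F =ᶠ[𝓝 z] G) :
    pd μ F z = pd μ G z := by
  ext i j
  exact Filter.EventuallyEq.lineDeriv_eq (h.fun_comp fun X : Mat n => X i j)

theorem pd_smul (μ : Fin 3) (c : ℝ) (F : Spacetime → Mat n) (z : Spacetime) :
    pd μ (fun w => c • F w) z = c • pd μ F z := by
  ext i j
  exact deriv_const_smul_field c fun t : ℝ => F (z + t • coordVec μ) i j

theorem pd_neg (μ : Fin 3) (F : Spacetime → Mat n) (z : Spacetime) :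
    pd μ (fun w => -F w) z = -pd μ F z := by
  simpa using pd_smul μ (-1) F z

theorem pd_lie (μ : Fin 3) {F G : Spacetime → Mat n} {z : Spacetime}
    (hF : ∀ i j, DifferentiableAt ℝ (fun w => F w i j) z)
    (hG : ∀ i j, DifferentiableAt ℝ (fun w => G w i j) z) :
    pd μ (fun w => ⁅F w, G w⁆) z = ⁅pd μ F z, G z⁆ + ⁅F z, pd μ G z⁆ := by
  ext i j
  have h1 : ∀ i j, HasLineDerivAt ℝ (fun w => F w i j) (pd μ F z i j) z (coordVec μ) :=
    fun i j => (hF i j).lineDifferentiableAt.hasLineDerivAt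
  have h2 : ∀ i j, HasLineDerivAt ℝ (fun w => G w i j) (pd μ G z i j) z (coordVec μ) :=
    fun i j => (hG i j).lineDifferentiableAt.hasLineDerivAt
  unfold HasLineDerivAt at h1 h2
  have h3 := HasDerivAt.fun_sum (u := (Finset.univ : Finset (Fin n))) fun l _ =>
    ((h1 i l).mul (h2 l j)).sub ((h2 i l).mul (h1 l j))
  have h4 := h3.congr_of_eventuallyEq
    (f₁ := fun t : ℝ => (⁅F (z + t • coordVec μ), G (z + t • coordVec μ)⁆ : Mat n) i j)
    (Filter.Eventually.of_forall fun t => by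
      simp [Ring.lie_def, Matrix.mul_apply, Finset.sum_sub_distrib])
  have h5 := h4.deriv
  change pd μ (fun w => ⁅F w, G w⁆) z i j = _ at h5
  rw [h5]
  simp only [zero_smul, add_zero, Ring.lie_def, Matrix.add_apply, Matrix.sub_apply,
    Matrix.mul_apply, ← Finset.sum_sub_distrib, ← Finset.sum_add_distrib]
  exact Finset.sum_congr rfl fun l _ => by ring

variable {D : InitData n} {k : ℕ} {T m : ℝ} {hT : 0 ≤ T} {hm : 0 ≤ m} {δ : ℝ} {U : FieldW n}

/-- The fixed point equation writes each entry as a free evolution of the data plus two Duhamel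
terms; adding their sources gives the equation satisfied by the entry. -/
theorem IsMild.isWave (hU : IsMild D k hT hm δ U) (a : Option (Fin 3)) (i j : Fin n) :
    IsWave k T (fieldMass m a) (fun d => U a d i j) ((quad k U U a + cubic k U a) i j) := by
  have h := ((((IsWave.free k T (fieldMass m a) (D.pos a i j) (D.vel a i j)).smul δ).add
    ((IsWave.free k T (fieldMass m a) 0 (D.velQuad a i j)).smul (δ ^ 2))).add
    (IsWave.duhamel k hT (fieldMass_nonneg hm a) (quad k U U a i j))).add
    (IsWave.duhamel k hT (fieldMass_nonneg hm a) (cubic k U a i j))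
  convert h using 1
  · funext d
    conv_lhs => rw [hU.eq]
    rfl
  · simp

theorem IsMild.pd_phys (hU : IsMild D k hT hm δ U) (a : Option (Fin 3)) (μ : Fin 3)
    {z : Spacetime} (hz : z ∈ Ioo (-T) T ×ˢ (univ : Set Plane)) :
    pd μ (phys k (U a none)) z = phys k (U a (some μ)) z := by
  ext i j
  exact (hU.isWave a i j).lineDeriv hz μ

theorem IsMild.box_phys (hU : IsMild D k hT hm δ U) (a : Option (Fin 3))
    {z : Spacetime} (hz : z ∈ Ioo (-T) T ×ˢ (univ : Set Plane)) :
    box (phys k (U a none)) z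
      = phys k (quad k U U a + cubic k U a) z - fieldMass m a • phys k (U a none) z := by
  have h1 : ∀ μ, pd μ (pdUp μ (phys k (U a none))) z = eta μ • pd μ (phys k (U a (some μ))) z :=
    fun μ => by
      rw [← pd_smul]
      refine pd_congr μ ?_
      filter_upwards [mem_slab_nhds hz] with w hw
      rw [pdUp, hU.pd_phys a μ hw]
  ext i j
  simp only [box, h1, Matrix.sum_apply, Matrix.smul_apply, Matrix.sub_apply, Complex.real_smul]
  exact (hU.isWave a i j).lineDeriv_lineDeriv (fieldMass_nonneg hm a) hz

/-- A skew-Hermitian matrix commutes with its adjoint, so every commutator in the force drops out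
and only `-2v²` times `higgsCore v X = -v² X` is left. The Higgs potential thus acts as a mass term.
-/
theorem higgsForce_of_skew (v : ℝ) {X : Mat n} (hX : Xᴴ = -X) :
    higgsForce v X = (2 * v ^ 4) • X := by
  have h : higgsCore v X = -(v ^ 2) • X := by
    simp [higgsCore, hX, mat_lie_neg, mat_neg_lie, mat_lie_self, mat_zero_lie]
  have h2 : (-(v ^ 2) • X)ᴴ = v ^ 2 • X := by
    rw [Matrix.conjTranspose_smul, hX]; simp
  rw [higgsForce, h, h2, hX]
  simp only [mat_lie_neg, mat_neg_lie, mat_lie_self, mat_lie_smul, mat_zero_lie, smul_smul, neg_zero,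
    smul_zero, mat_lie_zero]
  module

/-- For skew-Hermitian fields the two terms of the cubic current coincide. -/
theorem lie_lie_sub_of_skew {A X : Mat n} (hA : Aᴴ = -A) (hX : Xᴴ = -X) (c : ℝ) :
    ⁅Xᴴ, ⁅c • A, X⁆⁆ - ⁅(⁅c • A, X⁆)ᴴ, X⁆ = (-2 * c) • ⁅X, ⁅A, X⁆⁆ := by
  have h : (⁅c • A, X⁆)ᴴ = -(c • ⁅A, X⁆) := by
    rw [conjTranspose_lie, Matrix.conjTranspose_smul, hA, hX]
    rw [star_trivial, smul_neg, mat_neg_lie, mat_lie_neg, neg_neg, mat_lie_smul, mat_lie_swap,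
      smul_neg]
  rw [h, hX, mat_smul_lie, mat_neg_lie, mat_neg_lie, mat_lie_smul, mat_smul_lie,
    mat_lie_swap ⁅A, X⁆]
  module

theorem IsMild.contDiffOn (hU : IsMild D k hT hm δ U) (a : Option (Fin 3)) (i j : Fin n) :
    ContDiffOn ℝ 2 (fun z => phys k (U a none) z i j) (Ioo (-T) T ×ˢ univ) :=
  (hU.isWave a i j).contDiffOn (fieldMass_nonneg hm a)

theorem IsMild.differentiableAt (hU : IsMild D k hT hm δ U) (a : Option (Fin 3))
    {z : Spacetime} (hz : z ∈ Ioo (-T) T ×ˢ (univ : Set Plane)) (i j : Fin n) :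
    DifferentiableAt ℝ (fun z => phys k (U a none) z i j) z :=
  ((hU.contDiffOn a i j).differentiableOn two_ne_zero).differentiableAt (mem_slab_nhds hz)

/-- The Duhamel integrals are empty at time `0`, so only the free evolutions contribute. -/
theorem IsMild.hat_zero (hU : IsMild D k hT hm δ U) (hT' : 0 < T) (a d : Option (Fin 3))
    (i j : Fin n) (ξ : Plane) : hat k (U a d i j) 0 ξ
      = δ * (posSym (fieldMass m a) d 0 ξ * D.pos a i j ξ
          + velSym (fieldMass m a) d 0 ξ * D.vel a i j ξ)
        + δ ^ 2 * (velSym (fieldMass m a) d 0 ξ * D.velQuad a i j ξ) := by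
  have hc : clip T 0 = 0 := clip_of_mem ⟨by linarith, hT'.le⟩
  conv_lhs => rw [hU.eq]
  simp only [Pi.add_apply, Pi.smul_apply, hat_add, hat_smul, InitData.lin, InitData.linQuad,
    freeField, hat_free, quadMap, cubicMap, solve, hat_duhamel, hc]
  simp

/-- Identifies brackets of the fields at a fixed time with brackets of the profiles. This is what
the quadratic part of the initial velocities is compared with. -/
theorem hat_lieW_of_eq {X Y : MatW n} {b c : MatC n} {t r s : ℝ}
    (hX : ∀ i j ξ, hat k (X i j) t ξ = r * b i j ξ) (hY : ∀ i j ξ, hat k (Y i j) t ξ = s * c i j ξ)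
    (i j : Fin n) (ξ : Plane) : hat k (lieW n k X Y i j) t ξ = (r * s : ℝ) * lieC b c i j ξ := by
  rw [lieW_apply, hat_sum, lieC, CompactlySupportedContinuousMap.sum_apply, Finset.mul_sum]
  refine Finset.sum_congr rfl fun l _ => ?_
  rw [hat_sub, hat_cmul, hat_cmul, CompactlySupportedContinuousMap.sub_apply, pconv_apply,
    pconv_apply, mul_sub, ← integral_const_mul, ← integral_const_mul]
  simp only [hX, hY]
  congr 2 <;> (funext η; push_cast; ring)

/-- With `φ† = -φ` each of the two null forms equals `-[∂^ν φ, ∂^α φ]`; this is the origin of the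
factor `2` in `quad`. -/
theorem nullForm_of_skew {φ : Spacetime → Mat n} (hφ : dag φ = fun z => -φ z) (ν α : Fin 3)
    (z : Spacetime) : nullForm ν α (dag φ) φ z + nullForm ν α φ (dag φ) z
      = (-2 * (eta ν * eta α)) • ⁅pd ν φ z, pd α φ z⁆ := by
  simp only [nullForm, hφ, pdUp, pd_neg, Ring.lie_def, smul_neg, neg_mul, mul_neg,
    Matrix.smul_mul, Matrix.mul_smul, smul_smul, smul_sub]
  rw [mul_comm (eta α)]
  module

/-- Mild solutions are classical solutions. -/
theorem IsMild.isClassicalSolution (hU : IsMild D k hT hm δ U) (hT' : 0 < T) {v : ℝ}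
    (hv : m = 2 * v ^ 4) : IsClassicalSolution v T (phys k (U none none))
      (fun μ => phys k (U (some μ) none)) := by
  have hsk : ∀ a d z, (phys k (U a d) z)ᴴ = -phys k (U a d) z := fun a d z =>
    phys_conjTranspose k (hU.skew a d) z
  have hz0 : ∀ x : Plane, ((0 : ℝ), x) ∈ Ioo (-T) T ×ˢ (univ : Set Plane) := fun x =>
    ⟨⟨by simpa using hT', hT'⟩, mem_univ _⟩
  have hsucc : ∀ j : Fin 2, eta j.succ = -1 := fun j => by simp [eta, Fin.succ_ne_zero]
  refine ⟨hU.contDiffOn none, fun μ => hU.contDiffOn (some μ), fun z hz => ?_, fun μ z hz => ?_,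
    fun x => ?_, fun x => ?_, fun j x => ?_⟩
  · rw [hU.box_phys none hz, higgsForce_of_skew v (hsk _ _ _), ← hv]
    simp only [hU.pd_phys _ _ hz, quad, cubic, phys_add, phys_smul, phys_sum, phys_lieW, up,
      mat_smul_lie, mat_lie_smul, fieldMass]
    module
  · have hdag : dag (phys k (U none none)) = fun z => -phys k (U none none) z := funext (hsk _ _)
    -- The derivative of the cubic current by the Leibniz rule. Only first derivatives appear, and
    -- these are themselves components of `U`.
    have h3 : ∀ ν α, pdUp ν (fun w => ⁅(phys k (U none none) w)ᴴ,
          ⁅up (fun μ => phys k (U (some μ) none)) α w, phys k (U none none) w⁆⁆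
          - ⁅(⁅up (fun μ => phys k (U (some μ) none)) α w, phys k (U none none) w⁆)ᴴ,
            phys k (U none none) w⁆) z
        = (-2 * (eta ν * eta α)) •
          (⁅phys k (U none (some ν)) z, ⁅phys k (U (some α) none) z, phys k (U none none) z⁆⁆
          + (⁅phys k (U none none) z, ⁅phys k (U (some α) (some ν)) z, phys k (U none none) z⁆⁆
          + ⁅phys k (U none none) z, ⁅phys k (U (some α) none) z, phys k (U none (some ν)) z⁆⁆)) :=
      fun ν α => by
        have hd := fun a => hU.differentiableAt a hz
        have hd2 : ∀ i j, DifferentiableAt ℝ (fun w => (⁅phys k (U (some α) none) w,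
            phys k (U none none) w⁆ : Mat n) i j) z := fun i j => by
          simp only [Ring.lie_def, Matrix.sub_apply, Matrix.mul_apply]
          refine DifferentiableAt.fun_sub (DifferentiableAt.fun_sum fun l _ => ?_)
            (DifferentiableAt.fun_sum fun l _ => ?_)
          · exact (hd _ _ _).mul (hd _ _ _)
          · exact (hd _ _ _).mul (hd _ _ _)
        rw [pdUp]
        simp only [up, lie_lie_sub_of_skew (hsk _ _ _) (hsk _ _ _)]
        rw [pd_smul, pd_lie ν (hd none) hd2, pd_lie ν (hd (some α)) (hd none), smul_smul]
        simp only [hU.pd_phys _ _ hz, mat_lie_add]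
        congr 1
        ring
    rw [hU.box_phys (some μ) hz]
    simp only [nullForm_of_skew hdag, h3]
    simp only [pdUp, hU.pd_phys _ _ hz, quad, cubic, phys_add, phys_smul,
      phys_sum, phys_lieW, mat_smul_lie, fieldMass, zero_smul, sub_zero, smul_smul,
      Finset.smul_sum]
    rw [add_assoc, sub_sub, sub_eq_add_neg]
    congr 1
    simp only [← Finset.sum_add_distrib, ← Finset.sum_neg_distrib]
    refine Finset.sum_congr rfl fun ν _ => Finset.sum_congr rfl fun α _ => ?_
    module
  -- The initial conditions are compared in frequency at `t = 0`, where `cos(tω) = 1` and `sin(tω)/ω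
  -- = 0`. The two orders in `δ` of the velocities match `InitData.vel` and `InitData.velQuad`.
  · rw [hU.pd_phys none 0 (hz0 x), ← phys_zero (n := n) k (0, x)]
    refine phys_congr k (fun i j ξ => ?_) x
    simp [hU.hat_zero hT', InitData.vel, InitData.velQuad, sinProp_zero, CSH.hat_zero]
  · simp only [pdUp, hsucc, hU.pd_phys _ _ (hz0 x), neg_smul, one_smul, Finset.sum_neg_distrib,
      neg_neg, ← phys_sum]
    refine phys_congr k (fun i j ξ => ?_) x
    simp only [Finset.sum_apply, hat_sum]
    simp [hU.hat_zero hT', InitData.vel, InitData.velQuad, sinProp_zero, cosProp_zero, hat_zero]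
    ring
  · have hp : ∀ a i j ξ, hat k (U a none i j) 0 ξ = δ * D.pos a i j ξ := fun a i j ξ => by
      simp [hU.hat_zero hT', sinProp_zero, cosProp_zero]
    have hd : ∀ a (l : Fin 2) i j ξ, hat k (U a (some l.succ) i j) 0 ξ
        = δ * dmul l (D.pos a i j) ξ := fun a l i j ξ => by
      simp [hU.hat_zero hT', sinProp_zero, cosProp_zero]
    have h2 : ∀ l : Fin 2, ⁅(phys k (U none none) (0, x))ᴴ, pdUp l.succ (phys k (U none none)) (0, x)⁆
        - ⁅(pdUp l.succ (phys k (U none none)) (0, x))ᴴ, phys k (U none none) (0, x)⁆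
        = (2 : ℝ) • phys k (lieW n k (U none none) (U none (some l.succ))) (0, x) := fun l => by
      simp only [pdUp, hsucc, hU.pd_phys _ _ (hz0 x), neg_smul, one_smul,
        Matrix.conjTranspose_neg, hsk, mat_neg_lie, mat_lie_neg, neg_neg, phys_lieW]
      rw [mat_lie_swap (phys k (U none (some l.succ)) (0, x))]
      module
    simp only [h2]
    rw [hU.pd_phys _ _ (hz0 x), hU.pd_phys _ _ (hz0 x), ← phys_lieW, sub_eq_add_neg,
      ← neg_one_smul ℝ (phys k (lieW n k _ _) _)]
    simp only [← phys_smul, ← phys_sum, ← phys_add]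
    refine phys_congr k (fun i l ξ => ?_) x
    simp only [Pi.add_apply, Pi.smul_apply, Finset.sum_apply, hat_add, hat_smul, hat_sum,
      hat_lieW_of_eq (hp none) (hd none _), hat_lieW_of_eq (hp _) (hp _)]
    simp [hU.hat_zero hT', InitData.vel, InitData.velQuad, sinProp_zero, cosProp_zero]
    ring

end CSH

end

noncomputable section

namespace CSH

open FourierTransform
open scoped CompactlySupported

variable {n : ℕ}

/-! ### Finite differences of smooth maps -/

theorem hasFDerivAt_fwdDiff_iter {E F : Type} [NormedAddCommGroup E] [NormedSpace ℝ E]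
    [NormedAddCommGroup F] [NormedSpace ℝ F] (d : E) (p : ℕ) {f : E → F} {f' : E → E →L[ℝ] F}
    (x : E) (h : ∀ j ≤ p, HasFDerivAt f (f' (x + (j : ℝ) • d)) (x + (j : ℝ) • d)) :
    HasFDerivAt ((fwdDiff d)^[p] f) ((fwdDiff d)^[p] f' x) x := by
  induction p generalizing x with
  | zero => simpa using h 0 le_rfl
  | succ p ih =>
    rw [Function.iterate_succ_apply', Function.iterate_succ_apply']
    have h1 := ih x fun j hj => h j (by omega)
    have h2 := ih (x + d) fun j hj => by
      have := h (j + 1) (by omega)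
      push_cast at this
      rwa [add_smul, one_smul, add_comm ((j : ℝ) • d), ← add_assoc] at this
    have h3 : HasFDerivAt (fun y => (fwdDiff d)^[p] f (y + d)) ((fwdDiff d)^[p] f' (x + d)) x := by
      exact (hasFDerivAt_comp_add_right d).2 h2
    exact h3.sub h1

/-- Each difference gains one factor `‖d‖`: the mean value inequality on the segment from `x` to `x
+ d` bounds the last difference by the derivative of the preceding ones, which are differences of
`fderiv ℝ f` and fall under the induction hypothesis. -/
theorem exists_fwdDiff_iter_le (p : ℕ) {E F : Type} [NormedAddCommGroup E] [NormedSpace ℝ E]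
    [NormedAddCommGroup F] [NormedSpace ℝ F] {f : E → F} (hf : ContDiffAt ℝ p f 0) :
    ∃ C r : ℝ, 0 < r ∧ ∀ x d : E, ‖x‖ < r → ‖d‖ < r →
      ‖(fwdDiff d)^[p] f x‖ ≤ C * ‖d‖ ^ p := by
  induction p generalizing F with
  | zero =>
    have h := (hf.continuousAt.norm).eventually_lt_const (lt_add_one ‖f 0‖)
    obtain ⟨r, hr, hb⟩ := Metric.eventually_nhds_iff.1 h
    exact ⟨‖f 0‖ + 1, r, hr, fun x d hx _ => by simpa using (hb (by simpa using hx)).le⟩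
  | succ p ih =>
    have hf' : ContDiffAt ℝ p (fderiv ℝ f) 0 := hf.fderiv_right (by norm_cast)
    obtain ⟨C, r, hr, hC⟩ := ih hf'
    have hd : ∀ᶠ x in 𝓝 (0 : E), DifferentiableAt ℝ f x := by
      have h1 : ContDiffAt ℝ 1 f 0 := hf.of_le (by norm_cast; omega)
      filter_upwards [h1.eventually (by simp)] with x hx
      exact hx.differentiableAt one_ne_zero
    obtain ⟨r', hr', hd⟩ := Metric.eventually_nhds_iff.1 hd
    have hp : (0 : ℝ) < p + 2 := by positivity
    -- The points met are `x + c d`, to lie in the ball of radius `r`, and `x + (c + j) d` with `c ≤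
    -- 1` and `j ≤ p`, of norm below `(p + 2) · r'/(p + 2)`.
    refine ⟨C, min (r / 2) (r' / (p + 2)), by positivity, fun x d hx hdd => ?_⟩
    rw [Function.iterate_succ_apply']
    have hx1 : ‖x‖ < r / 2 := hx.trans_le (min_le_left _ _)
    have hd1 : ‖d‖ < r / 2 := hdd.trans_le (min_le_left _ _)
    have hx2 : ‖x‖ < r' / (p + 2) := hx.trans_le (min_le_right _ _)
    have hd2 : ‖d‖ < r' / (p + 2) := hdd.trans_le (min_le_right _ _)
    have hseg : ∀ y ∈ segment ℝ x (x + d), ∃ c : ℝ, 0 ≤ c ∧ c ≤ 1 ∧ y = x + c • d := by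
      rintro y hy
      rw [segment_eq_image'] at hy
      obtain ⟨c, hc, rfl⟩ := hy
      exact ⟨c, hc.1, hc.2, by simp⟩
    have h := (convex_segment (𝕜 := ℝ) x (x + d)).norm_image_sub_le_of_norm_hasFDerivWithin_le
      (f := (fwdDiff d)^[p] f) (f' := (fwdDiff d)^[p] (fderiv ℝ f)) (C := C * ‖d‖ ^ p)
      (fun y hy => by
        obtain ⟨c, hc0, hc1, rfl⟩ := hseg y hy
        refine (hasFDerivAt_fwdDiff_iter d p _ fun j hj => (hd ?_).hasFDerivAt).hasFDerivWithinAt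
        rw [dist_zero_right, add_assoc, ← add_smul]
        have hj' : (j : ℝ) ≤ p := by exact_mod_cast hj
        calc ‖x + (c + j) • d‖ ≤ ‖x‖ + (c + j) * ‖d‖ := by
              refine (norm_add_le _ _).trans ?_
              rw [norm_smul, Real.norm_of_nonneg (by positivity)]
          _ ≤ ‖x‖ + (1 + p) * ‖d‖ := by gcongr
          _ < r' / (p + 2) + (1 + p) * (r' / (p + 2)) := by gcongr
          _ = r' := by field_simp; ring)
      (fun y hy => by
        obtain ⟨c, hc0, hc1, rfl⟩ := hseg y hy
        refine hC _ _ ?_ (by linarith)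
        calc ‖x + c • d‖ ≤ ‖x‖ + c * ‖d‖ := by
              refine (norm_add_le _ _).trans ?_
              rw [norm_smul, Real.norm_of_nonneg hc0]
          _ ≤ ‖x‖ + 1 * ‖d‖ := by gcongr
          _ < r := by linarith)
      (left_mem_segment ℝ x (x + d)) (right_mem_segment ℝ x (x + d))
    rw [add_sub_cancel_left] at h
    rw [pow_succ, ← mul_assoc]
    exact h

/-- Divide by `|δ|^p` and let `δ → 0`. The remainder only has to be small along one fixed ray,
without any uniformity in the direction. -/
theorem coeff_le_of_fwdDiff {a b : ℝ} {S : ℝ → ℂ} {p : ℕ} {c : ℂ}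
    (hS : S =o[𝓝 0] fun δ : ℝ => δ ^ p) (ha : 0 ≤ a)
    (h : ∀ᶠ δ in 𝓝 (0 : ℝ), ‖S δ + (a * δ ^ p : ℝ) * c‖ ≤ b * |δ| ^ p) : a * ‖c‖ ≤ b := by
  refine le_of_forall_pos_le_add fun ε hε => ?_
  have h1 := (h.and (hS.bound hε)).filter_mono (nhdsWithin_le_nhds (s := {0}ᶜ))
  obtain ⟨δ, ⟨h2, h3⟩, h0⟩ := (h1.and self_mem_nhdsWithin).exists
  have hδ : 0 < |δ| ^ p := pow_pos (abs_pos.2 h0) _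
  have h4 : ‖((a * δ ^ p : ℝ) : ℂ) * c‖ = a * ‖c‖ * |δ| ^ p := by
    rw [norm_mul, Complex.norm_real, norm_mul, norm_pow, Real.norm_eq_abs, Real.norm_eq_abs,
      abs_of_nonneg ha]
    ring
  have h5 : ‖((a * δ ^ p : ℝ) : ℂ) * c‖ ≤ ‖S δ + (a * δ ^ p : ℝ) * c‖ + ‖S δ‖ := by
    refine le_trans (le_of_eq ?_) (norm_sub_le _ _)
    congr 1
    ring
  rw [norm_pow, Real.norm_eq_abs] at h3
  rw [h4] at h5
  refine le_of_mul_le_mul_right ?_ hδ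
  linarith

theorem isLittleO_comp_mul {R : ℝ → ℂ} {p : ℕ} (hR : R =o[𝓝 0] fun δ : ℝ => δ ^ p) (j : ℝ) :
    (fun δ => R (j * δ)) =o[𝓝 0] fun δ : ℝ => δ ^ p := by
  have h : Filter.Tendsto (fun δ : ℝ => j * δ) (𝓝 0) (𝓝 0) := by
    have : Continuous fun δ : ℝ => j * δ := by fun_prop
    simpa using this.tendsto 0
  refine (hR.comp_tendsto h).trans_isBigO ?_
  refine Asymptotics.IsBigO.of_bound (|j| ^ p) (Filter.Eventually.of_forall fun δ => ?_)
  simp [mul_pow]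

section coefficients

variable {E F : Type} [NormedAddCommGroup E] [NormedSpace ℝ E]
    [NormedAddCommGroup F] [NormedSpace ℝ F] {Φ : E → F}

theorem eventually_fwdDiff_le {p : ℕ} {C r : ℝ} (hr : 0 < r)
    (h : ∀ x d : E, ‖x‖ < r → ‖d‖ < r → ‖(fwdDiff d)^[p] Φ x‖ ≤ C * ‖d‖ ^ p) (d : E)
    {ℓ : F →ₗ[ℝ] ℂ} {K : ℝ} (hK : 0 ≤ K) (hℓ : ∀ x, ‖ℓ x‖ ≤ K * ‖x‖) :
    ∀ᶠ δ in 𝓝 (0 : ℝ), ‖ℓ ((fwdDiff (δ • d))^[p] Φ 0)‖ ≤ K * C * ‖d‖ ^ p * |δ| ^ p := by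
  have h1 : Filter.Tendsto (fun δ : ℝ => ‖δ • d‖) (𝓝 0) (𝓝 0) := by
    have : Continuous fun δ : ℝ => ‖δ • d‖ := by fun_prop
    simpa using this.tendsto 0
  filter_upwards [h1.eventually_lt_const hr] with δ hδ
  refine (hℓ _).trans ((mul_le_mul_of_nonneg_left (h 0 (δ • d) (by simpa) hδ) hK).trans_eq ?_)
  rw [norm_smul, Real.norm_eq_abs, mul_pow]
  ring

/-- The second difference with weights `1, -2, 1` at `2δ, δ, 0` annihilates the constant and linear
terms and multiplies the coefficient of `δ²` by `2`. The constant depends on `Φ` only, not on the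
direction or on the functional. -/
theorem exists_coeff_two_le (hΦ : ContDiffAt ℝ 2 Φ 0) :
    ∃ C, ∀ (d : E) (ℓ : F →ₗ[ℝ] ℂ) (K : ℝ) (c₁ c₂ : ℂ), 0 ≤ K → (∀ x, ‖ℓ x‖ ≤ K * ‖x‖) →
      ((fun δ : ℝ => ℓ (Φ (δ • d)) - δ * c₁ - δ ^ 2 * c₂) =o[𝓝 0] fun δ : ℝ => δ ^ 2) →
      ‖c₂‖ ≤ C * K * ‖d‖ ^ 2 := by
  obtain ⟨C, r, hr, h⟩ := exists_fwdDiff_iter_le 2 (E := E) (F := F) (f := Φ) (by exact_mod_cast hΦ)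
  refine ⟨C / 2, fun d ℓ K c₁ c₂ hK hℓ hR => ?_⟩
  set R : ℝ → ℂ := fun δ : ℝ => ℓ (Φ (δ • d)) - δ * c₁ - δ ^ 2 * c₂ with hRdef
  have hS := ((isLittleO_comp_mul hR 2).sub ((isLittleO_comp_mul hR 1).const_mul_left 2)).add
    (isLittleO_comp_mul hR 0)
  have h2 := coeff_le_of_fwdDiff (a := 2) (c := c₂) hS (by norm_num) (by
    filter_upwards [eventually_fwdDiff_le hr h d hK hℓ] with δ hδ
    refine le_trans (le_of_eq ?_) hδ
    congr 1
    simp only [hRdef, Function.iterate_succ_apply', Function.iterate_zero_apply, fwdDiff, map_sub,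
      zero_add]
    rw [mul_smul, two_smul]
    simp
    ring)
  linarith

/-- The weights `1, -3, 3, -1` at `3δ, 2δ, δ, 0` annihilate the terms of degree at most two and
multiply the coefficient of `δ³` by `27 - 24 + 3 = 6`. -/
theorem exists_coeff_three_le (hΦ : ContDiffAt ℝ 3 Φ 0) :
    ∃ C, ∀ (d : E) (ℓ : F →ₗ[ℝ] ℂ) (K : ℝ) (c₁ c₂ c₃ : ℂ), 0 ≤ K → (∀ x, ‖ℓ x‖ ≤ K * ‖x‖) →
      ((fun δ : ℝ => ℓ (Φ (δ • d)) - δ * c₁ - δ ^ 2 * c₂ - δ ^ 3 * c₃) =o[𝓝 0]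
        fun δ : ℝ => δ ^ 3) →
      ‖c₃‖ ≤ C * K * ‖d‖ ^ 3 := by
  obtain ⟨C, r, hr, h⟩ := exists_fwdDiff_iter_le 3 (E := E) (F := F) (f := Φ) (by exact_mod_cast hΦ)
  refine ⟨C / 6, fun d ℓ K c₁ c₂ c₃ hK hℓ hR => ?_⟩
  set R : ℝ → ℂ := fun δ : ℝ => ℓ (Φ (δ • d)) - δ * c₁ - δ ^ 2 * c₂ - δ ^ 3 * c₃ with hRdef
  have hS := (((isLittleO_comp_mul hR 3).sub ((isLittleO_comp_mul hR 2).const_mul_left 3)).add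
    ((isLittleO_comp_mul hR 1).const_mul_left 3)).sub (isLittleO_comp_mul hR 0)
  have h2 := coeff_le_of_fwdDiff (a := 6) (c := c₃) hS (by norm_num) (by
    filter_upwards [eventually_fwdDiff_le hr h d hK hℓ] with δ hδ
    refine le_trans (le_of_eq ?_) hδ
    congr 1
    simp only [hRdef, Function.iterate_succ_apply', Function.iterate_zero_apply, fwdDiff, map_sub,
      zero_add]
    rw [mul_smul, mul_smul, two_smul, show (3 : ℝ) • δ • d = δ • d + δ • d + δ • d by module]
    simp
    ring)
  linarith

end coefficients

/-! ### Sobolev spaces and the weighted space -/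

theorem bracketPow_mul_wt_le {k : ℕ} {r : ℝ} (hr : r ≤ k) (ξ : Plane) :
    bracketPow r ξ * wt k ξ ≤ wt 0 ξ := by
  have h0 := norm_nonneg ξ
  have h1 : bracketPow r ξ ≤ (1 + ‖ξ‖) ^ k := by
    calc bracketPow r ξ ≤ (1 + ‖ξ‖ ^ 2) ^ ((k : ℝ) / 2) := by
          unfold bracketPow
          exact Real.rpow_le_rpow_of_exponent_le (by nlinarith) (by linarith)
      _ ≤ ((1 + ‖ξ‖) ^ (2 : ℝ)) ^ ((k : ℝ) / 2) := by
          refine Real.rpow_le_rpow (by positivity) ?_ (by positivity)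
          rw [Real.rpow_two]
          nlinarith
      _ = (1 + ‖ξ‖) ^ k := by
          rw [← Real.rpow_mul (by positivity), mul_div_cancel₀ _ two_ne_zero, Real.rpow_natCast]
  unfold wt
  rw [← div_eq_mul_inv, div_le_iff₀ (by positivity), zero_add, pow_add,
    mul_comm ((1 + ‖ξ‖) ^ k), inv_mul_cancel_left₀ (by positivity)]
  exact h1

theorem memLp_wt : MemLp (wt 0) 2 (volume : Measure Plane) := by
  rw [memLp_two_iff_integrable_sq (continuous_wt 0).aestronglyMeasurable]
  refine (integrable_wt 0).mono' (by fun_prop) (Filter.Eventually.of_forall fun ξ => ?_)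
  have h := wt_pos 0 ξ
  rw [Real.norm_of_nonneg (by positivity)]
  nlinarith [wt_le_one 0 ξ]

theorem norm_bracketPow_mul_hat_le {k : ℕ} {r : ℝ} (hr : r ≤ k) (g : WSpace) (t : ℝ) (ξ : Plane) :
    ‖(bracketPow r ξ : ℂ) * hat k g t ξ‖ ≤ ‖g‖ * wt 0 ξ := by
  rw [norm_mul, Complex.norm_real, Real.norm_of_nonneg (bracketPow_pos r ξ).le]
  calc bracketPow r ξ * ‖hat k g t ξ‖ ≤ bracketPow r ξ * (‖g‖ * wt k ξ) := by
        have := bracketPow_pos r ξ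
        gcongr
        exact norm_hat_le k g t ξ
    _ = ‖g‖ * (bracketPow r ξ * wt k ξ) := by ring
    _ ≤ ‖g‖ * wt 0 ξ := by
        gcongr
        exact bracketPow_mul_wt_le hr ξ

theorem memLp_bracketPow_mul_hat {k : ℕ} {r : ℝ} (hr : r ≤ k) (g : WSpace) (t : ℝ) :
    MemLp (fun ξ => (bracketPow r ξ : ℂ) * hat k g t ξ) 2 (volume : Measure Plane) := by
  refine (memLp_wt.const_mul ‖g‖).mono' ?_
    (Filter.Eventually.of_forall (norm_bracketPow_mul_hat_le hr g t))
  have := continuous_bracketPow r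
  exact Continuous.aestronglyMeasurable (by fun_prop)

/-- The value at time `t` of a space-time function, as an element of `H^r`. -/
def sobolevAt {k : ℕ} {r : ℝ} (hr : r ≤ k) (t : ℝ) : WSpace →L[ℝ] Sobolev r :=
  LinearMap.mkContinuous
    { toFun := fun g => Sobolev.ofFourier r ((memLp_bracketPow_mul_hat hr g t).toLp _)
      map_add' := fun g h => by
        rw [← map_add, ← MemLp.toLp_add]
        congr 1
        refine MemLp.toLp_congr _ _ (Filter.Eventually.of_forall fun ξ => ?_)
        simp only [hat_add, Pi.add_apply]
        ring
      map_smul' := fun c g => by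
        change _ = (c : ℂ) • Sobolev.ofFourier r _
        rw [← map_smul (Sobolev.ofFourier r) (c : ℂ), ← MemLp.toLp_const_smul]
        congr 1
        refine MemLp.toLp_congr _ _ (Filter.Eventually.of_forall fun ξ => ?_)
        simp only [hat_smul, Pi.smul_apply, smul_eq_mul]
        ring }
    ‖memLp_wt.toLp (wt 0)‖ (fun g => by
      change ‖Sobolev.ofFourier r _‖ ≤ _
      rw [Sobolev.norm_ofFourier, mul_comm]
      refine Lp.norm_le_mul_norm_of_ae_le_mul ?_
      filter_upwards [(memLp_bracketPow_mul_hat hr g t).coeFn_toLp, memLp_wt.coeFn_toLp] with ξ h1 h2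
      rw [h1, h2, Real.norm_of_nonneg (wt_pos 0 ξ).le]
      exact norm_bracketPow_mul_hat_le hr g t ξ)

theorem sobolevAt_apply {k : ℕ} {r : ℝ} (hr : r ≤ k) (t : ℝ) (g : WSpace) :
    sobolevAt hr t g = Sobolev.ofFourier r ((memLp_bracketPow_mul_hat hr g t).toLp _) := rfl

theorem continuous_sobolevAt {k : ℕ} {r : ℝ} (hr : r ≤ k) (g : WSpace) :
    Continuous fun t => sobolevAt hr t g := by
  refine (Sobolev.ofFourierIsometry r).continuous.comp
    (continuous_toLp_of_dominated (memLp_bracketPow_mul_hat hr g) (b := fun ξ => ‖g‖ * wt 0 ξ)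
      ((memLp_wt.const_mul ‖g‖).integrable_sq) (norm_bracketPow_mul_hat_le hr g) fun ξ => ?_)
  fun_prop

theorem toDist_sobolevAt {k : ℕ} {r : ℝ} (hr : r ≤ k) (t : ℝ) (g : WSpace) (ψ : 𝓢(Plane, ℂ)) :
    Sobolev.toDist r (sobolevAt hr t g) ψ = ∫ x, ψ x * synth (hat k g) (t, x) :=
  Sobolev.toDist_ofFourier_apply r (integrable_hat k g t) (MemLp.coeFn_toLp _) ψ

theorem fourierPairing_sobolevAt {k : ℕ} {r : ℝ} (hr : r ≤ k) (t : ℝ) (g : WSpace)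
    (χ : Lp ℂ 2 (volume : Measure Plane)) :
    Sobolev.fourierPairing r χ (sobolevAt hr t g)
      = ∫ ξ, starRingEnd ℂ (χ ξ) * ((bracketPow r ξ : ℂ) * hat k g t ξ) := by
  rw [sobolevAt_apply, Sobolev.fourierPairing_ofFourier, L2.inner_def]
  refine integral_congr_ae ?_
  filter_upwards [(memLp_bracketPow_mul_hat hr g t).coeFn_toLp] with ξ h
  rw [h, RCLike.inner_apply, mul_comm]

theorem sobolevAt_congr {k : ℕ} {r : ℝ} (hr : r ≤ k) {t : ℝ} {g h : WSpace}
    (hgh : ∀ ξ, hat k g t ξ = hat k h t ξ) : sobolevAt hr t g = sobolevAt hr t h := by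
  rw [sobolevAt_apply, sobolevAt_apply]
  congr 1
  exact MemLp.toLp_congr _ _ (Filter.Eventually.of_forall fun ξ => by simp only [hgh])

theorem pairing_mem_su {k : ℕ} {r : ℝ} (hr : r ≤ k) {X : MatW n} (hX : skewAdj X = X)
    (hX' : traceW X = 0) (t : ℝ) : (fun i j => sobolevAt hr t (X i j)) ∈ fieldSpace n (su n) r := by
  intro ψ hψ
  have hψ' : ∀ x, starRingEnd ℂ (ψ x) = ψ x := fun x => Complex.conj_eq_iff_im.2 (hψ x)
  constructor
  · ext i j
    simp only [pairing, Matrix.conjTranspose_apply, Matrix.of_apply, Matrix.neg_apply,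
      toDist_sobolevAt]
    rw [← integral_neg, ← starRingEnd_apply, ← integral_conj]
    refine integral_congr_ae (Filter.Eventually.of_forall fun x => ?_)
    have h := congrFun (congrFun (phys_conjTranspose k hX (t, x)) i) j
    rw [Matrix.conjTranspose_apply, Matrix.neg_apply, phys_apply, phys_apply] at h
    simp only [map_mul, hψ', starRingEnd_apply, h, mul_neg]
  · simp only [pairing, Matrix.trace, Matrix.diag_apply, Matrix.of_apply]
    have h : ∑ i, sobolevAt hr t (X i i) = 0 := by
      rw [← map_sum, show ∑ i, X i i = 0 from hX', map_zero]
    have h2 := congrArg (fun u => Sobolev.toDist r u ψ) h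
    simpa using h2

/-! ### The trajectories of mild solutions -/

section trajectory

variable {𝔪 : Submodule ℝ (Mat n)} {s σ : ℝ} {k : ℕ}

/-- The state at time `t` of fields with values in `𝔰𝔲(n)`. -/
def stateAt (h𝔪 : su n ≤ 𝔪) (hs : s ≤ k) (hσ : σ ≤ k) (U : FieldW n)
    (hU : ∀ a d, skewAdj (U a d) = U a d) (hU' : ∀ a d, traceW (U a d) = 0) (t : ℝ) :
    State n 𝔪 s σ :=
  (⟨fun i j => sobolevAt hs t (U none none i j),
      fun ψ hψ => h𝔪 (pairing_mem_su hs (hU none none) (hU' none none) t ψ hψ)⟩,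
    fun μ => ⟨fun i j => sobolevAt hσ t (U (some μ) none i j),
      pairing_mem_su hσ (hU (some μ) none) (hU' (some μ) none) t⟩)

theorem continuous_stateAt (h𝔪 : su n ≤ 𝔪) (hs : s ≤ k) (hσ : σ ≤ k) (U : FieldW n)
    (hU : ∀ a d, skewAdj (U a d) = U a d) (hU' : ∀ a d, traceW (U a d) = 0) :
    Continuous (stateAt h𝔪 hs hσ U hU hU') := by
  refine Continuous.prodMk ?_ (continuous_pi fun μ => ?_)
  · exact Continuous.subtype_mk (continuous_pi fun i => continuous_pi fun j =>
      continuous_sobolevAt hs _) _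
  · exact Continuous.subtype_mk (continuous_pi fun i => continuous_pi fun j =>
      continuous_sobolevAt hσ _) _

theorem InitData.skewAdj_lin (D : InitData n) (k : ℕ) (T m : ℝ) (a d : Option (Fin 3)) :
    skewAdj (D.lin k T m a d) = D.lin k T m a d :=
  congrFun (congrFun (skewField_freeField k T m D.isSkew D.isSkew_vel) a) d

theorem InitData.traceW_lin (D : InitData n) (k : ℕ) (T m : ℝ) (a d : Option (Fin 3)) :
    traceW (D.lin k T m a d) = 0 := traceW_freeField k T m D.isSkew D.isSkew_vel a d

/-- The initial data, as an element of `H^s × H^σ`. -/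
def InitData.state (D : InitData n) (h𝔪 : su n ≤ 𝔪) (hs : s ≤ k) (hσ : σ ≤ k) (T m : ℝ) :
    State n 𝔪 s σ :=
  stateAt h𝔪 hs hσ (D.lin k T m) (D.skewAdj_lin k T m) (D.traceW_lin k T m) 0

theorem InitData.hat_lin_zero (D : InitData n) {T : ℝ} (hT : 0 ≤ T) (m : ℝ) (a : Option (Fin 3))
    (i j : Fin n) (ξ : Plane) : hat k (D.lin k T m a none i j) 0 ξ = D.pos a i j ξ := by
  have hc : clip T 0 = 0 := clip_of_mem ⟨by linarith, hT⟩
  simp [InitData.lin, freeField, hat_free, hc, sinProp_zero, cosProp_zero]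

variable {v T m : ℝ}

/-- The flow map follows mild solutions. -/
theorem IsFlowMap.eventually_eq {hT : 0 < T} {Φ : State n 𝔪 s σ → Traj n 𝔪 s σ T}
    (hΦ : IsFlowMap v hT Φ) (h𝔪 : su n ≤ 𝔪) (hs : s ≤ k) (hσ : σ ≤ k) (hm : 0 ≤ m)
    (hv : m = 2 * v ^ 4) (D : InitData n) {U : ℝ → FieldW n}
    (hU : ∀ᶠ δ in 𝓝 (0 : ℝ), IsMild D k hT.le hm δ (U δ)) :
    ∀ᶠ δ in 𝓝 (0 : ℝ), ∀ t : Icc (-T) T,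
      (∀ i j, (Φ (δ • D.state h𝔪 hs hσ T m) t).1.1 i j = sobolevAt hs t (U δ none none i j)) ∧
      ∀ μ i j, ((Φ (δ • D.state h𝔪 hs hσ T m) t).2 μ).1 i j
        = sobolevAt hσ t (U δ (some μ) none i j) := by
  have h0 : Filter.Tendsto (fun δ : ℝ => δ • D.state h𝔪 hs hσ T m) (𝓝 0) (𝓝 0) := by
    have : Continuous fun δ : ℝ => δ • D.state h𝔪 hs hσ T m := by fun_prop
    simpa using this.tendsto 0
  filter_upwards [hU, h0.eventually hΦ] with δ hδ hΦδ
  let u : Traj n 𝔪 s σ T := ⟨fun t => stateAt h𝔪 hs hσ (U δ) hδ.skew hδ.trace t,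
    (continuous_stateAt h𝔪 hs hσ (U δ) hδ.skew hδ.trace).comp continuous_subtype_val⟩
  -- Only positions enter the data of the flow map. The quadratic corrections concern velocities, so
  -- the trajectory starts exactly at `δ` times a fixed state.
  have hz : ∀ a i j ξ, hat k (U δ a none i j) 0 ξ = hat k (δ • D.lin k T m a none i j) 0 ξ :=
    fun a i j ξ => by
      rw [hδ.hat_zero hT, hat_smul, D.hat_lin_zero hT.le]
      simp [sinProp_zero, cosProp_zero]
  -- The mild solution is an admissible classical solution with these data, so the defining property
  -- of a flow map applies to it.
  have hu : Φ (δ • D.state h𝔪 hs hσ T m) = u := by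
    refine hΦδ u ⟨phys k (U δ none none), fun μ => phys k (U δ (some μ) none),
      hδ.isClassicalSolution hT hv, fun t _ => ⟨fun i j ψ _ => ?_, fun μ i j ψ _ => ?_⟩⟩ ?_
    · exact toDist_sobolevAt hs t _ ψ
    · exact toDist_sobolevAt hσ t _ ψ
    · refine Prod.ext (Subtype.ext (funext fun i => funext fun j => ?_))
        (funext fun μ => Subtype.ext (funext fun i => funext fun j => ?_))
      · change sobolevAt hs 0 (U δ none none i j) = δ • sobolevAt hs 0 (D.lin k T m none none i j)
        rw [← map_smul]
        exact sobolevAt_congr hs (hz none i j)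
      · change sobolevAt hσ 0 (U δ (some μ) none i j)
          = δ • sobolevAt hσ 0 (D.lin k T m (some μ) none i j)
        rw [← map_smul]
        exact sobolevAt_congr hσ (hz (some μ) i j)
  intro t
  rw [hu]
  exact ⟨fun _ _ => rfl, fun _ _ _ => rfl⟩

end trajectory

end CSH

end

noncomputable section

namespace CSH

open FourierTransform
open scoped CompactlySupported

variable {n : ℕ}

/-! ### Bounds for the Taylor coefficients of a flow map -/

/-- The pairing of `χ` with the value at time `t` of an entry of a field. -/
def fieldPairing {k : ℕ} {r : ℝ} (hr : r ≤ k) (χ : Lp ℂ 2 (volume : Measure Plane)) (t : ℝ)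
    (a : Option (Fin 3)) (i j : Fin n) : FieldW n →L[ℝ] ℂ :=
  ((((((Sobolev.fourierPairing r χ).restrictScalars ℝ).comp (sobolevAt hr t)).comp
    (ContinuousLinearMap.proj (R := ℝ) (φ := fun _ : Fin n => WSpace) j)).comp
    (ContinuousLinearMap.proj (R := ℝ) (φ := fun _ : Fin n => Fin n → WSpace) i)).comp
    (ContinuousLinearMap.proj (R := ℝ) (φ := fun _ : Option (Fin 3) => MatW n) none)).comp
    (ContinuousLinearMap.proj (R := ℝ) (φ := fun _ : Option (Fin 3) => Option (Fin 3) → MatW n) a)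

theorem fieldPairing_apply {k : ℕ} {r : ℝ} (hr : r ≤ k) (χ : Lp ℂ 2 (volume : Measure Plane))
    (t : ℝ) (a : Option (Fin 3)) (i j : Fin n) (U : FieldW n) : fieldPairing hr χ t a i j U
      = Sobolev.fourierPairing r χ (sobolevAt hr t (U a none i j)) := rfl

theorem isLittleO_fieldPairing {k : ℕ} {r : ℝ} (hr : r ≤ k)
    (χ : Lp ℂ 2 (volume : Measure Plane)) (t : ℝ) (a : Option (Fin 3)) (i j : Fin n)
    {U : ℝ → FieldW n} {U₁ U₂ U₃ : FieldW n}
    (h : (fun δ => U δ - δ • U₁ - δ ^ 2 • U₂ - δ ^ 3 • U₃) =o[𝓝 0] fun δ : ℝ => δ ^ 3) :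
    (fun δ : ℝ => fieldPairing hr χ t a i j (U δ) - δ * fieldPairing hr χ t a i j U₁
      - δ ^ 2 * fieldPairing hr χ t a i j U₂ - δ ^ 3 * fieldPairing hr χ t a i j U₃)
      =o[𝓝 0] fun δ : ℝ => δ ^ 3 := by
  refine (((fieldPairing hr χ t a i j).isBigO_comp _ _).trans_isLittleO h).congr_left fun δ => ?_
  simp

section flow

variable {𝔪 : Submodule ℝ (Mat n)} {s σ : ℝ} {k : ℕ} {v T m : ℝ} {hT : 0 < T}
  {Φ : State n 𝔪 s σ → Traj n 𝔪 s σ T}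

/-- Along `δ ↦ δ d` the flow map agrees with the mild solution, whose second coefficient is
`D.second`. Evaluation at time `t` and pairing with `χ` is a functional of norm at most `‖χ‖`. -/
theorem IsFlowMap.exists_second_le (hΦ : IsFlowMap v hT Φ) (h𝔪 : su n ≤ 𝔪) (hs : s ≤ k)
    (hσ : σ ≤ k) (hm : 0 ≤ m) (hv : m = 2 * v ^ 4) (hC : ContDiffAt ℝ 2 Φ 0) :
    ∃ C, ∀ (D : InitData n) (χ : Lp ℂ 2 (volume : Measure Plane)) (t : ℝ), t ∈ Icc (-T) T →
      ∀ (μ : Fin 3) (i j : Fin n),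
      ‖fieldPairing hσ χ t (some μ) i j (D.second k hT.le hm)‖
        ≤ C * ‖χ‖ * ‖D.state h𝔪 hs hσ T m‖ ^ 2 := by
  obtain ⟨C, h⟩ := exists_coeff_two_le hC
  refine ⟨C, fun D χ t ht μ i j => ?_⟩
  obtain ⟨U, hU, hexp⟩ := D.exists_mild k hT.le hm
  let ℓ : Traj n 𝔪 s σ T →ₗ[ℝ] ℂ :=
    { toFun := fun u => Sobolev.fourierPairing σ χ (((u ⟨t, ht⟩).2 μ).1 i j)
      map_add' := fun u w => map_add (Sobolev.fourierPairing σ χ) _ _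
      map_smul' := fun c u =>
        ((Sobolev.fourierPairing σ χ).restrictScalars ℝ).map_smul c (((u ⟨t, ht⟩).2 μ).1 i j) }
  have hℓ : ∀ u, ‖ℓ u‖ ≤ ‖χ‖ * ‖u‖ := fun u => by
    refine ((Sobolev.fourierPairing σ χ).le_opNorm _).trans ?_
    gcongr
    · exact Sobolev.norm_fourierPairing_le σ χ
    · exact ((norm_le_pi_norm (((u ⟨t, ht⟩).2 μ).1 i) j).trans
        (norm_le_pi_norm ((u ⟨t, ht⟩).2 μ).1 i)).trans
        (((norm_le_pi_norm (u ⟨t, ht⟩).2 μ).trans (norm_snd_le _)).trans (u.norm_coe_le_norm _))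
  refine h (D.state h𝔪 hs hσ T m) ℓ ‖χ‖ (fieldPairing hσ χ t (some μ) i j (D.lin k T m)) _
    (norm_nonneg _) hℓ ?_
  have h3 := (isLittleO_fieldPairing hσ χ t (some μ) i j hexp).trans_isBigO
    (Asymptotics.IsLittleO.isBigO (g := fun δ : ℝ => δ ^ 2)
      (Asymptotics.isLittleO_pow_pow (by norm_num)))
  -- The expansion is known to third order; here its last term is moved into the remainder.
  have h4 : (fun δ : ℝ => (δ : ℂ) ^ 3 * fieldPairing hσ χ t (some μ) i j (D.third k hT.le hm))
      =o[𝓝 0] fun δ : ℝ => δ ^ 2 := by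
    have h5 : (fun δ : ℝ => (δ : ℂ) ^ 3) =o[𝓝 0] fun δ : ℝ => δ ^ 2 := by
      have h6 : (fun δ : ℝ => δ ^ 3) =o[𝓝 0] fun δ : ℝ => δ ^ 2 :=
        Asymptotics.isLittleO_pow_pow (by norm_num)
      refine Asymptotics.IsLittleO.of_norm_left ?_
      refine h6.norm_left.congr_left fun δ => by simp
    exact (h5.const_mul_left (fieldPairing hσ χ t (some μ) i j (D.third k hT.le hm))).congr_left
      fun δ => mul_comm _ _
  refine (h3.add h4).congr' ?_ Filter.EventuallyEq.rfl
  filter_upwards [hΦ.eventually_eq h𝔪 hs hσ hm hv D hU] with δ hδ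
  have h6 : ℓ (Φ (δ • D.state h𝔪 hs hσ T m)) = fieldPairing hσ χ t (some μ) i j (U δ) :=
    congrArg (Sobolev.fourierPairing σ χ) ((hδ ⟨t, ht⟩).2 μ i j)
  rw [h6]
  ring

theorem IsFlowMap.exists_third_le (hΦ : IsFlowMap v hT Φ) (h𝔪 : su n ≤ 𝔪) (hs : s ≤ k)
    (hσ : σ ≤ k) (hm : 0 ≤ m) (hv : m = 2 * v ^ 4) (hC : ContDiffAt ℝ 3 Φ 0) :
    ∃ C, ∀ (D : InitData n) (χ : Lp ℂ 2 (volume : Measure Plane)) (t : ℝ), t ∈ Icc (-T) T →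
      ∀ (i j : Fin n), ‖fieldPairing hs χ t none i j (D.third k hT.le hm)‖
        ≤ C * ‖χ‖ * ‖D.state h𝔪 hs hσ T m‖ ^ 3 := by
  obtain ⟨C, h⟩ := exists_coeff_three_le hC
  refine ⟨C, fun D χ t ht i j => ?_⟩
  obtain ⟨U, hU, hexp⟩ := D.exists_mild k hT.le hm
  let ℓ : Traj n 𝔪 s σ T →ₗ[ℝ] ℂ :=
    { toFun := fun u => Sobolev.fourierPairing s χ ((u ⟨t, ht⟩).1.1 i j)
      map_add' := fun u w => map_add (Sobolev.fourierPairing s χ) _ _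
      map_smul' := fun c u =>
        ((Sobolev.fourierPairing s χ).restrictScalars ℝ).map_smul c ((u ⟨t, ht⟩).1.1 i j) }
  have hℓ : ∀ u, ‖ℓ u‖ ≤ ‖χ‖ * ‖u‖ := fun u => by
    refine ((Sobolev.fourierPairing s χ).le_opNorm _).trans ?_
    gcongr
    · exact Sobolev.norm_fourierPairing_le s χ
    · exact ((norm_le_pi_norm ((u ⟨t, ht⟩).1.1 i) j).trans
        (norm_le_pi_norm (u ⟨t, ht⟩).1.1 i)).trans
        ((norm_fst_le (u ⟨t, ht⟩)).trans (u.norm_coe_le_norm _))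
  refine h (D.state h𝔪 hs hσ T m) ℓ ‖χ‖ (fieldPairing hs χ t none i j (D.lin k T m))
    (fieldPairing hs χ t none i j (D.second k hT.le hm)) _ (norm_nonneg _) hℓ ?_
  refine (isLittleO_fieldPairing hs χ t none i j hexp).congr' ?_ Filter.EventuallyEq.rfl
  filter_upwards [hΦ.eventually_eq h𝔪 hs hσ hm hv D hU] with δ hδ
  have h6 : ℓ (Φ (δ • D.state h𝔪 hs hσ T m)) = fieldPairing hs χ t none i j (U δ) :=
    congrArg (Sobolev.fourierPairing s χ) ((hδ ⟨t, ht⟩).1 i j)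
  rw [h6]

end flow

/-! ### Explicit bounds -/

/-- On this annulus `N² ≤ 1 + |ξ|² ≤ 401 N²`, where `401 = 1 + 20²`. The upper bound serves for `r ≥
0` and the lower one for `r ≤ 0`. -/
theorem bracketPow_le {r N : ℝ} (hN : 1 ≤ N) {ξ : Plane} (h1 : N ≤ ‖ξ‖) (h2 : ‖ξ‖ ≤ 20 * N) :
    bracketPow r ξ ≤ 401 ^ (|r| / 2) * N ^ r := by
  have hN0 : 0 < N := by linarith
  have h3 : N ^ 2 ≤ 1 + ‖ξ‖ ^ 2 := by nlinarith
  have h4 : 1 + ‖ξ‖ ^ 2 ≤ 401 * N ^ 2 := by nlinarith [norm_nonneg ξ]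
  have h5 : (N ^ 2) ^ (r / 2) = N ^ r := by
    rw [← Real.rpow_natCast, ← Real.rpow_mul hN0.le]
    congr 1
    push_cast
    ring
  unfold bracketPow
  rcases le_total 0 r with hr | hr
  · calc (1 + ‖ξ‖ ^ 2) ^ (r / 2) ≤ (401 * N ^ 2) ^ (r / 2) :=
          Real.rpow_le_rpow (by positivity) h4 (by linarith)
      _ = 401 ^ (|r| / 2) * N ^ r := by
          rw [Real.mul_rpow (by norm_num) (by positivity), h5, abs_of_nonneg hr]
  · calc (1 + ‖ξ‖ ^ 2) ^ (r / 2) ≤ (N ^ 2) ^ (r / 2) :=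
          Real.rpow_le_rpow_of_nonpos (by positivity) h3 (by linarith)
      _ = 1 * N ^ r := by rw [h5, one_mul]
      _ ≤ _ := by
          gcongr
          exact Real.one_le_rpow (by norm_num) (by positivity)

theorem norm_toLp_le_of_indicator {f : Plane → ℂ} (hf : MemLp f 2 volume) {B : Set Plane}
    (hB : MeasurableSet B) (hB' : volume B ≠ ∞) {M : ℝ} (hM : 0 ≤ M)
    (h : ∀ ξ, ‖f ξ‖ ≤ B.indicator (fun _ => M) ξ) :
    ‖hf.toLp f‖ ≤ M * √(volume.real B) := by
  have h1 : ‖hf.toLp f‖ ≤ ‖indicatorConstLp 2 hB hB' M‖ := by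
    refine Lp.norm_le_norm_of_ae_le ?_
    filter_upwards [hf.coeFn_toLp, indicatorConstLp_coeFn (p := 2) (hs := hB) (hμs := hB')
      (c := M)] with ξ e1 e2
    rw [e1, e2]
    exact (h ξ).trans (le_abs_self _)
  refine h1.trans_eq ?_
  rw [norm_indicatorConstLp (by norm_num) (by norm_num), Real.norm_of_nonneg hM, Real.sqrt_eq_rpow]
  norm_num

/-- Test functions for the pairing with the elements of `H^r`. -/
theorem exists_test {r : ℝ} {ρ : Plane → ℝ} (hρ : Measurable ρ) {B : Set Plane}
    (hB : MeasurableSet B) (hB' : volume B ≠ ∞) {M : ℝ} (hM : 0 ≤ M)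
    (h : ∀ ξ, |ρ ξ| * bracketPow (-r) ξ ≤ B.indicator (fun _ => M) ξ) :
    ∃ χ : Lp ℂ 2 (volume : Measure Plane), ‖χ‖ ≤ M * √(volume.real B) ∧
      ∀ {k : ℕ} (hr : r ≤ k) (t : ℝ) (a : Option (Fin 3)) (i j : Fin n) (U : FieldW n),
        fieldPairing hr χ t a i j U = ∫ ξ, (ρ ξ : ℂ) * hat k (U a none i j) t ξ := by
  have hb : ∀ ξ, ‖((ρ ξ * bracketPow (-r) ξ : ℝ) : ℂ)‖ ≤ B.indicator (fun _ => M) ξ := fun ξ => by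
    rw [Complex.norm_real, norm_mul, Real.norm_of_nonneg (bracketPow_pos _ ξ).le]
    exact h ξ
  have hm : MemLp (fun ξ => ((ρ ξ * bracketPow (-r) ξ : ℝ) : ℂ)) 2 (volume : Measure Plane) := by
    refine MemLp.mono' (memLp_indicator_const 2 hB M (Or.inr hB')) ?_
      (Filter.Eventually.of_forall hb)
    have := (continuous_bracketPow (-r)).measurable
    exact (Complex.measurable_ofReal.comp (hρ.mul this)).aestronglyMeasurable
  refine ⟨hm.toLp _, norm_toLp_le_of_indicator hm hB hB' hM hb, fun {k} hr t a i j U => ?_⟩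
  rw [fieldPairing_apply, fourierPairing_sobolevAt]
  refine integral_congr_ae ?_
  filter_upwards [hm.coeFn_toLp] with ξ e
  have e1 : (bracketPow (-r) ξ : ℂ) * bracketPow r ξ = 1 := by
    exact_mod_cast bracketPow_neg_mul r ξ
  rw [e, Complex.conj_ofReal]
  push_cast
  linear_combination (ρ ξ : ℂ) * hat k (U a none i j) t ξ * e1

theorem norm_sobolevAt_le {k : ℕ} {r : ℝ} (hr : r ≤ k) (t : ℝ) (g : WSpace) {B : Set Plane}
    (hB : MeasurableSet B) (hB' : volume B ≠ ∞) {M : ℝ} (hM : 0 ≤ M)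
    (h : ∀ ξ, bracketPow r ξ * ‖hat k g t ξ‖ ≤ B.indicator (fun _ => M) ξ) :
    ‖sobolevAt hr t g‖ ≤ M * √(volume.real B) := by
  rw [sobolevAt_apply, Sobolev.norm_ofFourier]
  refine norm_toLp_le_of_indicator _ hB hB' hM fun ξ => ?_
  rw [norm_mul, Complex.norm_real, Real.norm_of_nonneg (bracketPow_pos r ξ).le]
  exact h ξ

/-- The norms of products are maxima, so each entry may be estimated separately and on its own
frequency set. -/
theorem InitData.norm_state_le {𝔪 : Submodule ℝ (Mat n)} {s σ : ℝ} {k : ℕ} {T : ℝ}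
    (D : InitData n) (h𝔪 : su n ≤ 𝔪) (hs : s ≤ k) (hσ : σ ≤ k) (hT : 0 ≤ T) (m : ℝ) {L : ℝ}
    (hL : 0 ≤ L)
    (h₁ : ∀ i j, ∃ (B : Set Plane) (M : ℝ), MeasurableSet B ∧ volume B ≠ ∞ ∧ 0 ≤ M ∧
      M * √(volume.real B) ≤ L ∧
      ∀ ξ, bracketPow s ξ * ‖D.pos none i j ξ‖ ≤ B.indicator (fun _ => M) ξ)
    (h₂ : ∀ μ i j, ∃ (B : Set Plane) (M : ℝ), MeasurableSet B ∧ volume B ≠ ∞ ∧ 0 ≤ M ∧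
      M * √(volume.real B) ≤ L ∧
      ∀ ξ, bracketPow σ ξ * ‖D.pos (some μ) i j ξ‖ ≤ B.indicator (fun _ => M) ξ) :
    ‖D.state h𝔪 hs hσ T m‖ ≤ L := by
  refine max_le ?_ ?_
  · refine (pi_norm_le_iff_of_nonneg hL).2 fun i => (pi_norm_le_iff_of_nonneg hL).2 fun j => ?_
    obtain ⟨B, M, hB, hB', hM, hML, hb⟩ := h₁ i j
    exact (norm_sobolevAt_le hs 0 _ hB hB' hM fun ξ => by
      rw [D.hat_lin_zero hT]; exact hb ξ).trans hML
  · refine (pi_norm_le_iff_of_nonneg hL).2 fun μ => ?_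
    refine (pi_norm_le_iff_of_nonneg hL).2 fun i => (pi_norm_le_iff_of_nonneg hL).2 fun j => ?_
    obtain ⟨B, M, hB, hB', hM, hML, hb⟩ := h₂ μ i j
    exact (norm_sobolevAt_le hσ 0 _ hB hB' hM fun ξ => by
      rw [D.hat_lin_zero hT]; exact hb ξ).trans hML

/-! ### Boxes and bumps -/

/-- The box with center `(x, y)` and half-widths `w`, `h`. -/
def boxAt (x y w h : ℝ) : Set Plane := {ξ | |ξ 0 - x| ≤ w ∧ |ξ 1 - y| ≤ h}

theorem boxAt_eq_preimage (x y w h : ℝ) : boxAt x y w h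
    = (MeasurableEquiv.toLp 2 (Fin 2 → ℝ)).symm ⁻¹' (Icc ![x - w, y - h] ![x + w, y + h]) := by
  ext ξ
  simp only [boxAt, mem_ofPred_eq, mem_preimage, mem_Icc, Pi.le_def, Fin.forall_fin_two, abs_le]
  simp
  constructor
  · rintro ⟨⟨h1, h2⟩, h3, h4⟩
    refine ⟨⟨?_, ?_⟩, ?_, ?_⟩ <;> linarith
  · rintro ⟨⟨h1, h2⟩, h3, h4⟩
    refine ⟨⟨?_, ?_⟩, ?_, ?_⟩ <;> linarith

theorem measurableSet_boxAt (x y w h : ℝ) : MeasurableSet (boxAt x y w h) := by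
  rw [boxAt_eq_preimage]
  exact (MeasurableEquiv.measurable _) measurableSet_Icc

theorem volume_boxAt (x y w h : ℝ) :
    volume (boxAt x y w h) = ENNReal.ofReal (2 * w) * ENNReal.ofReal (2 * h) := by
  rw [boxAt_eq_preimage,
    (EuclideanSpace.volume_preserving_symm_measurableEquiv_toLp (Fin 2)).measure_preimage
      measurableSet_Icc.nullMeasurableSet, Real.volume_Icc_pi]
  rw [Fin.prod_univ_two]
  congr 2 <;> (simp; ring)

theorem volume_boxAt_ne_top (x y w h : ℝ) : volume (boxAt x y w h) ≠ ∞ := by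
  rw [volume_boxAt]
  exact ENNReal.mul_ne_top ENNReal.ofReal_ne_top ENNReal.ofReal_ne_top

theorem volume_real_boxAt (x y : ℝ) {w h : ℝ} (hw : 0 ≤ w) (hh : 0 ≤ h) :
    volume.real (boxAt x y w h) = 4 * w * h := by
  rw [Measure.real, volume_boxAt, ENNReal.toReal_mul, ENNReal.toReal_ofReal (by positivity),
    ENNReal.toReal_ofReal (by positivity)]
  ring

/-- A trapezoidal profile, equal to `1` on `[-1/2, 1/2]` and supported in `[-1, 1]`. -/
def trap (x : ℝ) : ℝ := max 0 (min 1 (2 - 2 * |x|))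

@[fun_prop]
theorem continuous_trap : Continuous trap := by unfold trap; fun_prop

theorem trap_nonneg (x : ℝ) : 0 ≤ trap x := le_max_left _ _

theorem trap_le_one (x : ℝ) : trap x ≤ 1 := max_le zero_le_one (min_le_left _ _)

theorem trap_eq_one {x : ℝ} (h : |x| ≤ 1 / 2) : trap x = 1 := by
  unfold trap
  rw [min_eq_left (by linarith), max_eq_right zero_le_one]

theorem trap_eq_zero {x : ℝ} (h : 1 ≤ |x|) : trap x = 0 := by
  unfold trap
  rw [max_eq_left]
  exact (min_le_right _ _).trans (by linarith)

/-- A bump adapted to the box with center `(x, y)` and half-widths `w`, `h`. -/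
def bump (x y w h : ℝ) (ξ : Plane) : ℝ := trap ((ξ 0 - x) / w) * trap ((ξ 1 - y) / h)

@[fun_prop]
theorem continuous_bump (x y w h : ℝ) : Continuous (bump x y w h) := by
  unfold bump
  fun_prop

theorem bump_nonneg (x y w h : ℝ) (ξ : Plane) : 0 ≤ bump x y w h ξ :=
  mul_nonneg (trap_nonneg _) (trap_nonneg _)

theorem bump_le_one (x y w h : ℝ) (ξ : Plane) : bump x y w h ξ ≤ 1 :=
  mul_le_one₀ (trap_le_one _) (trap_nonneg _) (trap_le_one _)

theorem bump_eq_one {x y w h : ℝ} (hw : 0 < w) (hh : 0 < h) {ξ : Plane}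
    (hξ : ξ ∈ boxAt x y (w / 2) (h / 2)) : bump x y w h ξ = 1 := by
  have h1 : |(ξ 0 - x) / w| ≤ 1 / 2 := by
    rw [abs_div, abs_of_pos hw, div_le_iff₀ hw]
    linarith [hξ.1]
  have h2 : |(ξ 1 - y) / h| ≤ 1 / 2 := by
    rw [abs_div, abs_of_pos hh, div_le_iff₀ hh]
    linarith [hξ.2]
  rw [bump, trap_eq_one h1, trap_eq_one h2, one_mul]

theorem bump_eq_zero {x y w h : ℝ} (hw : 0 < w) (hh : 0 < h) {ξ : Plane}
    (hξ : ξ ∉ boxAt x y w h) : bump x y w h ξ = 0 := by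
  rw [boxAt, mem_ofPred_eq, not_and_or, not_le, not_le] at hξ
  rcases hξ with h1 | h1
  · rw [bump, trap_eq_zero, zero_mul]
    rw [abs_div, abs_of_pos hw, le_div_iff₀ hw]
    linarith
  · rw [bump, trap_eq_zero (x := (ξ 1 - y) / h), mul_zero]
    rw [abs_div, abs_of_pos hh, le_div_iff₀ hh]
    linarith

/-- An even function which is the sum of two bumps. -/
def evenBump (x y w h : ℝ) (ξ : Plane) : ℝ := bump x y w h ξ + bump x y w h (-ξ)

theorem evenBump_neg (x y w h : ℝ) (ξ : Plane) : evenBump x y w h (-ξ) = evenBump x y w h ξ := by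
  rw [evenBump, evenBump, neg_neg, add_comm]

@[fun_prop]
theorem continuous_evenBump (x y w h : ℝ) : Continuous (evenBump x y w h) := by
  unfold evenBump
  fun_prop

theorem evenBump_nonneg (x y w h : ℝ) (ξ : Plane) : 0 ≤ evenBump x y w h ξ :=
  add_nonneg (bump_nonneg _ _ _ _ _) (bump_nonneg _ _ _ _ _)

theorem evenBump_le_two (x y w h : ℝ) (ξ : Plane) : evenBump x y w h ξ ≤ 2 := by
  unfold evenBump
  linarith [bump_le_one x y w h ξ, bump_le_one x y w h (-ξ)]

theorem one_le_evenBump {x y w h : ℝ} (hw : 0 < w) (hh : 0 < h) {ξ : Plane}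
    (hξ : ξ ∈ boxAt x y (w / 2) (h / 2)) : 1 ≤ evenBump x y w h ξ := by
  rw [evenBump, bump_eq_one hw hh hξ]
  linarith [bump_nonneg x y w h (-ξ)]

theorem mem_or_mem_of_evenBump_ne_zero {x y w h : ℝ} (hw : 0 < w) (hh : 0 < h) {ξ : Plane}
    (hξ : evenBump x y w h ξ ≠ 0) : ξ ∈ boxAt x y w h ∨ -ξ ∈ boxAt x y w h := by
  by_contra! h1
  exact hξ (by rw [evenBump, bump_eq_zero hw hh h1.1, bump_eq_zero hw hh h1.2, add_zero])

theorem neg_mem_boxAt {x y w h : ℝ} {ξ : Plane} : -ξ ∈ boxAt x y w h ↔ ξ ∈ boxAt (-x) (-y) w h := by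
  have e : ∀ a b : ℝ, |(-a) - b| = |a - -b| := fun a b => by rw [← abs_neg]; congr 1; ring
  simp [boxAt, e]

/-- The union of a box and its reflection. -/
def evenBox (x y w h : ℝ) : Set Plane := boxAt x y w h ∪ boxAt (-x) (-y) w h

theorem measurableSet_evenBox (x y w h : ℝ) : MeasurableSet (evenBox x y w h) :=
  (measurableSet_boxAt _ _ _ _).union (measurableSet_boxAt _ _ _ _)

theorem volume_evenBox_ne_top (x y w h : ℝ) : volume (evenBox x y w h) ≠ ∞ :=
  measure_union_ne_top (volume_boxAt_ne_top _ _ _ _) (volume_boxAt_ne_top _ _ _ _)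

theorem volume_real_evenBox_le (x y : ℝ) {w h : ℝ} (hw : 0 ≤ w) (hh : 0 ≤ h) :
    volume.real (evenBox x y w h) ≤ 8 * w * h := by
  refine (measureReal_union_le _ _).trans_eq ?_
  rw [volume_real_boxAt _ _ hw hh, volume_real_boxAt _ _ hw hh]
  ring

theorem evenBump_le_indicator {x y w h : ℝ} (hw : 0 < w) (hh : 0 < h) (ξ : Plane) :
    evenBump x y w h ξ ≤ (evenBox x y w h).indicator (fun _ => 2) ξ := by
  by_cases h1 : ξ ∈ evenBox x y w h
  · rw [indicator_of_mem h1]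
    exact evenBump_le_two _ _ _ _ _
  · rw [indicator_of_notMem h1]
    refine le_of_eq ?_
    by_contra h2
    rcases mem_or_mem_of_evenBump_ne_zero hw hh h2 with h3 | h3
    · exact h1 (Or.inl h3)
    · exact h1 (Or.inr (neg_mem_boxAt.1 h3))

theorem abs_le_norm (ξ : Plane) (j : Fin 2) : |ξ j| ≤ ‖ξ‖ := abs_coord_le ξ j

theorem norm_le_add_abs (ξ : Plane) : ‖ξ‖ ≤ |ξ 0| + |ξ 1| := by
  rw [EuclideanSpace.norm_eq, Fin.sum_univ_two]
  refine Real.sqrt_le_iff.2 ⟨by positivity, ?_⟩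
  simp only [Real.norm_eq_abs]
  nlinarith [abs_nonneg (ξ 0), abs_nonneg (ξ 1)]

theorem isCompact_boxAt (x y w h : ℝ) : IsCompact (boxAt x y w h) := by
  refine Metric.isCompact_of_isClosed_isBounded ?_ ?_
  · have h0 : Continuous fun ξ : Plane => |ξ 0 - x| := by fun_prop
    have h1 : Continuous fun ξ : Plane => |ξ 1 - y| := by fun_prop
    exact (isClosed_le h0 continuous_const).inter (isClosed_le h1 continuous_const)
  · refine (Metric.isBounded_closedBall (x := (0 : Plane)) (r := |x| + w + (|y| + h))).subset ?_
    intro ξ hξ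
    rw [mem_closedBall_zero_iff]
    have h1 := hξ.1
    have h2 := hξ.2
    have h3 := abs_sub_abs_le_abs_sub (ξ 0) x
    have h4 := abs_sub_abs_le_abs_sub (ξ 1) y
    linarith [norm_le_add_abs ξ]

/-- An even bump as a compactly supported profile. -/
def bumpProfile (x y : ℝ) {w h : ℝ} (hw : 0 < w) (hh : 0 < h) : C_c(Plane, ℂ) where
  toFun ξ := evenBump x y w h ξ
  continuous_toFun := by fun_prop
  hasCompactSupport' := by
    refine HasCompactSupport.intro
      ((isCompact_boxAt x y w h).union (isCompact_boxAt (-x) (-y) w h)) fun ξ hξ => ?_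
    have h1 := evenBump_le_indicator (x := x) (y := y) hw hh ξ
    rw [indicator_of_notMem (show ξ ∉ evenBox x y w h from hξ)] at h1
    simp [le_antisymm h1 (evenBump_nonneg x y w h ξ)]

@[simp] theorem bumpProfile_apply (x y : ℝ) {w h : ℝ} (hw : 0 < w) (hh : 0 < h) (ξ : Plane) :
    bumpProfile x y hw hh ξ = evenBump x y w h ξ := rfl

end CSH

end

noncomputable section

namespace CSH

open FourierTransform
open scoped CompactlySupported

variable {n : ℕ}

/-! ### A copy of `𝔰𝔲(2)` in `𝔰𝔲(n)` -/

/-- Generators of a copy of `𝔰𝔲(2)` in `𝔰𝔲(n)`, supported on two indices. -/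
def gen (i₀ i₁ : Fin n) : Fin 3 → Mat n :=
  ![Matrix.single i₀ i₁ 1 - Matrix.single i₁ i₀ 1,
    Matrix.single i₀ i₁ Complex.I + Matrix.single i₁ i₀ Complex.I,
    Matrix.single i₀ i₀ Complex.I - Matrix.single i₁ i₁ Complex.I]

theorem gen_conjTranspose (i₀ i₁ : Fin n) (p : Fin 3) :
    (gen i₀ i₁ p)ᴴ = -gen i₀ i₁ p := by
  have hn : ∀ (i j : Fin n) (c : ℂ), Matrix.single i j (-c) = -Matrix.single i j c :=
    fun i j c => (Matrix.single_neg _ _ _).symm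
  fin_cases p
  · simp [gen, Matrix.conjTranspose_single]
  · simp [gen, Matrix.conjTranspose_single, hn, add_comm]
  · simp [gen, Matrix.conjTranspose_single, hn]
    abel

theorem gen_trace {i₀ i₁ : Fin n} (p : Fin 3) (h : i₀ ≠ i₁) : (gen i₀ i₁ p).trace = 0 := by
  fin_cases p
  · simp [gen, h, h.symm]
  · simp [gen, h, h.symm]
  · simp [gen]

/-- The indices are taken modulo `3`; these cyclic relations make the commutator twice the vector
product in the basis `E₀, E₁, E₂`. -/
theorem gen_lie {i₀ i₁ : Fin n} (h : i₀ ≠ i₁) (p : Fin 3) :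
    ⁅gen i₀ i₁ p, gen i₀ i₁ (p + 1)⁆ = (2 : ℂ) • gen i₀ i₁ (p + 2) := by
  have e : ∀ (i j : Fin n) (c : ℂ), (2 : ℂ) • Matrix.single i j c = Matrix.single i j (c + c) :=
    fun i j c => by rw [Matrix.smul_single, smul_eq_mul, two_mul]
  have ea : ∀ (i j : Fin n) (c : ℂ), Matrix.single i j (c + c)
      = Matrix.single i j c + Matrix.single i j c := fun i j c => Matrix.single_add _ _ _ _
  have hn : ∀ (i j : Fin n) (c : ℂ), Matrix.single i j (-c) = -Matrix.single i j c :=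
    fun i j c => (Matrix.single_neg _ _ _).symm
  fin_cases p
  · simp [gen, Ring.lie_def, mul_add, mul_sub, add_mul, sub_mul, h, h.symm, e, ea, smul_sub]
    abel
  · simp [gen, Ring.lie_def, mul_add, mul_sub, add_mul, sub_mul, h, h.symm, e, ea, smul_sub,
      hn]
    abel
  · simp [gen, Ring.lie_def, mul_add, mul_sub, add_mul, sub_mul, h, h.symm, e, ea, smul_add,
      hn]
    abel

/-- The matrix `∑ₚ xₚ Eₚ`. -/
def emb (i₀ i₁ : Fin n) (x : Fin 3 → WSpace) : MatW n := fun i j => ∑ p, gen i₀ i₁ p i j • x p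

/-- The matrix of profiles `∑ₚ bₚ Eₚ`. -/
def embC (i₀ i₁ : Fin n) (b : Fin 3 → C_c(Plane, ℂ)) : MatC n :=
  fun i j => ∑ p, gen i₀ i₁ p i j • b p

/-- The vector product for the multiplication of space-time functions. -/
def crossW (k : ℕ) (x y : Fin 3 → WSpace) : Fin 3 → WSpace := fun p =>
  (2 : ℂ) • (cmul k (x (p + 1)) (y (p + 2)) - cmul k (x (p + 2)) (y (p + 1)))

/-- The vector product for the convolution of profiles. -/
def crossC (b c : Fin 3 → C_c(Plane, ℂ)) : Fin 3 → C_c(Plane, ℂ) := fun p =>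
  (2 : ℂ) • (pconv (b (p + 1)) (c (p + 2)) - pconv (b (p + 2)) (c (p + 1)))

/-- The bilinear extension of the cyclic relations. The coefficients lie in an arbitrary module
because it serves both for `cmul` and for `pconv`. -/
theorem sum_gen_lie {i₀ i₁ : Fin n} (h : i₀ ≠ i₁) (i j : Fin n) {V : Type*} [AddCommGroup V]
    [Module ℂ V] (z : Fin 3 → Fin 3 → V) :
    ∑ p, ∑ q, (⁅gen i₀ i₁ p, gen i₀ i₁ q⁆ : Mat n) i j • z p q
      = ∑ p, gen i₀ i₁ p i j • ((2 : ℂ) • (z (p + 1) (p + 2) - z (p + 2) (p + 1))) := by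
  have h0 := gen_lie h 0
  have h1 := gen_lie h 1
  have h2 := gen_lie h 2
  have hs : ∀ p, (⁅gen i₀ i₁ p, gen i₀ i₁ p⁆ : Mat n) = 0 := fun p => mat_lie_self _
  simp only [Fin.sum_univ_three, hs, Matrix.zero_apply, zero_smul]
  change ⁅gen i₀ i₁ 0, gen i₀ i₁ 1⁆ = (2 : ℂ) • gen i₀ i₁ 2 at h0
  change ⁅gen i₀ i₁ 1, gen i₀ i₁ 2⁆ = (2 : ℂ) • gen i₀ i₁ 0 at h1
  change ⁅gen i₀ i₁ 2, gen i₀ i₁ 0⁆ = (2 : ℂ) • gen i₀ i₁ 1 at h2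
  rw [mat_lie_swap (gen i₀ i₁ 1) (gen i₀ i₁ 0), mat_lie_swap (gen i₀ i₁ 2) (gen i₀ i₁ 1),
    mat_lie_swap (gen i₀ i₁ 0) (gen i₀ i₁ 2), h0, h1, h2]
  simp only [Matrix.smul_apply, Matrix.neg_apply, smul_eq_mul]
  change _ = gen i₀ i₁ 0 i j • ((2 : ℂ) • (z 1 2 - z 2 1)) +
    gen i₀ i₁ 1 i j • ((2 : ℂ) • (z 2 0 - z 0 2)) + gen i₀ i₁ 2 i j • ((2 : ℂ) • (z 0 1 - z 1 0))
  module

theorem lieW_emb {i₀ i₁ : Fin n} (h : i₀ ≠ i₁) (k : ℕ) (x y : Fin 3 → WSpace) :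
    lieW n k (emb i₀ i₁ x) (emb i₀ i₁ y) = emb i₀ i₁ (crossW k x y) := by
  funext i j
  rw [emb]
  unfold crossW
  rw [← sum_gen_lie h i j fun p q => cmul k (x p) (y q), lieW_apply]
  have e1 : ∀ l, cmul k (emb i₀ i₁ x i l) (emb i₀ i₁ y l j)
      = ∑ p, ∑ q, (gen i₀ i₁ p i l * gen i₀ i₁ q l j) • cmul k (x p) (y q) := fun l => by
    simp only [emb, map_sum, map_smul, sum_apply, smul_apply, Finset.smul_sum, smul_smul]
    rw [Finset.sum_comm]
    exact Finset.sum_congr rfl fun p _ => Finset.sum_congr rfl fun q _ => by rw [mul_comm]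
  have e2 : ∀ l, cmul k (emb i₀ i₁ y i l) (emb i₀ i₁ x l j)
      = ∑ p, ∑ q, (gen i₀ i₁ q i l * gen i₀ i₁ p l j) • cmul k (x p) (y q) := fun l => by
    simp only [emb, map_sum, map_smul, sum_apply, smul_apply, Finset.smul_sum, smul_smul]
    exact Finset.sum_congr rfl fun p _ => Finset.sum_congr rfl fun q _ => by
      rw [mul_comm, cmul_comm]
  simp only [e1, e2, ← Finset.sum_sub_distrib, ← sub_smul]
  rw [Finset.sum_comm]
  refine Finset.sum_congr rfl fun p _ => ?_
  rw [Finset.sum_comm]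
  refine Finset.sum_congr rfl fun q _ => ?_
  rw [← Finset.sum_smul, Ring.lie_def, Matrix.sub_apply, Matrix.mul_apply, Matrix.mul_apply,
    Finset.sum_sub_distrib]

theorem pconv_add_left (b b' c : C_c(Plane, ℂ)) : pconv (b + b') c = pconv b c + pconv b' c := by
  ext ξ
  have hi : ∀ b : C_c(Plane, ℂ), Integrable fun η => b η * c (ξ - η) := fun b => by
    have h1 := b.continuous
    have h2 := c.continuous
    exact Continuous.integrable_of_hasCompactSupport (by fun_prop) b.hasCompactSupport.mul_right
  simp only [pconv_apply, CompactlySupportedContinuousMap.add_apply, add_mul]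
  exact integral_add (hi b) (hi b')

theorem pconv_smul_left (z : ℂ) (b c : C_c(Plane, ℂ)) : pconv (z • b) c = z • pconv b c := by
  ext ξ
  simp only [pconv_apply, CompactlySupportedContinuousMap.smul_apply, smul_eq_mul, mul_assoc]
  exact integral_const_mul _ _

theorem pconv_sum_smul_left {ι : Type*} (s : Finset ι) (z : ι → ℂ) (b : ι → C_c(Plane, ℂ))
    (c : C_c(Plane, ℂ)) : pconv (∑ p ∈ s, z p • b p) c = ∑ p ∈ s, z p • pconv (b p) c := by
  induction s using Finset.cons_induction with
  | empty => simpa using pconv_smul_left 0 0 c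
  | cons a s ha ih => rw [Finset.sum_cons, Finset.sum_cons, pconv_add_left, pconv_smul_left, ih]

theorem pconv_sum_smul {ι ι' : Type*} (s : Finset ι) (s' : Finset ι') (z : ι → ℂ) (z' : ι' → ℂ)
    (b : ι → C_c(Plane, ℂ)) (c : ι' → C_c(Plane, ℂ)) :
    pconv (∑ p ∈ s, z p • b p) (∑ q ∈ s', z' q • c q)
      = ∑ p ∈ s, ∑ q ∈ s', (z p * z' q) • pconv (b p) (c q) := by
  rw [pconv_sum_smul_left]
  refine Finset.sum_congr rfl fun p _ => ?_
  rw [pconv_comm, pconv_sum_smul_left, Finset.smul_sum]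
  exact Finset.sum_congr rfl fun q _ => by rw [pconv_comm, smul_smul]

theorem lieC_embC {i₀ i₁ : Fin n} (h : i₀ ≠ i₁) (b c : Fin 3 → C_c(Plane, ℂ)) :
    lieC (embC i₀ i₁ b) (embC i₀ i₁ c) = embC i₀ i₁ (crossC b c) := by
  funext i j
  rw [embC]
  unfold crossC
  rw [← sum_gen_lie h i j fun p q => pconv (b p) (c q), lieC]
  have e1 : ∀ l, pconv (embC i₀ i₁ b i l) (embC i₀ i₁ c l j)
      = ∑ p, ∑ q, (gen i₀ i₁ p i l * gen i₀ i₁ q l j) • pconv (b p) (c q) := fun l =>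
    pconv_sum_smul _ _ _ _ _ _
  have e2 : ∀ l, pconv (embC i₀ i₁ c i l) (embC i₀ i₁ b l j)
      = ∑ p, ∑ q, (gen i₀ i₁ q i l * gen i₀ i₁ p l j) • pconv (b p) (c q) := fun l => by
    rw [embC, embC, pconv_sum_smul, Finset.sum_comm]
    exact Finset.sum_congr rfl fun p _ => Finset.sum_congr rfl fun q _ => by rw [pconv_comm]
  simp only [e1, e2, ← Finset.sum_sub_distrib]
  rw [Finset.sum_comm]
  refine Finset.sum_congr rfl fun p _ => ?_
  rw [Finset.sum_comm]
  refine Finset.sum_congr rfl fun q _ => ?_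
  ext ξ
  simp only [CompactlySupportedContinuousMap.sum_apply, CompactlySupportedContinuousMap.sub_apply,
    CompactlySupportedContinuousMap.smul_apply, smul_eq_mul, ← sub_mul]
  rw [← Finset.sum_mul, Ring.lie_def, Matrix.sub_apply, Matrix.mul_apply, Matrix.mul_apply,
    Finset.sum_sub_distrib]

theorem isSkew_embC {i₀ i₁ : Fin n} (h : i₀ ≠ i₁) {b : Fin 3 → C_c(Plane, ℂ)}
    (hb : ∀ p ξ, b p (-ξ) = starRingEnd ℂ (b p ξ)) : IsSkew (embC i₀ i₁ b) := by
  refine ⟨fun i j ξ => ?_, fun ξ => ?_⟩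
  · simp only [embC, CompactlySupportedContinuousMap.sum_apply,
      CompactlySupportedContinuousMap.smul_apply, smul_eq_mul, map_sum, map_mul, hb]
    rw [← Finset.sum_neg_distrib]
    refine Finset.sum_congr rfl fun p _ => ?_
    have h1 : starRingEnd ℂ (gen i₀ i₁ p i j) = -gen i₀ i₁ p j i :=
      congrFun (congrFun (gen_conjTranspose i₀ i₁ p) j) i
    rw [h1]
    ring
  · simp only [embC, CompactlySupportedContinuousMap.sum_apply,
      CompactlySupportedContinuousMap.smul_apply, smul_eq_mul]
    rw [Finset.sum_comm]
    refine Finset.sum_eq_zero fun p _ => ?_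
    rw [← Finset.sum_mul, show ∑ i, gen i₀ i₁ p i i = 0 from gen_trace p h, zero_mul]

theorem emb_add (i₀ i₁ : Fin n) (x y : Fin 3 → WSpace) :
    emb i₀ i₁ (x + y) = emb i₀ i₁ x + emb i₀ i₁ y := by
  funext i j
  simp [emb, Finset.sum_add_distrib]

theorem emb_smul (i₀ i₁ : Fin n) (c : ℝ) (x : Fin 3 → WSpace) :
    emb i₀ i₁ (c • x) = c • emb i₀ i₁ x := by
  funext i j
  simp [emb, Finset.smul_sum, smul_comm c]

theorem emb_zero (i₀ i₁ : Fin n) : emb i₀ i₁ 0 = 0 := by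
  simpa using emb_smul i₀ i₁ 0 0

theorem emb_sum (i₀ i₁ : Fin n) {ι : Type*} (s : Finset ι) (x : ι → Fin 3 → WSpace) :
    emb i₀ i₁ (∑ a ∈ s, x a) = ∑ a ∈ s, emb i₀ i₁ (x a) := by
  induction s using Finset.cons_induction with
  | empty => simp [emb_zero]
  | cons a s ha ih => rw [Finset.sum_cons, Finset.sum_cons, emb_add, ih]

/-- `E₂` is the only generator with diagonal entries, so the component along it can be read off. -/
theorem emb_diag {i₀ i₁ : Fin n} (h : i₀ ≠ i₁) (x : Fin 3 → WSpace) :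
    emb i₀ i₁ x i₀ i₀ = Complex.I • x 2 := by
  simp [emb, gen, Fin.sum_univ_three, h, h.symm]

/-- `E₁` is symmetric and cancels in the difference, while `E₀` is antisymmetric and counts twice.
-/
theorem emb_offDiag {i₀ i₁ : Fin n} (h : i₀ ≠ i₁) (x : Fin 3 → WSpace) :
    emb i₀ i₁ x i₀ i₁ - emb i₀ i₁ x i₁ i₀ = (2 : ℂ) • x 0 := by
  simp [emb, gen, Fin.sum_univ_three, h, h.symm]
  module

theorem norm_gen_le_one {i₀ i₁ : Fin n} (h : i₀ ≠ i₁) (p : Fin 3) (i j : Fin n) :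
    ‖gen i₀ i₁ p i j‖ ≤ 1 := by
  fin_cases p <;> simp only [gen, Matrix.sub_apply, Matrix.add_apply, Matrix.single_apply]
  all_goals
    by_cases h1 : i₀ = i <;> by_cases h2 : i₁ = j <;> by_cases h3 : i₁ = i <;>
    by_cases h4 : i₀ = j <;> subst_vars <;> simp_all

theorem free_emb {i₀ i₁ : Fin n} (k : ℕ) (T m : ℝ) (d : Option (Fin 3))
    (b c : Fin 3 → C_c(Plane, ℂ)) (i j : Fin n) :
    free k T m d (embC i₀ i₁ b i j) (embC i₀ i₁ c i j)
      = emb i₀ i₁ (fun p => free k T m d (b p) (c p)) i j := by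
  refine ext_hat k fun t ξ => ?_
  simp only [emb, hat_sum, hat_csmul, hat_free, embC, CompactlySupportedContinuousMap.sum_apply,
      CompactlySupportedContinuousMap.smul_apply, smul_eq_mul, Finset.mul_sum]
  rw [← Finset.sum_add_distrib]
  exact Finset.sum_congr rfl fun p _ => by ring

theorem solve_emb {i₀ i₁ : Fin n} (k : ℕ) {T m : ℝ} (hT : 0 ≤ T) (hm : 0 ≤ m)
    {S : Option (Fin 3) → MatW n} {a : Option (Fin 3)} {x : Fin 3 → WSpace}
    (h : S a = emb i₀ i₁ x) (d : Option (Fin 3)) : solve k hT hm S a d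
      = emb i₀ i₁ fun p => duhamel k hT (velPropagator (fieldMass_nonneg hm a) d) (x p) := by
  funext i j
  simp only [solve, h, emb, map_sum, map_smul]

end CSH

end

noncomputable section

namespace CSH

open FourierTransform
open scoped CompactlySupported

variable {n : ℕ}

/-! ### Data for which the null form structure is lost -/

/-- The vector product of two vectors in the plane. -/
def cross (η ζ : Plane) : ℝ := η 0 * ζ 1 - η 1 * ζ 0

@[fun_prop]
theorem continuous_cross {X : Type*} [TopologicalSpace X] {a b : X → Plane}
    (ha : Continuous a) (hb : Continuous b) : Continuous fun x => cross (a x) (b x) := by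
  unfold cross
  have h0 : ∀ j : Fin 2, Continuous fun x => a x j := fun j => by fun_prop
  have h1 : ∀ j : Fin 2, Continuous fun x => b x j := fun j => by fun_prop
  fun_prop

/-- The Fourier transform of the rotated gradient. -/
def curl (g : C_c(Plane, ℂ)) : Fin 2 → C_c(Plane, ℂ) := ![dmul 1 g, -dmul 0 g]

theorem curl_neg {g : C_c(Plane, ℂ)} (hg : ∀ ξ, g (-ξ) = starRingEnd ℂ (g ξ)) (j : Fin 2)
    (ξ : Plane) : curl g j (-ξ) = starRingEnd ℂ (curl g j ξ) := by
  fin_cases j <;> simp [curl, dsym_neg, hg]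

/-- The profiles of the gauge field `A₀ = c E₀`, `A_j = ε_{jk} ∂_k g E₁`. -/
def gaugeProfile (c g : C_c(Plane, ℂ)) (μ : Fin 3) : Fin 3 → C_c(Plane, ℂ) :=
  Fin.cases ![c, 0, 0] (fun j => ![0, curl g j, 0]) μ

/-- The initial data `φ = 0`, `A₀ = c E₀`, `A_j = ε_{jk} ∂_k g E₁`. -/
def gaugeData {i₀ i₁ : Fin n} (h : i₀ ≠ i₁) {c g : C_c(Plane, ℂ)}
    (hc : ∀ ξ, c (-ξ) = starRingEnd ℂ (c ξ)) (hg : ∀ ξ, g (-ξ) = starRingEnd ℂ (g ξ)) :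
    InitData n where
  pos a := a.elim 0 fun μ => embC i₀ i₁ (gaugeProfile c g μ)
  isSkew a := by
    rcases a with _ | μ
    · exact IsSkew.zero
    · refine isSkew_embC h fun p ξ => ?_
      refine Fin.cases ?_ (fun j => ?_) μ
      · fin_cases p <;> simp [gaugeProfile, hc]
      · fin_cases p <;> simp [gaugeProfile, curl_neg hg]

section gauge

variable {i₀ i₁ : Fin n} (h : i₀ ≠ i₁) {c g : C_c(Plane, ℂ)}
  (hc : ∀ ξ, c (-ξ) = starRingEnd ℂ (c ξ)) (hg : ∀ ξ, g (-ξ) = starRingEnd ℂ (g ξ))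

/-- The velocity is the divergence of `(A₁, A₂)`, and a rotated gradient is divergence free. -/
theorem gaugeData_vel_zero : (gaugeData h hc hg).vel (some 0) = embC i₀ i₁ 0 := by
  funext i l
  ext ξ
  simp [InitData.vel, gaugeData, gaugeProfile, embC, Fin.sum_univ_three, curl]
  ring

theorem gaugeData_vel_succ (j : Fin 2) :
    (gaugeData h hc hg).vel (some j.succ) = embC i₀ i₁ ![dmul j c, 0, 0] := by
  funext i l
  ext ξ
  simp [InitData.vel, gaugeData, gaugeProfile, embC, Fin.sum_univ_three]
  ring

theorem gaugeData_lin_none (k : ℕ) (T m : ℝ) (d : Option (Fin 3)) :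
    (gaugeData h hc hg).lin k T m none d = 0 := by
  funext i j
  exact free_zero k T m d

theorem gaugeData_lin_zero (k : ℕ) (T m : ℝ) (d : Option (Fin 3)) :
    (gaugeData h hc hg).lin k T m (some 0) d = emb i₀ i₁ ![free k T 0 d c 0, 0, 0] := by
  funext i j
  rw [InitData.lin, freeField, gaugeData_vel_zero]
  refine (free_emb k T 0 d ![c, 0, 0] 0 i j).trans ?_
  congr 1
  funext p
  fin_cases p <;> simp [free_zero]

theorem gaugeData_lin_succ (k : ℕ) (T m : ℝ) (d : Option (Fin 3)) (j : Fin 2) :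
    (gaugeData h hc hg).lin k T m (some j.succ) d
      = emb i₀ i₁ ![free k T 0 d 0 (dmul j c), free k T 0 d (curl g j) 0, 0] := by
  funext i l
  rw [InitData.lin, freeField, gaugeData_vel_succ]
  refine (free_emb k T 0 d ![0, curl g j, 0] ![dmul j c, 0, 0] i l).trans ?_
  congr 1
  funext p
  fin_cases p <;> simp [free_zero]

/-- To first order `A₀` points along `E₀`. In `[∂^ν A₀, A_ν]` the term `ν = 0` and the `E₀` parts of
`A_j` therefore commute away, and what is left is the null form of `c` and `g` along `E₂`. The
quadratic velocity of `A₀` vanishes, so there is no further contribution. -/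
theorem gaugeData_second (k : ℕ) {T m : ℝ} (hT : 0 ≤ T) (hm : 0 ≤ m) :
    (gaugeData h hc hg).second k hT hm (some 0) none i₀ i₀
      = Complex.I • duhamel k hT (velPropagator le_rfl none)
        ((-2 : ℂ) • ∑ j : Fin 2, cmul k (free k T 0 (some j.succ) c 0) (free k T 0 none (curl g j) 0)) := by
  have hq : quad k ((gaugeData h hc hg).lin k T m) ((gaugeData h hc hg).lin k T m) (some 0)
      = emb i₀ i₁ (∑ ν, eta ν • crossW k ![free k T 0 (some ν) c 0, 0, 0]
        (Fin.cases ![free k T 0 none c 0, 0, 0]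
          (fun j => ![free k T 0 none 0 (dmul j c), free k T 0 none (curl g j) 0, 0]) ν)) := by
    rw [emb_sum]
    simp only [quad, gaugeData_lin_none, map_zero, zero_apply, smul_zero, Finset.sum_const_zero,
      add_zero]
    refine Finset.sum_congr rfl fun ν _ => ?_
    rw [emb_smul, ← lieW_emb h, gaugeData_lin_zero]
    refine Fin.cases ?_ (fun j => ?_) ν
    · rw [gaugeData_lin_zero]
      rfl
    · rw [gaugeData_lin_succ]
      rfl
  have hl : (gaugeData h hc hg).linQuad k T m (some 0) none i₀ i₀ = 0 := free_zero k T 0 none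
  rw [InitData.second, Pi.add_apply, Pi.add_apply, Pi.add_apply, Pi.add_apply, hl, zero_add,
    quadMap, solve_emb k hT hm hq none, emb_diag h]
  congr 2
  have hsucc : ∀ j : Fin 2, eta j.succ = -1 := fun j => by simp [eta, Fin.succ_ne_zero]
  rw [Finset.sum_apply, Fin.sum_univ_succ]
  simp only [Pi.smul_apply, crossW, hsucc, Fin.cases_succ, Fin.cases_zero]
  change eta 0 • ((2 : ℂ) • (cmul k (free k T 0 (some 0) c 0) 0 - cmul k 0 (free k T 0 none c 0)))
    + ∑ j : Fin 2, (-1 : ℝ) • ((2 : ℂ) • (cmul k (free k T 0 (some j.succ) c 0)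
      (free k T 0 none (curl g j) 0) - cmul k 0 (free k T 0 none 0 (dmul j c)))) = _
  simp only [map_zero, zero_apply, sub_zero, smul_zero, zero_add, Finset.smul_sum]
  refine Finset.sum_congr rfl fun j _ => ?_
  rw [neg_one_smul, neg_smul]

/-- The contraction of `∂_j c` with the rotated gradient of `g` has symbol `(2πi)²` times a vector
product; with the factor `-2` this is `8π² cross η (ξ - η)`. -/
theorem hat_gaugeData_second (k : ℕ) {T m : ℝ} (hT : 0 ≤ T) (hm : 0 ≤ m) {t : ℝ}
    (ht : t ∈ Icc 0 T) (ξ : Plane) :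
    hat k ((gaugeData h hc hg).second k hT hm (some 0) none i₀ i₀) t ξ
      = Complex.I * ∫ s in (0 : ℝ)..t, (sinProp 0 (t - s) ξ : ℂ) *
        ∫ η, ((8 * Real.pi ^ 2 * cross η (ξ - η) * cosProp 0 s η * cosProp 0 s (ξ - η) : ℝ) : ℂ)
          * (c η * g (ξ - η)) := by
  have hct : clip T t = t := clip_of_mem ⟨by linarith [ht.1], ht.2⟩
  rw [gaugeData_second, hat_csmul, hat_duhamel, hct]
  congr 1
  refine intervalIntegral.integral_congr fun s hs => ?_
  rw [uIcc_of_le ht.1] at hs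
  have hcs : clip T s = s := clip_of_mem ⟨by linarith [hs.1, ht.1], hs.2.trans ht.2⟩
  change (sinProp 0 (t - s) ξ : ℂ) * _ = _
  congr 1
  rw [hat_csmul, hat_sum]
  simp only [hat_cmul]
  rw [← integral_finsetSum _ fun j _ => integrable_hat_mul_hat k _ _ s ξ, ← integral_const_mul]
  congr 1
  funext η
  rw [Fin.sum_univ_two]
  simp only [hat_free, hcs, posSym_succ, posSym_none]
  simp only [curl, cross, dsym, Matrix.cons_val_zero, Matrix.cons_val_one, dmul_apply,
    CompactlySupportedContinuousMap.neg_apply]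
  push_cast
  simp
  linear_combination (-8 * Real.pi ^ 2 * (η 0 * (ξ 1 - η 1) - η 1 * (ξ 0 - η 0))
    * cosProp 0 s η * cosProp 0 s (ξ - η) * (c η * g (ξ - η))) * Complex.I_sq

end gauge

end CSH

end

noncomputable section

namespace CSH

open FourierTransform
open scoped CompactlySupported

variable {n : ℕ}

/-! ### The lower bound for the second order term -/

theorem integral_swap_of_bound {μ : Measure Plane} [SFinite μ] {F : ℝ → Plane → ℝ}
    (hF : Continuous fun z : ℝ × Plane => F z.1 z.2) {w : Plane → ℝ} (hw : Integrable w μ)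
    {a b : ℝ} (hb : ∀ s ∈ uIoc a b, ∀ η, |F s η| ≤ w η) :
    ∫ s in a..b, ∫ η, F s η ∂μ = ∫ η, (∫ s in a..b, F s η) ∂μ := by
  refine intervalIntegral_integral_swap ?_
  have h1 : Integrable (fun _ : ℝ => (1 : ℝ)) (volume.restrict (uIoc a b)) := by
    rw [integrable_const_iff]
    right
    exact ⟨by simp [uIoc]⟩
  refine (h1.mul_prod hw).mono' hF.aestronglyMeasurable ?_
  have h2 : ∀ᵐ z ∂((volume.restrict (uIoc a b)).prod μ), z.1 ∈ uIoc a b :=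
    Measure.quasiMeasurePreserving_fst.ae (ae_restrict_mem measurableSet_uIoc)
  filter_upwards [h2] with z hz
  rw [one_mul]
  exact hb z.1 hz z.2

theorem abs_integral_sin_le {b β : ℝ} (hb : 0 < b) (h : b ≤ β) (α t : ℝ) :
    |∫ s in (0 : ℝ)..t, Real.sin (α - s * β)| ≤ 2 / b := by
  have hβ : 0 < β := hb.trans_le h
  have h1 : ∀ s ∈ uIcc 0 t, HasDerivAt (fun s => Real.cos (α - s * β) / β)
      (Real.sin (α - s * β)) s := fun s _ => by
    have := ((((hasDerivAt_id s).mul_const β).const_sub α).cos).div_const β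
    refine this.congr_deriv ?_
    simp only [id]
    field_simp
  rw [intervalIntegral.integral_eq_sub_of_hasDerivAt h1
    (Continuous.intervalIntegrable (by fun_prop) _ _), ← sub_div, abs_div, abs_of_pos hβ]
  refine div_le_div₀ (by norm_num) ?_ hb h
  refine (abs_sub _ _).trans ?_
  linarith [Real.abs_cos_le_one (α - t * β), Real.abs_cos_le_one (α - 0 * β)]

theorem sin_mul_cos_mul_cos (x y z : ℝ) : Real.sin x * (Real.cos y * Real.cos z)
    = (Real.sin (x + y + z) + Real.sin (x - y + z) + Real.sin (x + y - z)
      + Real.sin (x - y - z)) / 4 := by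
  simp only [Real.sin_add, Real.sin_sub, Real.cos_add, Real.cos_sub]
  ring

/-- The resonant part of the time integral. -/
theorem abs_resonance_sub_le {p q r b t : ℝ} (hb : 0 < b) (h1 : b ≤ p + q + r)
    (h2 : b ≤ p - q + r) (h3 : b ≤ p + q - r) (ht : 0 ≤ t) (ht1 : t ≤ 1) :
    |(∫ s in (0 : ℝ)..t, Real.sin ((t - s) * p) * (Real.cos (s * q) * Real.cos (s * r)))
      - t / 4 * Real.sin (t * p)| ≤ (|q + r - p| + 6 / b) / 4 := by
  -- Product to sum formula. Among the four phases only the one with frequency `q + r - p` may be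
  -- stationary; the other three have frequency at least `b` and contribute at most `2 / b` each.
  have e : ∀ s, Real.sin ((t - s) * p) * (Real.cos (s * q) * Real.cos (s * r))
      = ((Real.sin (t * p + s * (q + r - p)) + Real.sin (t * p - s * (p + q - r)))
        + Real.sin (t * p - s * (p - q + r)) + Real.sin (t * p - s * (p + q + r))) / 4 := fun s => by
    rw [sin_mul_cos_mul_cos, show (t - s) * p + s * q + s * r = t * p + s * (q + r - p) by ring,
      show (t - s) * p - s * q + s * r = t * p - s * (p + q - r) by ring,
      show (t - s) * p + s * q - s * r = t * p - s * (p - q + r) by ring,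
      show (t - s) * p - s * q - s * r = t * p - s * (p + q + r) by ring]
  have hi : ∀ α β : ℝ, IntervalIntegrable (fun s => Real.sin (α - s * β)) volume 0 t := fun α β =>
    Continuous.intervalIntegrable (by fun_prop) _ _
  have hi0 : IntervalIntegrable (fun s => Real.sin (t * p + s * (q + r - p))) volume 0 t :=
    Continuous.intervalIntegrable (by fun_prop) _ _
  -- On the resonant phase the integrand is nearly constant in `s`, with an error of at most the
  -- detuning because `s ≤ t ≤ 1`.
  have h4 : |(∫ s in (0 : ℝ)..t, Real.sin (t * p + s * (q + r - p))) - t * Real.sin (t * p)|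
      ≤ |q + r - p| := by
    have e2 : t * Real.sin (t * p) = ∫ s in (0 : ℝ)..t, Real.sin (t * p) := by simp
    rw [e2, ← intervalIntegral.integral_sub hi0 (by simp), ← Real.norm_eq_abs]
    refine (intervalIntegral.norm_integral_le_of_norm_le_const (C := |q + r - p|)
      fun s hs => ?_).trans ?_
    · rw [uIoc_of_le ht] at hs
      refine (Real.abs_sin_sub_sin_le _ _).trans ?_
      rw [add_sub_cancel_left, abs_mul, abs_of_pos hs.1]
      exact mul_le_of_le_one_left (abs_nonneg _) (hs.2.trans ht1)
    · rw [sub_zero, abs_of_nonneg ht]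
      exact mul_le_of_le_one_right (abs_nonneg _) ht1
  rw [intervalIntegral.integral_congr fun s _ => e s, intervalIntegral.integral_div,
    intervalIntegral.integral_add ((hi0.add (hi _ _)).add (hi _ _)) (hi _ _),
    intervalIntegral.integral_add (hi0.add (hi _ _)) (hi _ _),
    intervalIntegral.integral_add hi0 (hi _ _)]
  have h5 := abs_le.1 (abs_integral_sin_le hb h3 (t * p) t)
  have h6 := abs_le.1 (abs_integral_sin_le hb h2 (t * p) t)
  have h7 := abs_le.1 (abs_integral_sin_le hb h1 (t * p) t)
  have h8 := abs_le.1 h4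
  have h9 : 6 / b = 2 / b + 2 / b + 2 / b := by ring
  rw [h9, abs_le]
  constructor <;> linarith

/-- Since `sin²` has mean `1/2`, the integral is `T₀²/4` up to oscillations, which `ω ≥ 100/T₀`
makes negligible. The subtracted constant costs at most `T₀²/16`. -/
theorem integral_mul_sin_sq_ge {T₀ ω δ : ℝ} (hT : 0 < T₀) (hω : 100 / T₀ ≤ ω) (hδ : δ ≤ T₀ / 16) :
    T₀ ^ 2 / 8 ≤ ∫ t in (0 : ℝ)..T₀, (t * Real.sin (t * ω) ^ 2 - δ) := by
  have hω0 : 0 < ω := lt_of_lt_of_le (by positivity) hω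
  have h1 : ∀ t ∈ uIcc 0 T₀, HasDerivAt (fun t => t ^ 2 / 4 - t * Real.sin (2 * (t * ω)) / (4 * ω)
      - Real.cos (2 * (t * ω)) / (8 * ω ^ 2) - δ * t) (t * Real.sin (t * ω) ^ 2 - δ) t := fun t _ => by
    have ha := ((hasDerivAt_id t).mul_const ω).const_mul 2
    have hb := (((hasDerivAt_pow 2 t).div_const 4).sub
      (((hasDerivAt_id t).mul ha.sin).div_const (4 * ω))).sub (ha.cos.div_const (8 * ω ^ 2))
    refine (hb.sub ((hasDerivAt_id t).const_mul δ)).congr_deriv ?_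
    simp only [id]
    rw [Real.sin_sq_eq_half_sub]
    field_simp
    push_cast
    ring
  rw [intervalIntegral.integral_eq_sub_of_hasDerivAt h1
    (Continuous.intervalIntegrable (by fun_prop) _ _)]
  have h2 := Real.cos_le_one (2 * (T₀ * ω))
  have h3 := Real.sin_le_one (2 * (T₀ * ω))
  have h4 : T₀ * Real.sin (2 * (T₀ * ω)) / (4 * ω) ≤ T₀ ^ 2 / 400 := by
    rw [div_le_iff₀ (by positivity)]
    have : 100 ≤ ω * T₀ := (div_le_iff₀ hT).1 hω
    nlinarith
  have h5 : Real.cos (2 * (T₀ * ω)) / (8 * ω ^ 2) ≤ 1 / (8 * ω ^ 2) := by gcongr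
  have h6 : δ * T₀ ≤ T₀ / 16 * T₀ := by gcongr
  simp only [zero_mul, mul_zero, Real.cos_zero, zero_div, sub_zero]
  nlinarith

theorem norm_sq_eq_coord (ξ : Plane) : ‖ξ‖ ^ 2 = ξ 0 ^ 2 + ξ 1 ^ 2 := by
  rw [EuclideanSpace.norm_sq_eq, Fin.sum_univ_two, Real.norm_eq_abs, Real.norm_eq_abs, sq_abs,
    sq_abs]

theorem disp_zero (ξ : Plane) : disp 0 ξ = 2 * Real.pi * ‖ξ‖ := by
  unfold disp
  rw [add_zero, Real.sqrt_eq_iff_mul_self_eq (by positivity)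
    (by have := Real.pi_pos; positivity)]
  ring

theorem cross_sq (η ζ : Plane) :
    cross η ζ ^ 2 = (‖η‖ * ‖ζ‖) ^ 2 - (η 0 * ζ 0 + η 1 * ζ 1) ^ 2 := by
  rw [mul_pow, norm_sq_eq_coord, norm_sq_eq_coord, cross]
  ring

section geometry

variable {N H : ℝ} {η ζ : Plane}

/-- The two boxes lie on opposite sides of the first axis, so `η₀ ζ₁` and `-η₁ ζ₀` are both
positive: first coordinates lie in `[4N, 6N]`, second ones have absolute value in `[H, 3H]`. -/
theorem cross_mem (hH : 0 < H) (hN : H ≤ N) (hη : η ∈ boxAt (5 * N) (-2 * H) N H)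
    (hζ : ζ ∈ boxAt (5 * N) (2 * H) N H) : 8 * N * H ≤ cross η ζ ∧ cross η ζ ≤ 36 * N * H := by
  obtain ⟨h1, h2⟩ := hη
  obtain ⟨h3, h4⟩ := hζ
  rw [abs_le] at h1 h2 h3 h4
  have a1 : 4 * N ≤ η 0 := by linarith
  have a2 : η 0 ≤ 6 * N := by linarith
  have a3 : H ≤ -η 1 := by linarith
  have a4 : -η 1 ≤ 3 * H := by linarith
  have b1 : 4 * N ≤ ζ 0 := by linarith
  have b2 : ζ 0 ≤ 6 * N := by linarith
  have b3 : H ≤ ζ 1 := by linarith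
  have b4 : ζ 1 ≤ 3 * H := by linarith
  have hN0 : 0 < N := hH.trans_le hN
  have c1 : 4 * N * H ≤ η 0 * ζ 1 := mul_le_mul a1 b3 hH.le (by linarith)
  have c2 : η 0 * ζ 1 ≤ 6 * N * (3 * H) := mul_le_mul a2 b4 (by linarith) (by linarith)
  have c3 : H * (4 * N) ≤ -η 1 * ζ 0 := mul_le_mul a3 b1 (by linarith) (by linarith)
  have c4 : -η 1 * ζ 0 ≤ 3 * H * (6 * N) := mul_le_mul a4 b2 (by linarith) (by linarith)
  unfold cross
  constructor <;> linarith

/-- The angle between `η` and `ζ` is `O(H/N)`, so the defect in the triangle inequality is `O(N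
(H/N)²)`. Precisely, `(|η| + |ζ|)² - |η + ζ|² = 2(|η||ζ| - η·ζ)` and `|η|²|ζ|² - (η·ζ)²` is the
square of the vector product. -/
theorem norm_add_norm_sub_le (hH : 0 < H) (hN : H ≤ N) (hη : η ∈ boxAt (5 * N) (-2 * H) N H)
    (hζ : ζ ∈ boxAt (5 * N) (2 * H) N H) :
    4 * N ≤ ‖η‖ ∧ 4 * N ≤ ‖ζ‖ ∧ ‖η‖ + ‖ζ‖ - ‖η + ζ‖ ≤ 8 * H ^ 2 / N := by
  have hN0 : 0 < N := hH.trans_le hN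
  obtain ⟨hc1, hc2⟩ := cross_mem hH hN hη hζ
  obtain ⟨h1, h2⟩ := hη
  obtain ⟨h3, h4⟩ := hζ
  rw [abs_le] at h1 h2 h3 h4
  have a1 : 4 * N ≤ η 0 := by linarith
  have b1 : 4 * N ≤ ζ 0 := by linarith
  have ha : 4 * N ≤ ‖η‖ := a1.trans ((le_abs_self _).trans (abs_le_norm η 0))
  have hb : 4 * N ≤ ‖ζ‖ := b1.trans ((le_abs_self _).trans (abs_le_norm ζ 0))
  have hc : 8 * N ≤ ‖η + ζ‖ := by
    refine le_trans ?_ ((le_abs_self _).trans (abs_le_norm (η + ζ) 0))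
    rw [PiLp.add_apply]
    linarith
  refine ⟨ha, hb, ?_⟩
  set P := ‖η‖ * ‖ζ‖ with hP
  set D := η 0 * ζ 0 + η 1 * ζ 1 with hD
  have h5 : cross η ζ ^ 2 = (P - D) * (P + D) := by rw [cross_sq]; ring
  have h6 : 16 * N ^ 2 ≤ P := by nlinarith
  have h7 : -9 * N ^ 2 ≤ η 1 * ζ 1 := by nlinarith
  have h8 : 7 * N ^ 2 ≤ D := by nlinarith
  have h9 : cross η ζ ^ 2 ≤ (36 * N * H) ^ 2 := by
    have : 0 ≤ cross η ζ := le_trans (by positivity) hc1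
    gcongr
  -- `36² N² H² / (23 N²) < 57 H²`, with `P + D ≥ 16 N² + 7 N²`.
  have h10 : P - D ≤ 57 * H ^ 2 := by
    by_contra! hcon
    have h11 : 57 * H ^ 2 * (23 * N ^ 2) < (P - D) * (P + D) :=
      calc 57 * H ^ 2 * (23 * N ^ 2) ≤ 57 * H ^ 2 * (P + D) := by gcongr; linarith
        _ < (P - D) * (P + D) := mul_lt_mul_of_pos_right hcon (by nlinarith)
    nlinarith [mul_pos (pow_pos hH 2) (pow_pos hN0 2)]
  have h11 : (‖η‖ + ‖ζ‖ - ‖η + ζ‖) * (‖η‖ + ‖ζ‖ + ‖η + ζ‖) = 2 * (P - D) := by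
    have e1 := norm_sq_eq_coord η
    have e2 := norm_sq_eq_coord ζ
    have e3 := norm_sq_eq_coord (η + ζ)
    simp only [PiLp.add_apply] at e3
    rw [hP, hD]
    linear_combination e1 + e2 - e3
  have h12 : 0 ≤ ‖η‖ + ‖ζ‖ - ‖η + ζ‖ := by linarith [norm_add_le η ζ]
  -- The sum of the three norms is at least `16 N`, and `2 · 57 / 16 < 8`.
  rw [le_div_iff₀ hN0]
  nlinarith

end geometry

end CSH

end

/-! ### The null form of two thin boxes and its lower bound averaged in time. -/

noncomputable section

namespace CSH

open FourierTransform
open scoped CompactlySupported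

variable {n : ℕ}

/-- The integrand of the null form of two bumps. -/
def nullWeight (N H : ℝ) (ξ η : Plane) : ℝ :=
  8 * Real.pi ^ 2 * cross η (ξ - η) *
    (N * evenBump (5 * N) (-2 * H) N H η * evenBump (5 * N) (2 * H) N H (ξ - η))

theorem continuous_nullWeight (N H : ℝ) :
    Continuous fun z : Plane × Plane => nullWeight N H z.1 z.2 := by
  unfold nullWeight
  fun_prop

@[fun_prop]
theorem continuous_nullWeight_right (N H : ℝ) (ξ : Plane) : Continuous (nullWeight N H ξ) := by
  unfold nullWeight
  fun_prop

theorem isCompact_evenBox (x y w h : ℝ) : IsCompact (evenBox x y w h) :=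
  (isCompact_boxAt _ _ _ _).union (isCompact_boxAt _ _ _ _)

theorem evenBump_eq_zero {x y w h : ℝ} (hw : 0 < w) (hh : 0 < h) {ξ : Plane}
    (hξ : ξ ∉ evenBox x y w h) : evenBump x y w h ξ = 0 := by
  by_contra h2
  rcases mem_or_mem_of_evenBump_ne_zero hw hh h2 with h3 | h3
  · exact hξ (Or.inl h3)
  · exact hξ (Or.inr (neg_mem_boxAt.1 h3))

section weight

variable {N H : ℝ} (hH : 0 < H) (hN : H ≤ N)

include hH hN

theorem nullWeight_eq_zero {ξ η : Plane} (hη : η ∉ evenBox (5 * N) (-2 * H) N H) :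
    nullWeight N H ξ η = 0 := by
  rw [nullWeight, evenBump_eq_zero (hH.trans_le hN) hH hη]
  ring

theorem integrable_nullWeight (ξ : Plane) : Integrable (nullWeight N H ξ) :=
  (continuous_nullWeight_right N H ξ).integrable_of_hasCompactSupport
    (HasCompactSupport.intro (isCompact_evenBox _ _ _ _) fun _ => nullWeight_eq_zero hH hN)

theorem continuous_integral_nullWeight : Continuous fun ξ => ∫ η, nullWeight N H ξ η := by
  have h1 : (fun ξ => ∫ η, nullWeight N H ξ η)
      = fun ξ => ∫ η in evenBox (5 * N) (-2 * H) N H, nullWeight N H ξ η := by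
    funext ξ
    exact (setIntegral_eq_integral_of_forall_compl_eq_zero fun η hη =>
      nullWeight_eq_zero hH hN hη).symm
  rw [h1]
  exact continuous_parametric_integral_of_continuous (f := fun ξ η => nullWeight N H ξ η)
    (continuous_nullWeight N H) (isCompact_evenBox _ _ _ _)

/-- The bumps are even, but the output has first coordinate near `10 N`, which cannot be reached
when one of the two bumps is replaced by its reflection. The vector product therefore has one sign
and nothing cancels. -/
theorem mem_boxes_of_ne_zero {ξ η : Plane} (hξ : ξ ∈ boxAt (10 * N) 0 (N / 2) (H / 2))
    (h : nullWeight N H ξ η ≠ 0) :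
    η ∈ boxAt (5 * N) (-2 * H) N H ∧ ξ - η ∈ boxAt (5 * N) (2 * H) N H := by
  have hN0 : 0 < N := hH.trans_le hN
  have h1 : evenBump (5 * N) (-2 * H) N H η ≠ 0 := fun h0 => h (by rw [nullWeight, h0]; ring)
  have h2 : evenBump (5 * N) (2 * H) N H (ξ - η) ≠ 0 := fun h0 => h (by rw [nullWeight, h0]; ring)
  have h3 := abs_le.1 hξ.1
  rcases mem_or_mem_of_evenBump_ne_zero hN0 hH h1 with h4 | h4 <;>
  rcases mem_or_mem_of_evenBump_ne_zero hN0 hH h2 with h5 | h5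
  · exact ⟨h4, h5⟩
  all_goals
    exfalso
    have h6 := abs_le.1 h4.1
    have h7 := abs_le.1 h5.1
    simp only [PiLp.neg_apply, PiLp.sub_apply] at h6 h7
    linarith

theorem nullWeight_nonneg {ξ η : Plane} (hξ : ξ ∈ boxAt (10 * N) 0 (N / 2) (H / 2)) :
    0 ≤ nullWeight N H ξ η := by
  by_cases h : nullWeight N H ξ η = 0
  · rw [h]
  · obtain ⟨h1, h2⟩ := mem_boxes_of_ne_zero hH hN hξ h
    have hN0 : 0 < N := hH.trans_le hN
    have h3 : 0 ≤ cross η (ξ - η) := le_trans (by positivity) (cross_mem hH hN h1 h2).1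
    have := evenBump_nonneg (5 * N) (-2 * H) N H η
    have := evenBump_nonneg (5 * N) (2 * H) N H (ξ - η)
    unfold nullWeight
    positivity

theorem integral_nullWeight_ge {ξ : Plane} (hξ : ξ ∈ boxAt (10 * N) 0 (N / 2) (H / 2)) :
    16 * Real.pi ^ 2 * N ^ 3 * H ^ 2 ≤ ∫ η, nullWeight N H ξ η := by
  have hN0 : 0 < N := hH.trans_le hN
  -- For `η` in this box, roughly centred at half of `ξ`, both `η` and `ξ - η` stay where the bumps
  -- equal one. Its area `NH/4`, times `8π² · 8NH · N`, gives the bound.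
  set K := boxAt (ξ 0 / 2) (-2 * H + ξ 1 / 2) (N / 4) (H / 4) with hK
  have h1 : ∀ η, K.indicator (fun _ => 64 * Real.pi ^ 2 * N ^ 2 * H) η ≤ nullWeight N H ξ η := by
    intro η
    by_cases hη : η ∈ K
    · rw [indicator_of_mem hη]
      have a1 := abs_le.1 hξ.1
      have a2 := abs_le.1 hξ.2
      have a3 := abs_le.1 hη.1
      have a4 := abs_le.1 hη.2
      have b1 : η ∈ boxAt (5 * N) (-2 * H) (N / 2) (H / 2) := by
        constructor <;> rw [abs_le] <;> constructor <;> linarith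
      have b2 : ξ - η ∈ boxAt (5 * N) (2 * H) (N / 2) (H / 2) := by
        constructor <;> rw [abs_le, PiLp.sub_apply] <;> constructor <;> linarith
      have c1 : η ∈ boxAt (5 * N) (-2 * H) N H := ⟨b1.1.trans (by linarith), b1.2.trans (by linarith)⟩
      have c2 : ξ - η ∈ boxAt (5 * N) (2 * H) N H :=
        ⟨b2.1.trans (by linarith), b2.2.trans (by linarith)⟩
      have d1 := one_le_evenBump hN0 hH b1
      have d2 := one_le_evenBump hN0 hH b2
      have d3 := (cross_mem hH hN c1 c2).1
      have d4 : 0 ≤ cross η (ξ - η) := le_trans (by positivity) d3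
      unfold nullWeight
      calc 64 * Real.pi ^ 2 * N ^ 2 * H = 8 * Real.pi ^ 2 * (8 * N * H) * (N * 1 * 1) := by ring
        _ ≤ _ := by gcongr
    · rw [indicator_of_notMem hη]
      exact nullWeight_nonneg hH hN hξ
  have h2 := integral_mono ((integrable_indicator_iff (measurableSet_boxAt _ _ _ _)).2
    (integrableOn_const (volume_boxAt_ne_top _ _ _ _))) (integrable_nullWeight hH hN ξ) h1
  rw [integral_indicator_const _ (measurableSet_boxAt _ _ _ _),
    volume_real_boxAt _ _ (by positivity) (by positivity)] at h2
  refine le_trans (le_of_eq ?_) h2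
  rw [smul_eq_mul]
  ring

end weight

/-- The frequency profile of `A₀`. -/
def lowProfile {N H : ℝ} (hN : 0 < N) (hH : 0 < H) : C_c(Plane, ℂ) :=
  (N : ℂ) • bumpProfile (5 * N) (-2 * H) hN hH

theorem lowProfile_apply {N H : ℝ} (hN : 0 < N) (hH : 0 < H) (ξ : Plane) :
    lowProfile hN hH ξ = (N * evenBump (5 * N) (-2 * H) N H ξ : ℝ) := by
  simp [lowProfile]

theorem lowProfile_neg {N H : ℝ} (hN : 0 < N) (hH : 0 < H) (ξ : Plane) :
    lowProfile hN hH (-ξ) = starRingEnd ℂ (lowProfile hN hH ξ) := by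
  rw [lowProfile_apply, lowProfile_apply, evenBump_neg, Complex.conj_ofReal]

theorem bumpProfile_neg (x y : ℝ) {w h : ℝ} (hw : 0 < w) (hh : 0 < h) (ξ : Plane) :
    bumpProfile x y hw hh (-ξ) = starRingEnd ℂ (bumpProfile x y hw hh ξ) := by
  rw [bumpProfile_apply, bumpProfile_apply, evenBump_neg, Complex.conj_ofReal]

/-- The time dependent test function. -/
def gaugeTest (N H t : ℝ) : Plane → ℝ := (boxAt (10 * N) 0 (N / 2) (H / 2)).indicator
  fun ξ => Real.sin (t * disp 0 ξ) * disp 0 ξ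

section lower

variable {i₀ i₁ : Fin n} (h : i₀ ≠ i₁) (k : ℕ) {T m : ℝ} (hT : 0 ≤ T) (hm : 0 ≤ m)

/-- The profiles and the symbols are real, so the coefficient is `i` times a real function. This
makes the pairing with a real test function amenable to one-sided bounds. -/
theorem exists_real_second {N H : ℝ} (hN : 0 < N) (hH : 0 < H) {t : ℝ} (ht : t ∈ Icc 0 T) :
    ∃ R : Plane → ℝ, Continuous R ∧
      (∀ ξ, hat k ((gaugeData h (lowProfile_neg hN hH)
        (bumpProfile_neg (5 * N) (2 * H) hN hH)).second k hT hm (some 0) none i₀ i₀) t ξ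
          = Complex.I * (R ξ : ℂ)) ∧
      ∀ ξ, R ξ = ∫ s in (0 : ℝ)..t, sinProp 0 (t - s) ξ *
        ∫ η, nullWeight N H ξ η * (cosProp 0 s η * cosProp 0 s (ξ - η)) := by
  have h1 : ∀ ξ, hat k ((gaugeData h (lowProfile_neg hN hH)
        (bumpProfile_neg (5 * N) (2 * H) hN hH)).second k hT hm (some 0) none i₀ i₀) t ξ
      = Complex.I * ((∫ s in (0 : ℝ)..t, sinProp 0 (t - s) ξ *
        ∫ η, nullWeight N H ξ η * (cosProp 0 s η * cosProp 0 s (ξ - η)) : ℝ) : ℂ) := fun ξ => by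
    rw [hat_gaugeData_second h _ _ k hT hm ht ξ, ← intervalIntegral.integral_ofReal]
    congr 1
    refine intervalIntegral.integral_congr fun s _ => ?_
    simp only [Complex.ofReal_mul, ← integral_complex_ofReal]
    congr 1
    refine integral_congr_ae (Filter.Eventually.of_forall fun η => ?_)
    simp only [lowProfile_apply, bumpProfile_apply, nullWeight]
    push_cast
    ring
  refine ⟨_, ?_, h1, fun ξ => rfl⟩
  have h2 : ∀ ξ, (∫ s in (0 : ℝ)..t, sinProp 0 (t - s) ξ *
        ∫ η, nullWeight N H ξ η * (cosProp 0 s η * cosProp 0 s (ξ - η)))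
      = (hat k ((gaugeData h (lowProfile_neg hN hH)
        (bumpProfile_neg (5 * N) (2 * H) hN hH)).second k hT hm (some 0) none i₀ i₀) t ξ).im :=
    fun ξ => by
      rw [h1]
      simp
  simp only [h2]
  exact Complex.continuous_im.comp (continuous_hat_right _ _ _)

/-- The test weight `ω sin(tω)` cancels the `1/ω` of the propagator and turns the resonant part
`(t/4) sin(tω)` into a square. The error is pointwise in `η`, so integrating it against the
nonnegative weight loses nothing. -/
theorem sin_mul_disp_mul_ge {N H : ℝ} (hH : 0 < H) (hN : 8 * H ^ 2 ≤ N) (hN1 : 1 ≤ N) (hHN : H ≤ N)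
    {t δ : ℝ}
    (ht : t ∈ Icc (0 : ℝ) 1) (hδ : 2 * Real.pi * (8 * H ^ 2 / N) + 6 / N ≤ δ) {ξ : Plane}
    (hξ : ξ ∈ boxAt (10 * N) 0 (N / 2) (H / 2)) :
    (t * Real.sin (t * disp 0 ξ) ^ 2 - δ) / 4 * (∫ η, nullWeight N H ξ η)
      ≤ Real.sin (t * disp 0 ξ) * disp 0 ξ * ∫ s in (0 : ℝ)..t, sinProp 0 (t - s) ξ *
        ∫ η, nullWeight N H ξ η * (cosProp 0 s η * cosProp 0 s (ξ - η)) := by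
  have hN0 : 0 < N := by linarith
  let A : Plane → ℝ := fun η => ∫ s in (0 : ℝ)..t, Real.sin ((t - s) * disp 0 ξ) *
    (Real.cos (s * disp 0 η) * Real.cos (s * disp 0 (ξ - η)))
  have hA : Continuous A := by
    refine intervalIntegral.continuous_parametric_intervalIntegral_of_continuous' ?_ 0 t
    fun_prop
  have hwc : Continuous fun η => nullWeight N H ξ η := continuous_nullWeight_right N H ξ
  have hwi := integrable_nullWeight hH hHN ξ
  have hcs : HasCompactSupport (nullWeight N H ξ) :=
    HasCompactSupport.intro (isCompact_evenBox _ _ _ _) fun _ => nullWeight_eq_zero hH hHN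
  have h1 : disp 0 ξ * ∫ s in (0 : ℝ)..t, sinProp 0 (t - s) ξ *
        ∫ η, nullWeight N H ξ η * (cosProp 0 s η * cosProp 0 s (ξ - η))
      = ∫ η, nullWeight N H ξ η * A η := by
    have e1 : ∀ η, nullWeight N H ξ η * A η = ∫ s in (0 : ℝ)..t, nullWeight N H ξ η *
        (Real.sin ((t - s) * disp 0 ξ) * (Real.cos (s * disp 0 η) * Real.cos (s * disp 0 (ξ - η)))) :=
      fun η => (intervalIntegral.integral_const_mul _ _).symm
    simp only [e1]
    rw [← integral_swap_of_bound (F := fun s η => nullWeight N H ξ η *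
        (Real.sin ((t - s) * disp 0 ξ) * (Real.cos (s * disp 0 η) * Real.cos (s * disp 0 (ξ - η)))))
      (by fun_prop) hwi.norm fun s _ η => ?_, ← intervalIntegral.integral_const_mul]
    · refine intervalIntegral.integral_congr fun s _ => ?_
      rw [← mul_assoc, disp_mul_sinProp, ← integral_const_mul]
      refine integral_congr_ae (Filter.Eventually.of_forall fun η => ?_)
      simp only [cosProp]
      ring
    · rw [abs_mul, Real.norm_eq_abs]
      refine mul_le_of_le_one_right (abs_nonneg _) ?_
      rw [abs_mul, abs_mul]
      exact mul_le_one₀ (Real.abs_sin_le_one _) (by positivity)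
        (mul_le_one₀ (Real.abs_cos_le_one _) (abs_nonneg _) (Real.abs_cos_le_one _))
  rw [mul_assoc, h1, ← integral_const_mul, ← integral_const_mul]
  refine integral_mono (hwi.const_mul _) (Integrable.const_mul ?_ _) fun η => ?_
  · exact (hwc.mul hA).integrable_of_hasCompactSupport hcs.mul_right
  · simp only
    by_cases hw : nullWeight N H ξ η = 0
    · rw [hw]; simp
    · obtain ⟨hη, hζ⟩ := mem_boxes_of_ne_zero hH hHN hξ hw
      have hw0 := nullWeight_nonneg hH hHN hξ (η := η)
      obtain ⟨a1, a2, a3⟩ := norm_add_norm_sub_le hH hHN hη hζ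
      rw [add_sub_cancel] at a3
      have a4 : 0 ≤ ‖η‖ + ‖ξ - η‖ - ‖ξ‖ := by
        have := norm_add_le η (ξ - η)
        rw [add_sub_cancel] at this
        linarith
      have a5 : 8 * H ^ 2 / N ≤ 1 := (div_le_one hN0).2 hN
      have hpi := Real.pi_gt_three
      -- The three nonresonant combinations of norms are at least `N`, hence so are the
      -- corresponding frequencies.
      have b : ∀ x : ℝ, N ≤ x → N ≤ 2 * Real.pi * x := fun x hx => by nlinarith
      have c1 := abs_resonance_sub_le (p := disp 0 ξ) (q := disp 0 η) (r := disp 0 (ξ - η)) (b := N)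
        (t := t) hN0
        (by
          have := b (‖ξ‖ + ‖η‖ + ‖ξ - η‖) (by linarith [norm_nonneg ξ])
          simp only [disp_zero]; linarith)
        (by
          have := b (‖ξ‖ - ‖η‖ + ‖ξ - η‖) (by linarith)
          simp only [disp_zero]; linarith)
        (by
          have := b (‖ξ‖ + ‖η‖ - ‖ξ - η‖) (by linarith)
          simp only [disp_zero]; linarith) ht.1 ht.2
      have c2 : |disp 0 η + disp 0 (ξ - η) - disp 0 ξ| ≤ 2 * Real.pi * (8 * H ^ 2 / N) := by
        simp only [disp_zero]
        rw [← mul_add, ← mul_sub, abs_of_nonneg (by positivity)]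
        gcongr
      have c3 : |A η - t / 4 * Real.sin (t * disp 0 ξ)| ≤ δ / 4 := c1.trans (by linarith)
      have c4 : |Real.sin (t * disp 0 ξ) * (A η - t / 4 * Real.sin (t * disp 0 ξ))| ≤ δ / 4 := by
        rw [abs_mul]
        exact (mul_le_of_le_one_left (abs_nonneg _) (Real.abs_sin_le_one _)).trans c3
      have c5 := (abs_le.1 c4).1
      have c6 : (t * Real.sin (t * disp 0 ξ) ^ 2 - δ) / 4 ≤ Real.sin (t * disp 0 ξ) * A η := by
        linarith
      calc (t * Real.sin (t * disp 0 ξ) ^ 2 - δ) / 4 * nullWeight N H ξ η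
          ≤ Real.sin (t * disp 0 ξ) * A η * nullWeight N H ξ η := by gcongr
        _ = _ := by ring

/-- At a single time `sin(tω)` may vanish on part of the output box; averaging over `[0, T₀]`
removes this. The average of the time factor is at least `T₀²/32` before division by `T₀`, the
weight is `≳ N³ H²` and the box has area `NH`. -/
theorem second_lower_bound {T₀ : ℝ} (hT₀ : 0 < T₀) (hT₁ : T₀ ≤ 1) (hT₂ : T₀ ≤ T) {N H K : ℝ}
    (hN : 0 < N) (hH : 0 < H) (hH1 : 1 ≤ H) (hNH : 4000 / T₀ * H ^ 2 ≤ N)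
    (hK : ∀ t ∈ Icc 0 T₀, ‖∫ ξ, (gaugeTest N H t ξ : ℂ) * hat k ((gaugeData h (lowProfile_neg hN hH)
        (bumpProfile_neg (5 * N) (2 * H) hN hH)).second k hT hm (some 0) none i₀ i₀) t ξ‖ ≤ K) :
    T₀ * N ^ 4 * H ^ 3 ≤ K := by
  set G := boxAt (10 * N) 0 (N / 2) (H / 2) with hG
  have hGm : MeasurableSet G := measurableSet_boxAt _ _ _ _
  have hGc : IsCompact G := isCompact_boxAt _ _ _ _
  have hN4 : 4000 / T₀ ≤ N := le_trans (le_mul_of_one_le_right (by positivity)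
    (one_le_pow₀ hH1)) hNH
  have hT4 : 4000 ≤ 4000 / T₀ := by rw [le_div_iff₀ hT₀]; linarith
  have hN8 : 8 * H ^ 2 ≤ N := le_trans (by gcongr; linarith) hNH
  have hHN : H ≤ N := by nlinarith
  have hN1 : 1 ≤ N := by linarith
  set W : Plane → ℝ := fun ξ => ∫ η, nullWeight N H ξ η with hW
  have hWc : Continuous W := continuous_integral_nullWeight hH hHN
  have hWp : ∀ ξ ∈ G, 16 * Real.pi ^ 2 * N ^ 3 * H ^ 2 ≤ W ξ := fun ξ hξ =>
    integral_nullWeight_ge hH hHN hξ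
  -- The requirement `N ≥ 4000 H²/T₀` is made for this: the detuning and the nonresonant terms stay
  -- below the allowance `T₀/16` of `integral_mul_sin_sq_ge`.
  have hδ : 2 * Real.pi * (8 * H ^ 2 / N) + 6 / N ≤ T₀ / 16 := by
    have h1 : H ^ 2 / N ≤ T₀ / 4000 := by
      rw [div_le_div_iff₀ hN (by norm_num)]
      rw [div_mul_eq_mul_div, div_le_iff₀ hT₀] at hNH
      linarith
    have h2 : 1 / N ≤ T₀ / 4000 := by
      refine le_trans ?_ h1
      gcongr
      exact one_le_pow₀ hH1
    have h3 := Real.pi_lt_d2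
    have e1 : 2 * Real.pi * (8 * H ^ 2 / N) = 16 * Real.pi * (H ^ 2 / N) := by ring
    have e2 : 6 / N = 6 * (1 / N) := by ring
    have h4 : 16 * Real.pi * (H ^ 2 / N) ≤ 16 * 3.15 * (T₀ / 4000) := by gcongr
    rw [e1, e2]
    nlinarith
  have h1 : ∀ t ∈ Icc 0 T₀,
      ∫ ξ in G, (t * Real.sin (t * disp 0 ξ) ^ 2 - T₀ / 16) / 4 * W ξ ≤ K := fun t ht => by
    refine le_trans ?_ (hK t ht)
    obtain ⟨R, hRc, hR, hR'⟩ := exists_real_second h k hT hm hN hH ⟨ht.1, ht.2.trans hT₂⟩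
    have e1 : ∫ ξ, (gaugeTest N H t ξ : ℂ) * hat k ((gaugeData h (lowProfile_neg hN hH)
        (bumpProfile_neg (5 * N) (2 * H) hN hH)).second k hT hm (some 0) none i₀ i₀) t ξ
        = Complex.I * ((∫ ξ in G, Real.sin (t * disp 0 ξ) * disp 0 ξ * R ξ : ℝ) : ℂ) := by
      rw [← integral_indicator hGm, ← integral_complex_ofReal, ← integral_const_mul]
      refine integral_congr_ae (Filter.Eventually.of_forall fun ξ => ?_)
      simp only [hR, gaugeTest, ← hG]
      by_cases hξ : ξ ∈ G
      · simp only [indicator_of_mem hξ]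
        push_cast
        ring
      · simp only [indicator_of_notMem hξ]
        simp
    rw [e1, norm_mul, Complex.norm_I, one_mul, Complex.norm_real]
    refine le_trans ?_ (le_abs_self _)
    refine setIntegral_mono_on ?_ ?_ hGm fun ξ hξ => ?_
    · exact (Continuous.continuousOn (by fun_prop)).integrableOn_compact hGc
    · exact (Continuous.continuousOn (by fun_prop)).integrableOn_compact hGc
    · rw [hR']
      exact sin_mul_disp_mul_ge hH hN8 hN1 hHN ⟨ht.1, ht.2.trans hT₁⟩ hδ hξ
  have hWi : IntegrableOn W G := hWc.continuousOn.integrableOn_compact hGc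
  have h2 : ∫ t in (0 : ℝ)..T₀, ∫ ξ in G, (t * Real.sin (t * disp 0 ξ) ^ 2 - T₀ / 16) / 4 * W ξ
      = ∫ ξ in G, (∫ t in (0 : ℝ)..T₀, (t * Real.sin (t * disp 0 ξ) ^ 2 - T₀ / 16) / 4 * W ξ) := by
    refine integral_swap_of_bound
      (F := fun t ξ => (t * Real.sin (t * disp 0 ξ) ^ 2 - T₀ / 16) / 4 * W ξ) (by fun_prop)
      hWi.norm fun t ht ξ => ?_
    rw [uIoc_of_le hT₀.le] at ht
    rw [abs_mul, Real.norm_eq_abs]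
    refine mul_le_of_le_one_left (abs_nonneg _) ?_
    have a1 := Real.sin_sq_le_one (t * disp 0 ξ)
    have a2 := sq_nonneg (Real.sin (t * disp 0 ξ))
    have a3 : t * Real.sin (t * disp 0 ξ) ^ 2 ≤ 1 := by nlinarith [ht.1, ht.2]
    have a4 : 0 ≤ t * Real.sin (t * disp 0 ξ) ^ 2 := mul_nonneg ht.1.le a2
    rw [abs_le]
    constructor <;> linarith
  have h3 : ∫ t in (0 : ℝ)..T₀, ∫ ξ in G, (t * Real.sin (t * disp 0 ξ) ^ 2 - T₀ / 16) / 4 * W ξ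
      ≤ T₀ * K := by
    have h4 : Continuous fun t => ∫ ξ in G, (t * Real.sin (t * disp 0 ξ) ^ 2 - T₀ / 16) / 4 * W ξ :=
      continuous_parametric_integral_of_continuous (μ := volume)
        (f := fun t ξ => (t * Real.sin (t * disp 0 ξ) ^ 2 - T₀ / 16) / 4 * W ξ)
        (by unfold Function.uncurry; fun_prop) hGc
    have h5 := intervalIntegral.integral_mono_on hT₀.le (h4.intervalIntegrable (μ := volume) _ _)
      (continuous_const.intervalIntegrable (μ := volume) _ _) h1
    simpa using h5
  have h4 : ∫ ξ in G, T₀ ^ 2 / 8 / 4 * (16 * Real.pi ^ 2 * N ^ 3 * H ^ 2)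
      ≤ ∫ ξ in G, (∫ t in (0 : ℝ)..T₀, (t * Real.sin (t * disp 0 ξ) ^ 2 - T₀ / 16) / 4 * W ξ) := by
    refine setIntegral_mono_on (integrableOn_const (volume_boxAt_ne_top _ _ _ _)) ?_ hGm
      fun ξ hξ => ?_
    · refine ContinuousOn.integrableOn_compact hGc (Continuous.continuousOn ?_)
      refine intervalIntegral.continuous_parametric_intervalIntegral_of_continuous' ?_ 0 T₀
      unfold Function.uncurry
      fun_prop
    · rw [intervalIntegral.integral_mul_const, intervalIntegral.integral_div]
      have hω : 100 / T₀ ≤ disp 0 ξ := by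
        have b1 := abs_le.1 hξ.1
        have b2 : N ≤ ‖ξ‖ := le_trans (by linarith) ((le_abs_self _).trans (abs_le_norm ξ 0))
        have b3 : 100 / T₀ ≤ 4000 / T₀ := by gcongr; norm_num
        rw [disp_zero]
        nlinarith [Real.pi_gt_three]
      have b4 := integral_mul_sin_sq_ge hT₀ hω le_rfl
      have b5 := hWp ξ hξ
      exact mul_le_mul (by gcongr) b5 (by positivity)
        (div_nonneg (le_trans (by positivity) b4) (by norm_num))
  rw [setIntegral_const, volume_real_boxAt _ _ (by positivity) (by positivity), smul_eq_mul] at h4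
  have h5 : T₀ * K ≥ T₀ * (T₀ * N ^ 4 * H ^ 3) := by
    have hpi : 9 ≤ Real.pi ^ 2 := by nlinarith [Real.pi_gt_three]
    have e : 4 * (N / 2) * (H / 2) * (T₀ ^ 2 / 8 / 4 * (16 * Real.pi ^ 2 * N ^ 3 * H ^ 2))
        = T₀ ^ 2 * N ^ 4 * H ^ 3 * (Real.pi ^ 2 / 2) := by ring
    rw [e] at h4
    have : T₀ ^ 2 * N ^ 4 * H ^ 3 * 1 ≤ T₀ ^ 2 * N ^ 4 * H ^ 3 * (Real.pi ^ 2 / 2) := by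
      gcongr
      linarith
    linarith
  exact le_of_mul_le_mul_left h5 hT₀

end lower

end CSH

end

/-! ### Size of the gauge data and of the test functions; failure of `C²`. -/

noncomputable section

namespace CSH

open FourierTransform
open scoped CompactlySupported

variable {n : ℕ}

theorem norm_embC_le {i₀ i₁ : Fin n} (h : i₀ ≠ i₁) (b : Fin 3 → C_c(Plane, ℂ)) (i j : Fin n)
    (ξ : Plane) : ‖embC i₀ i₁ b i j ξ‖ ≤ ∑ p, ‖b p ξ‖ := by
  simp only [embC, CompactlySupportedContinuousMap.sum_apply,
    CompactlySupportedContinuousMap.smul_apply, smul_eq_mul]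
  refine (norm_sum_le _ _).trans (Finset.sum_le_sum fun p _ => ?_)
  rw [norm_mul]
  exact mul_le_of_le_one_left (norm_nonneg _) (norm_gen_le_one h p i j)

theorem norm_bumpProfile (x y : ℝ) {w h : ℝ} (hw : 0 < w) (hh : 0 < h) (ξ : Plane) :
    ‖bumpProfile x y hw hh ξ‖ = evenBump x y w h ξ := by
  rw [bumpProfile_apply, Complex.norm_real, Real.norm_of_nonneg (evenBump_nonneg _ _ _ _ _)]

theorem bracketPow_mul_le {r : ℝ} {B : Set Plane} {N M : ℝ} {F : Plane → ℝ} (hN : 1 ≤ N)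
    (hM : 0 ≤ M) (hB : ∀ ξ ∈ B, N ≤ ‖ξ‖ ∧ ‖ξ‖ ≤ 20 * N)
    (hF : ∀ ξ, F ξ ≤ B.indicator (fun _ => M) ξ) (ξ : Plane) :
    bracketPow r ξ * F ξ ≤ B.indicator (fun _ => M * (401 ^ (|r| / 2) * N ^ r)) ξ := by
  have h1 := hF ξ
  have h2 := bracketPow_pos r ξ
  by_cases hξ : ξ ∈ B
  · rw [indicator_of_mem hξ] at h1 ⊢
    obtain ⟨h3, h4⟩ := hB ξ hξ
    calc bracketPow r ξ * F ξ ≤ bracketPow r ξ * M := by gcongr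
      _ ≤ 401 ^ (|r| / 2) * N ^ r * M := by
        gcongr
        exact bracketPow_le hN h3 h4
      _ = _ := mul_comm _ _
  · rw [indicator_of_notMem hξ] at h1 ⊢
    exact mul_nonpos_of_nonneg_of_nonpos h2.le h1

theorem mem_evenBox_norm {N H y : ℝ} (hH : 0 < H) (hN : H ≤ N) (hy : |y| ≤ 2 * H) {ξ : Plane}
    (hξ : ξ ∈ evenBox (5 * N) y N H) : N ≤ ‖ξ‖ ∧ ‖ξ‖ ≤ 20 * N := by
  have h0 := norm_le_add_abs ξ
  have h1 := abs_le_norm ξ 0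
  have hy' := abs_le.1 hy
  rcases hξ with ⟨a, b⟩ | ⟨a, b⟩ <;>
  · rw [abs_le] at a b
    constructor
    · refine le_trans ?_ h1
      rw [le_abs]
      first
      | exact Or.inl (by linarith)
      | exact Or.inr (by linarith)
    · have c0 : |ξ 0| ≤ 6 * N := abs_le.2 ⟨by linarith, by linarith⟩
      have c1 : |ξ 1| ≤ 3 * H := abs_le.2 ⟨by linarith, by linarith⟩
      linarith

section gauge

variable {i₀ i₁ : Fin n} (h : i₀ ≠ i₁)

/-- The factor `N` in the profile of `A₀` balances the derivative in `A_j`, so all components have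
height `O(N)`: the curl is bounded by `2π · 20N · 2 = 80πN`. Frequencies are comparable to `N` and
each support has area at most `8NH`. -/
theorem norm_state_gaugeData_le {𝔪 : Submodule ℝ (Mat n)} {s σ : ℝ} {k : ℕ} {T : ℝ}
    (h𝔪 : su n ≤ 𝔪) (hs : s ≤ k) (hσ : σ ≤ k) (hT : 0 ≤ T) (m : ℝ) {N H : ℝ} (hN : 0 < N)
    (hH : 0 < H) (hHN : H ≤ N) (hN1 : 1 ≤ N) :
    ‖(gaugeData h (lowProfile_neg hN hH) (bumpProfile_neg (5 * N) (2 * H) hN hH)).state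
        h𝔪 hs hσ T m‖ ≤ 80 * Real.pi * N * (401 ^ (|σ| / 2) * N ^ σ) * √(8 * N * H) := by
  have hpi := Real.pi_gt_three
  have hM : 0 ≤ 80 * Real.pi * N * (401 ^ (|σ| / 2) * N ^ σ) := by positivity
  have hprod : ∀ y, |y| ≤ 2 * H → ∀ F : Plane → ℝ,
      (∀ ξ, F ξ ≤ (evenBox (5 * N) y N H).indicator (fun _ => 80 * Real.pi * N) ξ) →
      ∃ (B : Set Plane) (M : ℝ), MeasurableSet B ∧ volume B ≠ ∞ ∧ 0 ≤ M ∧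
      M * √(volume.real B) ≤ 80 * Real.pi * N * (401 ^ (|σ| / 2) * N ^ σ) * √(8 * N * H) ∧
      ∀ ξ, bracketPow σ ξ * F ξ ≤ B.indicator (fun _ => M) ξ := fun y hy F hF =>
    ⟨evenBox (5 * N) y N H, _, measurableSet_evenBox _ _ _ _, volume_evenBox_ne_top _ _ _ _, hM,
      by gcongr; exact volume_real_evenBox_le _ _ hN.le hH.le,
      bracketPow_mul_le hN1 (by positivity) (fun ξ hξ => mem_evenBox_norm hH hHN hy hξ) hF⟩
  refine InitData.norm_state_le _ h𝔪 hs hσ hT m (by positivity) (fun i j => ?_) fun μ i j => ?_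
  · exact ⟨∅, 0, MeasurableSet.empty, by simp, le_rfl, by rw [zero_mul]; positivity,
      fun ξ => by simp [gaugeData]⟩
  · refine Fin.cases ?_ (fun l => ?_) μ
    · refine hprod (-2 * H) (by rw [abs_le]; constructor <;> linarith) _ fun ξ => ?_
      refine (norm_embC_le h _ i j ξ).trans ?_
      have e : ∑ p, ‖gaugeProfile (lowProfile hN hH) (bumpProfile (5 * N) (2 * H) hN hH) 0 p ξ‖
          = N * evenBump (5 * N) (-2 * H) N H ξ := by
        simp only [gaugeProfile, Fin.cases_zero, Fin.sum_univ_three]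
        simp [lowProfile_apply, abs_of_pos hN, abs_of_nonneg (evenBump_nonneg _ _ _ _ ξ)]
      rw [e]
      have e2 := evenBump_le_indicator (x := 5 * N) (y := -2 * H) hN hH ξ
      by_cases hξ : ξ ∈ evenBox (5 * N) (-2 * H) N H
      · rw [indicator_of_mem hξ] at e2 ⊢
        nlinarith
      · rw [evenBump_eq_zero hN hH hξ, indicator_of_notMem hξ, mul_zero]
    · refine hprod (2 * H) (abs_of_pos (by positivity)).le _ fun ξ => ?_
      refine (norm_embC_le h _ i j ξ).trans ?_
      have e : ∑ p, ‖gaugeProfile (lowProfile hN hH) (bumpProfile (5 * N) (2 * H) hN hH) l.succ p ξ‖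
          ≤ 2 * Real.pi * ‖ξ‖ * evenBump (5 * N) (2 * H) N H ξ := by
        simp only [gaugeProfile, Fin.cases_succ, Fin.sum_univ_three]
        have h0 := evenBump_nonneg (5 * N) (2 * H) N H ξ
        have hd : ∀ q : Fin 2, ‖dsym q ξ‖ ≤ 2 * Real.pi * ‖ξ‖ := fun q => by
          rw [norm_dsym]
          gcongr
          exact abs_le_norm ξ q
        have hc : ‖curl (bumpProfile (5 * N) (2 * H) hN hH) l ξ‖
            ≤ 2 * Real.pi * ‖ξ‖ * evenBump (5 * N) (2 * H) N H ξ := by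
          revert l
          rw [Fin.forall_fin_two]
          constructor
          · change ‖dsym 1 ξ * bumpProfile (5 * N) (2 * H) hN hH ξ‖ ≤ _
            rw [norm_mul, norm_bumpProfile]
            gcongr
            exact hd 1
          · change ‖-(dsym 0 ξ * bumpProfile (5 * N) (2 * H) hN hH ξ)‖ ≤ _
            rw [norm_neg, norm_mul, norm_bumpProfile]
            gcongr
            exact hd 0
        simpa using hc
      refine e.trans ?_
      have e2 := evenBump_le_indicator (x := 5 * N) (y := 2 * H) hN hH ξ
      by_cases hξ : ξ ∈ evenBox (5 * N) (2 * H) N H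
      · rw [indicator_of_mem hξ] at e2 ⊢
        have e3 := (mem_evenBox_norm hH hHN (abs_of_pos (by positivity)).le hξ).2
        have h0 := evenBump_nonneg (5 * N) (2 * H) N H ξ
        calc 2 * Real.pi * ‖ξ‖ * evenBump (5 * N) (2 * H) N H ξ
            ≤ 2 * Real.pi * (20 * N) * 2 := by gcongr
          _ = _ := by ring
      · rw [evenBump_eq_zero hN hH hξ, indicator_of_notMem hξ, mul_zero]

theorem measurable_gaugeTest (N H t : ℝ) : Measurable (gaugeTest N H t) := by
  unfold gaugeTest
  refine Measurable.indicator ?_ (measurableSet_boxAt _ _ _ _)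
  exact Continuous.measurable (by fun_prop)

/-- By duality the test function is measured with `⟨ξ⟩^{-σ}`; its height is at most `ω ≤ 2π · 20N`
on a box of area `NH`. -/
theorem exists_gaugeTest {σ : ℝ} {N H : ℝ} (hN : 1 ≤ N) (hH : 0 < H) (hHN : H ≤ N) (t : ℝ) :
    ∃ χ : Lp ℂ 2 (volume : Measure Plane),
      ‖χ‖ ≤ 40 * Real.pi * N * (401 ^ (|σ| / 2) * N ^ (-σ)) * √(N * H) ∧
      ∀ {k : ℕ} (hr : σ ≤ k) (a : Option (Fin 3)) (i j : Fin n) (U : FieldW n),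
        fieldPairing hr χ t a i j U = ∫ ξ, (gaugeTest N H t ξ : ℂ) * hat k (U a none i j) t ξ := by
  have hN0 : 0 < N := by linarith
  have hG : ∀ ξ ∈ boxAt (10 * N) 0 (N / 2) (H / 2), N ≤ ‖ξ‖ ∧ ‖ξ‖ ≤ 20 * N := by
    rintro ξ ⟨a, b⟩
    have h0 := norm_le_add_abs ξ
    have h1 := (le_abs_self _).trans (abs_le_norm ξ 0)
    rw [abs_le] at a b
    have c0 : |ξ 0| ≤ 11 * N := abs_le.2 ⟨by linarith, by linarith⟩
    have c1 : |ξ 1| ≤ H := abs_le.2 ⟨by linarith, by linarith⟩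
    constructor <;> linarith
  have hF : ∀ ξ, |gaugeTest N H t ξ|
      ≤ (boxAt (10 * N) 0 (N / 2) (H / 2)).indicator (fun _ => 40 * Real.pi * N) ξ := fun ξ => by
    unfold gaugeTest
    by_cases hξ : ξ ∈ boxAt (10 * N) 0 (N / 2) (H / 2)
    · rw [indicator_of_mem hξ, indicator_of_mem hξ, abs_mul, disp_zero,
        abs_of_nonneg (by positivity : 0 ≤ 2 * Real.pi * ‖ξ‖)]
      calc |Real.sin (t * (2 * Real.pi * ‖ξ‖))| * (2 * Real.pi * ‖ξ‖)
          ≤ 1 * (2 * Real.pi * (20 * N)) := by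
            gcongr
            · exact Real.abs_sin_le_one _
            · exact (hG ξ hξ).2
        _ = _ := by ring
    · rw [indicator_of_notMem hξ, indicator_of_notMem hξ, abs_zero]
  obtain ⟨χ, h1, h2⟩ := exists_test (n := n) (r := σ) (measurable_gaugeTest N H t)
    (measurableSet_boxAt _ _ _ _) (volume_boxAt_ne_top _ _ _ _)
    (by positivity : 0 ≤ 40 * Real.pi * N * (401 ^ (|-σ| / 2) * N ^ (-σ))) fun ξ => by
      rw [mul_comm]
      exact bracketPow_mul_le hN (by positivity) hG hF ξ
  refine ⟨χ, h1.trans_eq ?_, fun hr => h2 hr t⟩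
  rw [abs_neg, volume_real_boxAt _ _ (by positivity) (by positivity)]
  congr 2
  ring

end gauge

theorem not_forall_rpow_le {a : ℝ} (b C : ℝ) (ha : 0 < a) :
    ¬ ∀ x : ℝ, b ≤ x → x ^ a ≤ C := fun h => by
  obtain ⟨x, h1, h2⟩ := ((tendsto_rpow_atTop ha).eventually_gt_atTop C |>.and
    (Filter.eventually_ge_atTop b)).exists
  exact absurd (h x h2) (not_le.2 h1)

/-- The lower bound `T₀ N⁴ H³` meets an upper bound that is a constant times `N^{4+σ} H (NH)^{1/2}`.
With `N = L H²` the powers of `N` cancel up to `N^σ ~ H^{2σ}`, and `H^{1/2 - 2σ}` would remain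
bounded. -/
theorem IsFlowMap.not_contDiffAt_two (hn : 2 ≤ n) {𝔪 : Submodule ℝ (Mat n)} (h𝔪 : su n ≤ 𝔪)
    {v s σ T : ℝ} {hT : 0 < T} {Φ : State n 𝔪 s σ → Traj n 𝔪 s σ T} (hΦ : IsFlowMap v hT Φ)
    (hσ : σ < 1 / 4) : ¬ ContDiffAt ℝ 2 Φ 0 := fun hC => by
  obtain ⟨k, hk⟩ := exists_nat_ge (max s σ)
  have hsk : s ≤ k := (le_max_left _ _).trans hk
  have hσk : σ ≤ k := (le_max_right _ _).trans hk
  have hm : 0 ≤ 2 * v ^ 4 := by positivity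
  obtain ⟨C, hC⟩ := hΦ.exists_second_le h𝔪 hsk hσk hm rfl hC
  have h01 : (⟨0, by omega⟩ : Fin n) ≠ ⟨1, by omega⟩ := by simp
  set T₀ := min T 1 with hT₀
  have hT₀p : 0 < T₀ := lt_min hT one_pos
  set L := 4000 / T₀ with hL
  have hL1 : 1 ≤ L := by
    rw [hL, le_div_iff₀ hT₀p]
    linarith [min_le_right T 1]
  have hL0 : 0 < L := by linarith
  set c : ℝ := 401 ^ (|σ| / 2) with hc
  have hcp : 0 < c := by positivity
  -- The free parameter is the height `H ≥ 1` of the boxes; the choice `N = L H²` below is the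
  -- smallest length that keeps the interaction resonant.
  refine not_forall_rpow_le (a := 1 / 2 - 2 * σ) 1
    (|C| * (40 * Real.pi * c) * (80 * Real.pi * c) ^ 2 * 8 * L ^ σ * √L / T₀) (by linarith)
    fun H hH => ?_
  have hH0 : 0 < H := by linarith
  have hN1 : 1 ≤ L * H ^ 2 := one_le_mul_of_one_le_of_one_le hL1 (one_le_pow₀ hH)
  have hN : 0 < L * H ^ 2 := by linarith
  have hHN : H ≤ L * H ^ 2 := by nlinarith
  generalize hNe : L * H ^ 2 = N at hN1 hN hHN
  have hmain := second_lower_bound h01 k hT.le hm hT₀p (min_le_right _ _) (min_le_left _ _) hN hH0 hH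
    hNe.le (K := |C| * (40 * Real.pi * N * (c * N ^ (-σ)) * √(N * H))
      * (80 * Real.pi * N * (c * N ^ σ) * √(8 * N * H)) ^ 2) fun t ht => by
    obtain ⟨χ, h1, h2⟩ := exists_gaugeTest (n := n) (σ := σ) hN1 hH0 hHN t
    rw [← h2 hσk]
    refine (hC _ χ t ⟨by linarith [ht.1], ht.2.trans (min_le_left _ _)⟩ 0 _ _).trans ?_
    have h3 := norm_state_gaugeData_le h01 h𝔪 hsk hσk hT.le (2 * v ^ 4) hN hH0 hHN hN1
    gcongr
    exact le_abs_self C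
  have hP : 0 < N ^ σ := Real.rpow_pos_of_pos hN _
  have e1 : √(8 * N * H) ^ 2 = 8 * N * H := Real.sq_sqrt (by positivity)
  have e2 : √(N * H) = √L * (H * H ^ (1 / 2 : ℝ)) := by
    rw [← hNe, show L * H ^ 2 * H = L * (H ^ 2 * H) by ring, Real.sqrt_mul hL0.le,
      Real.sqrt_mul (by positivity), Real.sqrt_sq hH0.le, Real.sqrt_eq_rpow H]
  have e3 : N ^ σ = L ^ σ * H ^ (2 * σ) := by
    rw [← hNe, Real.mul_rpow hL0.le (by positivity), ← Real.rpow_natCast, ← Real.rpow_mul hH0.le]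
    norm_num
  have e4 : H ^ (1 / 2 - 2 * σ) * (H ^ (2 * σ) * H ^ (1 / 2 : ℝ)) = H := by
    rw [← Real.rpow_add hH0, ← Real.rpow_add hH0]
    ring_nf
    exact Real.rpow_one H
  have e5 : |C| * (40 * Real.pi * N * (c * N ^ (-σ)) * √(N * H))
      * (80 * Real.pi * N * (c * N ^ σ) * √(8 * N * H)) ^ 2
      = N ^ 4 * H ^ 2 * (|C| * (40 * Real.pi * c) * (80 * Real.pi * c) ^ 2 * 8 * L ^ σ * √L
        * (H ^ (2 * σ) * H ^ (1 / 2 : ℝ))) := by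
    rw [mul_pow _ (√(8 * N * H)), e1, Real.rpow_neg hN.le, e2]
    field_simp
    rw [e3]
    ring
  rw [e5] at hmain
  have e6 : T₀ * N ^ 4 * H ^ 3 = N ^ 4 * H ^ 2 * (T₀ * H) := by ring
  rw [e6] at hmain
  have h7 := le_of_mul_le_mul_left hmain (by positivity)
  rw [le_div_iff₀ hT₀p]
  have hq : 0 < H ^ (2 * σ) * H ^ (1 / 2 : ℝ) := by positivity
  refine le_of_mul_le_mul_right ?_ hq
  calc H ^ (1 / 2 - 2 * σ) * T₀ * (H ^ (2 * σ) * H ^ (1 / 2 : ℝ))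
      = T₀ * (H ^ (1 / 2 - 2 * σ) * (H ^ (2 * σ) * H ^ (1 / 2 : ℝ))) := by ring
    _ = T₀ * H := by rw [e4]
    _ ≤ _ := h7

end CSH

end

noncomputable section

namespace CSH

open FourierTransform
open scoped CompactlySupported

variable {n : ℕ}

/-! ### Data for which the cubic interaction of the matter field is large -/

theorem crossW_two (k : ℕ) (x₀ x₁ y₀ y₁ : WSpace) : crossW k ![x₀, x₁, 0] ![y₀, y₁, 0]
    = ![0, 0, (2 : ℂ) • (cmul k x₀ y₁ - cmul k x₁ y₀)] := by
  funext p
  fin_cases p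
  · change (2 : ℂ) • (cmul k x₁ 0 - cmul k 0 y₁) = 0
    simp
  · change (2 : ℂ) • (cmul k 0 y₀ - cmul k x₀ 0) = 0
    simp
  · rfl

theorem crossC_two (b₀ b₁ c₀ c₁ : C_c(Plane, ℂ)) : crossC ![b₀, b₁, 0] ![c₀, c₁, 0]
    = ![0, 0, (2 : ℂ) • (pconv b₀ c₁ - pconv b₁ c₀)] := by
  have h1 : ∀ b : C_c(Plane, ℂ), pconv 0 b = 0 := fun b => by
    ext ξ
    simp [pconv_apply]
  have h2 : ∀ b : C_c(Plane, ℂ), pconv b 0 = 0 := fun b => by rw [pconv_comm, h1]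
  funext p
  fin_cases p
  · change (2 : ℂ) • (pconv b₁ 0 - pconv 0 c₁) = 0
    simp [h1, h2]
  · change (2 : ℂ) • (pconv 0 c₀ - pconv b₀ 0) = 0
    simp [h1, h2]
  · rfl

/-- The initial data `φ = f₁ E₀ + f₂ E₁`, `A = 0`. -/
def matterData {i₀ i₁ : Fin n} (h : i₀ ≠ i₁) {f₁ f₂ : C_c(Plane, ℂ)}
    (hf₁ : ∀ ξ, f₁ (-ξ) = starRingEnd ℂ (f₁ ξ)) (hf₂ : ∀ ξ, f₂ (-ξ) = starRingEnd ℂ (f₂ ξ)) :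
    InitData n where
  pos a := a.elim (embC i₀ i₁ ![f₁, f₂, 0]) fun _ => 0
  isSkew a := by
    rcases a with _ | μ
    · refine isSkew_embC h fun p ξ => ?_
      fin_cases p <;> simp [hf₁, hf₂]
    · exact IsSkew.zero

/-- The velocity of the gauge field generated by the matter field. -/
def currentProfile (f₁ f₂ : C_c(Plane, ℂ)) (μ : Fin 3) : C_c(Plane, ℂ) :=
  Fin.cases 0 (fun j => (4 : ℂ) • ∑ l : Fin 2, (eps 0 j.succ l.succ : ℂ) •
    (pconv f₁ (dmul l f₂) - pconv f₂ (dmul l f₁))) μ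

/-- The null form of the matter field. -/
def currentSource (k : ℕ) (T m : ℝ) (f₁ f₂ : C_c(Plane, ℂ)) (μ : Fin 3) : WSpace :=
  (2 : ℝ) • ∑ ν, ∑ α, (eps μ ν α * eta ν * eta α) • ((2 : ℂ) •
    (cmul k (free k T m (some ν) f₁ 0) (free k T m (some α) f₂ 0)
      - cmul k (free k T m (some ν) f₂ 0) (free k T m (some α) f₁ 0)))

/-- The gauge field generated by the matter field. -/
def inducedGauge (k : ℕ) {T : ℝ} (hT : 0 ≤ T) (m : ℝ) (f₁ f₂ : C_c(Plane, ℂ)) (μ : Fin 3) :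
    WSpace :=
  free k T 0 none 0 (currentProfile f₁ f₂ μ)
    + duhamel k hT (velPropagator le_rfl none) (currentSource k T m f₁ f₂ μ)

theorem solve_zero (k : ℕ) {T m : ℝ} (hT : 0 ≤ T) (hm : 0 ≤ m) {S : Option (Fin 3) → MatW n}
    {a : Option (Fin 3)} (h : S a = 0) (d : Option (Fin 3)) : solve k hT hm S a d = 0 := by
  funext i j
  simp [solve, h]

section matter

variable {i₀ i₁ : Fin n} (h : i₀ ≠ i₁) {f₁ f₂ : C_c(Plane, ℂ)}
  (hf₁ : ∀ ξ, f₁ (-ξ) = starRingEnd ℂ (f₁ ξ)) (hf₂ : ∀ ξ, f₂ (-ξ) = starRingEnd ℂ (f₂ ξ))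

theorem matterData_vel (a : Option (Fin 3)) : (matterData h hf₁ hf₂).vel a = 0 := by
  revert a
  rw [forall_option_fin_three]
  refine ⟨rfl, ?_, fun j => ?_⟩ <;>
  · funext i l
    ext ξ
    simp [InitData.vel, matterData]

theorem matterData_lin_some (k : ℕ) (T m : ℝ) (μ : Fin 3) (d : Option (Fin 3)) :
    (matterData h hf₁ hf₂).lin k T m (some μ) d = 0 := by
  funext i j
  rw [InitData.lin, freeField, matterData_vel]
  exact free_zero k T 0 d

theorem matterData_lin_none (k : ℕ) (T m : ℝ) (d : Option (Fin 3)) :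
    (matterData h hf₁ hf₂).lin k T m none d
      = emb i₀ i₁ ![free k T m d f₁ 0, free k T m d f₂ 0, 0] := by
  funext i j
  rw [InitData.lin, freeField, matterData_vel]
  have e : (0 : MatC n) = embC i₀ i₁ 0 := by
    funext i j
    simp [embC]
  rw [e]
  refine (free_emb k T m d ![f₁, f₂, 0] 0 i j).trans ?_
  congr 1
  funext p
  fin_cases p <;> simp [free_zero]

theorem matterData_velQuad (μ : Fin 3) : (matterData h hf₁ hf₂).velQuad (some μ)
    = embC i₀ i₁ ![0, 0, currentProfile f₁ f₂ μ] := by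
  refine Fin.cases ?_ (fun j => ?_) μ
  · funext i l
    ext ξ
    simp [InitData.velQuad, embC, currentProfile, Fin.sum_univ_three]
  · have e : ∀ l : Fin 2, (fun i q => dmul l ((matterData h hf₁ hf₂).pos none i q))
        = embC i₀ i₁ ![dmul l f₁, dmul l f₂, 0] := fun l => by
      funext i q
      ext ξ
      simp [matterData, embC, Fin.sum_univ_three]
      ring
    have e0 : lieC ((matterData h hf₁ hf₂).pos (some 0)) ((matterData h hf₁ hf₂).pos (some j.succ))
        = 0 := by
      funext i l
      ext ξ
      simp [lieC, matterData]
    have e1 : (matterData h hf₁ hf₂).velQuad (some j.succ)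
        = (-1 : ℝ) • lieC ((matterData h hf₁ hf₂).pos (some 0))
            ((matterData h hf₁ hf₂).pos (some j.succ))
          + (2 : ℝ) • ∑ l : Fin 2, eps 0 j.succ l.succ •
          lieC (embC i₀ i₁ ![f₁, f₂, 0])
            (fun i q => dmul l ((matterData h hf₁ hf₂).pos none i q)) := rfl
    rw [e1, e0]
    simp only [e, lieC_embC h, crossC_two]
    funext i l
    ext ξ
    simp [embC, currentProfile, Fin.sum_univ_three, Fin.sum_univ_two]
    ring

/-- Products of components along `E₀` and `E₁` only have brackets along `E₂`. Both the initial
current and the null form source are of this kind. -/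
theorem matterData_second_some (k : ℕ) {T m : ℝ} (hT : 0 ≤ T) (hm : 0 ≤ m) (μ : Fin 3) :
    (matterData h hf₁ hf₂).second k hT hm (some μ) none
      = emb i₀ i₁ ![0, 0, inducedGauge k hT m f₁ f₂ μ] := by
  have e : quad k ((matterData h hf₁ hf₂).lin k T m) ((matterData h hf₁ hf₂).lin k T m) (some μ)
      = emb i₀ i₁ ![0, 0, currentSource k T m f₁ f₂ μ] := by
    have e1 : ∀ ν α, lieW n k ((matterData h hf₁ hf₂).lin k T m none (some ν))
        ((matterData h hf₁ hf₂).lin k T m none (some α)) = emb i₀ i₁ ![0, 0, (2 : ℂ) •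
          (cmul k (free k T m (some ν) f₁ 0) (free k T m (some α) f₂ 0)
            - cmul k (free k T m (some ν) f₂ 0) (free k T m (some α) f₁ 0))] := fun ν α => by
      rw [matterData_lin_none, matterData_lin_none, lieW_emb h, crossW_two]
    simp only [quad, matterData_lin_some, map_zero, zero_apply, smul_zero, Finset.sum_const_zero,
      zero_add, e1]
    simp only [← emb_smul, ← emb_sum]
    congr 1
    funext p
    fin_cases p <;> simp [currentSource, Finset.sum_apply]
  rw [InitData.second, Pi.add_apply, Pi.add_apply, quadMap, solve_emb k hT hm e none]
  have e2 : (matterData h hf₁ hf₂).linQuad k T m (some μ) none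
      = emb i₀ i₁ ![0, 0, free k T 0 none 0 (currentProfile f₁ f₂ μ)] := by
    funext i j
    rw [InitData.linQuad, freeField, matterData_velQuad]
    have e3 : (0 : MatC n) = embC i₀ i₁ 0 := by
      funext i j
      simp [embC]
    change free k T 0 none ((0 : MatC n) i j) _ = _
    rw [e3]
    refine (free_emb k T 0 none 0 ![0, 0, currentProfile f₁ f₂ μ] i j).trans ?_
    congr 1
    funext p
    fin_cases p <;> simp [free_zero]
  rw [e2, ← emb_add]
  congr 1
  funext p
  fin_cases p
  · simp
  · simp
  · rfl

/-- The source of the cubic interaction. -/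
def matterSource (k : ℕ) {T : ℝ} (hT : 0 ≤ T) (m : ℝ) (f₁ f₂ : C_c(Plane, ℂ)) : WSpace :=
  (4 : ℝ) • ∑ μ, eta μ • cmul k (inducedGauge k hT m f₁ f₂ μ) (free k T m (some μ) f₂ 0)

/-- Since the gauge field vanishes to first order, the cubic term and one of the two quadratic terms
disappear, and only the second order gauge field along `E₂` acting on `∂_μ φ` survives. As `[E₂, E₁]
= -2E₀`, the component along `E₀` involves `f₂` alone. -/
theorem matterData_third (k : ℕ) {T m : ℝ} (hT : 0 ≤ T) (hm : 0 ≤ m) :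
    (matterData h hf₁ hf₂).third k hT hm none none i₀ i₁
      - (matterData h hf₁ hf₂).third k hT hm none none i₁ i₀
      = (2 : ℂ) • duhamel k hT (velPropagator hm none) (matterSource k hT m f₁ f₂) := by
  have e1 : quad k ((matterData h hf₁ hf₂).lin k T m) ((matterData h hf₁ hf₂).second k hT hm) none
      = 0 := by
    simp [quad, matterData_lin_some]
  have e2 : cubic k ((matterData h hf₁ hf₂).lin k T m) none = 0 := by
    simp [cubic, matterData_lin_some]
  have e3 : quad k ((matterData h hf₁ hf₂).second k hT hm) ((matterData h hf₁ hf₂).lin k T m) none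
      = emb i₀ i₁ ((-2 : ℝ) • ∑ μ, eta μ • crossW k ![0, 0, inducedGauge k hT m f₁ f₂ μ]
        ![free k T m (some μ) f₁ 0, free k T m (some μ) f₂ 0, 0]) := by
    simp only [quad, matterData_second_some, matterData_lin_none, lieW_emb h, emb_smul, emb_sum]
  have e4 : (matterData h hf₁ hf₂).third k hT hm none none = emb i₀ i₁ fun p =>
      duhamel k hT (velPropagator (fieldMass_nonneg hm none) none)
        (((-2 : ℝ) • ∑ μ, eta μ • crossW k ![0, 0, inducedGauge k hT m f₁ f₂ μ]
        ![free k T m (some μ) f₁ 0, free k T m (some μ) f₂ 0, 0]) p) := by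
    rw [InitData.third, Pi.add_apply, Pi.add_apply, Pi.add_apply, Pi.add_apply, cubicMap,
      solve_zero k hT hm e1, solve_zero k hT hm e2, solve_emb k hT hm e3 none, zero_add, add_zero]
  rw [e4, emb_offDiag h]
  congr 2
  have e5 : ∀ μ, crossW k ![0, 0, inducedGauge k hT m f₁ f₂ μ]
        ![free k T m (some μ) f₁ 0, free k T m (some μ) f₂ 0, 0] 0
      = (2 : ℂ) • -cmul k (inducedGauge k hT m f₁ f₂ μ) (free k T m (some μ) f₂ 0) := fun μ => by
    change (2 : ℂ) • (cmul k 0 0 - cmul k (inducedGauge k hT m f₁ f₂ μ) (free k T m (some μ) f₂ 0))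
      = _
    simp
  simp only [Pi.smul_apply, Finset.sum_apply, e5, matterSource, Finset.smul_sum]
  refine Finset.sum_congr rfl fun μ _ => ?_
  module

end matter

end CSH

end

noncomputable section

namespace CSH

open FourierTransform
open scoped CompactlySupported

variable {n : ℕ}

/-! ### Estimates for the propagators at small times -/

theorem disp_le {m : ℝ} (hm : 0 ≤ m) (ξ : Plane) : disp m ξ ≤ 2 * Real.pi * ‖ξ‖ + √m := by
  unfold disp
  have hpi := Real.pi_pos
  refine Real.sqrt_le_iff.2 ⟨by positivity, ?_⟩
  have h1 := Real.sq_sqrt hm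
  have h2 : 0 ≤ 2 * Real.pi * ‖ξ‖ * √m := by positivity
  nlinarith

/-- At times below the inverse frequency nothing has oscillated, and `sin x > x - x³/4` keeps `sinc`
above `1/2`. -/
theorem half_le_sinProp {m t : ℝ} {ξ : Plane} (ht : 0 ≤ t) (h : t * disp m ξ ≤ 1) :
    t / 2 ≤ sinProp m t ξ := by
  have h0 : 0 ≤ t * disp m ξ := mul_nonneg ht (disp_nonneg m ξ)
  have h1 : 1 / 2 ≤ Real.sinc (t * disp m ξ) := by
    rcases h0.eq_or_lt with h2 | h2
    · rw [← h2, Real.sinc_zero]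
      norm_num
    · rw [Real.sinc_of_ne_zero h2.ne', le_div_iff₀ h2]
      have h3 := Real.sin_gt_sub_cube h2
      have h4 := pow_le_of_le_one h0 h three_ne_zero
      linarith
  unfold sinProp
  nlinarith

theorem half_le_cosProp {m t : ℝ} {ξ : Plane} (ht : 0 ≤ t) (h : t * disp m ξ ≤ 1) :
    1 / 2 ≤ cosProp m t ξ := by
  have h0 : 0 ≤ t * disp m ξ := mul_nonneg ht (disp_nonneg m ξ)
  have h1 := Real.one_sub_sq_div_two_le_cos (x := t * disp m ξ)
  unfold cosProp
  nlinarith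

theorem norm_posSym_some_le {m : ℝ} (hm : 0 ≤ m) (ν : Fin 3) (t : ℝ) (ξ : Plane) :
    ‖posSym m (some ν) t ξ‖ ≤ 2 * Real.pi * ‖ξ‖ + √m := by
  have hpi := Real.pi_pos
  refine Fin.cases ?_ (fun j => ?_) ν
  · have e : (posSym m (some 0) t ξ) = ((-(disp m ξ * Real.sin (t * disp m ξ)) : ℝ) : ℂ) := by
      rw [posSym_zero, ← disp_mul_sinProp]
      push_cast
      ring
    rw [e, Complex.norm_real, norm_neg, norm_mul, Real.norm_of_nonneg (disp_nonneg m ξ)]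
    exact (mul_le_of_le_one_right (disp_nonneg m ξ) (Real.abs_sin_le_one _)).trans (disp_le hm ξ)
  · rw [posSym_succ, norm_mul, norm_dsym, Complex.norm_real]
    have h1 : 2 * Real.pi * |ξ j| * ‖cosProp m t ξ‖ ≤ 2 * Real.pi * ‖ξ‖ * 1 := by
      gcongr
      · exact abs_le_norm ξ j
      · exact abs_cosProp_le m t ξ
    linarith [Real.sqrt_nonneg m]

theorem sum_abs_eps_mul_eta (μ : Fin 3) :
    ∑ ν, ∑ α, |eps μ ν α * eta ν * eta α| = 2 := by
  have h : (2 : Fin 3) ≠ 0 := by decide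
  fin_cases μ <;> norm_num [eps, eta, Fin.sum_univ_three, h]

section profile

variable {f₁ f₂ : C_c(Plane, ℂ)} {F₁ F₂ : Plane → ℝ} (hf₁ : ∀ ξ, f₁ ξ = F₁ ξ)
  (hf₂ : ∀ ξ, f₂ ξ = F₂ ξ)

include hf₁ in
theorem continuous_of_profile : Continuous F₁ := by
  have h : F₁ = fun ξ => (f₁ ξ).re := by
    funext ξ
    rw [hf₁, Complex.ofReal_re]
  rw [h]
  exact Complex.continuous_re.comp f₁.continuous

include hf₁ hf₂

theorem integrable_profile_mul {a : Plane → ℝ} (ha : Continuous a) (η : Plane) :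
    Integrable fun κ => a κ * (F₁ κ * F₂ (η - κ)) := by
  have h1 := continuous_of_profile hf₁
  have h2 := continuous_of_profile hf₂
  have h3 : HasCompactSupport F₁ := by
    have h4 := f₁.hasCompactSupport
    refine h4.mono fun ξ hξ => ?_
    rw [Function.mem_support] at hξ ⊢
    rw [hf₁]
    exact_mod_cast hξ
  exact Continuous.integrable_of_hasCompactSupport (by fun_prop) (h3.mul_right.mul_left)

theorem pconv_eq_ofReal (η : Plane) :
    pconv f₁ f₂ η = ((∫ κ, F₁ κ * F₂ (η - κ) : ℝ) : ℂ) := by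
  rw [pconv_apply, ← integral_complex_ofReal]
  congr 1
  funext κ
  rw [hf₁, hf₂, Complex.ofReal_mul]

theorem norm_integral_hat_mul_le {k : ℕ} {x y : WSpace} {s R : ℝ} (η : Plane)
    (hF₁ : ∀ ξ, 0 ≤ F₁ ξ)
    (hx : ∀ ξ, ‖hat k x s ξ‖ ≤ R * F₁ ξ) (hy : ∀ ξ, ‖hat k y s ξ‖ ≤ R * F₂ ξ) (hR : 0 ≤ R) :
    ‖hat k (cmul k x y) s η‖ ≤ R ^ 2 * ∫ κ, F₁ κ * F₂ (η - κ) := by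
  rw [hat_cmul, ← integral_const_mul]
  refine norm_integral_le_of_norm_le (integrable_profile_mul hf₁ hf₂ continuous_const η)
    (Filter.Eventually.of_forall fun κ => ?_)
  rw [norm_mul]
  calc ‖hat k x s κ‖ * ‖hat k y s (η - κ)‖ ≤ (R * F₁ κ) * (R * F₂ (η - κ)) :=
        mul_le_mul (hx _) (hy _) (norm_nonneg _) (mul_nonneg hR (hF₁ _))
    _ = _ := by ring

/-- The current `f₁ ∂f₂ - f₂ ∂f₁` has symbol proportional to `(η - κ) - κ = η - 2κ`, and contraction
of `ε_{0jl}` with `∂_j` makes a vector product of it with `ζ`. The constant is `-4 (2πi)² = 16π²`.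
-/
theorem current_sum_eq (η ζ : Plane) :
    -∑ j : Fin 2, currentProfile f₁ f₂ j.succ η * dsym j ζ
      = ((∫ κ, 16 * Real.pi ^ 2 * cross ζ (η - (2 : ℝ) • κ) * (F₁ κ * F₂ (η - κ)) : ℝ) : ℂ) := by
  have h1 : ∀ l : Fin 2, (pconv f₁ (dmul l f₂) - pconv f₂ (dmul l f₁)) η
      = 2 * Real.pi * Complex.I *
        ((∫ κ, (η l - 2 * κ l) * (F₁ κ * F₂ (η - κ)) : ℝ) : ℂ) := fun l => by
    rw [pconv_comm f₂, CompactlySupportedContinuousMap.sub_apply, pconv_apply, pconv_apply,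
      ← integral_complex_ofReal, ← integral_const_mul, ← integral_sub]
    · congr 1
      funext κ
      simp only [dmul_apply, hf₁, hf₂, dsym, PiLp.sub_apply]
      push_cast
      ring
    · have : Integrable fun κ => (((η - κ) l * (F₁ κ * F₂ (η - κ)) : ℝ) : ℂ) :=
        (integrable_profile_mul hf₁ hf₂ (a := fun κ => (η - κ) l) (by fun_prop) η).ofReal
      refine (this.const_mul (2 * Real.pi * Complex.I)).congr
        (Filter.Eventually.of_forall fun κ => ?_)
      simp only [dmul_apply, hf₁, hf₂, dsym]
      push_cast
      ring
    · have : Integrable fun κ => ((κ l * (F₁ κ * F₂ (η - κ)) : ℝ) : ℂ) :=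
        (integrable_profile_mul hf₁ hf₂ (a := fun κ => κ l) (by fun_prop) η).ofReal
      refine (this.const_mul (2 * Real.pi * Complex.I)).congr
        (Filter.Eventually.of_forall fun κ => ?_)
      simp only [dmul_apply, hf₁, hf₂, dsym]
      push_cast
      ring
  have h2 : ∫ κ, 16 * Real.pi ^ 2 * cross ζ (η - (2 : ℝ) • κ) * (F₁ κ * F₂ (η - κ))
      = 16 * Real.pi ^ 2 * (ζ 0 * (∫ κ, (η 1 - 2 * κ 1) * (F₁ κ * F₂ (η - κ)))
        - ζ 1 * ∫ κ, (η 0 - 2 * κ 0) * (F₁ κ * F₂ (η - κ))) := by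
    rw [← integral_const_mul, ← integral_const_mul, ← integral_sub, ← integral_const_mul]
    · congr 1
      funext κ
      simp only [cross, PiLp.sub_apply, PiLp.smul_apply, smul_eq_mul]
      ring
    · exact (integrable_profile_mul hf₁ hf₂ (by fun_prop) η).const_mul _
    · exact (integrable_profile_mul hf₁ hf₂ (by fun_prop) η).const_mul _
  have e : ∀ j : Fin 2, currentProfile f₁ f₂ j.succ = (4 : ℂ) • ∑ l : Fin 2,
      (eps 0 j.succ l.succ : ℂ) • (pconv f₁ (dmul l f₂) - pconv f₂ (dmul l f₁)) := fun j => rfl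
  rw [h2]
  simp only [e, Fin.sum_univ_two, CompactlySupportedContinuousMap.smul_apply,
    CompactlySupportedContinuousMap.add_apply, h1, smul_eq_mul, dsym]
  have e1 : eps 0 (Fin.succ (0 : Fin 2)) (Fin.succ (0 : Fin 2)) = 0 := by norm_num [eps]
  have e2 : eps 0 (Fin.succ (0 : Fin 2)) (Fin.succ (1 : Fin 2)) = 1 := by norm_num [eps]
  have e3 : eps 0 (Fin.succ (1 : Fin 2)) (Fin.succ (0 : Fin 2)) = -1 := by norm_num [eps]
  have e4 : eps 0 (Fin.succ (1 : Fin 2)) (Fin.succ (1 : Fin 2)) = 0 := by norm_num [eps]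
  rw [e1, e2, e3, e4]
  push_cast
  generalize ((∫ κ, (η 1 - 2 * κ 1) * (F₁ κ * F₂ (η - κ)) : ℝ) : ℂ) = I₁
  generalize ((∫ κ, (η 0 - 2 * κ 0) * (F₁ κ * F₂ (η - κ)) : ℝ) : ℂ) = I₀
  linear_combination (-16 * Real.pi ^ 2 * (I₁ * ζ 0 - I₀ * ζ 1)) * Complex.I_sq

variable (hF₁ : ∀ ξ, 0 ≤ F₁ ξ) (hF₂ : ∀ ξ, 0 ≤ F₂ ξ) {N m : ℝ} (hm : 0 ≤ m) (hmN : √m ≤ N)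
  (hN : 0 ≤ N) (hb₁ : ∀ ξ, F₁ ξ ≠ 0 → ‖ξ‖ ≤ 3 * N) (hb₂ : ∀ ξ, F₂ ξ ≠ 0 → ‖ξ‖ ≤ 3 * N)

omit hf₂ in
include hF₁ hm hmN hN hb₁ in
theorem norm_hat_free_le (k : ℕ) (T : ℝ) (ν : Fin 3) (s : ℝ) (ξ : Plane) :
    ‖hat k (free k T m (some ν) f₁ 0) s ξ‖ ≤ 20 * N * F₁ ξ := by
  rw [hat_free, CompactlySupportedContinuousMap.zero_apply, mul_zero, add_zero, norm_mul, hf₁,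
    Complex.norm_real, Real.norm_of_nonneg (hF₁ ξ)]
  by_cases h : F₁ ξ = 0
  · rw [h, mul_zero, mul_zero]
  · refine mul_le_mul_of_nonneg_right ((norm_posSym_some_le hm ν _ ξ).trans ?_) (hF₁ ξ)
    have h1 := hb₁ ξ h
    have h2 := Real.pi_lt_d2
    -- `2 · 3.15 · 3N`, plus `√m ≤ N`, is below `20 N`.
    have h3 : 2 * Real.pi * ‖ξ‖ ≤ 2 * 3.15 * (3 * N) := by gcongr
    linarith

include hF₁ hF₂ hm hmN hN hb₁ hb₂

/-- `6400 = 2 · 2 · (2 · 2 · 20²)`: the outer factor, the sum of the `|ε|`, and twice the two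
products with each factor at most `20 N` times its profile. -/
theorem norm_hat_currentSource_le (k : ℕ) (T : ℝ) (μ : Fin 3) (s : ℝ) (η : Plane) :
    ‖hat k (currentSource k T m f₁ f₂ μ) s η‖
      ≤ 6400 * N ^ 2 * ∫ κ, F₁ κ * F₂ (η - κ) := by
  have hN20 : 0 ≤ 20 * N := by linarith
  have h1 := norm_hat_free_le hf₁ hF₁ hm hmN hN hb₁ k T (s := s)
  have h2 := norm_hat_free_le hf₂ hF₂ hm hmN hN hb₂ k T (s := s)
  have h3 : ∫ κ, F₂ κ * F₁ (η - κ) = ∫ κ, F₁ κ * F₂ (η - κ) := by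
    rw [← integral_sub_left_eq_self _ volume η]
    simp [mul_comm]
  set P := ∫ κ, F₁ κ * F₂ (η - κ) with hP
  have h4 : ∀ ν α, ‖hat k ((2 : ℂ) • (cmul k (free k T m (some ν) f₁ 0) (free k T m (some α) f₂ 0)
      - cmul k (free k T m (some ν) f₂ 0) (free k T m (some α) f₁ 0))) s η‖ ≤ 1600 * N ^ 2 * P := by
    intro ν α
    rw [hat_csmul, hat_sub, norm_mul]
    have a1 := norm_integral_hat_mul_le hf₁ hf₂ η hF₁ (h1 ν) (h2 α) hN20
    have a2 := norm_integral_hat_mul_le hf₂ hf₁ η hF₂ (h2 ν) (h1 α) hN20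
    rw [h3] at a2
    have a3 := (norm_sub_le _ _).trans (add_le_add a1 a2)
    calc ‖(2 : ℂ)‖ * _ ≤ ‖(2 : ℂ)‖ * _ := mul_le_mul_of_nonneg_left a3 (norm_nonneg _)
      _ = _ := by
        rw [Complex.norm_ofNat]
        ring
  rw [currentSource, hat_smul, hat_sum, norm_mul, Complex.norm_real]
  have h5 : ‖∑ ν, hat k (∑ α, (eps μ ν α * eta ν * eta α) • ((2 : ℂ) •
      (cmul k (free k T m (some ν) f₁ 0) (free k T m (some α) f₂ 0)
      - cmul k (free k T m (some ν) f₂ 0) (free k T m (some α) f₁ 0)))) s η‖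
      ≤ ∑ ν, ∑ α, |eps μ ν α * eta ν * eta α| * (1600 * N ^ 2 * P) := by
    refine (norm_sum_le _ _).trans (Finset.sum_le_sum fun ν _ => ?_)
    rw [hat_sum]
    refine (norm_sum_le _ _).trans (Finset.sum_le_sum fun α _ => ?_)
    rw [hat_smul, norm_mul, Complex.norm_real]
    exact mul_le_mul_of_nonneg_left (h4 ν α) (norm_nonneg _)
  simp only [← Finset.sum_mul, sum_abs_eps_mul_eta] at h5
  rw [Real.norm_ofNat]
  linarith

/-- For small times the gauge field is its initial velocity multiplied by `~ s`; the null form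
enters only through Duhamel's formula, at order `s²`. -/
theorem exists_hat_inducedGauge (k : ℕ) {T : ℝ} (hT : 0 ≤ T) (μ : Fin 3) {s : ℝ}
    (hs : s ∈ Icc 0 T) (η : Plane) :
    ∃ E : ℂ, hat k (inducedGauge k hT m f₁ f₂ μ) s η
        = sinProp 0 s η * currentProfile f₁ f₂ μ η + E ∧
      ‖E‖ ≤ 6400 * s ^ 2 * N ^ 2 * ∫ κ, F₁ κ * F₂ (η - κ) := by
  have hcs : clip T s = s := clip_of_mem ⟨by linarith [hs.1], hs.2⟩
  refine ⟨∫ r in (0 : ℝ)..s, (sinProp 0 (s - r) η : ℂ) * hat k (currentSource k T m f₁ f₂ μ) r η,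
    ?_, ?_⟩
  · rw [inducedGauge, hat_add, hat_free, hat_duhamel, hcs]
    simp only [CompactlySupportedContinuousMap.zero_apply, mul_zero, zero_add, velSym_none]
    rfl
  · refine (intervalIntegral.norm_integral_le_of_norm_le_const
      (C := s * (6400 * N ^ 2 * ∫ κ, F₁ κ * F₂ (η - κ))) fun r hr => ?_).trans_eq ?_
    · rw [uIoc_of_le hs.1] at hr
      rw [norm_mul, Complex.norm_real]
      refine mul_le_mul ((abs_sinProp_le _ _ _).trans ?_)
        (norm_hat_currentSource_le hf₁ hf₂ hF₁ hF₂ hm hmN hN hb₁ hb₂ k T μ r η) (norm_nonneg _) hs.1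
      rw [abs_of_nonneg (by linarith [hr.2])]
      linarith [hr.1]
    · rw [sub_zero, abs_of_nonneg hs.1]
      ring

/-- The Duhamel part of the gauge field is smaller than its linear part by a factor `O(sN)`, and so
costs only a fixed amount in the constant `c` of the main term. The component `μ = 0` has no initial
velocity and contributes to the error only. -/
theorem re_sum_inducedGauge_ge (k : ℕ) {T : ℝ} (hT : 0 ≤ T) {s : ℝ} (hs : s ∈ Icc 0 T)
    (hsN : s * N ≤ 1 / 100000) (η ζ : Plane) {c : ℝ}
    (hmain : c * s * N ^ 2 * (∫ κ, F₁ κ * F₂ (η - κ)) * F₂ ζ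
      ≤ 4 * (sinProp 0 s η * cosProp m s ζ * F₂ ζ *
        ∫ κ, 16 * Real.pi ^ 2 * cross ζ (η - (2 : ℝ) • κ) * (F₁ κ * F₂ (η - κ)))) :
    (c - 20) * s * N ^ 2 * (∫ κ, F₁ κ * F₂ (η - κ)) * F₂ ζ
      ≤ (4 * ∑ μ, (eta μ : ℂ) * (hat k (inducedGauge k hT m f₁ f₂ μ) s η *
        hat k (free k T m (some μ) f₂ 0) s ζ)).re := by
  have hcs : clip T s = s := clip_of_mem ⟨by linarith [hs.1], hs.2⟩
  have hE := fun μ => exists_hat_inducedGauge hf₁ hf₂ hF₁ hF₂ hm hmN hN hb₁ hb₂ k hT μ hs η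
  choose E hE1 hE2 using hE
  have hcur := current_sum_eq hf₁ hf₂ η ζ
  set P := ∫ κ, F₁ κ * F₂ (η - κ) with hP
  set J := ∫ κ, 16 * Real.pi ^ 2 * cross ζ (η - (2 : ℝ) • κ) * (F₁ κ * F₂ (η - κ)) with hJ
  have hP0 : 0 ≤ P := integral_nonneg fun κ => mul_nonneg (hF₁ _) (hF₂ _)
  have hy := fun μ => norm_hat_free_le hf₂ hF₂ hm hmN hN hb₂ k T μ s ζ
  have hc0 : currentProfile f₁ f₂ 0 η = 0 := rfl
  have e1 : 4 * ∑ μ, (eta μ : ℂ) * (hat k (inducedGauge k hT m f₁ f₂ μ) s η *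
        hat k (free k T m (some μ) f₂ 0) s ζ)
      = ((4 * (sinProp 0 s η * cosProp m s ζ * F₂ ζ * J) : ℝ) : ℂ)
        + 4 * ∑ μ, (eta μ : ℂ) * (E μ * hat k (free k T m (some μ) f₂ 0) s ζ) := by
    have e2 : ∀ j : Fin 2, hat k (free k T m (some j.succ) f₂ 0) s ζ
        = dsym j ζ * cosProp m s ζ * F₂ ζ := fun j => by
      rw [hat_free, hcs, posSym_succ, hf₂]
      simp
    have hsucc : ∀ j : Fin 2, eta j.succ = -1 := fun j => by simp [eta, Fin.succ_ne_zero]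
    simp only [hE1, add_mul, mul_add, Finset.sum_add_distrib]
    congr 1
    rw [Fin.sum_univ_succ, hc0]
    simp only [e2, hsucc]
    push_cast
    rw [← hcur, Fin.sum_univ_two, Fin.sum_univ_two]
    ring
  have h2 : ‖4 * ∑ μ, (eta μ : ℂ) * (E μ * hat k (free k T m (some μ) f₂ 0) s ζ)‖
      ≤ 20 * s * N ^ 2 * P * F₂ ζ := by
    have h3 : ∀ μ, ‖(eta μ : ℂ) * (E μ * hat k (free k T m (some μ) f₂ 0) s ζ)‖
        ≤ 6400 * s ^ 2 * N ^ 2 * P * (20 * N * F₂ ζ) := fun μ => by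
      have h4 : ‖(eta μ : ℂ)‖ = 1 := by
        rw [Complex.norm_real]
        unfold eta
        split_ifs <;> simp
      rw [norm_mul, norm_mul, h4, one_mul]
      have := hs.1
      exact mul_le_mul (hE2 μ) (hy μ) (norm_nonneg _) (by positivity)
    have h5 : ‖∑ μ, (eta μ : ℂ) * (E μ * hat k (free k T m (some μ) f₂ 0) s ζ)‖
        ≤ 3 * (6400 * s ^ 2 * N ^ 2 * P * (20 * N * F₂ ζ)) := by
      refine (norm_sum_le_of_le _ fun μ _ => h3 μ).trans_eq ?_
      simp
    rw [norm_mul, Complex.norm_ofNat]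
    have h6 : 0 ≤ s * N ^ 2 * P * F₂ ζ := by
      have := hs.1
      have := hF₂ ζ
      positivity
    -- `4 · 3 · 6400 · 20 = 1536000`, and `sN ≤ 10⁻⁵` brings this below `20`.
    calc 4 * ‖∑ μ, (eta μ : ℂ) * (E μ * hat k (free k T m (some μ) f₂ 0) s ζ)‖
        ≤ 4 * (3 * (6400 * s ^ 2 * N ^ 2 * P * (20 * N * F₂ ζ))) := by gcongr
      _ = 1536000 * (s * N) * (s * N ^ 2 * P * F₂ ζ) := by ring
      _ ≤ 20 * (s * N ^ 2 * P * F₂ ζ) := by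
        refine mul_le_mul_of_nonneg_right ?_ h6
        linarith
      _ = _ := by ring
  rw [e1, Complex.add_re, Complex.ofReal_re]
  have h7 := (abs_le.1 (Complex.abs_re_le_norm
    (4 * ∑ μ, (eta μ : ℂ) * (E μ * hat k (free k T m (some μ) f₂ 0) s ζ)))).1
  linarith

end profile

end CSH

end

noncomputable section

namespace CSH

open FourierTransform
open scoped CompactlySupported

variable {n : ℕ}

/-! ### The cubic interaction of two bumps -/

/-- The interaction of the two bumps. -/
def pairWeight (N : ℝ) (η : Plane) : ℝ :=
  ∫ κ, evenBump (2 * N) 0 (N / 5) (N / 5) κ * evenBump 0 (2 * N) (N / 5) (N / 5) (η - κ)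

section weights

variable {N : ℝ} (hN : 0 < N)

include hN

/-- Each of the three bumps may be reflected, but only the unreflected choice produces a sum near
`(2N, 4N)`. -/
theorem mem_box_of_evenBump {κ η ζ : Plane}
    (hκ : evenBump (2 * N) 0 (N / 5) (N / 5) κ ≠ 0)
    (hη : evenBump 0 (2 * N) (N / 5) (N / 5) η ≠ 0)
    (hζ : evenBump 0 (2 * N) (N / 5) (N / 5) ζ ≠ 0)
    (h : κ + η + ζ ∈ boxAt (2 * N) (4 * N) (N / 20) (N / 20)) :
    κ ∈ boxAt (2 * N) 0 (N / 5) (N / 5) ∧ η ∈ boxAt 0 (2 * N) (N / 5) (N / 5) ∧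
      ζ ∈ boxAt 0 (2 * N) (N / 5) (N / 5) := by
  have hN5 : 0 < N / 5 := by positivity
  have h0 := abs_le.1 h.1
  have h1 := abs_le.1 h.2
  simp only [PiLp.add_apply] at h0 h1
  rcases mem_or_mem_of_evenBump_ne_zero hN5 hN5 hκ with a | a <;>
  rcases mem_or_mem_of_evenBump_ne_zero hN5 hN5 hη with b | b <;>
  rcases mem_or_mem_of_evenBump_ne_zero hN5 hN5 hζ with c | c
  · exact ⟨a, b, c⟩
  all_goals
    exfalso
    have a0 := abs_le.1 a.1
    have a1 := abs_le.1 a.2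
    have b0 := abs_le.1 b.1
    have b1 := abs_le.1 b.2
    have c0 := abs_le.1 c.1
    have c1 := abs_le.1 c.2
    simp only [PiLp.neg_apply] at a0 a1 b0 b1 c0 c1
    linarith

/-- The product `ζ₁ κ₀ ~ 4N²` dominates. With the widths `N/5` the vector product is at least
`(9/5)(8/5)N² - (1/5)(12/5)N² = 12N²/5`. -/
theorem two_mul_sq_le_cross {κ η ζ : Plane} (hκ : κ ∈ boxAt (2 * N) 0 (N / 5) (N / 5))
    (hη : η ∈ boxAt 0 (2 * N) (N / 5) (N / 5)) (hζ : ζ ∈ boxAt 0 (2 * N) (N / 5) (N / 5)) :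
    2 * N ^ 2 ≤ cross ζ (η - κ) := by
  have a0 := abs_le.1 hκ.1
  have a1 := abs_le.1 hκ.2
  have b0 := abs_le.1 hη.1
  have b1 := abs_le.1 hη.2
  have c0 := abs_le.1 hζ.1
  have c1 := abs_le.1 hζ.2
  have h1 : (9 / 5 * N) * (8 / 5 * N) ≤ ζ 1 * (κ 0 - η 0) :=
    mul_le_mul (by linarith) (by linarith) (by positivity) (by linarith)
  have h2 : |ζ 0 * (η 1 - κ 1)| ≤ (N / 5) * (12 / 5 * N) := by
    rw [abs_mul]
    exact mul_le_mul (abs_le.2 ⟨by linarith, by linarith⟩) (abs_le.2 ⟨by linarith, by linarith⟩)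
      (abs_nonneg _) (by positivity)
  have h3 := (abs_le.1 h2).1
  simp only [cross, PiLp.sub_apply]
  nlinarith [sq_nonneg N]

theorem norm_le_of_evenBump_ne_zero {x y : ℝ} (hxy : |x| + |y| ≤ 2 * N) {ξ : Plane}
    (hξ : evenBump x y (N / 5) (N / 5) ξ ≠ 0) : ‖ξ‖ ≤ 3 * N := by
  have hN5 : 0 < N / 5 := by positivity
  have h0 := norm_le_add_abs ξ
  have hx := abs_sub_abs_le_abs_sub (ξ 0) x
  have hy := abs_sub_abs_le_abs_sub (ξ 1) y
  have hx' := abs_sub_abs_le_abs_sub ((-ξ) 0) x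
  have hy' := abs_sub_abs_le_abs_sub ((-ξ) 1) y
  rw [PiLp.neg_apply, abs_neg] at hx' hy'
  rcases mem_or_mem_of_evenBump_ne_zero hN5 hN5 hξ with ⟨a, b⟩ | ⟨a, b⟩ <;>
  · simp only [PiLp.neg_apply] at a b
    linarith

theorem pconv_bumpProfile (η : Plane) :
    pconv (bumpProfile (2 * N) 0 (w := N / 5) (h := N / 5) (by positivity) (by positivity))
      (bumpProfile 0 (2 * N) (w := N / 5) (h := N / 5) (by positivity) (by positivity)) η
      = pairWeight N η :=
  pconv_eq_ofReal (bumpProfile_apply _ _ _ _) (bumpProfile_apply _ _ _ _) η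

theorem integrable_bump_mul {a : Plane → ℝ} (ha : Continuous a) (η : Plane) :
    Integrable fun κ => a κ * (evenBump (2 * N) 0 (N / 5) (N / 5) κ *
      evenBump 0 (2 * N) (N / 5) (N / 5) (η - κ)) :=
  integrable_profile_mul (bumpProfile_apply (2 * N) 0 (w := N / 5) (h := N / 5) (by positivity)
    (by positivity)) (bumpProfile_apply 0 (2 * N) (w := N / 5) (h := N / 5) (by positivity)
    (by positivity)) ha η

theorem integrable_pairWeight_mul (ξ : Plane) :
    Integrable fun η => pairWeight N η * evenBump 0 (2 * N) (N / 5) (N / 5) (ξ - η) := by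
  simpa using integrable_profile_mul (pconv_bumpProfile hN)
    (bumpProfile_apply 0 (2 * N) (w := N / 5) (h := N / 5) (by positivity)
    (by positivity)) (a := fun _ => 1) continuous_const ξ

omit hN in
theorem pairWeight_nonneg (η : Plane) : 0 ≤ pairWeight N η :=
  integral_nonneg fun _ => mul_nonneg (evenBump_nonneg _ _ _ _ _) (evenBump_nonneg _ _ _ _ _)

theorem pairWeight_ge {η : Plane} (hη : η ∈ boxAt (2 * N) (2 * N) (N / 40) (N / 40)) :
    N ^ 2 / 400 ≤ pairWeight N η := by
  have hN5 : 0 < N / 5 := by positivity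
  have h1 := integral_mono
    ((integrable_indicator_iff (measurableSet_boxAt (2 * N) 0 (N / 40) (N / 40))).2
    (integrableOn_const (C := (1 : ℝ)) (volume_boxAt_ne_top _ _ _ _)))
    (by simpa using integrable_bump_mul hN (a := fun _ => 1) continuous_const η) fun κ => by
      refine indicator_apply_le' (fun hκ => ?_) fun _ => mul_nonneg
        (evenBump_nonneg _ _ _ _ _) (evenBump_nonneg _ _ _ _ _)
      have a0 := abs_le.1 hκ.1
      have a1 := abs_le.1 hκ.2
      have b0 := abs_le.1 hη.1
      have b1 := abs_le.1 hη.2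
      have c1 : κ ∈ boxAt (2 * N) 0 (N / 5 / 2) (N / 5 / 2) :=
        ⟨abs_le.2 ⟨by linarith, by linarith⟩, abs_le.2 ⟨by linarith, by linarith⟩⟩
      have c2 : η - κ ∈ boxAt 0 (2 * N) (N / 5 / 2) (N / 5 / 2) := by
        constructor <;> rw [PiLp.sub_apply, abs_le] <;> constructor <;> linarith
      exact one_le_mul_of_one_le_of_one_le (one_le_evenBump hN5 hN5 c1)
        (one_le_evenBump hN5 hN5 c2)
  rw [integral_indicator_const _ (measurableSet_boxAt _ _ _ _),
    volume_real_boxAt _ _ (by positivity) (by positivity)] at h1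
  refine le_trans (le_of_eq ?_) h1
  rw [smul_eq_mul]
  ring

theorem integral_pairWeight_ge {ξ : Plane} (hξ : ξ ∈ boxAt (2 * N) (4 * N) (N / 20) (N / 20)) :
    N ^ 4 / 160000 ≤ ∫ η, pairWeight N η * evenBump 0 (2 * N) (N / 5) (N / 5) (ξ - η) := by
  have hN5 : 0 < N / 5 := by positivity
  have h1 := integral_mono
    ((integrable_indicator_iff (measurableSet_boxAt (2 * N) (2 * N) (N / 40) (N / 40))).2
    (integrableOn_const (C := N ^ 2 / 400) (volume_boxAt_ne_top _ _ _ _)))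
    (integrable_pairWeight_mul hN ξ) fun η => by
      refine indicator_apply_le' (fun hη => ?_) fun _ => mul_nonneg (pairWeight_nonneg _)
        (evenBump_nonneg _ _ _ _ _)
      have a0 := abs_le.1 hη.1
      have a1 := abs_le.1 hη.2
      have b0 := abs_le.1 hξ.1
      have b1 := abs_le.1 hξ.2
      have c2 : ξ - η ∈ boxAt 0 (2 * N) (N / 5 / 2) (N / 5 / 2) := by
        constructor <;> rw [PiLp.sub_apply, abs_le] <;> constructor <;> linarith
      have d1 := pairWeight_ge hN hη
      have d2 := one_le_evenBump hN5 hN5 c2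
      nlinarith [sq_nonneg N]
  rw [integral_indicator_const _ (measurableSet_boxAt _ _ _ _),
    volume_real_boxAt _ _ (by positivity) (by positivity)] at h1
  refine le_trans (le_of_eq ?_) h1
  rw [smul_eq_mul]
  ring

/-- All the factors are positive on the supports involved, so lower bounds multiply: `288 = 4 · (1/2
· 1/2) · 16 · 9 · 2`, from the two propagators, `π² ≥ 9` and the vector product. -/
theorem main_interaction_ge {m : ℝ} (hm : 0 ≤ m) (hmN : √m ≤ N) {s : ℝ} (hs : 0 ≤ s)
    (hsN : s * N ≤ 1 / 100000) {ξ : Plane}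
    (hξ : ξ ∈ boxAt (2 * N) (4 * N) (N / 20) (N / 20)) (η : Plane) :
    288 * s * N ^ 2 * pairWeight N η * evenBump 0 (2 * N) (N / 5) (N / 5) (ξ - η)
      ≤ 4 * (sinProp 0 s η * cosProp m s (ξ - η) * evenBump 0 (2 * N) (N / 5) (N / 5) (ξ - η) *
        ∫ κ, 16 * Real.pi ^ 2 * cross (ξ - η) (η - (2 : ℝ) • κ) *
          (evenBump (2 * N) 0 (N / 5) (N / 5) κ *
            evenBump 0 (2 * N) (N / 5) (N / 5) (η - κ))) := by
  by_cases hζ : evenBump 0 (2 * N) (N / 5) (N / 5) (ξ - η) = 0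
  · rw [hζ]
    simp
  have h1 : 288 * s * N ^ 2 * pairWeight N η ≤ 4 * sinProp 0 s η * cosProp m s (ξ - η) *
      ∫ κ, 16 * Real.pi ^ 2 * cross (ξ - η) (η - (2 : ℝ) • κ) *
          (evenBump (2 * N) 0 (N / 5) (N / 5) κ *
            evenBump 0 (2 * N) (N / 5) (N / 5) (η - κ)) := by
    rw [pairWeight, ← integral_const_mul, ← integral_const_mul]
    refine integral_mono (integrable_bump_mul hN continuous_const η)
      ((integrable_bump_mul hN (by fun_prop) η).const_mul _) fun κ => ?_
    simp only
    by_cases hκ : evenBump (2 * N) 0 (N / 5) (N / 5) κ = 0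
    · rw [hκ]
      simp
    by_cases hl : evenBump 0 (2 * N) (N / 5) (N / 5) (η - κ) = 0
    · rw [hl]
      simp
    obtain ⟨a, b, c⟩ := mem_box_of_evenBump hN hκ hl hζ (by
      rwa [add_sub_cancel, add_sub_cancel])
    have hx := two_mul_sq_le_cross hN a b c
    rw [sub_sub, ← two_smul ℝ κ] at hx
    have h3 : |(2 : ℝ) * N| ≤ 2 * N := (abs_of_pos (by positivity)).le
    have n1 := norm_le_of_evenBump_ne_zero hN (x := 2 * N) (y := 0) (by simpa using h3) hκ
    have n2 := norm_le_of_evenBump_ne_zero hN (x := 0) (y := 2 * N) (by simpa using h3) hl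
    have n3 := norm_le_of_evenBump_ne_zero hN (x := 0) (y := 2 * N) (by simpa using h3) hζ
    have n4 : ‖η‖ ≤ 6 * N := by
      have := norm_add_le κ (η - κ)
      rw [add_sub_cancel] at this
      linarith
    have hpi := Real.pi_lt_d2
    have hpi' := Real.pi_gt_three
    have d1 : s * disp 0 η ≤ 1 := by
      have e1 : disp 0 η ≤ 2 * 3.15 * (6 * N) := by
        rw [disp_zero]
        gcongr
      calc s * disp 0 η ≤ s * (2 * 3.15 * (6 * N)) := by gcongr
        _ ≤ 1 := by linarith
    have d2 : s * disp m (ξ - η) ≤ 1 := by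
      have e1 : 2 * Real.pi * ‖ξ - η‖ ≤ 2 * 3.15 * (3 * N) := by gcongr
      have e2 : disp m (ξ - η) ≤ 20 * N := (disp_le hm _).trans (by linarith)
      calc s * disp m (ξ - η) ≤ s * (20 * N) := by gcongr
        _ ≤ 1 := by linarith
    have e1 := half_le_sinProp hs d1
    have e2 := half_le_cosProp hs d2
    have e3 : s / 2 * (1 / 2) ≤ sinProp 0 s η * cosProp m s (ξ - η) :=
      mul_le_mul e1 e2 (by norm_num) (le_trans (by positivity) e1)
    have e4 : 9 ≤ Real.pi ^ 2 := by nlinarith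
    have e5 : 16 * 9 * (2 * N ^ 2) ≤ 16 * Real.pi ^ 2 * cross (ξ - η) (η - (2 : ℝ) • κ) := by
      gcongr
    have e6 : s / 2 * (1 / 2) * (16 * 9 * (2 * N ^ 2)) ≤ sinProp 0 s η * cosProp m s (ξ - η) *
        (16 * Real.pi ^ 2 * cross (ξ - η) (η - (2 : ℝ) • κ)) :=
      mul_le_mul e3 e5 (by positivity) (le_trans (by positivity) e3)
    have e7 : 0 ≤ evenBump (2 * N) 0 (N / 5) (N / 5) κ *
        evenBump 0 (2 * N) (N / 5) (N / 5) (η - κ) :=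
      mul_nonneg (evenBump_nonneg _ _ _ _ _) (evenBump_nonneg _ _ _ _ _)
    calc _ ≤ (4 * (sinProp 0 s η * cosProp m s (ξ - η) *
        (16 * Real.pi ^ 2 * cross (ξ - η) (η - (2 : ℝ) • κ)))) *
          (evenBump (2 * N) 0 (N / 5) (N / 5) κ *
        evenBump 0 (2 * N) (N / 5) (N / 5) (η - κ)) :=
          mul_le_mul_of_nonneg_right (by linarith) e7
      _ = _ := by ring
  calc _ ≤ _ := mul_le_mul_of_nonneg_right h1 (evenBump_nonneg 0 (2 * N) (N / 5) (N / 5) (ξ - η))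
    _ = _ := by ring

theorem re_hat_matterSource_ge (k : ℕ) {T m : ℝ} (hT : 0 ≤ T) (hm : 0 ≤ m) (hmN : √m ≤ N)
    {s : ℝ} (hs : s ∈ Icc 0 T) (hsN : s * N ≤ 1 / 100000) {ξ : Plane}
    (hξ : ξ ∈ boxAt (2 * N) (4 * N) (N / 20) (N / 20)) :
    s * N ^ 6 / 1000 ≤ (hat k (matterSource k hT m
      (bumpProfile (2 * N) 0 (w := N / 5) (h := N / 5) (by positivity) (by positivity))
      (bumpProfile 0 (2 * N) (w := N / 5) (h := N / 5) (by positivity) (by positivity)))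
      s ξ).re := by
  set f₁ := bumpProfile (2 * N) 0 (w := N / 5) (h := N / 5) (by positivity) (by positivity) with h₁
  set f₂ := bumpProfile 0 (2 * N) (w := N / 5) (h := N / 5) (by positivity) (by positivity) with h₂
  have h3 : |(2 : ℝ) * N| ≤ 2 * N := (abs_of_pos (by positivity)).le
  have hi : ∀ μ, Integrable fun η => (eta μ : ℂ) * (hat k (inducedGauge k hT m f₁ f₂ μ) s η *
        hat k (free k T m (some μ) f₂ 0) s (ξ - η)) := fun μ =>
    (integrable_hat_mul_hat k _ _ s ξ).const_mul _
  have e1 : hat k (matterSource k hT m f₁ f₂) s ξ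
      = ∫ η, 4 * ∑ μ, (eta μ : ℂ) * (hat k (inducedGauge k hT m f₁ f₂ μ) s η *
        hat k (free k T m (some μ) f₂ 0) s (ξ - η)) := by
    rw [integral_const_mul, integral_finsetSum _ fun μ _ => hi μ, matterSource, hat_smul, hat_sum]
    simp only [hat_smul, hat_cmul, integral_const_mul]
    norm_num
  have hint : Integrable fun η => 4 * ∑ μ, (eta μ : ℂ) *
      (hat k (inducedGauge k hT m f₁ f₂ μ) s η * hat k (free k T m (some μ) f₂ 0) s (ξ - η)) :=
    (integrable_finsetSum _ fun μ _ => hi μ).const_mul _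
  have e2 := Complex.reCLM.integral_comp_comm hint
  rw [e1, ← Complex.reCLM_apply, ← e2]
  have h4 : ∫ η, 268 * s * N ^ 2 *
      (pairWeight N η * evenBump 0 (2 * N) (N / 5) (N / 5) (ξ - η))
      ≤ ∫ η, Complex.reCLM (4 * ∑ μ, (eta μ : ℂ) * (hat k (inducedGauge k hT m f₁ f₂ μ) s η *
        hat k (free k T m (some μ) f₂ 0) s (ξ - η))) := by
    refine integral_mono ((integrable_pairWeight_mul hN ξ).const_mul _)
      (Complex.reCLM.integrable_comp hint) fun η => ?_
    have h5 := re_sum_inducedGauge_ge (f₁ := f₁) (f₂ := f₂) (bumpProfile_apply _ _ _ _)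
      (bumpProfile_apply _ _ _ _) (evenBump_nonneg _ _ _ _) (evenBump_nonneg _ _ _ _) hm hmN hN.le
      (fun ξ => norm_le_of_evenBump_ne_zero hN (by simpa using h3))
      (fun ξ => norm_le_of_evenBump_ne_zero hN (by simpa using h3)) k hT hs hsN η (ξ - η)
      (main_interaction_ge hN hm hmN hs.1 hsN hξ η)
    refine le_trans (le_of_eq ?_) h5
    rw [pairWeight]
    ring
  rw [integral_const_mul] at h4
  refine le_trans ?_ h4
  have h6 := integral_pairWeight_ge hN hξ
  have hs0 := hs.1
  -- `268 = 288 - 20` is what is left of the main constant after the error term.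
  calc s * N ^ 6 / 1000 ≤ 268 * s * N ^ 2 * (N ^ 4 / 160000) := by
        have : 0 ≤ s * N ^ 6 := by positivity
        linarith
    _ ≤ _ := by gcongr

/-- Over this time range `sin((t - s)ω)/ω ≥ (t - s)/2`, and the source grows at least like `s
N⁶/1000`; the time integral of their product is `t³ N⁶/12000`, doubled by the factor in front. -/
theorem re_hat_third_ge (k : ℕ) {T m : ℝ} (hT : 0 ≤ T) (hm : 0 ≤ m) (hmN : √m ≤ N)
    {t : ℝ} (ht : t ∈ Icc 0 T) (htN : t * N ≤ 1 / 100000) {ξ : Plane}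
    (hξ : ξ ∈ boxAt (2 * N) (4 * N) (N / 20) (N / 20)) :
    t ^ 3 * N ^ 6 / 6000 ≤ (hat k ((2 : ℂ) • duhamel k hT (velPropagator hm none)
      (matterSource k hT m
      (bumpProfile (2 * N) 0 (w := N / 5) (h := N / 5) (by positivity) (by positivity))
      (bumpProfile 0 (2 * N) (w := N / 5) (h := N / 5) (by positivity) (by positivity))))
      t ξ).re := by
  have hct : clip T t = t := clip_of_mem ⟨by linarith [ht.1], ht.2⟩
  have hsrc := fun s hs hs' => re_hat_matterSource_ge hN k hT hm hmN (s := s) hs hs' hξ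
  set S := matterSource k hT m
      (bumpProfile (2 * N) 0 (w := N / 5) (h := N / 5) (by positivity) (by positivity))
      (bumpProfile 0 (2 * N) (w := N / 5) (h := N / 5) (by positivity) (by positivity)) with hS
  have hcS : Continuous fun s => hat k S s ξ :=
    continuous_hat_comp k S continuous_id continuous_const
  have hcI : Continuous fun s => (sinProp m (t - s) ξ : ℂ) * hat k S s ξ := by
    have : Continuous fun s => sinProp m (t - s) ξ := by fun_prop
    exact (Complex.continuous_ofReal.comp this).mul hcS
  have e1 : hat k ((2 : ℂ) • duhamel k hT (velPropagator hm none) S) t ξ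
      = 2 * ∫ s in (0 : ℝ)..t, (sinProp m (t - s) ξ : ℂ) * hat k S s ξ := by
    rw [hat_csmul, hat_duhamel, hct]
    rfl
  have e2 := Complex.reCLM.intervalIntegral_comp_comm (hcI.intervalIntegrable (μ := volume) 0 t)
  have e3 : (2 * ∫ s in (0 : ℝ)..t, (sinProp m (t - s) ξ : ℂ) * hat k S s ξ).re
      = 2 * ∫ s in (0 : ℝ)..t, ((sinProp m (t - s) ξ : ℂ) * hat k S s ξ).re := by
    have e4 := Complex.re_ofReal_mul 2 (∫ s in (0 : ℝ)..t, (sinProp m (t - s) ξ : ℂ) * hat k S s ξ)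
    rw [Complex.ofReal_ofNat] at e4
    rw [e4]
    exact congrArg _ e2.symm
  rw [e1, e3]
  have h1 : ∫ s in (0 : ℝ)..t, (t - s) / 2 * (s * N ^ 6 / 1000)
      ≤ ∫ s in (0 : ℝ)..t, ((sinProp m (t - s) ξ : ℂ) * hat k S s ξ).re := by
    refine intervalIntegral.integral_mono_on ht.1
      ((by fun_prop : Continuous fun s : ℝ =>
        (t - s) / 2 * (s * N ^ 6 / 1000)).intervalIntegrable (μ := volume) _ _)
      ((Complex.continuous_re.comp hcI).intervalIntegrable (μ := volume) _ _) fun s hs => ?_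
    rw [Complex.re_ofReal_mul]
    have a1 : s * N ≤ 1 / 100000 := le_trans (by gcongr; exact hs.2) htN
    have a2 := hsrc s ⟨hs.1, hs.2.trans ht.2⟩ a1
    have a3 : ‖ξ‖ ≤ 7 * N := by
      have c0 := abs_le.1 hξ.1
      have c1 := abs_le.1 hξ.2
      have d0 : |ξ 0| ≤ 2.5 * N := abs_le.2 ⟨by linarith, by linarith⟩
      have d1 : |ξ 1| ≤ 4.5 * N := abs_le.2 ⟨by linarith, by linarith⟩
      have := norm_le_add_abs ξ
      linarith
    have a4 : disp m ξ ≤ 46 * N := by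
      have hpi := Real.pi_lt_d2
      have e1 : 2 * Real.pi * ‖ξ‖ ≤ 2 * 3.15 * (7 * N) := by gcongr
      exact (disp_le hm _).trans (by linarith)
    have hts : 0 ≤ t - s := by linarith [hs.2]
    have a5 : (t - s) * disp m ξ ≤ 1 := by
      calc (t - s) * disp m ξ ≤ t * (46 * N) :=
            mul_le_mul (by linarith [hs.1]) a4 (disp_nonneg _ _) ht.1
        _ ≤ 1 := by linarith
    have hs0 := hs.1
    exact mul_le_mul (half_le_sinProp hts a5) a2 (by positivity)
      (le_trans (by positivity) (half_le_sinProp hts a5))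
  have h2 : ∫ s in (0 : ℝ)..t, (t - s) / 2 * (s * N ^ 6 / 1000) = t ^ 3 * N ^ 6 / 12000 := by
    have e5 : ∀ s, (t - s) / 2 * (s * N ^ 6 / 1000) = N ^ 6 / 2000 * (t * s - s ^ 2) := fun s => by
      ring
    simp only [e5]
    rw [intervalIntegral.integral_const_mul, intervalIntegral.integral_sub,
      intervalIntegral.integral_const_mul, integral_id, integral_pow]
    · ring
    · exact (by fun_prop : Continuous fun s : ℝ => t * s).intervalIntegrable _ _
    · exact (by fun_prop : Continuous fun s : ℝ => s ^ 2).intervalIntegrable _ _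
  rw [h2] at h1
  linarith

end weights

end CSH

end

/-! ### Size of the matter data; failure of `C³`. -/

noncomputable section

namespace CSH

open FourierTransform
open scoped CompactlySupported

variable {n : ℕ}

theorem mem_box_norm {N : ℝ} (hN : 0 < N) {ξ : Plane}
    (hξ : ξ ∈ evenBox (2 * N) 0 (N / 5) (N / 5) ∪ evenBox 0 (2 * N) (N / 5) (N / 5)) :
    N ≤ ‖ξ‖ ∧ ‖ξ‖ ≤ 20 * N := by
  have h0 := norm_le_add_abs ξ
  have h1 := abs_le_norm ξ 0
  have h2 := abs_le_norm ξ 1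
  rcases hξ with (⟨a, b⟩ | ⟨a, b⟩) | ⟨a, b⟩ | ⟨a, b⟩ <;>
  · rw [abs_le] at a b
    have c0 : |ξ 0| ≤ 3 * N := abs_le.2 ⟨by linarith, by linarith⟩
    have c1 : |ξ 1| ≤ 3 * N := abs_le.2 ⟨by linarith, by linarith⟩
    refine ⟨?_, by linarith⟩
    first
    | exact le_trans (by linarith [le_abs_self (ξ 0)]) h1
    | exact le_trans (by linarith [neg_abs_le (ξ 0)]) h1
    | exact le_trans (by linarith [le_abs_self (ξ 1)]) h2
    | exact le_trans (by linarith [neg_abs_le (ξ 1)]) h2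

theorem norm_state_matterData_le {i₀ i₁ : Fin n} (h : i₀ ≠ i₁) {𝔪 : Submodule ℝ (Mat n)}
    {s σ : ℝ} {k : ℕ} {T : ℝ} (h𝔪 : su n ≤ 𝔪) (hs : s ≤ k) (hσ : σ ≤ k) (hT : 0 ≤ T) (m : ℝ)
    {N : ℝ} (hN : 1 ≤ N) (hN5 : 0 < N / 5) :
    ‖(matterData h (bumpProfile_neg (2 * N) 0 hN5 hN5) (bumpProfile_neg 0 (2 * N) hN5 hN5)).state
        h𝔪 hs hσ T m‖ ≤ 4 * (401 ^ (|s| / 2) * N ^ s) * N := by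
  have hN0 : 0 < N := by linarith
  -- The supports have total area at most `2 · 8 (N/5)² < N²`.
  have hv : √(volume.real
      (evenBox (2 * N) 0 (N / 5) (N / 5) ∪ evenBox 0 (2 * N) (N / 5) (N / 5))) ≤ N := by
    refine Real.sqrt_le_iff.2 ⟨hN0.le, (measureReal_union_le _ _).trans ?_⟩
    have h1 := volume_real_evenBox_le (2 * N) 0 hN5.le hN5.le
    have h2 := volume_real_evenBox_le 0 (2 * N) hN5.le hN5.le
    nlinarith
  refine InitData.norm_state_le _ h𝔪 hs hσ hT m (by positivity) (fun i j => ?_) fun μ i j => ?_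
  · refine ⟨evenBox (2 * N) 0 (N / 5) (N / 5) ∪ evenBox 0 (2 * N) (N / 5) (N / 5),
      4 * (401 ^ (|s| / 2) * N ^ s),
      (measurableSet_evenBox _ _ _ _).union (measurableSet_evenBox _ _ _ _),
      measure_union_ne_top (volume_evenBox_ne_top _ _ _ _) (volume_evenBox_ne_top _ _ _ _),
      by positivity, by gcongr, ?_⟩
    refine bracketPow_mul_le hN (by norm_num) (fun ξ hξ => mem_box_norm hN0 hξ) fun ξ => ?_
    refine (norm_embC_le h _ i j ξ).trans ?_
    have e : ∑ p, ‖(![bumpProfile (2 * N) 0 hN5 hN5, bumpProfile 0 (2 * N) hN5 hN5, 0] :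
        Fin 3 → C_c(Plane, ℂ)) p ξ‖
        = evenBump (2 * N) 0 (N / 5) (N / 5) ξ + evenBump 0 (2 * N) (N / 5) (N / 5) ξ := by
      rw [Fin.sum_univ_three]
      change ‖bumpProfile (2 * N) 0 hN5 hN5 ξ‖ + ‖bumpProfile 0 (2 * N) hN5 hN5 ξ‖
        + ‖(0 : ℂ)‖ = _
      rw [norm_bumpProfile, norm_bumpProfile, norm_zero, add_zero]
    rw [e]
    by_cases hξ : ξ ∈ evenBox (2 * N) 0 (N / 5) (N / 5) ∪ evenBox 0 (2 * N) (N / 5) (N / 5)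
    · rw [indicator_of_mem hξ]
      linarith [evenBump_le_two (2 * N) 0 (N / 5) (N / 5) ξ,
        evenBump_le_two 0 (2 * N) (N / 5) (N / 5) ξ]
    · rw [indicator_of_notMem hξ]
      rw [mem_union, not_or] at hξ
      rw [evenBump_eq_zero hN5 hN5 hξ.1, evenBump_eq_zero hN5 hN5 hξ.2, add_zero]
  · exact ⟨∅, 0, MeasurableSet.empty, by simp, le_rfl, by rw [zero_mul]; positivity,
      fun ξ => by simp [matterData]⟩

theorem exists_boxTest {s N : ℝ} (hN : 1 ≤ N) (t : ℝ) :
    ∃ χ : Lp ℂ 2 (volume : Measure Plane), ‖χ‖ ≤ 401 ^ (|s| / 2) * N ^ (-s) * N ∧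
      ∀ {k : ℕ} (hr : s ≤ k) (a : Option (Fin 3)) (i j : Fin n) (U : FieldW n),
        fieldPairing hr χ t a i j U
          = ∫ ξ in boxAt (2 * N) (4 * N) (N / 20) (N / 20), hat k (U a none i j) t ξ := by
  have hN0 : 0 < N := by linarith
  have hG : ∀ ξ ∈ boxAt (2 * N) (4 * N) (N / 20) (N / 20), N ≤ ‖ξ‖ ∧ ‖ξ‖ ≤ 20 * N := by
    rintro ξ ⟨a, b⟩
    have h0 := norm_le_add_abs ξ
    have h1 := (le_abs_self _).trans (abs_le_norm ξ 0)
    rw [abs_le] at a b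
    have c0 : |ξ 0| ≤ 3 * N := abs_le.2 ⟨by linarith, by linarith⟩
    have c1 : |ξ 1| ≤ 5 * N := abs_le.2 ⟨by linarith, by linarith⟩
    constructor <;> linarith
  set G := boxAt (2 * N) (4 * N) (N / 20) (N / 20) with hGdef
  have hGm : MeasurableSet G := measurableSet_boxAt _ _ _ _
  obtain ⟨χ, h1, h2⟩ := exists_test (n := n) (r := s) (ρ := G.indicator fun _ => 1)
    (measurable_const.indicator hGm) hGm (volume_boxAt_ne_top _ _ _ _)
    (by positivity : 0 ≤ 1 * (401 ^ (|-s| / 2) * N ^ (-s))) fun ξ => by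
      rw [mul_comm]
      refine bracketPow_mul_le (F := fun ξ => |G.indicator (fun _ => 1) ξ|) hN zero_le_one hG
        (fun ξ => ?_) ξ
      by_cases hξ : ξ ∈ G <;> simp [hξ]
  refine ⟨χ, h1.trans ?_, fun {k} hr a i j U => ?_⟩
  · rw [one_mul, abs_neg]
    gcongr
    refine Real.sqrt_le_iff.2 ⟨hN0.le, ?_⟩
    rw [hGdef, volume_real_boxAt _ _ (by positivity) (by positivity)]
    nlinarith
  · rw [h2 hr, ← integral_indicator hGm]
    congr 1
    funext ξ
    by_cases hξ : ξ ∈ G <;> simp [hξ]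

/-- The component along `E₀` is seen through the difference of two matrix entries, whence `2 K`. The
box of integration has area `N²/100`. -/
theorem third_lower_bound {i₀ i₁ : Fin n} (h : i₀ ≠ i₁) (k : ℕ) {T m : ℝ} (hT : 0 ≤ T)
    (hm : 0 ≤ m) {N : ℝ} (hN : 0 < N) (hN5 : 0 < N / 5) (hmN : √m ≤ N) {t : ℝ} (ht : t ∈ Icc 0 T)
    (htN : t * N ≤ 1 / 100000) {K : ℝ}
    (hK : ∀ i j, ‖∫ ξ in boxAt (2 * N) (4 * N) (N / 20) (N / 20),
      hat k ((matterData h (bumpProfile_neg (2 * N) 0 hN5 hN5)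
        (bumpProfile_neg 0 (2 * N) hN5 hN5)).third k hT hm none none i j) t ξ‖ ≤ K) :
    t ^ 3 * N ^ 8 / 600000 ≤ 2 * K := by
  have hGm := measurableSet_boxAt (2 * N) (4 * N) (N / 20) (N / 20)
  have hGi := volume_boxAt_ne_top (2 * N) (4 * N) (N / 20) (N / 20)
  have hGv := volume_real_boxAt (2 * N) (4 * N) (w := N / 20) (h := N / 20) (by positivity)
    (by positivity)
  have hlow := fun ξ hξ => re_hat_third_ge hN k hT hm hmN ht htN (ξ := ξ) hξ
  set G := boxAt (2 * N) (4 * N) (N / 20) (N / 20) with hG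
  set D := matterData h (bumpProfile_neg (2 * N) 0 hN5 hN5) (bumpProfile_neg 0 (2 * N) hN5 hN5)
    with hD
  have e1 := matterData_third h (bumpProfile_neg (2 * N) 0 hN5 hN5)
    (bumpProfile_neg 0 (2 * N) hN5 hN5) k hT hm
  rw [← hD] at e1
  rw [← e1] at hlow
  have hi : ∀ g : WSpace, IntegrableOn (hat k g t) G := fun g => (integrable_hat k g t).integrableOn
  have h1 : ∫ ξ in G, t ^ 3 * N ^ 6 / 6000
      ≤ ∫ ξ in G, Complex.reCLM (hat k (D.third k hT hm none none i₀ i₁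
        - D.third k hT hm none none i₁ i₀) t ξ) :=
    setIntegral_mono_on (integrableOn_const hGi) (Complex.reCLM.integrable_comp (hi _)) hGm hlow
  rw [Complex.reCLM.integral_comp_comm (hi _), setIntegral_const, hGv, smul_eq_mul] at h1
  have h2 : ∫ ξ in G, hat k (D.third k hT hm none none i₀ i₁
        - D.third k hT hm none none i₁ i₀) t ξ
      = (∫ ξ in G, hat k (D.third k hT hm none none i₀ i₁) t ξ)
        - ∫ ξ in G, hat k (D.third k hT hm none none i₁ i₀) t ξ := by
    rw [← integral_sub (hi _) (hi _)]
    simp only [hat_sub]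
  rw [h2] at h1
  have h3 := (Complex.re_le_norm _).trans ((norm_sub_le _ _).trans
    (add_le_add (hK i₀ i₁) (hK i₁ i₀)))
  rw [Complex.reCLM_apply] at h1
  have e2 : 4 * (N / 20) * (N / 20) * (t ^ 3 * N ^ 6 / 6000) = t ^ 3 * N ^ 8 / 600000 := by ring
  linarith

/-- At `t = 10⁻⁵/N` the lower bound `t³ N⁸` is of order `N⁵`, whereas the upper bound is a constant
times `N^{1-s} (N^{1+s})³ = N^{4+2s}`. Thus `N^{1-2s}` would stay bounded. -/
theorem IsFlowMap.not_contDiffAt_three (hn : 2 ≤ n) {𝔪 : Submodule ℝ (Mat n)} (h𝔪 : su n ≤ 𝔪)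
    {v s σ T : ℝ} {hT : 0 < T} {Φ : State n 𝔪 s σ → Traj n 𝔪 s σ T} (hΦ : IsFlowMap v hT Φ)
    (hs : s < 1 / 2) : ¬ ContDiffAt ℝ 3 Φ 0 := fun hC => by
  obtain ⟨k, hk⟩ := exists_nat_ge (max s σ)
  have hsk : s ≤ k := (le_max_left _ _).trans hk
  have hσk : σ ≤ k := (le_max_right _ _).trans hk
  have hm : 0 ≤ 2 * v ^ 4 := by positivity
  obtain ⟨C, hC⟩ := hΦ.exists_third_le h𝔪 hsk hσk hm rfl hC
  have h01 : (⟨0, by omega⟩ : Fin n) ≠ ⟨1, by omega⟩ := by simp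
  set c : ℝ := 401 ^ (|s| / 2) with hc
  have hcp : 0 < c := by positivity
  -- `N` must exceed `√m`, so that the mass is negligible against the frequencies, and `1/T`, so
  -- that the chosen time lies in `[0, T]`.
  refine not_forall_rpow_le (a := 1 - 2 * s) (max (max 1 √(2 * v ^ 4)) (1 / T))
    (600000 * 100000 ^ 3 * (128 * |C| * c ^ 4)) (by linarith) fun N hNb => ?_
  have hN : 1 ≤ N := (le_max_left _ _).trans ((le_max_left _ _).trans hNb)
  have hmN : √(2 * v ^ 4) ≤ N := (le_max_right _ _).trans ((le_max_left _ _).trans hNb)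
  have hTN : 1 / T ≤ N := (le_max_right _ _).trans hNb
  have hN0 : 0 < N := by linarith
  have hN5 : 0 < N / 5 := by positivity
  have htN : 1 / 100000 / N * N = 1 / 100000 := div_mul_cancel₀ _ hN0.ne'
  have ht : 1 / 100000 / N ∈ Icc 0 T := by
    refine ⟨by positivity, ?_⟩
    rw [div_le_iff₀ hT] at hTN
    rw [div_le_iff₀ hN0]
    linarith
  obtain ⟨χ, h1, h2⟩ := exists_boxTest (n := n) (s := s) hN (1 / 100000 / N)
  have h3 := norm_state_matterData_le h01 h𝔪 hsk hσk hT.le (2 * v ^ 4) hN hN5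
  have hmain := third_lower_bound h01 k hT.le hm hN0 hN5 hmN ht htN.le
    (K := |C| * (c * N ^ (-s) * N) * (4 * (c * N ^ s) * N) ^ 3) fun i j => by
    rw [← h2 hsk]
    refine (hC _ χ _ ⟨by linarith [ht.1], ht.2⟩ i j).trans ?_
    gcongr
    exact le_abs_self C
  have hP : 0 < N ^ s := Real.rpow_pos_of_pos hN0 _
  have e1 : N ^ (1 - 2 * s) * (N ^ s) ^ 2 = N := by
    rw [← Real.rpow_natCast, ← Real.rpow_mul hN0.le, ← Real.rpow_add hN0]
    ring_nf
    exact Real.rpow_one N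
  have e2 : 2 * (|C| * (c * N ^ (-s) * N) * (4 * (c * N ^ s) * N) ^ 3)
      = N ^ 4 * (128 * |C| * c ^ 4 * (N ^ s) ^ 2) := by
    rw [Real.rpow_neg hN0.le]
    field_simp
    ring
  have e3 : (1 / 100000 / N) ^ 3 * N ^ 8 / 600000
      = N ^ 4 * (N ^ (1 - 2 * s) * (N ^ s) ^ 2 / (600000 * 100000 ^ 3)) := by
    rw [e1]
    field_simp
  rw [e2, e3] at hmain
  have h7 := le_of_mul_le_mul_left hmain (by positivity)
  rw [div_le_iff₀ (by positivity)] at h7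
  refine le_of_mul_le_mul_right (h7.trans_eq ?_) (by positivity : 0 < (N ^ s) ^ 2)
  ring

end CSH

end

theorem theorem1p2 (n : ℕ) (hn : 2 ≤ n) (𝔪 : Submodule ℝ (Mat n))
    (h𝔪 : 𝔪 = su n ∨ 𝔪 = sl n) (v : ℝ) (hv : 0 < v) (s σ T : ℝ) (hT : 0 < T)
    (Φ : State n 𝔪 s σ → Traj n 𝔪 s σ T) (hΦ : IsFlowMap v hT Φ) :
    (σ < 1 / 4 → ¬ ContDiffAt ℝ 2 Φ 0) ∧ (s < 1 / 2 → ¬ ContDiffAt ℝ 3 Φ 0) := by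
  -- All the data used take values in `𝔰𝔲(n)`, which is contained in `𝔪` in both cases.
  have hsu : su n ≤ 𝔪 := by
    rcases h𝔪 with rfl | rfl
    · exact le_rfl
    · exact fun X hX => hX.2
  exact ⟨hΦ.not_contDiffAt_two hn hsu, hΦ.not_contDiffAt_three hn hsu⟩
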